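/- \textbf{Setting.} Let $(X,Y)^\sharp=X_1Y_1+X_2Y_2-X_3Y_3$ on $\mathbb R^{2,1}$, let $\mathbb H=\{X:(X,X)^\sharp=-1,\ X_3\ge 1\}$, $G=SO^+(2,1)$, $\mathfrak g=so(2,1)$ with $(A,B)^\sharp=\operatorname{Tr}AB$, and $X\times Y=YX^\sharp-XY^\sharp\in\mathfrak g$, where $X^\sharp$ is the row vector with $X^\sharp Y=(X,Y)^\sharp$. Let $\sigma:\pi\to G$ be discrete and faithful such that $\sigma(\pi)$ acts freely and cocompactly on $\mathbb H$, and let $M=\mathbb H/\sigma(\pi)$ be the resulting closed hyperbolic surface. $\Omega^k(M,ad(E_\sigma))$ denotes the smooth $\mathfrak g$-valued $k$-forms on $\mathbb H$ that are equivariant for $Ad\,\sigma$, with the flat differential $d$. For a $\mathfrak g$-valued one-form $\phi$, $\phi_{id}$ denotes its pointwise $(,)^\sharp$-orthogonal projection onto $\{v\times X: v\in T_X\mathbb H\}$, and $\omega_{mc}(v)=v\times X$ is the Maurer--Cartan form. A \emph{geodesic lamination} $\lambda$ of $M$ is a closed subset whose lift $\tilde\lambda\subset\mathbb H$ is the union of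 a $\pi$-invariant family of pairwise disjoint complete geodesics. A \emph{flow-box} is a bi-Lipschitz homeomorphism $F:[a,b]\times[c,d]\to R\subset M$ with $F^{-1}(\lambda)=[a,b]\times C$, $C\subset(c,d)$ closed of Hausdorff dimension $0$. A \emph{transverse measure} $\mu$ gives for each flow-box a finite positive Borel measure on $[c,d]$ supported in $C$, compatible with changes of flow-boxes (full support is not required); then $(\lambda,\mu)$ is a \emph{measured geodesic lamination}. On a leaf with unit tangent $e$ at $X$, for either local orientation, put $B=e\times X$. For $\phi\in\Omega^1(M,ad(E_\sigma))$ compactly supported inside a flow-box let $$T_\mu(\phi)=\int_c^d\int_{(a,b)\times\{s\}}(\phi,B)^\sharp\,d\mu(s),$$ the horizontal arcs being directed by $B$, and for $\phi=\sum_i\phi_i$ (finite sum) with $\phi_i\in\Omega^1(M,ad(E_\sigma))$ compactly supported inside flow-boxes $R_i$ let $T_\mu(\phi)=\sum_iT_\mu(\phi_i)$. \textbf{Theorem.} Let $(\lambda,\mu)$ be a measured geodesic lamination on $M$; no orientation of $\lambda$ is required. The integrals above exist, every $\phi\in\Omega^1(M,ad(E_\sigma))$ has such a decomposition, the value $T_\mu(\phi)$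 does not depend on the decomposition, and $T_\mu$ is a linear functional. It is closed ($T_\mu(d\xi)=0$ for all $\xi\in\Omega^0(M,ad(E_\sigma))$), is supported in $\lambda$, and has finite mass: $T_\mu$ is bounded above on the forms $\phi=\phi_{id}$ with $(\phi(v),\phi(v))^\sharp\le 2(v,v)^\sharp$ for all tangent vectors $v$. Moreover $T_\mu$ is a Lie algebra valued transverse measure on $\lambda$: there is $\tilde w:\mathbb H\to\mathfrak g$ such that \begin{itemize} \item[(i)] $\tilde w$ is constant on each component of $\mathbb H\setminus\tilde\lambda$, and almost everywhere equal to that constant on the closure of the component (the plaque); \item[(ii)] $\tilde w$ is of locally bounded variation; \item[(iii)] $\tilde w(\gamma X)=Ad(\sigma(\gamma))\tilde w(X)+\alpha(\gamma)$ for all $\gamma\in\pi$, $X\in\mathbb H$, where $\alpha:\pi\to\mathfrak g$ satisfies $\alpha(\gamma_1\gamma_2)=Ad(\sigma(\gamma_1))\alpha(\gamma_2)+\alpha(\gamma_1)$; \item[(iv)] the current $d\tilde w(\eta)=\int_{\mathbb H}(\tilde w,d\eta)^\sharp$, for compactly supported smooth $\mathfrak g$-valued one-forms $\eta$, has tangent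 values: $d\tilde w(\eta_{id})=d\tilde w(\eta)$; \item[(v)] $*(\omega_{mc}\wedge d\tilde w)^\sharp:\chi\mapsto d\tilde w(\chi\,\omega_{mc})$ is a positive Radon measure; \end{itemize} and $T_\mu=dw$, i.e. $d\tilde w$ descends to $T_\mu$: $T_\mu(\sum_{\gamma\in\pi}\gamma\cdot\eta)=d\tilde w(\eta)$ for all compactly supported smooth $\mathfrak g$-valued one-forms $\eta$ on $\mathbb H$, where $(\gamma\cdot\eta)_X(v)=Ad(\sigma(\gamma))\,\eta_{\sigma(\gamma)^{-1}X}(\sigma(\gamma)^{-1}v)$. -/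

import Mathlib

open scoped ContDiff Matrix
open MeasureTheory

namespace LieLam

noncomputable section

/-! ### The hyperboloid in `ℝ^{2,1}` and the group `SO⁺(2,1)` -/

/-- The underlying vector space of `ℝ^{2,1}`. -/
abbrev V : Type := Fin 3 → ℝ

/-- Real `3 × 3` matrices. -/
abbrev Mat : Type := Matrix (Fin 3) (Fin 3) ℝ

/-- The matrix `e^♯ = diag(1, 1, -1)`. -/
def eSharp : Mat := Matrix.diagonal ![1, 1, -1]

/-- The indefinite inner product `(X, Y)^♯ = X₀Y₀ + X₁Y₁ - X₂Y₂` on `ℝ^{2,1}`. -/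
def mink (X Y : V) : ℝ := X ⬝ᵥ (eSharp *ᵥ Y)

/-- The hyperbolic plane, as the unit hyperboloid in `ℝ^{2,1}`. -/
abbrev Hyp : Type := {X : V // mink X X = -1 ∧ 1 ≤ X 2}

/-- The hyperbolic distance: `cosh d(X, Y) = -(X, Y)^♯`. -/
def hdist (X Y : Hyp) : ℝ := Real.arcosh (-mink X Y)

/-- The group `G = SO⁺(2,1)`: matrices of determinant one which preserve the inner product
and the hyperboloid. -/
def SOPlus : Subgroup (Matrix.SpecialLinearGroup (Fin 3) ℝ) where
  carrier := {g | (∀ X Y : V, mink ((g : Mat) *ᵥ X) ((g : Mat) *ᵥ Y) = mink X Y) ∧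
    ∀ X : V, (mink ((g : Mat) *ᵥ X) ((g : Mat) *ᵥ X) = -1 ∧ 1 ≤ ((g : Mat) *ᵥ X) 2) ↔
      (mink X X = -1 ∧ 1 ≤ X 2)}
  mul_mem' := by
    intro g h hg hh
    refine ⟨fun X Y => ?_, fun X => ?_⟩
    · rw [Matrix.SpecialLinearGroup.coe_mul, ← Matrix.mulVec_mulVec, ← Matrix.mulVec_mulVec,
        hg.1, hh.1]
    · rw [Matrix.SpecialLinearGroup.coe_mul, ← Matrix.mulVec_mulVec]
      exact (hg.2 _).trans (hh.2 _)
  one_mem' := by simp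
  inv_mem' := by
    intro g hg
    have key : ∀ X : V, (g : Mat) *ᵥ (((g⁻¹ : Matrix.SpecialLinearGroup (Fin 3) ℝ) : Mat) *ᵥ X)
        = X := by
      intro X
      rw [Matrix.mulVec_mulVec, ← Matrix.SpecialLinearGroup.coe_mul, mul_inv_cancel]
      simp
    refine ⟨fun X Y => ?_, fun X => ?_⟩
    · have h := hg.1 (((g⁻¹ : Matrix.SpecialLinearGroup (Fin 3) ℝ) : Mat) *ᵥ X)
        (((g⁻¹ : Matrix.SpecialLinearGroup (Fin 3) ℝ) : Mat) *ᵥ Y)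
      rw [key, key] at h
      exact h.symm
    · have h := hg.2 (((g⁻¹ : Matrix.SpecialLinearGroup (Fin 3) ℝ) : Mat) *ᵥ X)
      rw [key] at h
      exact h.symm

/-- The linear action of `g ∈ SO⁺(2,1)` on `ℝ^{2,1}`. -/
def lin (g : SOPlus) (v : V) : V := ((g : Matrix.SpecialLinearGroup (Fin 3) ℝ) : Mat) *ᵥ v

/-- The action of `g ∈ SO⁺(2,1)` on the hyperbolic plane. -/
def act (g : SOPlus) (X : Hyp) : Hyp := ⟨lin g X, (g.2.2 X).2 X.2⟩

/-- The adjoint action `Ad(g) A = g A g⁻¹`. -/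
def Ad (g : SOPlus) (A : Mat) : Mat :=
  ((g : Matrix.SpecialLinearGroup (Fin 3) ℝ) : Mat) * A *
    ((g⁻¹ : SOPlus) : Matrix.SpecialLinearGroup (Fin 3) ℝ)

/-- The Lie algebra `𝔤 = so(2,1)`, i.e. the matrices with `Bᵀ e^♯ = - e^♯ B`. -/
def so21 : Submodule ℝ Mat := skewAdjointMatricesSubmodule eSharp

/-- The Killing form `(A, B)^♯ = Tr AB` on `𝔤`. -/
def killing (A B : Mat) : ℝ := (A * B).trace

/-- The cross product `X × Y = Y X^♯ - X Y^♯ ∈ 𝔤`, where `X^♯ = (e^♯ X)ᵀ`. -/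
def cross (X Y : V) : Mat :=
  Matrix.vecMulVec Y (eSharp *ᵥ X) - Matrix.vecMulVec X (eSharp *ᵥ Y)

/-- The orthogonal projection of `A ∈ 𝔤` onto the image `{v × X : v ∈ T_X ℍ}` of `β_X`, namely
`A ↦ (A X) × X`. -/
def projTangent (X : V) (A : Mat) : Mat := cross (A *ᵥ X) X

/-! ### Closed hyperbolic surfaces -/

/-- A hyperbolic structure with fundamental group `π`: a discrete and faithful representation
`σ : π → SO⁺(2,1)` such that `M = ℍ / σ(π)` is a closed surface (the action is free and
cocompact). -/
structure HypSurface (π : Type*) [Group π] where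
  σ : π →* SOPlus
  faithful : Function.Injective σ
  discrete : DiscreteTopology σ.range
  free : ∀ (γ : π) (X : Hyp), act (σ γ) X = X → γ = 1
  cocompact : ∃ K : Set Hyp, IsCompact K ∧ ∀ X : Hyp, ∃ γ : π, act (σ γ) X ∈ K

/-! ### Differential forms, in the global coordinates `(x, y)` of the hyperboloid -/

/-- The global chart `(x, y) ↦ (x, y, √(1 + x² + y²))`, as a map to `ℝ^{2,1}`. -/
def chartV (p : ℝ × ℝ) : V := ![p.1, p.2, √(1 + p.1 ^ 2 + p.2 ^ 2)]

/-- The global chart `ℝ² → ℍ`. -/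
def chart (p : ℝ × ℝ) : Hyp := ⟨chartV p, by
  have h : (0 : ℝ) ≤ 1 + p.1 ^ 2 + p.2 ^ 2 := by positivity
  have h2 := Real.mul_self_sqrt h
  constructor
  · simp [mink, eSharp, chartV, Matrix.mulVec_diagonal, dotProduct, Fin.sum_univ_three]
    nlinarith
  · simp only [chartV, Matrix.cons_val]
    rw [Real.one_le_sqrt]
    nlinarith [sq_nonneg p.1, sq_nonneg p.2]⟩

/-- Smoothness of a real-valued function on the hyperbolic plane.  Matrix-valued functions are
smooth (differentiated, integrated) entry by entry. -/
def SmoothOnHyp (f : Hyp → ℝ) : Prop :=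
  ContDiff ℝ ∞ (fun p : ℝ × ℝ => f (chart p))

/-- A (rough) `𝔤`-valued one-form on `ℍ`.  A one-form assigns to `X ∈ ℍ` a linear map on
`T_X ℍ = X^⊥`, which is extended to `ℝ^{2,1} = T_X ℍ ⊕ ℝ X` by zero on `X` (see `IsOneForm`). -/
abbrev RawForm : Type := Hyp → V →ₗ[ℝ] Mat

/-- Smooth `𝔤`-valued one-forms on `ℍ`. -/
def IsOneForm (φ : RawForm) : Prop :=
  (∀ X : Hyp, φ X X = 0) ∧ (∀ (X : Hyp) (v : V), φ X v ∈ so21) ∧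
    ∀ (v : V) (i j : Fin 3), SmoothOnHyp (fun X => φ X v i j)

/-- The form `φ_id`: pointwise orthogonal projection of `φ` onto the image of `β`. -/
def projForm (φ : RawForm) (X : Hyp) (v : V) : Mat := projTangent X (φ X v)

/-- Compactly supported smooth `𝔤`-valued one-forms on `ℍ`, supported in `K`. -/
def IsTestForm (K : Set Hyp) (η : RawForm) : Prop :=
  IsOneForm η ∧ IsCompact K ∧ ∀ X, X ∉ K → η X = 0

/-- The coefficient of `dφ = (∂ₓ φ(∂_y) - ∂_y φ(∂ₓ)) dx ∧ dy` in the global chart. -/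
def curl (φ : Hyp → V → Mat) (p : ℝ × ℝ) : Mat :=
  Matrix.of fun i j =>
    fderiv ℝ (fun q => φ (chart q) (fderiv ℝ chartV q (0, 1)) i j) p (1, 0) -
      fderiv ℝ (fun q => φ (chart q) (fderiv ℝ chartV q (1, 0)) i j) p (0, 1)

/-- The distributional derivative of `w : ℍ → 𝔤`, as a current on compactly supported
`𝔤`-valued one-forms: `dw(η) = ∫ (η ∧ dw)^♯ = ∫_ℍ (w, dη)^♯`. -/
def dCurrent (w : Hyp → Mat) (η : Hyp → V → Mat) : ℝ :=
  ∫ p : ℝ × ℝ, killing (w (chart p)) (curl η p)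

/-- The one-form `χ ω_mc`, where `ω_mc(v) = v × X` is the Maurer-Cartan form. -/
def maurerCartan (χ : Hyp → ℝ) (X : Hyp) (v : V) : Mat := χ X • cross v X

section Surface

variable {π : Type*} [Group π] (S : HypSurface π)

/-- `Ω¹(M, ad(E_σ))`: smooth `𝔤`-valued one-forms on `ℍ` which are equivariant,
`φ_{γX}(γ v) = Ad(σ(γ)) φ_X(v)`. -/
def Omega1 : Submodule ℝ RawForm where
  carrier := {φ | IsOneForm φ ∧ ∀ (γ : π) (X : Hyp) (v : V),
    φ (act (S.σ γ) X) (lin (S.σ γ) v) = Ad (S.σ γ) (φ X v)}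
  add_mem' := by
    rintro φ ψ ⟨⟨a1, a2, a3⟩, a4⟩ ⟨⟨b1, b2, b3⟩, b4⟩
    refine ⟨⟨fun X => ?_, fun X v => ?_, fun v i j => ?_⟩, fun γ X v => ?_⟩
    · simp [a1, b1]
    · exact so21.add_mem (a2 X v) (b2 X v)
    · exact ContDiff.add (a3 v i j) (b3 v i j)
    · simp [a4, b4, Ad, mul_add, add_mul]
  zero_mem' := by
    refine ⟨⟨fun X => rfl, fun X v => so21.zero_mem, fun v i j => contDiff_const⟩, fun γ X v => ?_⟩
    simp [Ad]
  smul_mem' := by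
    rintro c φ ⟨⟨a1, a2, a3⟩, a4⟩
    refine ⟨⟨fun X => ?_, fun X v => ?_, fun v i j => ?_⟩, fun γ X v => ?_⟩
    · simp [a1]
    · exact so21.smul_mem c (a2 X v)
    · exact ContDiff.const_smul c (a3 v i j)
    · simp [a4, Ad]

/-- `ξ ∈ Ω⁰(M, ad(E_σ))`. -/
def IsOmega0 (ξ : Hyp → Mat) : Prop :=
  (∀ i j, SmoothOnHyp (fun X => ξ X i j)) ∧ (∀ X, ξ X ∈ so21) ∧
    ∀ (γ : π) (X : Hyp), ξ (act (S.σ γ) X) = Ad (S.σ γ) (ξ X)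

/-- `φ = dξ` for the flat connection. -/
def IsDifferential (φ : RawForm) (ξ : Hyp → Mat) : Prop :=
  ∀ (p u : ℝ × ℝ) (i j : Fin 3),
    φ (chart p) (fderiv ℝ chartV p u) i j = fderiv ℝ (fun q => ξ (chart q) i j) p u

/-! ### Measured geodesic laminations -/

/-- Complete geodesics of the hyperbolic plane. -/
def IsGeodesicLine (L : Set Hyp) : Prop :=
  ∃ (X : Hyp) (v : V), mink v v = 1 ∧ mink X v = 0 ∧
    L = {Y : Hyp | ∃ t : ℝ, (Y : V) = Real.cosh t • (X : V) + Real.sinh t • v}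

/-- A geodesic lamination `λ` of `M = ℍ / σ(π)`, given by its lift to `ℍ`: a closed set which is
the disjoint union of an invariant family of complete geodesics. -/
structure GeodesicLamination where
  leaves : Set (Set Hyp)
  isGeodesic : ∀ L ∈ leaves, IsGeodesicLine L
  disjoint : leaves.PairwiseDisjoint id
  invariant : ∀ (γ : π), ∀ L ∈ leaves, act (S.σ γ) '' L ∈ leaves
  isClosed : IsClosed (⋃₀ leaves)

variable {S}

/-- The lift to `ℍ` of the lamination, as a set. -/
def GeodesicLamination.support (Λ : GeodesicLamination S) : Set Hyp := ⋃₀ Λ.leaves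

/-- A flow-box `[a,b] × [c,d] → R ⊂ M` of a geodesic lamination, given by a lift `F` to `ℍ`:
a bi-Lipschitz homeomorphism onto its image, for the distance
`d_M(X, Y) = inf_γ d(X, σ(γ) Y)` of `M`, such that the preimage of `λ` is `[a,b] × C` with
`C ⊂ (c,d)` closed of Hausdorff dimension zero. -/
structure FlowBox (Λ : GeodesicLamination S) where
  a : ℝ
  b : ℝ
  c : ℝ
  d : ℝ
  hab : a < b
  hcd : c < d
  F : ℝ → ℝ → Hyp
  biLipschitz : ∃ K : ℝ, 0 < K ∧ ∀ p ∈ Set.Icc a b ×ˢ Set.Icc c d, ∀ q ∈ Set.Icc a b ×ˢ Set.Icc c d,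
    hdist (F p.1 p.2) (F q.1 q.2) ≤ K * dist p q ∧
      ∀ γ : π, K⁻¹ * dist p q ≤ hdist (F p.1 p.2) (act (S.σ γ) (F q.1 q.2))
  C : Set ℝ
  isClosed : IsClosed C
  subset : C ⊆ Set.Ioo c d
  dim_zero : dimH C = 0
  preimage : ∀ t ∈ Set.Icc a b, ∀ s ∈ Set.Icc c d, F t s ∈ Λ.support ↔ s ∈ C

/-- A transverse measure on a geodesic lamination: for every flow-box a finite measure `μ(s)` on
the transversal `[c,d]`, supported in `C`, compatible with changes of flow-boxes: if `h` is the
transverse part of a change of flow-boxes, i.e. on the Borel set `A ⊂ C` it is continuous and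
injective with values in `C'`, and the horizontal arcs at `s` and `h s` meet inside both boxes
(up to the deck transformation `γ`), then `h` carries `μ` on `A` to `μ'` on `h(A)`.
The full support of `μ` is not required. -/
structure TransverseMeasure (Λ : GeodesicLamination S) where
  μ : FlowBox Λ → Measure ℝ
  finite : ∀ R, IsFiniteMeasure (μ R)
  supported : ∀ R : FlowBox Λ, μ R (R.C)ᶜ = 0
  compatible : ∀ (R R' : FlowBox Λ) (γ : π) (A : Set ℝ) (h : ℝ → ℝ),
    MeasurableSet A → A ⊆ R.C → ContinuousOn h A → Set.InjOn h A →
    (∀ s ∈ A, h s ∈ R'.C ∧ ∃ t ∈ Set.Ioo R.a R.b, ∃ t' ∈ Set.Ioo R'.a R'.b,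
      R.F t s = act (S.σ γ) (R'.F t' (h s))) →
    μ R A = μ R' (h '' A)

/-! ### The current `T_μ` -/

/-- The element `B ∈ 𝔤` of the unit tangent vector `v / |v|` at `X`, i.e. `(v / |v|) × X`. -/
def generator (X v : V) : Mat := (√(mink v v))⁻¹ • cross v X

/-- `∂F/∂t` in a flow-box. -/
def FlowBox.dt {Λ : GeodesicLamination S} (R : FlowBox Λ) (t s : ℝ) : V :=
  deriv (fun τ => (R.F τ s : V)) t

/-- The coefficient of `dt` in the one-form `(φ, B)^♯` on the horizontal arc at height `s`, where
`B` is the generator of the leaf in the direction of increasing `t`. -/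
def FlowBox.integrand {Λ : GeodesicLamination S} (R : FlowBox Λ) (φ : RawForm) (t s : ℝ) : ℝ :=
  killing (φ (R.F t s) (R.dt t s)) (generator (R.F t s) (R.dt t s))

/-- `∫_c^d ∫_{(a,b) × {s}} (φ, B)^♯ dμ(s)`. -/
def TransverseMeasure.boxIntegral {Λ : GeodesicLamination S} (m : TransverseMeasure Λ)
    (R : FlowBox Λ) (φ : RawForm) : ℝ :=
  ∫ s, (∫ t in R.a..R.b, R.integrand φ t s) ∂(m.μ R)

/-- The equivariant form `φ`, as a form on `M`, is compactly supported inside the flow-box. -/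
def FlowBox.Supports {Λ : GeodesicLamination S} (R : FlowBox Λ) (φ : RawForm) : Prop :=
  ∃ K ⊆ Set.Ioo R.a R.b ×ˢ Set.Ioo R.c R.d, IsCompact K ∧
    ∀ X : Hyp, φ X ≠ 0 → ∃ γ : π, ∃ p ∈ K, X = act (S.σ γ) (R.F p.1 p.2)

/-- `φ = ∑ᵢ φᵢ` with `φᵢ ∈ Ω¹(M, ad(E_σ))` supported in the flow-box `Rᵢ`. -/
def IsDecomposition {Λ : GeodesicLamination S} (φ : Omega1 S) {n : ℕ} (R : Fin n → FlowBox Λ)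
    (ψ : Fin n → Omega1 S) : Prop :=
  φ = ∑ i, ψ i ∧ ∀ i, (R i).Supports (ψ i : RawForm)

/-- `T` is the current `T_μ`: for every decomposition of `φ` into forms supported in flow-boxes,
`T(φ) = ∑ᵢ ∫∫ (φᵢ, B)^♯ dμ(s)`. -/
def IsStandardCurrent {Λ : GeodesicLamination S} (m : TransverseMeasure Λ)
    (T : Omega1 S →ₗ[ℝ] ℝ) : Prop :=
  ∀ (φ : Omega1 S) (n : ℕ) (R : Fin n → FlowBox Λ) (ψ : Fin n → Omega1 S),
    IsDecomposition φ R ψ → T φ = ∑ i, m.boxIntegral (R i) (ψ i : RawForm)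

/-- `T` is closed: `T(dξ) = 0` for all `ξ ∈ Ω⁰(M, ad(E_σ))`. -/
def IsClosedCurrent (T : Omega1 S →ₗ[ℝ] ℝ) : Prop :=
  ∀ (ξ : Hyp → Mat) (φ : Omega1 S), IsOmega0 S ξ → IsDifferential (φ : RawForm) ξ → T φ = 0

/-- The support of `T` is contained in the lamination. -/
def IsSupportedOn (T : Omega1 S →ₗ[ℝ] ℝ) (Λ : GeodesicLamination S) : Prop :=
  ∀ (U : Set Hyp) (φ : Omega1 S), IsOpen U → Λ.support ⊆ U →
    (∀ X ∈ U, (φ : RawForm) X = 0) → T φ = 0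

/-- `T` has finite mass: it is bounded on the forms with `φ = φ_id` and `s(φ) ≤ √2`, where `s(φ)`
is the pointwise operator norm. -/
def HasFiniteMass (T : Omega1 S →ₗ[ℝ] ℝ) : Prop :=
  ∃ K : ℝ, ∀ φ : Omega1 S, (∀ X v, (φ : RawForm) X v = projForm φ X v) →
    (∀ (X : Hyp) (v : V), mink X v = 0 →
      killing ((φ : RawForm) X v) ((φ : RawForm) X v) ≤ 2 * mink v v) → T φ ≤ K

/-! ### Lie algebra valued transverse measures -/

/-- `w : ℍ → 𝔤` is of locally bounded variation. -/
def IsLocallyBV (w : Hyp → Mat) : Prop :=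
  (∀ i j, LocallyIntegrable (fun p : ℝ × ℝ => w (chart p) i j)) ∧
    ∀ K : Set Hyp, ∃ D : ℝ, ∀ η : RawForm, IsTestForm K η →
      (∀ X v i j, |η X v i j| ≤ ‖v‖) → |dCurrent w (fun X v => η X v)| ≤ D

/-- Lie algebra valued transverse measures on a geodesic lamination.
A function of bounded variation is defined up to null sets, and the leaves form a null set, so
that `w` is constant on a plaque (the closure of a component of the complement of the lamination)
when it is constant on the component and almost everywhere constant on its closure.
Since the current `dw` is invariant, conditions on the current which it induces on `M` are
expressed by compactly supported forms on `ℍ`. -/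
structure IsLieAlgebraTransverseMeasure (Λ : GeodesicLamination S) (w : Hyp → Mat) : Prop where
  mem : ∀ X, w X ∈ so21
  plaque : ∀ X : Hyp, X ∉ Λ.support → ∃ A : Mat,
    (∀ Y ∈ connectedComponentIn (Λ.support)ᶜ X, w Y = A) ∧
    ∀ᵐ p : ℝ × ℝ, chart p ∈ closure (connectedComponentIn (Λ.support)ᶜ X) → w (chart p) = A
  bv : IsLocallyBV w
  equivariant : ∃ α : π → Mat, (∀ γ, α γ ∈ so21) ∧
    (∀ γ₁ γ₂, α (γ₁ * γ₂) = Ad (S.σ γ₁) (α γ₂) + α γ₁) ∧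
    ∀ (γ : π) (X : Hyp), w (act (S.σ γ) X) = Ad (S.σ γ) (w X) + α γ
  tangent : ∀ (K : Set Hyp) (η : RawForm), IsTestForm K η →
    dCurrent w (projForm η) = dCurrent w (fun X v => η X v)
  positive : ∃ ν : Measure Hyp, IsFiniteMeasureOnCompacts ν ∧
    ∀ χ : Hyp → ℝ, SmoothOnHyp χ → HasCompactSupport χ →
      dCurrent w (maurerCartan χ) = ∫ X, χ X ∂ν

/-- `T = dw`: the current `T` on `M` is the one to which the current `dw` on `ℍ` descends, i.e.
`T(φ) = dw(η)` whenever the compactly supported form `η` on `ℍ` is pushed forward to `φ`,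
`φ = ∑_γ γ·η`. -/
def IsDerivative (T : Omega1 S →ₗ[ℝ] ℝ) (w : Hyp → Mat) : Prop :=
  ∀ (K : Set Hyp) (η : RawForm) (φ : Omega1 S), IsTestForm K η →
    (∀ (X : Hyp) (v : V), (φ : RawForm) X v =
      ∑ᶠ γ : π, Ad (S.σ γ) (η (act (S.σ γ⁻¹) X) (lin (S.σ γ⁻¹) v))) →
    T φ = dCurrent w (fun X v => η X v)

end Surface

end

end LieLam

open LieLam

namespace LieLam

/-! ### Lorentzian linear algebra -/

/-! Along a leaf with unit normal `n` the element `B = e × X` is the same at all points: it is `dual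
n`, the cross product with `n` (`cross_lx_eq_dual`). Reversing the leaf changes the sign of `B` and
of the direction of integration, so `(φ, B)^♯` along a leaf needs no orientation. `T_μ` is therefore
an integral over the space of leaves of the integral of `(φ, B)^♯` by arc length.

A leaf is represented by its two unit normals. The transverse measures of flow-boxes, pushed to
normals, agree where they overlap by compatibility and glue. After symmetrization under `n ↦ -n`
they give `leafMeasure`, which is invariant under the deck group (`map_lin_leafMeasure`) and finite
on the leaves that meet a compact set. `current` integrates `cutoff` times the density of `φ` over
all leaves, where the translates of `cutoff` add up to one. By unfolding (`leafIntegral_unfold`)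
every kernel with the right sum over the group gives the same value. For `φ` supported in a flow-box
such a kernel is the density on the slab `[a,b] × C`, whose leaf integral is the box integral
(`leafIntegral_slab_C`); this proves independence of the decomposition. For `φ = dξ` the kernel can
be chosen as the derivative of a compactly supported function along each leaf, so `T_μ(dξ) = 0`.
Cauchy-Schwarz bounds the mass.

The function `w` is `dual (primitive X)`, where `primitive X` is half the signed sum of the normals
of the leaves separating `X` from a base point off the lamination. By Fubini `dw` is a superposition
of derivatives of indicator functions of half-planes. Stokes' theorem in Fermi coordinates
(`IsTestForm.integral_half_plane`) evaluates each of them as an integral along a leaf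
(`dCurrent_primitive`), so `dw` descends to `T_μ`. Values are tangent because `dual n = e × X` on
the leaf, and pairing with the Maurer-Cartan form gives the product of transverse measure and
length. Invariance of `leafMeasure` makes `w` equivariant up to the cocycle caused by the base
point.

All this needs flow-boxes around every point, hence transversals that meet the lamination in
Hausdorff dimension zero. If two leaves crossing a short transversal stay close during `[-T, T]`,
their crossings are within `δ₀ / cosh T`. The number of leaves pairwise separated by time `T` grows
only linearly in `T` (`card_separated_le`). So linearly many exponentially short intervals cover the
intersection. In Klein coordinates leaves are straight, disjointness makes their slopes Lipschitz,
and a sheared rectangle is a flow-box (`exists_niceBox`). -/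

theorem mink_eq (X Y : V) : mink X Y = X 0 * Y 0 + X 1 * Y 1 - X 2 * Y 2 := by
  simp [mink, eSharp, Matrix.mulVec_diagonal, dotProduct, Fin.sum_univ_three]
  ring

theorem mink_comm (X Y : V) : mink X Y = mink Y X := by simp only [mink_eq]; ring

@[simp] theorem mink_add_left (X Y Z : V) : mink (X + Y) Z = mink X Z + mink Y Z := by
  simp only [mink_eq, Pi.add_apply]; ring

@[simp] theorem mink_add_right (X Y Z : V) : mink X (Y + Z) = mink X Y + mink X Z := by
  simp only [mink_eq, Pi.add_apply]; ring

@[simp] theorem mink_sub_left (X Y Z : V) : mink (X - Y) Z = mink X Z - mink Y Z := by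
  simp only [mink_eq, Pi.sub_apply]; ring

@[simp] theorem mink_sub_right (X Y Z : V) : mink X (Y - Z) = mink X Y - mink X Z := by
  simp only [mink_eq, Pi.sub_apply]; ring

@[simp] theorem mink_smul_left (c : ℝ) (X Y : V) : mink (c • X) Y = c * mink X Y := by
  simp only [mink_eq, Pi.smul_apply, smul_eq_mul]; ring

@[simp] theorem mink_smul_right (c : ℝ) (X Y : V) : mink X (c • Y) = c * mink X Y := by
  simp only [mink_eq, Pi.smul_apply, smul_eq_mul]; ring

@[simp] theorem mink_neg_left (X Y : V) : mink (-X) Y = -mink X Y := by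
  simp only [mink_eq, Pi.neg_apply]; ring

@[simp] theorem mink_neg_right (X Y : V) : mink X (-Y) = -mink X Y := by
  simp only [mink_eq, Pi.neg_apply]; ring

theorem continuous_mink : Continuous fun p : V × V => mink p.1 p.2 := by
  simp only [mink_eq]; fun_prop

theorem _root_.Continuous.mink {α : Type*} [TopologicalSpace α] {f g : α → V} (hf : Continuous f)
    (hg : Continuous g) : Continuous fun x => mink (f x) (g x) :=
  continuous_mink.comp (hf.prodMk hg)

theorem abs_mink_le (X Y : V) : |mink X Y| ≤ 3 * ‖X‖ * ‖Y‖ := by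
  have h : ∀ i, |X i * Y i| ≤ ‖X‖ * ‖Y‖ := fun i => by
    rw [abs_mul]
    exact mul_le_mul (norm_le_pi_norm X i) (norm_le_pi_norm Y i) (abs_nonneg _) (norm_nonneg _)
  rw [mink_eq]
  have h0 := abs_le.1 (h 0)
  have h1 := abs_le.1 (h 1)
  have h2 := abs_le.1 (h 2)
  rw [abs_le]
  constructor <;> linarith

/-- The Lorentzian cross product: `mink (lx a b) c = det (a, b, c)`. -/
def lx (a b : V) : V := ![a 1 * b 2 - a 2 * b 1, a 2 * b 0 - a 0 * b 2, -(a 0 * b 1 - a 1 * b 0)]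

@[simp] theorem lx_zero (a b : V) : lx a b 0 = a 1 * b 2 - a 2 * b 1 := rfl
@[simp] theorem lx_one (a b : V) : lx a b 1 = a 2 * b 0 - a 0 * b 2 := rfl
@[simp] theorem lx_two (a b : V) : lx a b 2 = -(a 0 * b 1 - a 1 * b 0) := rfl

@[simp] theorem mink_lx_left (a b : V) : mink (lx a b) a = 0 := by simp [mink_eq]; ring
@[simp] theorem mink_lx_right (a b : V) : mink (lx a b) b = 0 := by simp [mink_eq]; ring

theorem mink_lx_lx (a b : V) : mink (lx a b) (lx a b) = mink a b ^ 2 - mink a a * mink b b := by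
  simp [mink_eq]; ring

theorem lx_lx (a b : V) : lx a (lx a b) = mink a a • b - mink a b • a := by
  ext i; fin_cases i <;> simp [mink_eq] <;> ring

theorem V.ext3 {a b : V} (h0 : a 0 = b 0) (h1 : a 1 = b 1) (h2 : a 2 = b 2) : a = b := by
  ext i; fin_cases i <;> assumption

theorem Hyp.mink_self (X : Hyp) : mink X X = -1 := X.2.1
theorem Hyp.one_le (X : Hyp) : 1 ≤ (X : V) 2 := X.2.2

/-- A unit timelike vector lies on one of the two sheets of the hyperboloid, and by the reversed
Cauchy-Schwarz inequality its product with a point of `ℍ` is positive on the lower sheet. -/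
theorem one_le_of_mink_neg (X : Hyp) {Y : V} (h : mink Y Y = -1) (hXY : mink X Y ≤ 0) :
    1 ≤ Y 2 := by
  have h1 := X.mink_self
  have h2 := X.one_le
  rw [mink_eq] at h h1 hXY
  by_contra hY
  have h3 : 1 ≤ Y 2 ^ 2 := by nlinarith [sq_nonneg (Y 0), sq_nonneg (Y 1)]
  have h4 : Y 2 ≤ -1 := by nlinarith
  have h5 : (X.1 0 * Y 0 + X.1 1 * Y 1) ^ 2 ≤ (X.1 2 ^ 2 - 1) * (Y 2 ^ 2 - 1) := by
    have e1 : X.1 2 ^ 2 - 1 = X.1 0 ^ 2 + X.1 1 ^ 2 := by linarith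
    have e2 : Y 2 ^ 2 - 1 = Y 0 ^ 2 + Y 1 ^ 2 := by linarith
    rw [e1, e2]; nlinarith [sq_nonneg (X.1 0 * Y 1 - X.1 1 * Y 0)]
  have h6 : X.1 0 * Y 0 + X.1 1 * Y 1 ≤ X.1 2 * Y 2 := by linarith
  have h7 : (X.1 2 * Y 2) ^ 2 ≤ (X.1 0 * Y 0 + X.1 1 * Y 1) ^ 2 := by
    have : X.1 2 * Y 2 ≤ 0 := by nlinarith
    exact sq_le_sq' (by linarith) (by linarith) |>.trans' (by nlinarith) |>.trans (by nlinarith)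
  nlinarith

theorem mink_hyp_le (X Y : Hyp) : mink X Y ≤ -1 := by
  have h1 := X.mink_self
  have h2 := X.one_le
  have h3 := Y.mink_self
  have h4 := Y.one_le
  rw [mink_eq] at *
  have h5 : (X.1 0 * Y.1 0 + X.1 1 * Y.1 1) ^ 2 ≤ (X.1 2 * Y.1 2 - 1) ^ 2 := by
    have e1 : X.1 0 ^ 2 + X.1 1 ^ 2 = X.1 2 ^ 2 - 1 := by linarith
    have e2 : Y.1 0 ^ 2 + Y.1 1 ^ 2 = Y.1 2 ^ 2 - 1 := by linarith
    nlinarith [sq_nonneg (X.1 0 * Y.1 1 - X.1 1 * Y.1 0), sq_nonneg (X.1 2 - Y.1 2)]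
  have h6 : 0 ≤ X.1 2 * Y.1 2 - 1 := by nlinarith
  have := abs_le_of_sq_le_sq' h5 h6
  linarith [this.2]

theorem Hyp.two_sq (X : Hyp) : (X : V) 2 = √(1 + (X : V) 0 ^ 2 + (X : V) 1 ^ 2) := by
  have h1 := X.mink_self
  have h2 := X.one_le
  rw [mink_eq] at h1
  rw [eq_comm, Real.sqrt_eq_iff_mul_self_eq (by positivity) (by linarith)]
  linarith

/-- Vectors orthogonal to a point of the hyperbolic plane are controlled by their length. -/
theorem sq_le_of_orthogonal (X : Hyp) {w : V} (h : mink w X = 0) (i : Fin 3) :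
    w i ^ 2 ≤ (X : V) 2 ^ 2 * mink w w := by
  have h1 := X.mink_self
  have h2 := X.one_le
  rw [mink_eq] at *
  have e0 : w 2 * X.1 2 = w 0 * X.1 0 + w 1 * X.1 1 := by linarith
  have e1 : X.1 2 ^ 2 = X.1 0 ^ 2 + X.1 1 ^ 2 + 1 := by linarith
  have key : w 0 ^ 2 + w 1 ^ 2 ≤ X.1 2 ^ 2 * (w 0 * w 0 + w 1 * w 1 - w 2 * w 2) := by
    have : X.1 2 ^ 2 * (w 2 * w 2) = (w 0 * X.1 0 + w 1 * X.1 1) ^ 2 := by rw [← e0]; ring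
    rw [mul_sub, this, e1]
    nlinarith [sq_nonneg (w 0 * X.1 1 - w 1 * X.1 0)]
  have h3 : w 2 ^ 2 ≤ w 0 ^ 2 + w 1 ^ 2 := by
    have : X.1 2 ^ 2 * (w 2 ^ 2) = (w 0 * X.1 0 + w 1 * X.1 1) ^ 2 := by rw [← e0]; ring
    have h4 : (w 0 * X.1 0 + w 1 * X.1 1) ^ 2 ≤ X.1 2 ^ 2 * (w 0 ^ 2 + w 1 ^ 2) := by
      rw [e1]; nlinarith [sq_nonneg (w 0 * X.1 1 - w 1 * X.1 0), sq_nonneg (w 0), sq_nonneg (w 1)]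
    have h5 : 0 < X.1 2 ^ 2 := by positivity
    exact le_of_mul_le_mul_left (this ▸ h4) h5
  fin_cases i <;> simp only [Fin.zero_eta, Fin.mk_one, Fin.reduceFinMk, Fin.isValue] <;>
    nlinarith [sq_nonneg (w 0), sq_nonneg (w 1)]

theorem mink_self_nonneg_of_orthogonal (X : Hyp) {w : V} (h : mink w X = 0) : 0 ≤ mink w w := by
  have h1 := sq_le_of_orthogonal X h 0
  have h2 := X.one_le
  by_contra h3
  have : 0 < X.1 2 ^ 2 := by positivity
  nlinarith [sq_nonneg (w 0)]

theorem norm_le_of_orthogonal (X : Hyp) {w : V} (h : mink w X = 0) :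
    ‖w‖ ≤ (X : V) 2 * √(mink w w) := by
  have h2 := X.one_le
  rw [pi_norm_le_iff_of_nonneg (by positivity)]
  intro i
  rw [Real.norm_eq_abs]
  apply abs_le_of_sq_le_sq _ (by positivity)
  rw [mul_pow, Real.sq_sqrt (mink_self_nonneg_of_orthogonal X h)]
  exact sq_le_of_orthogonal X h i

theorem norm_sub_smul_le (A B : Hyp) :
    ‖(B : V) - (-mink A B) • (A : V)‖ ≤ (A : V) 2 * √((mink A B) ^ 2 - 1) := by
  have h : mink ((B : V) - (-mink A B) • (A : V)) A = 0 := by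
    simp [A.mink_self, mink_comm]
  refine (norm_le_of_orthogonal A h).trans (le_of_eq ?_)
  congr 2
  simp [A.mink_self, B.mink_self, mink_comm (B : V) A]
  ring

/-- The part of `B - A` orthogonal to `A` has length `sinh d`, the part along `A` has coefficient
`cosh d - 1`. This converts hyperbolic closeness into Euclidean closeness. -/
theorem norm_sub_le_of_mink (A B : Hyp) :
    ‖(B : V) - A‖ ≤ (A : V) 2 * √((mink A B) ^ 2 - 1) + (-mink A B - 1) * ‖(A : V)‖ := by
  have h := mink_hyp_le A B
  have e : (B : V) - A = ((B : V) - (-mink A B) • (A : V)) + (-mink A B - 1) • (A : V) := by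
    module
  rw [e]
  refine (norm_add_le _ _).trans (add_le_add (norm_sub_smul_le A B) ?_)
  rw [norm_smul, Real.norm_eq_abs, abs_of_nonneg (by linarith)]

theorem mink_eq_neg_one_iff (A B : Hyp) : mink A B = -1 ↔ A = B := by
  constructor
  · intro h
    have := norm_sub_le_of_mink A B
    rw [h] at this
    norm_num at this
    exact (Subtype.ext (sub_eq_zero.1 this)).symm
  · rintro rfl; exact A.mink_self

theorem hdist_nonneg (X Y : Hyp) : 0 ≤ hdist X Y :=
  Real.arcosh_nonneg (by linarith [mink_hyp_le X Y])

theorem cosh_hdist (X Y : Hyp) : Real.cosh (hdist X Y) = -mink X Y :=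
  Real.cosh_arcosh (by linarith [mink_hyp_le X Y])

theorem hdist_eq_zero_iff (X Y : Hyp) : hdist X Y = 0 ↔ X = Y := by
  rw [hdist, Real.arcosh_eq_zero_iff (by linarith [mink_hyp_le X Y]), ← mink_eq_neg_one_iff]
  constructor <;> intro h <;> linarith

/-! ### Frames -/

/-- A Lorentz-orthonormal frame whose first vector is a point of the hyperbolic plane. -/
structure Frame where
  X : Hyp
  e : V
  n : V
  ee : mink e e = 1
  nn : mink n n = 1
  eX : mink e X = 0
  nX : mink n X = 0
  ne : mink n e = 0

namespace Frame

variable (f : Frame)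

theorem Xe : mink f.X f.e = 0 := by rw [mink_comm, f.eX]
theorem Xn : mink f.X f.n = 0 := by rw [mink_comm, f.nX]
theorem en : mink f.e f.n = 0 := by rw [mink_comm, f.ne]

/-- For the matrix `A` with rows `X, e, n` orthonormality reads `A e^♯ Aᵀ = J`. A one-sided inverse
of a square matrix is two-sided, which turns orthonormality into completeness. -/
theorem expand (v : V) :
    v = -(mink v f.X) • (f.X : V) + (mink v f.e) • f.e + (mink v f.n) • f.n := by
  let A : Mat := Matrix.of ![(f.X : V), f.e, f.n]
  let J : Mat := Matrix.diagonal ![-1, 1, 1]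
  have h1 : (J * A * eSharp) * Aᵀ = 1 := by
    have hXX := f.X.mink_self
    have h := f.ee; have h' := f.nn; have h2 := f.eX; have h3 := f.nX; have h4 := f.ne
    rw [mink_eq] at *
    ext i j
    fin_cases i <;> fin_cases j <;>
      simp [A, J, eSharp, Matrix.mul_apply, Fin.sum_univ_three, Matrix.diagonal_apply] <;> linarith
  have h2 : Aᵀ * (J * A * eSharp) = 1 := mul_eq_one_comm.1 h1
  have h3 : v = (Aᵀ * (J * A * eSharp)) *ᵥ v := by rw [h2, Matrix.one_mulVec]
  conv_lhs => rw [h3]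
  ext i
  fin_cases i <;>
    simp [A, J, eSharp, Matrix.mul_apply, Fin.sum_univ_three, Matrix.diagonal_apply,
      Matrix.mulVec, dotProduct, mink_eq] <;> ring

theorem mink_expand (v w : V) :
    mink v w = -(mink v f.X * mink w f.X) + mink v f.e * mink w f.e + mink v f.n * mink w f.n := by
  conv_lhs => rw [f.expand v]
  simp only [mink_add_left, mink_smul_left, neg_smul, mink_neg_left]
  rw [mink_comm _ w, mink_comm _ w, mink_comm _ w]

/-- The vector at time `t` on the geodesic through `f.X` in the direction of `f.e`. -/
noncomputable def vec (t : ℝ) : V := Real.cosh t • (f.X : V) + Real.sinh t • f.e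

/-- The velocity of the geodesic. -/
noncomputable def vel (t : ℝ) : V := Real.sinh t • (f.X : V) + Real.cosh t • f.e

theorem mink_vec (v : V) (t : ℝ) :
    mink v (f.vec t) = Real.cosh t * mink v f.X + Real.sinh t * mink v f.e := by simp [vec]

theorem vec_mem (t : ℝ) : mink (f.vec t) (f.vec t) = -1 ∧ 1 ≤ f.vec t 2 := by
  have h : mink (f.vec t) (f.vec t) = -1 := by
    simp [vec, f.X.mink_self, f.ee, f.eX, f.Xe]
    nlinarith [Real.cosh_sq t]
  refine ⟨h, one_le_of_mink_neg f.X h ?_⟩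
  simp [vec, f.X.mink_self, f.Xe]
  exact (Real.cosh_pos t).le

/-- The point at time `t` on the geodesic. -/
noncomputable def pt (t : ℝ) : Hyp := ⟨f.vec t, f.vec_mem t⟩

@[simp] theorem coe_pt (t : ℝ) : (f.pt t : V) = f.vec t := rfl

theorem pt_zero : f.pt 0 = f.X := Subtype.ext (by simp [vec])

/-- Transport of a frame along its geodesic. -/
noncomputable def move (t : ℝ) : Frame where
  X := f.pt t
  e := f.vel t
  n := f.n
  ee := by simp [vel, f.X.mink_self, f.ee, f.eX, f.Xe]; nlinarith [Real.cosh_sq t]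
  nn := f.nn
  eX := by simp [vel, vec, f.X.mink_self, f.ee, f.eX, f.Xe]; ring
  nX := by simp [vec, f.nX, f.ne]
  ne := by simp [vel, f.nX, f.ne]

@[simp] theorem move_X (t : ℝ) : (f.move t).X = f.pt t := rfl
@[simp] theorem move_n (t : ℝ) : (f.move t).n = f.n := rfl
@[simp] theorem move_e (t : ℝ) : (f.move t).e = f.vel t := rfl

theorem move_pt (s t : ℝ) : (f.move s).pt t = f.pt (s + t) := by
  apply Subtype.ext
  simp only [coe_pt, vec, move_X, move_e, vel, Real.cosh_add, Real.sinh_add]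
  module

theorem mink_vec_vec (s t : ℝ) : mink (f.vec s) (f.vec t) = -Real.cosh (s - t) := by
  simp [vec, f.X.mink_self, f.ee, f.eX, f.Xe, Real.cosh_sub]; ring

theorem hdist_pt (s t : ℝ) : hdist (f.pt s) (f.pt t) = |s - t| := by
  rw [hdist, coe_pt, coe_pt, mink_vec_vec, neg_neg, ← Real.cosh_abs,
    Real.arcosh_cosh (abs_nonneg _)]

theorem pt_injective : Function.Injective f.pt := fun s t h => by
  have := f.hdist_pt s t
  rw [h, (hdist_eq_zero_iff _ _).2 rfl] at this
  linarith [abs_eq_zero.1 this.symm]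

theorem continuous_pt : Continuous f.pt :=
  Continuous.subtype_mk (by unfold vec; fun_prop) _

end Frame

/-- The geodesic with normal vector `n`. -/
def line (n : V) : Set Hyp := {Y | mink n Y = 0}

theorem Frame.pt_mem_line (f : Frame) (t : ℝ) : f.pt t ∈ line f.n := by
  simp [line, Frame.vec, f.nX, f.ne]

theorem Frame.mem_line (f : Frame) {Y : Hyp} (h : Y ∈ line f.n) :
    Y = f.pt (Real.arsinh (mink f.e Y)) := by
  have h0 : mink (Y : V) f.n = 0 := by rw [mink_comm]; exact h
  have h1 := f.expand Y
  have h2 := f.mink_expand Y Y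
  have h3 := mink_hyp_le Y f.X
  rw [h0, Y.mink_self] at h2
  have h4 : -(mink (Y : V) f.X) = Real.cosh (Real.arsinh (mink f.e Y)) := by
    rw [Real.cosh_arsinh, eq_comm, Real.sqrt_eq_iff_mul_self_eq (by positivity) (by linarith),
      mink_comm f.e]
    linarith
  apply Subtype.ext
  rw [f.coe_pt, Frame.vec, Real.sinh_arsinh, ← h4, mink_comm f.e]
  conv_lhs => rw [h1]
  rw [h0]; simp

theorem Frame.line_eq (f : Frame) : line f.n = Set.range f.pt := by
  ext Y
  exact ⟨fun h => ⟨_, (f.mem_line h).symm⟩, by rintro ⟨t, rfl⟩; exact f.pt_mem_line t⟩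

/-- The frame of a point and a unit tangent vector. -/
def Frame.mk' (X : Hyp) (e : V) (ee : mink e e = 1) (eX : mink e X = 0) : Frame where
  X := X
  e := e
  n := lx X e
  ee := ee
  nn := by rw [mink_lx_lx, X.mink_self, ee, mink_comm, eX]; norm_num
  eX := eX
  nX := by simp
  ne := by simp

/-- The frame of a geodesic, given by its normal vector, at one of its points. -/
def Frame.ofNormal (X : Hyp) (n : V) (nn : mink n n = 1) (nX : mink n X = 0) : Frame where
  X := X
  e := lx n X
  n := n
  ee := by rw [mink_lx_lx, X.mink_self, nn, nX]; norm_num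
  nn := nn
  eX := by simp
  nX := nX
  ne := by rw [mink_comm]; simp

theorem exists_frame (X : Hyp) : ∃ f : Frame, f.X = X := by
  let w : V := ![1, 0, 0] + (X : V) 0 • (X : V)
  have h1 : mink w X = 0 := by
    have := X.mink_self
    rw [mink_eq] at *; simp only [w, Pi.add_apply, Pi.smul_apply, smul_eq_mul]; simp; linear_combination (X : V) 0 * this
  have h2 : mink w w = 1 + (X : V) 0 ^ 2 := by
    have := X.mink_self
    rw [mink_eq] at *; simp only [w, Pi.add_apply, Pi.smul_apply, smul_eq_mul]; simp; linear_combination (X : V) 0 ^ 2 * this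
  have h3 : 0 < √(mink w w) := by rw [h2]; positivity
  refine ⟨Frame.mk' X ((√(mink w w))⁻¹ • w) ?_ (by simp [h1]), rfl⟩
  rw [mink_smul_left, mink_smul_right, ← mul_assoc, ← mul_inv, Real.mul_self_sqrt (by rw [h2]; positivity),
    inv_mul_cancel₀]
  rw [h2]; positivity

theorem isGeodesicLine_iff {L : Set Hyp} : IsGeodesicLine L ↔ ∃ f : Frame, L = line f.n := by
  constructor
  · rintro ⟨X, v, hv, hX, rfl⟩
    refine ⟨Frame.mk' X v hv (by rw [mink_comm, hX]), ?_⟩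
    rw [Frame.line_eq]
    ext Y
    simp only [Set.mem_ofPred_eq, Set.mem_range, Subtype.ext_iff]
    exact exists_congr fun t => eq_comm
  · rintro ⟨f, rfl⟩
    refine ⟨f.X, f.e, f.ee, f.Xe, ?_⟩
    rw [Frame.line_eq]
    ext Y
    simp only [Set.mem_ofPred_eq, Set.mem_range, Subtype.ext_iff]
    exact exists_congr fun t => eq_comm

/-- Disjoint geodesics have normal vectors whose product is at least one in absolute value. -/
theorem one_le_sq_of_disjoint {n : V} (hn : mink n n = 1) (f : Frame)
    (h : Disjoint (line n) (line f.n)) : 1 ≤ mink n f.n ^ 2 := by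
  by_contra hlt
  push Not at hlt
  have h1 := f.mink_expand n n
  rw [hn] at h1
  set α := mink n f.X
  set β := mink n f.e
  have h2 : α ^ 2 < β ^ 2 := by nlinarith
  have h3 : 0 < β ^ 2 - α ^ 2 := by linarith
  have h3' : 0 < √(β ^ 2 - α ^ 2) := Real.sqrt_pos.2 h3
  have hβ : β ≠ 0 := by rintro hb; rw [hb] at h2; nlinarith [sq_nonneg α]
  obtain ⟨c, hc1, hc2⟩ : ∃ c : ℝ, 0 < c * β ∧ c ^ 2 * (β ^ 2 - α ^ 2) = 1 := by
    rcases lt_or_gt_of_ne hβ with hb | hb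
    · refine ⟨-(√(β ^ 2 - α ^ 2))⁻¹, by nlinarith [inv_pos.2 h3'], ?_⟩
      rw [neg_sq, inv_pow, Real.sq_sqrt h3.le, inv_mul_cancel₀ h3.ne']
    · refine ⟨(√(β ^ 2 - α ^ 2))⁻¹, by positivity, ?_⟩
      rw [inv_pow, Real.sq_sqrt h3.le, inv_mul_cancel₀ h3.ne']
  -- The intersection of the two geodesics: this combination of `X` and `e` is orthogonal to both
  -- normals, and `α² < β²` makes it timelike.
  let Y : V := (c * β) • (f.X : V) - (c * α) • f.e
  have hY : mink Y Y = -1 := by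
    simp [Y, f.X.mink_self, f.ee, f.eX, f.Xe]; nlinarith
  have hY2 : 1 ≤ Y 2 := one_le_of_mink_neg f.X hY (by
    simp [Y, f.X.mink_self, f.Xe]; exact hc1.le)
  have hd := Set.disjoint_left.1 h
  refine @hd ⟨Y, And.intro hY hY2⟩ ?_ ?_
  · simp only [line, Set.mem_ofPred_eq, Y, mink_sub_right, mink_smul_right]
    change c * β * α - c * α * β = 0
    ring
  · simp [line, Y, f.nX, f.ne]

theorem eq_or_eq_neg_of_line_subset {n : V} (hn : mink n n = 1) (f : Frame)
    (h : line f.n ⊆ line n) : n = f.n ∨ n = -f.n := by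
  have h0 : mink n f.X = 0 := by
    have := h (f.pt_mem_line 0); rwa [f.pt_zero] at this
  have h1 : mink n f.e = 0 := by
    have := h (f.pt_mem_line 1)
    simp only [line, Set.mem_ofPred_eq, f.coe_pt, f.mink_vec, h0, mul_zero, zero_add] at this
    exact (mul_eq_zero.1 this).resolve_left (Real.sinh_pos_iff.2 one_pos).ne'
  have h2 := f.mink_expand n n
  have h3 := f.expand n
  rw [h0, h1] at h2 h3
  rw [hn] at h2
  have : mink n f.n ^ 2 = 1 := by linarith
  rcases sq_eq_one_iff_of_ne_zero.1 this with h | h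
  · left; rw [h] at h3; simpa using h3
  · right; rw [h] at h3; simpa using h3
where
  sq_eq_one_iff_of_ne_zero {a : ℝ} : a ^ 2 = 1 ↔ a = 1 ∨ a = -1 := sq_eq_one_iff

/-- The product of a normal vector with the points of a geodesic which does not cross the
corresponding geodesic has constant sign. -/
theorem sq_mink_e_le {n : V} (hn : mink n n = 1) (f : Frame) (h : 1 ≤ mink n f.n ^ 2) :
    mink n f.e ^ 2 ≤ mink n f.X ^ 2 := by
  have h1 := f.mink_expand n n
  rw [hn] at h1
  nlinarith

/-! ### The action of the group -/

@[simp] theorem mink_lin (g : SOPlus) (v w : V) : mink (lin g v) (lin g w) = mink v w := g.2.1 v w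

@[simp] theorem lin_add (g : SOPlus) (v w : V) : lin g (v + w) = lin g v + lin g w :=
  Matrix.mulVec_add _ _ _

@[simp] theorem lin_neg (g : SOPlus) (v : V) : lin g (-v) = -lin g v := Matrix.mulVec_neg _ _

@[simp] theorem lin_smul (g : SOPlus) (c : ℝ) (v : V) : lin g (c • v) = c • lin g v :=
  Matrix.mulVec_smul _ _ _

theorem lin_mul (g h : SOPlus) (v : V) : lin (g * h) v = lin g (lin h v) := by
  simp [lin, Matrix.mulVec_mulVec]

@[simp] theorem lin_one (v : V) : lin 1 v = v := by simp [lin]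

@[simp] theorem lin_inv_lin (g : SOPlus) (v : V) : lin g⁻¹ (lin g v) = v := by
  rw [← lin_mul]; simp

@[simp] theorem lin_lin_inv (g : SOPlus) (v : V) : lin g (lin g⁻¹ v) = v := by
  rw [← lin_mul]; simp

@[simp] theorem coe_act (g : SOPlus) (X : Hyp) : (act g X : V) = lin g X := rfl

theorem act_mul (g h : SOPlus) (X : Hyp) : act (g * h) X = act g (act h X) :=
  Subtype.ext (lin_mul g h X)

@[simp] theorem act_one (X : Hyp) : act 1 X = X := Subtype.ext (lin_one _)

@[simp] theorem act_inv_act (g : SOPlus) (X : Hyp) : act g⁻¹ (act g X) = X := by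
  rw [← act_mul]; simp

@[simp] theorem act_act_inv (g : SOPlus) (X : Hyp) : act g (act g⁻¹ X) = X := by
  rw [← act_mul]; simp

@[simp] theorem hdist_act (g : SOPlus) (X Y : Hyp) : hdist (act g X) (act g Y) = hdist X Y := by
  simp [hdist]

theorem mink_lin_inv_right (g : SOPlus) (v w : V) : mink v (lin g⁻¹ w) = mink (lin g v) w := by
  rw [← mink_lin g, lin_lin_inv]

theorem continuous_lin (g : SOPlus) : Continuous (lin g) := by
  unfold lin; exact Continuous.matrix_mulVec continuous_const continuous_id

theorem continuous_act (g : SOPlus) : Continuous (act g) :=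
  Continuous.subtype_mk ((continuous_lin g).comp continuous_subtype_val) _

/-- The homeomorphism of the hyperbolic plane given by an element of the group. -/
def actHomeo (g : SOPlus) : Hyp ≃ₜ Hyp where
  toFun := act g
  invFun := act g⁻¹
  left_inv := act_inv_act g
  right_inv := act_act_inv g
  continuous_toFun := continuous_act g
  continuous_invFun := continuous_act g⁻¹

/-- The image of a frame. -/
def Frame.map (g : SOPlus) (f : Frame) : Frame where
  X := act g f.X
  e := lin g f.e
  n := lin g f.n
  ee := by simp [f.ee]
  nn := by simp [f.nn]
  eX := by simp [f.eX]
  nX := by simp [f.nX]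
  ne := by simp [f.ne]

theorem Frame.map_pt (g : SOPlus) (f : Frame) (t : ℝ) : (f.map g).pt t = act g (f.pt t) :=
  Subtype.ext (by simp [Frame.vec, Frame.map])

theorem image_line (g : SOPlus) (n : V) : act g '' line n = line (lin g n) := by
  ext Y
  constructor
  · rintro ⟨X, hX, rfl⟩
    simpa [line] using hX
  · intro h
    refine ⟨act g⁻¹ Y, ?_, by simp⟩
    simpa [line, mink_lin_inv_right] using h

/-! ### The Lie algebra -/

theorem cross_mulVec (X Y v : V) : cross X Y *ᵥ v = mink X v • Y - mink Y v • X := by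
  ext i
  simp only [cross, Matrix.sub_mulVec, Pi.sub_apply, Pi.smul_apply, smul_eq_mul, mink_eq]
  simp [Matrix.mulVec, Matrix.vecMulVec, dotProduct, eSharp, Fin.sum_univ_three,
    Matrix.diagonal_apply]
  ring

theorem Mat.ext_mulVec {A B : Mat} (h : ∀ v, A *ᵥ v = B *ᵥ v) : A = B :=
  Matrix.mulVec_injective (funext h)

theorem cross_add_left (X Y Z : V) : cross (X + Y) Z = cross X Z + cross Y Z :=
  Mat.ext_mulVec fun v => by
    rw [Matrix.add_mulVec]; simp only [cross_mulVec, mink_add_left]; module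

theorem cross_smul_left (c : ℝ) (X Z : V) : cross (c • X) Z = c • cross X Z :=
  Mat.ext_mulVec fun v => by
    rw [Matrix.smul_mulVec]; simp only [cross_mulVec, mink_smul_left]; module

@[simp] theorem cross_self (X : V) : cross X X = 0 := by simp [cross]
theorem Ad_mulVec (g : SOPlus) (A : Mat) (v : V) : Ad g A *ᵥ v = lin g (A *ᵥ lin g⁻¹ v) := by
  simp only [Ad, lin, Matrix.mulVec_mulVec, Matrix.mul_assoc]

theorem Ad_smul (g : SOPlus) (c : ℝ) (A : Mat) : Ad g (c • A) = c • Ad g A := by simp [Ad]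

theorem Ad_mul (g h : SOPlus) (A : Mat) : Ad (g * h) A = Ad g (Ad h A) :=
  Mat.ext_mulVec fun v => by simp only [Ad_mulVec, mul_inv_rev, lin_mul]

@[simp] theorem Ad_one (A : Mat) : Ad 1 A = A := by simp [Ad]

@[simp] theorem Ad_Ad_inv (g : SOPlus) (A : Mat) : Ad g (Ad g⁻¹ A) = A := by rw [← Ad_mul]; simp

theorem killing_Ad (g : SOPlus) (A B : Mat) : killing (Ad g A) (Ad g B) = killing A B := by
  have h : (((g⁻¹ : SOPlus) : Matrix.SpecialLinearGroup (Fin 3) ℝ) : Mat) *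
      ((g : Matrix.SpecialLinearGroup (Fin 3) ℝ) : Mat) = 1 := by
    rw [← Matrix.SpecialLinearGroup.coe_mul, ← Subgroup.coe_mul]; simp
  unfold killing Ad
  rw [Matrix.mul_assoc, Matrix.mul_assoc, Matrix.trace_mul_comm]
  congr 1
  calc _ = A * ((((g⁻¹ : SOPlus) : Matrix.SpecialLinearGroup (Fin 3) ℝ) : Mat) *
      ((g : Matrix.SpecialLinearGroup (Fin 3) ℝ) : Mat)) * B *
      ((((g⁻¹ : SOPlus) : Matrix.SpecialLinearGroup (Fin 3) ℝ) : Mat) *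
      ((g : Matrix.SpecialLinearGroup (Fin 3) ℝ) : Mat)) := by simp only [Matrix.mul_assoc]
    _ = A * B := by rw [h, mul_one, mul_one]

theorem killing_eq (A B : Mat) : killing A B = ∑ i, ∑ j, A i j * B j i := by
  simp [killing, Matrix.trace, Matrix.mul_apply]

theorem killing_add_left (A B C : Mat) : killing (A + B) C = killing A C + killing B C := by
  simp [killing, add_mul]
theorem killing_add_right (A B C : Mat) : killing A (B + C) = killing A B + killing A C := by
  simp [killing, mul_add]
theorem killing_smul_left (c : ℝ) (A C : Mat) : killing (c • A) C = c * killing A C := by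
  simp [killing]
theorem killing_smul_right (c : ℝ) (A C : Mat) : killing A (c • C) = c * killing A C := by
  simp [killing]
@[simp] theorem killing_zero_left (C : Mat) : killing 0 C = 0 := by simp [killing]
@[simp] theorem killing_zero_right (C : Mat) : killing C 0 = 0 := by simp [killing]
theorem killing_neg_left (A C : Mat) : killing (-A) C = -killing A C := by simp [killing]
theorem killing_neg_right (A C : Mat) : killing A (-C) = -killing A C := by simp [killing]
theorem killing_comm (A B : Mat) : killing A B = killing B A := Matrix.trace_mul_comm A B

theorem killing_cross_right (A : Mat) (X Y : V) :
    killing A (cross X Y) = mink X (A *ᵥ Y) - mink Y (A *ᵥ X) := by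
  simp [killing_eq, cross, Matrix.vecMulVec, eSharp, Matrix.mulVec, dotProduct, Fin.sum_univ_three,
    mink_eq, Matrix.diagonal_apply]
  ring

theorem mem_so21_iff {A : Mat} : A ∈ so21 ↔ ∀ v w, mink (A *ᵥ v) w = -mink v (A *ᵥ w) := by
  have key : ∀ v w : V, mink (A *ᵥ v) w = v ⬝ᵥ ((Aᵀ * eSharp) *ᵥ w) := fun v w => by
    rw [mink, ← Matrix.mulVec_mulVec, Matrix.dotProduct_mulVec v, Matrix.vecMul_transpose]
  have key2 : ∀ v w : V, -mink v (A *ᵥ w) = v ⬝ᵥ ((eSharp * -A) *ᵥ w) := fun v w => by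
    rw [mink, ← Matrix.mulVec_mulVec, Matrix.neg_mulVec, Matrix.mulVec_neg, dotProduct_neg]
  rw [so21, mem_skewAdjointMatricesSubmodule, Matrix.IsSkewAdjoint, Matrix.IsAdjointPair]
  constructor
  · intro h v w
    rw [key, key2, h]
  · intro h
    ext i j
    have := h (Pi.single i 1) (Pi.single j 1)
    rw [key, key2] at this
    simpa using this

theorem cross_mem (X Y : V) : cross X Y ∈ so21 := by
  rw [mem_so21_iff]
  intro v w
  simp only [cross_mulVec, mink_sub_left, mink_sub_right, mink_smul_left, mink_smul_right]
  rw [mink_comm X v, mink_comm Y v]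
  ring

theorem killing_cross {A : Mat} (hA : A ∈ so21) (X Y : V) :
    killing A (cross X Y) = 2 * mink X (A *ᵥ Y) := by
  rw [killing_cross_right, mink_comm Y, mem_so21_iff.1 hA]; ring

theorem killing_cross_cross (X Y Z W : V) :
    killing (cross X Y) (cross Z W) = 2 * (mink X W * mink Y Z - mink X Z * mink Y W) := by
  rw [killing_cross (cross_mem _ _), cross_mulVec, mink_sub_right, mink_smul_right, mink_smul_right,
    mink_comm Z, mink_comm Z]
  ring

end LieLam

namespace LieLam

open Topology Filter

/-! ### Topology of the hyperbolic plane -/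

/-- The coordinates `(x, y)` of a vector. -/
def crd (v : V) : ℝ × ℝ := (v 0, v 1)

@[simp] theorem coe_chart (p : ℝ × ℝ) : (chart p : V) = chartV p := rfl

@[simp] theorem crd_chartV (p : ℝ × ℝ) : crd (chartV p) = p := rfl

@[simp] theorem chart_crd (X : Hyp) : chart (crd X) = X := by
  apply Subtype.ext
  refine V.ext3 rfl rfl ?_
  rw [X.two_sq]; rfl

theorem contDiff_chartV : ContDiff ℝ ∞ chartV := by
  rw [contDiff_pi]
  intro i
  fin_cases i
  · exact contDiff_fst
  · exact contDiff_snd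
  · change ContDiff ℝ ∞ fun p : ℝ × ℝ => √(1 + p.1 ^ 2 + p.2 ^ 2)
    exact ContDiff.sqrt (by fun_prop) fun p => by positivity

theorem continuous_chart : Continuous chart := Continuous.subtype_mk contDiff_chartV.continuous _

theorem contDiff_crd : ContDiff ℝ ∞ crd := by unfold crd; fun_prop

/-- The global chart as a homeomorphism. -/
noncomputable def chartHomeo : ℝ × ℝ ≃ₜ Hyp where
  toFun := chart
  invFun X := crd X
  left_inv := crd_chartV
  right_inv := chart_crd
  continuous_toFun := continuous_chart
  continuous_invFun := contDiff_crd.continuous.comp continuous_subtype_val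

theorem Hyp.norm_le (X : Hyp) : ‖(X : V)‖ ≤ (X : V) 2 := by
  have h1 := X.mink_self
  have h2 := X.one_le
  rw [mink_eq] at h1
  rw [pi_norm_le_iff_of_nonneg (by linarith)]
  intro i
  rw [Real.norm_eq_abs]
  apply abs_le_of_sq_le_sq _ (by linarith)
  fin_cases i <;> simp only [Fin.zero_eta, Fin.mk_one, Fin.reduceFinMk, Fin.isValue] <;>
    nlinarith [sq_nonneg (X.1 0), sq_nonneg (X.1 1)]

theorem isClosed_hyp : IsClosed {X : V | mink X X = -1 ∧ 1 ≤ X 2} :=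
  (isClosed_eq (continuous_id.mink continuous_id) continuous_const).inter
    (isClosed_le continuous_const (continuous_apply 2))

theorem isCompact_sublevel (c : ℝ) : IsCompact {X : Hyp | (X : V) 2 ≤ c} := by
  have : IsClosedEmbedding (Subtype.val : Hyp → V) := isClosed_hyp.isClosedEmbedding_subtypeVal
  have h := this.isCompact_preimage (isCompact_closedBall (0 : V) c)
  refine h.of_isClosed_subset
    (isClosed_le ((continuous_apply 2).comp continuous_subtype_val) continuous_const) fun X hX => ?_
  rw [Set.mem_preimage, mem_closedBall_zero_iff]
  exact (Hyp.norm_le X).trans hX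

theorem exists_two_le_of_isCompact {K : Set Hyp} (hK : IsCompact K) :
    ∃ c : ℝ, 1 ≤ c ∧ ∀ X ∈ K, (X : V) 2 ≤ c := by
  obtain ⟨c, hc⟩ := (hK.image ((continuous_apply 2).comp continuous_subtype_val)).bddAbove
  exact ⟨max 1 c, le_max_left _ _, fun X hX => (hc ⟨X, hX, rfl⟩).trans (le_max_right _ _)⟩

/-- Points at bounded distance have comparable heights; this leaves only finitely many group
elements to consider in `exists_separated_nhds`. -/
theorem two_le_of_mink {A B : Hyp} (h : -mink A B ≤ 2) : (B : V) 2 ≤ 4 * (A : V) 2 := by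
  have h1 := norm_sub_le_of_mink A B
  have h2 := mink_hyp_le A B
  have h3 : √((mink A B) ^ 2 - 1) ≤ 2 := by
    rw [Real.sqrt_le_left (by norm_num)]; nlinarith
  have h4 := A.norm_le
  have h5 := A.one_le
  have h6 := (le_abs_self _).trans (norm_le_pi_norm ((B : V) - (A : V)) 2)
  simp only [Pi.sub_apply] at h6
  nlinarith [norm_nonneg (A : V)]

/-- Hyperbolic balls are small neighbourhoods, uniformly on compact sets. -/
theorem exists_mink_ball {K U : Set Hyp} (hK : IsCompact K) (hU : IsOpen U) (hKU : K ⊆ U) :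
    ∃ δ : ℝ, 0 < δ ∧ ∀ A ∈ K, ∀ B : Hyp, -mink A B ≤ 1 + δ → B ∈ U := by
  obtain ⟨c, hc1, hc⟩ := exists_two_le_of_isCompact hK
  obtain ⟨r, hr, hrU⟩ := hK.exists_thickening_subset_open hU hKU
  have : Tendsto (fun δ : ℝ => c * √((1 + δ) ^ 2 - 1) + δ * c) (𝓝 0)
      (𝓝 (c * √((1 + 0) ^ 2 - 1) + 0 * c)) := by
    apply Continuous.tendsto; fun_prop
  norm_num at this
  obtain ⟨δ, hδ⟩ := ((this.eventually (gt_mem_nhds hr)).filter_mono nhdsWithin_le_nhds |>.and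
    (self_mem_nhdsWithin : Set.Ioi (0 : ℝ) ∈ 𝓝[>] 0)).exists
  refine ⟨δ, hδ.2, fun A hA B hAB => hrU (Metric.mem_thickening_iff.2 ⟨A, hA, ?_⟩)⟩
  rw [Subtype.dist_eq, dist_eq_norm]
  refine lt_of_le_of_lt ((norm_sub_le_of_mink A B).trans ?_) hδ.1
  have h0 := mink_hyp_le A B
  have h1 := hc A hA
  have h2 := A.norm_le
  have h3 := A.one_le
  have h4 : (mink A B) ^ 2 - 1 ≤ (1 + δ) ^ 2 - 1 := by nlinarith
  gcongr
  · linarith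
  · linarith
  · linarith

theorem continuousOn_of_hdist_le {α : Type*} [PseudoMetricSpace α] {s : Set α} {F : α → Hyp} {K : ℝ}
    (h : ∀ x ∈ s, ∀ y ∈ s, hdist (F x) (F y) ≤ K * dist x y) : ContinuousOn F s := by
  intro x hx
  rw [ContinuousWithinAt, (nhds_basis_opens (F x)).tendsto_right_iff]
  rintro U ⟨hxU, hU⟩
  obtain ⟨δ, hδ, h2⟩ := exists_mink_ball isCompact_singleton hU (Set.singleton_subset_iff.2 hxU)
  have h3 : Tendsto (fun y => Real.cosh (K * dist x y)) (𝓝[s] x) (𝓝 (Real.cosh (K * dist x x))) := by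
    apply Tendsto.mono_left _ nhdsWithin_le_nhds
    exact Continuous.tendsto (by fun_prop) x
  rw [dist_self, mul_zero, Real.cosh_zero] at h3
  filter_upwards [h3.eventually (gt_mem_nhds (show (1 : ℝ) < 1 + δ by linarith)),
    self_mem_nhdsWithin] with y hy hys
  refine h2 _ rfl _ ?_
  rw [← cosh_hdist]
  refine le_trans ?_ hy.le
  rw [Real.cosh_le_cosh, abs_of_nonneg (hdist_nonneg _ _)]
  exact (h x hx y hys).trans (le_abs_self _)

/-! ### Proper discontinuity -/

/-- On the orthogonal complement of a point the form is positive definite and comparable with the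
norm, with constants depending on the height only. Splitting `v` along `X` and its complement bounds
`g` by the heights of `X` and `g X`; this is the source of proper discontinuity. -/
theorem norm_lin_le (g : SOPlus) (X : Hyp) {c : ℝ} (h1 : (X : V) 2 ≤ c) (h2 : (act g X : V) 2 ≤ c)
    (v : V) : ‖lin g v‖ ≤ (3 * c ^ 2 + c * √(3 + 9 * c ^ 2)) * ‖v‖ := by
  set a := mink v X
  have hc : 0 ≤ c := by linarith [X.one_le]
  have ha : |a| ≤ 3 * ‖v‖ * c := (abs_mink_le v X).trans (by gcongr; exact X.norm_le.trans h1)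
  let w : V := v + a • (X : V)
  have hw : mink w X = 0 := by simp [w, X.mink_self, a]
  have hw2 : mink w w ≤ (3 + 9 * c ^ 2) * ‖v‖ ^ 2 := by
    have : mink w w = mink v v + a ^ 2 := by
      simp [w, X.mink_self, mink_comm (X : V) v]; ring
    have h3 := (le_abs_self _).trans (abs_mink_le v v)
    have h4 : a ^ 2 ≤ (3 * ‖v‖ * c) ^ 2 := by
      rw [← sq_abs]; gcongr
    rw [this]; nlinarith
  have e : lin g v = lin g w - a • (act g X : V) := by simp [w]
  have h5 : ‖lin g w‖ ≤ c * (√(3 + 9 * c ^ 2) * ‖v‖) := by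
    refine (norm_le_of_orthogonal (act g X) (by simp [hw])).trans ?_
    rw [mink_lin]
    refine mul_le_mul h2 ?_ (Real.sqrt_nonneg _) hc
    refine (Real.sqrt_le_sqrt hw2).trans (le_of_eq ?_)
    rw [Real.sqrt_mul (by positivity), Real.sqrt_sq (norm_nonneg _)]
  rw [e]
  refine (norm_sub_le _ _).trans ?_
  rw [norm_smul, Real.norm_eq_abs]
  have h6 : |a| * ‖(act g X : V)‖ ≤ 3 * ‖v‖ * c * c :=
    mul_le_mul ha ((act g X).norm_le.trans h2) (norm_nonneg _) (by positivity)
  nlinarith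

theorem isClosed_SOPlus : IsClosed (SOPlus : Set (Matrix.SpecialLinearGroup (Fin 3) ℝ)) := by
  have hcont : ∀ X : V, Continuous fun g : Matrix.SpecialLinearGroup (Fin 3) ℝ => (g : Mat) *ᵥ X :=
    fun X => Continuous.matrix_mulVec continuous_subtype_val continuous_const
  have : (SOPlus : Set (Matrix.SpecialLinearGroup (Fin 3) ℝ)) =
      {g : Matrix.SpecialLinearGroup (Fin 3) ℝ |
          ∀ X Y : V, mink ((g : Mat) *ᵥ X) ((g : Mat) *ᵥ Y) = mink X Y} ∩
        {g : Matrix.SpecialLinearGroup (Fin 3) ℝ | ∀ X : Hyp, 1 ≤ ((g : Mat) *ᵥ (X : V)) 2} := by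
    ext g
    constructor
    · intro h
      exact ⟨h.1, fun X => ((h.2 X).2 X.2).2⟩
    · rintro ⟨h1, h2⟩
      refine ⟨h1, fun X => ⟨fun h => ?_, fun h => ⟨by rw [h1, h.1], h2 ⟨X, h⟩⟩⟩⟩
      rw [h1] at h
      refine ⟨h.1, ?_⟩
      by_contra hX
      have h3 := h.1
      rw [mink_eq] at h3
      have h4 : (X 2) ^ 2 ≥ 1 := by nlinarith [sq_nonneg (X 0), sq_nonneg (X 1)]
      have h5 := h2 ⟨-X, by rw [mink_neg_left, mink_neg_right, neg_neg, h.1],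
        by rw [Pi.neg_apply]; nlinarith⟩
      simp only [Matrix.mulVec_neg, Pi.neg_apply] at h5
      linarith [h.2]
  rw [this]
  refine IsClosed.inter ?_ ?_
  · simp only [Set.ofPred_forall]
    exact isClosed_iInter fun X => isClosed_iInter fun Y =>
      isClosed_eq ((hcont X).mink (hcont Y)) continuous_const
  · simp only [Set.ofPred_forall]
    exact isClosed_iInter fun X =>
      isClosed_le continuous_const ((continuous_apply 2).comp (hcont X))

theorem isCompact_SOPlus_bounded (C : ℝ) :
    IsCompact {g : SOPlus | ∀ i j, |((g : Matrix.SpecialLinearGroup (Fin 3) ℝ) : Mat) i j| ≤ C} := by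
  have h1 : IsClosedEmbedding (Subtype.val : SOPlus → Matrix.SpecialLinearGroup (Fin 3) ℝ) :=
    isClosed_SOPlus.isClosedEmbedding_subtypeVal
  have h2 : IsClosedEmbedding (Subtype.val : Matrix.SpecialLinearGroup (Fin 3) ℝ → Mat) :=
    (isClosed_eq (Continuous.matrix_det continuous_id) continuous_const).isClosedEmbedding_subtypeVal
  have h3 : IsCompact {A : Mat | ∀ i j, |A i j| ≤ C} := by
    have : {A : Mat | ∀ i j, |A i j| ≤ C} =
        Set.pi Set.univ fun _ => Set.pi Set.univ fun _ => Set.Icc (-C) C := by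
      ext A
      exact ⟨fun h i _ j _ => abs_le.1 (h i j), fun h i j => abs_le.2 (h i trivial j trivial)⟩
    rw [this]
    exact isCompact_univ_pi fun _ => isCompact_univ_pi fun _ => isCompact_Icc
  exact (h2.comp h1).isCompact_preimage h3

section Surface

variable {π : Type*} [Group π] (S : HypSurface π)

/-- A discrete subgroup is closed, and the elements returning to `K` have bounded matrices. A closed
discrete set meets the compact set of bounded matrices in a finite set. -/
theorem finite_return {K : Set Hyp} (hK : IsCompact K) :
    {γ : π | ∃ X ∈ K, act (S.σ γ) X ∈ K}.Finite := by
  obtain ⟨c, hc1, hc⟩ := exists_two_le_of_isCompact hK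
  set C := 3 * c ^ 2 + c * √(3 + 9 * c ^ 2)
  have : DiscreteTopology S.σ.range := S.discrete
  have h1 : IsClosed (S.σ.range : Set SOPlus) := Subgroup.isClosed_of_discrete
  have h2 : ((S.σ.range : Set SOPlus) ∩
      {g : SOPlus | ∀ i j, |((g : Matrix.SpecialLinearGroup (Fin 3) ℝ) : Mat) i j| ≤ C}).Finite := by
    apply ((isCompact_SOPlus_bounded C).inter_left h1).finite
    have : IsDiscrete (S.σ.range : Set SOPlus) := ⟨S.discrete⟩
    exact this.mono Set.inter_subset_left
  refine (h2.preimage S.faithful.injOn).subset ?_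
  rintro γ ⟨X, hX, hγX⟩
  refine ⟨⟨γ, rfl⟩, fun i j => ?_⟩
  have h3 := norm_lin_le (S.σ γ) X (hc X hX) (hc _ hγX) (Pi.single j 1)
  have h4 := norm_le_pi_norm (lin (S.σ γ) (Pi.single j 1)) i
  rw [Pi.norm_single, norm_one, mul_one] at h3
  refine le_trans (le_of_eq ?_) (h4.trans h3)
  simp [lin]

/-- Every point has a neighbourhood whose translates are uniformly separated from it. -/
theorem exists_separated_nhds (X₀ : Hyp) : ∃ U : Set Hyp, IsOpen U ∧ X₀ ∈ U ∧ ∃ δ : ℝ, 0 < δ ∧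
    ∀ A ∈ U, ∀ B ∈ U, ∀ γ : π, γ ≠ 1 → 1 + δ ≤ -mink A (lin (S.σ γ) B) := by
  set c := (X₀ : V) 2 + 1
  have hX := X₀.one_le
  -- An element outside this finite set keeps points of height below `c` at `cosh d > 2` from each
  -- other, by `two_le_of_mink`; only the elements of `G` need an individual neighbourhood.
  set G := {γ : π | ∃ X ∈ {X : Hyp | (X : V) 2 ≤ 4 * c}, act (S.σ γ) X ∈ {X : Hyp | (X : V) 2 ≤ 4 * c}}
  have hG : G.Finite := finite_return S (isCompact_sublevel _)
  have key : ∀ γ ∈ G, γ ≠ 1 → ∃ U : Set Hyp, IsOpen U ∧ X₀ ∈ U ∧ ∃ δ : ℝ, 0 < δ ∧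
    ∀ A ∈ U, ∀ B ∈ U, 1 + δ ≤ -mink A (lin (S.σ γ) B) := by
    intro γ _ hγ
    have h1 : 1 < -mink X₀ (lin (S.σ γ) X₀) := by
      have h2 := mink_hyp_le X₀ (act (S.σ γ) X₀)
      rw [coe_act] at h2
      refine lt_of_le_of_ne (by linarith) fun h => hγ (S.free γ X₀ ?_)
      exact ((mink_eq_neg_one_iff _ _).1 (by rw [coe_act]; linarith)).symm
    obtain ⟨d, hd1, hd2⟩ := exists_between h1
    have h3 : Continuous fun p : Hyp × Hyp => -mink p.1 (lin (S.σ γ) p.2) :=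
      (Continuous.mink (continuous_subtype_val.comp continuous_fst)
        ((continuous_lin _).comp (continuous_subtype_val.comp continuous_snd))).neg
    have h4 : {p : Hyp × Hyp | d < -mink p.1 (lin (S.σ γ) p.2)} ∈ 𝓝 (X₀, X₀) :=
      (isOpen_lt continuous_const h3).mem_nhds hd2
    obtain ⟨u, v, hu, hu', hv, hv', huv⟩ := mem_nhds_prod_iff'.1 h4
    exact ⟨u ∩ v, hu.inter hv, ⟨hu', hv'⟩, d - 1, by linarith, fun A hA B hB => by
      have := huv (Set.mk_mem_prod hA.1 hB.2)
      simp only [Set.mem_ofPred_eq] at this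
      linarith⟩
  choose! u hu1 hu2 δ hδ1 hδ2 using key
  set G' := {γ ∈ G | γ ≠ 1}
  have hG' : G'.Finite := hG.subset (Set.sep_subset _ _)
  obtain ⟨ε, hε, hε'⟩ : ∃ ε : ℝ, 0 < ε ∧ ∀ γ ∈ G', ε ≤ δ γ := by
    rcases G'.eq_empty_or_nonempty with h | h
    · exact ⟨1, one_pos, by simp [h]⟩
    · obtain ⟨γ, hγ, hγ'⟩ := Set.exists_min_image G' δ hG' h
      exact ⟨δ γ, hδ1 γ hγ.1 hγ.2, hγ'⟩
  refine ⟨{X : Hyp | (X : V) 2 < c} ∩ ⋂ γ ∈ G', u γ, ?_, ⟨by simp [c], ?_⟩, min 1 ε, by positivity, ?_⟩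
  · exact (isOpen_lt ((continuous_apply 2).comp continuous_subtype_val) continuous_const).inter
      (hG'.isOpen_biInter fun γ hγ => hu1 γ hγ.1 hγ.2)
  · exact Set.mem_iInter₂.2 fun γ hγ => hu2 γ hγ.1 hγ.2
  · rintro A ⟨hA, hA'⟩ B ⟨hB, hB'⟩ γ hγ
    by_contra hlt
    push Not at hlt
    have h2 : -mink A (act (S.σ γ) B) ≤ 2 := by
      rw [coe_act]; linarith [min_le_left 1 ε]
    have hγG : γ ∈ G := ⟨B, by
      have := Hyp.one_le B
      simp only [Set.mem_ofPred_eq] at *; linarith, by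
      have := two_le_of_mink h2
      simp only [Set.mem_ofPred_eq] at *; linarith⟩
    have h3 := hδ2 γ hγG hγ A (Set.mem_iInter₂.1 hA' γ ⟨hγG, hγ⟩) B (Set.mem_iInter₂.1 hB' γ ⟨hγG, hγ⟩)
    linarith [hε' γ ⟨hγG, hγ⟩, min_le_right 1 ε]

end Surface

end LieLam

namespace LieLam

open Topology Filter

/-! ### Relative position of disjoint geodesics -/

theorem abs_sinh_lt_cosh (t : ℝ) : |Real.sinh t| < Real.cosh t :=
  abs_lt_of_sq_lt_sq (by linarith [Real.cosh_sq t]) (Real.cosh_pos t).le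

theorem mink_nonpos_on_line {n : V} (hn : mink n n = 1) (f : Frame) (h : 1 ≤ mink n f.n ^ 2)
    (hX : mink n f.X ≤ 0) {Y : Hyp} (hY : Y ∈ line f.n) : mink n Y ≤ 0 := by
  rw [f.mem_line hY, f.coe_pt, f.mink_vec]
  set t := Real.arsinh (mink f.e Y)
  have h1 := sq_le_sq.1 (sq_mink_e_le hn f h)
  have h2 : Real.sinh t * mink n f.e ≤ Real.cosh t * |mink n f.X| := by
    refine (le_abs_self _).trans ?_
    rw [abs_mul]
    exact mul_le_mul (abs_sinh_lt_cosh t).le h1 (abs_nonneg _) (Real.cosh_pos t).le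
  rw [abs_of_nonpos hX] at h2
  linarith

theorem mink_nonneg_on_line {n : V} (hn : mink n n = 1) (f : Frame) (h : 1 ≤ mink n f.n ^ 2)
    (hX : 0 ≤ mink n f.X) {Y : Hyp} (hY : Y ∈ line f.n) : 0 ≤ mink n Y := by
  have := mink_nonpos_on_line (n := -n) (by simp [hn]) f (by simpa using h) (by simpa using hX) hY
  simpa using this

/-- The frame with the opposite normal vector. -/
def Frame.negNormal (f : Frame) : Frame :=
  { f with n := -f.n, nn := by simp [f.nn], nX := by simp [f.nX], ne := by simp [f.ne] }

/-- Disjoint geodesics with normals pointing the same way are ordered. Otherwise the expansion of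
`(h.n, h.X)^♯ = 0` in the frame `g` would contain a dominating positive term and a nonnegative one.
-/
theorem mink_nonpos_antisymm {g h : Frame} (hgh : 1 ≤ mink g.n h.n ^ 2) (hpos : 0 < mink g.n h.n)
    (hX : 0 ≤ mink g.n h.X) : mink h.n g.X ≤ 0 := by
  by_contra ha
  push Not at ha
  have h1 := sq_mink_e_le h.nn g (by rw [mink_comm]; exact hgh)
  have h2 := g.mink_expand h.n h.X
  have h3 := g.mink_expand h.X h.X
  have h4 := mink_hyp_le h.X g.X
  rw [h.nX] at h2
  rw [h.X.mink_self] at h3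
  rw [mink_comm g.n h.X] at hX
  rw [mink_comm g.n h.n] at hpos
  set a := mink h.n g.X
  set b := mink h.n g.e
  set p := mink (h.X : V) g.X
  set q := mink (h.X : V) g.e
  set r := mink (h.X : V) g.n
  have h5 : |q| < -p := abs_lt_of_sq_lt_sq (by nlinarith) (by linarith)
  have h6 : |b| ≤ a := abs_le_of_sq_le_sq h1 ha.le
  have h7 : |b * q| < a * -p := by
    rw [abs_mul]; nlinarith [abs_nonneg q]
  have h8 := (abs_lt.1 h7).1
  nlinarith [mul_nonneg hpos.le hX]

theorem mink_nonneg_antisymm {g h : Frame} (hgh : 1 ≤ mink g.n h.n ^ 2) (hpos : 0 < mink g.n h.n)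
    (hX : mink g.n h.X ≤ 0) : 0 ≤ mink h.n g.X := by
  have := mink_nonpos_antisymm (g := g.negNormal) (h := h.negNormal)
    (by simpa [Frame.negNormal] using hgh) (by simpa [Frame.negNormal] using hpos)
    (by simpa [Frame.negNormal] using hX)
  simpa [Frame.negNormal] using this

theorem Frame.norm_e_le (f : Frame) : ‖f.e‖ ≤ (f.X : V) 2 := by
  have := norm_le_of_orthogonal f.X f.eX
  rwa [f.ee, Real.sqrt_one, mul_one] at this

theorem Frame.norm_n_le (f : Frame) : ‖f.n‖ ≤ (f.X : V) 2 := by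
  have := norm_le_of_orthogonal f.X f.nX
  rwa [f.nn, Real.sqrt_one, mul_one] at this

/-- Future null vectors have nonpositive products. -/
theorem mink_nonpos_of_null {u v : V} (hu : mink u u = 0) (hv : mink v v = 0) (hu2 : 0 ≤ u 2)
    (hv2 : 0 ≤ v 2) : mink u v ≤ 0 := by
  rw [mink_eq] at *
  have h1 : (u 0 * v 0 + u 1 * v 1) ^ 2 ≤ (u 2 * v 2) ^ 2 := by
    have e1 : u 0 ^ 2 + u 1 ^ 2 = u 2 ^ 2 := by linarith
    have e2 : v 0 ^ 2 + v 1 ^ 2 = v 2 ^ 2 := by linarith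
    rw [mul_pow, ← e1, ← e2]; nlinarith [sq_nonneg (u 0 * v 1 - u 1 * v 0)]
  linarith [(abs_le_of_sq_le_sq' h1 (mul_nonneg hu2 hv2)).2]

theorem Frame.null_add (f : Frame) :
    mink ((f.X : V) + f.e) (f.X + f.e) = 0 ∧ 0 ≤ ((f.X : V) + f.e) 2 := by
  constructor
  · simp [f.X.mink_self, f.ee, f.eX, f.Xe]
  · have := (abs_le.1 ((norm_le_pi_norm f.e 2).trans f.norm_e_le)).1
    simp only [Pi.add_apply]; linarith

theorem Frame.null_sub (f : Frame) :
    mink ((f.X : V) - f.e) (f.X - f.e) = 0 ∧ 0 ≤ ((f.X : V) - f.e) 2 := by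
  constructor
  · simp [f.X.mink_self, f.ee, f.eX, f.Xe]
  · have := (abs_le.1 ((norm_le_pi_norm f.e 2).trans f.norm_e_le)).2
    simp only [Pi.sub_apply]; linarith

theorem Frame.vec_eq_null (f : Frame) (t : ℝ) :
    f.vec t = (Real.exp t / 2) • ((f.X : V) + f.e) + (Real.exp (-t) / 2) • ((f.X : V) - f.e) := by
  rw [Frame.vec, Real.cosh_eq, Real.sinh_eq]; module

/-- Geodesics with nearby initial conditions only come close at nearby times. -/
theorem cosh_sub_le_of_close {g h : Frame} {ε c : ℝ} (hc : (g.X : V) 2 ≤ c)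
    (hX : ‖(h.X : V) - g.X‖ * (12 * c) ≤ ε) (he : ‖h.e - g.e‖ * (12 * c) ≤ ε) (s t : ℝ) :
    (2 - ε) * Real.cosh (s - t) ≤ 2 * -mink (h.vec s) (g.vec t) := by
  have hc1 : 1 ≤ c := g.X.one_le.trans hc
  have hgX : ‖(g.X : V)‖ ≤ c := (Hyp.norm_le _).trans hc
  have hge : ‖g.e‖ ≤ c := g.norm_e_le.trans hc
  have A := mink_nonpos_of_null h.null_add.1 g.null_add.1 h.null_add.2 g.null_add.2
  have A' := mink_nonpos_of_null h.null_sub.1 g.null_sub.1 h.null_sub.2 g.null_sub.2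
  have hXX := g.X.mink_self
  -- Two products, each at most `3` times the perturbation times `2 c`; this is where the factor `12
  -- * c` in the hypotheses comes from.
  have key1 : |mink (h.X - g.X : V) (g.X - g.e) + mink (h.e - g.e) (g.X - g.e)| ≤ ε := by
    have n1 : ‖(g.X : V) - g.e‖ ≤ 2 * c := (norm_sub_le _ _).trans (by linarith)
    refine (abs_add_le _ _).trans ((add_le_add (abs_mink_le _ _) (abs_mink_le _ _)).trans ?_)
    nlinarith [norm_nonneg ((h.X : V) - g.X), norm_nonneg (h.e - g.e)]
  have key2 : |mink (h.X - g.X : V) (g.X + g.e) - mink (h.e - g.e) (g.X + g.e)| ≤ ε := by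
    have n1 : ‖(g.X : V) + g.e‖ ≤ 2 * c := (norm_add_le _ _).trans (by linarith)
    refine (abs_sub _ _).trans ((add_le_add (abs_mink_le _ _) (abs_mink_le _ _)).trans ?_)
    nlinarith [norm_nonneg ((h.X : V) - g.X), norm_nonneg (h.e - g.e)]
  -- For `h = g` the product of the two null directions is `-2`. Of the four products of null
  -- vectors in the expansion of the two points, these mixed ones carry `cosh (s - t)`; the other
  -- two have a favourable sign and are dropped.
  have B : mink (h.X + h.e : V) (g.X - g.e) ≤ -(2 - ε) := by
    have := (abs_le.1 key1).2
    simp [hXX, g.ee, g.eX, g.Xe] at this ⊢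
    linarith
  have B' : mink (h.X - h.e : V) (g.X + g.e) ≤ -(2 - ε) := by
    have := (abs_le.1 key2).2
    simp [hXX, g.ee, g.eX, g.Xe] at this ⊢
    linarith
  have e1 : Real.exp s * Real.exp (-t) = Real.exp (s - t) := by rw [← Real.exp_add]; ring_nf
  have e2 : Real.exp (-s) * Real.exp t = Real.exp (-(s - t)) := by rw [← Real.exp_add]; ring_nf
  rw [h.vec_eq_null, g.vec_eq_null, Real.cosh_eq, ← e1, ← e2]
  generalize (h.X : V) + h.e = u₁ at *
  generalize (h.X : V) - h.e = u₂ at *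
  generalize (g.X : V) + g.e = v₁ at *
  generalize (g.X : V) - g.e = v₂ at *
  simp only [mink_add_left, mink_add_right, mink_smul_left, mink_smul_right]
  have a1 := mul_nonneg (mul_pos (Real.exp_pos s) (Real.exp_pos t)).le (neg_nonneg.2 A)
  have a2 := mul_nonneg (mul_pos (Real.exp_pos s) (Real.exp_pos (-t))).le (sub_nonneg.2 B)
  have a3 := mul_nonneg (mul_pos (Real.exp_pos (-s)) (Real.exp_pos t)).le (sub_nonneg.2 B')
  have a4 := mul_nonneg (mul_pos (Real.exp_pos (-s)) (Real.exp_pos (-t))).le (neg_nonneg.2 A')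
  linarith

/-- At the mouth of a strip: if `h` is close to `g`, on the side of `g` facing the geodesic with
normal vector `np` at distance `δ₀`, then `h` runs between the two. -/
theorem between_of_close {g h : Frame} {np : V} {δ₀ c ρ : ℝ} (hδ : 0 < δ₀) (hδ1 : δ₀ ≤ 1)
    (hc : (g.X : V) 2 ≤ c) (hρ : 16 * c * ρ ≤ δ₀)
    (hX : ‖(h.X : V) - g.X‖ ≤ ρ) (hn : ‖h.n - g.n‖ ≤ ρ)
    (hgh : 1 ≤ mink g.n h.n ^ 2) (hpos : 0 < mink g.n h.n) (hside : 0 ≤ mink g.n h.X)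
    (hnp : mink np np = 1) (hnpg : 1 ≤ mink np g.n ^ 2) (hnpg' : 0 < mink np g.n)
    (hnph : 1 ≤ mink np h.n ^ 2) (hnpX : mink np g.X = -δ₀) :
    mink np h.X < 0 ∧ (∀ Y ∈ line g.n, mink h.n Y ≤ 0) ∧ ∀ Y ∈ line np, 0 ≤ mink h.n Y := by
  have hc1 : 1 ≤ c := g.X.one_le.trans hc
  have hgX : ‖(g.X : V)‖ ≤ c := (Hyp.norm_le _).trans hc
  have hge : ‖g.e‖ ≤ c := g.norm_e_le.trans hc
  have hgn : ‖g.n‖ ≤ c := g.norm_n_le.trans hc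
  have hρ0 : 0 ≤ ρ := (norm_nonneg _).trans hX
  have h1 := sq_mink_e_le hnp g hnpg
  have h2 := g.mink_expand np np
  have h3 := g.expand np
  rw [hnpX] at h1 h2 h3
  rw [hnp] at h2
  have hν1 : 1 ≤ mink np g.n := by nlinarith
  have hν2 : mink np g.n ≤ 2 := by nlinarith [sq_nonneg (mink np g.e)]
  have hβ : |mink np g.e| ≤ δ₀ := by
    apply abs_le_of_sq_le_sq _ hδ.le; linarith [neg_sq δ₀]
  have hnpn : ‖np‖ ≤ 4 * c := by
    rw [h3]
    refine (norm_add_le _ _).trans (add_le_add (norm_add_le _ _) le_rfl |>.trans ?_)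
    rw [norm_smul, norm_smul, norm_smul, Real.norm_eq_abs, Real.norm_eq_abs, Real.norm_eq_abs,
      neg_neg, abs_of_pos hδ, abs_of_pos hnpg']
    have a1 := mul_le_mul hδ1 hgX (norm_nonneg _) zero_le_one
    have a2 := mul_le_mul (hβ.trans hδ1) hge (norm_nonneg _) zero_le_one
    have a3 := mul_le_mul hν2 hgn (norm_nonneg _) zero_le_two
    linarith
  refine ⟨?_, fun Y hY => ?_, fun Y hY => ?_⟩
  · have a := (abs_mink_le np ((h.X : V) - g.X))
    rw [mink_sub_right, hnpX] at a
    have b : 3 * ‖np‖ * ‖(h.X : V) - g.X‖ ≤ 3 * (4 * c) * ρ := by gcongr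
    have := (abs_le.1 (a.trans b)).2
    nlinarith
  · exact mink_nonpos_on_line h.nn g (by rwa [mink_comm]) (mink_nonpos_antisymm hgh hpos hside) hY
  · have hs : 0 < √(1 + δ₀ ^ 2) := by positivity
    -- The foot of the perpendicular from `g.X` to the geodesic of `np`. As that geodesic does not
    -- cross the one of `h`, the sign of `h.n` at this single point decides.
    let W : V := (√(1 + δ₀ ^ 2))⁻¹ • ((g.X : V) + δ₀ • np)
    have hWW : mink W W = -1 := by
      have e : mink ((g.X : V) + δ₀ • np) (g.X + δ₀ • np) = -(1 + δ₀ ^ 2) := by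
        simp [g.X.mink_self, hnp, hnpX, mink_comm (g.X : V) np]; ring
      simp only [W, mink_smul_left, mink_smul_right]
      rw [e, ← mul_assoc, ← mul_inv, Real.mul_self_sqrt (by positivity)]
      field_simp
    have hW2 : 1 ≤ W 2 := one_le_of_mink_neg g.X hWW (by
      simp only [W, mink_smul_right, mink_add_right, g.X.mink_self, mink_comm (g.X : V) np, hnpX]
      have : 0 < (√(1 + δ₀ ^ 2))⁻¹ := by positivity
      nlinarith [sq_nonneg δ₀])
    have hWn : mink np W = 0 := by
      simp only [W, mink_smul_right, mink_add_right, hnp, hnpX]; ring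
    refine mink_nonneg_on_line h.nn (Frame.ofNormal ⟨W, hWW, hW2⟩ np hnp hWn)
      (by rw [mink_comm]; exact hnph) ?_ hY
    simp only [Frame.ofNormal, W, mink_smul_right]
    refine mul_nonneg (by positivity) ?_
    -- Before normalization `g.n` has product `δ₀ (np, g.n)^♯ ≥ δ₀` with the foot, and replacing
    -- `g.n` by `h.n` costs at most `15 c ρ`.
    have a := abs_mink_le (h.n - g.n) ((g.X : V) + δ₀ • np)
    rw [mink_sub_left] at a
    have b : ‖(g.X : V) + δ₀ • np‖ ≤ 5 * c := by
      refine (norm_add_le _ _).trans ?_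
      rw [norm_smul, Real.norm_eq_abs, abs_of_pos hδ]
      nlinarith [norm_nonneg np]
    have d : 3 * ‖h.n - g.n‖ * ‖(g.X : V) + δ₀ • np‖ ≤ 3 * ρ * (5 * c) := by gcongr
    have e := (abs_le.1 (a.trans d)).1
    have f : mink g.n ((g.X : V) + δ₀ • np) = δ₀ * mink np g.n := by
      simp [g.nX, mink_comm g.n np]
    rw [f] at e
    nlinarith [mul_le_mul_of_nonneg_left hν1 hδ.le]

/-! ### Klein coordinates -/

/-- The vector with Klein coordinates `(x, y)` in a frame. -/
def Frame.kvec (f : Frame) (p : ℝ × ℝ) : V := (f.X : V) + p.1 • f.e + p.2 • f.n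

theorem Frame.mink_kvec_kvec (f : Frame) (p q : ℝ × ℝ) :
    mink (f.kvec p) (f.kvec q) = -(1 - p.1 * q.1 - p.2 * q.2) := by
  simp [kvec, f.X.mink_self, f.ee, f.eX, f.Xe, f.nn, f.ne, f.en, f.Xn, f.nX]; ring

theorem Frame.continuous_kvec (f : Frame) : Continuous f.kvec := by unfold kvec; fun_prop

open Classical in
/-- The point with Klein coordinates `(x, y)` in a frame; it is `f.X` outside of the disc. -/
noncomputable def Frame.kpt (f : Frame) (p : ℝ × ℝ) : Hyp :=
  if h : p.1 ^ 2 + p.2 ^ 2 < 1 then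
    ⟨(√(1 - p.1 ^ 2 - p.2 ^ 2))⁻¹ • f.kvec p, by
      have hs : 0 < 1 - p.1 ^ 2 - p.2 ^ 2 := by linarith
      have h1 : mink ((√(1 - p.1 ^ 2 - p.2 ^ 2))⁻¹ • f.kvec p)
          ((√(1 - p.1 ^ 2 - p.2 ^ 2))⁻¹ • f.kvec p) = -1 := by
        rw [mink_smul_left, mink_smul_right, f.mink_kvec_kvec, ← mul_assoc, ← mul_inv,
          Real.mul_self_sqrt hs.le]
        field_simp
      refine ⟨h1, one_le_of_mink_neg f.X h1 ?_⟩
      simp [kvec, f.X.mink_self, f.Xe, f.Xn]⟩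
  else f.X

theorem Frame.coe_kpt (f : Frame) {p : ℝ × ℝ} (h : p.1 ^ 2 + p.2 ^ 2 < 1) :
    (f.kpt p : V) = (√(1 - p.1 ^ 2 - p.2 ^ 2))⁻¹ • f.kvec p := by
  rw [kpt, dif_pos h]

theorem Frame.kpt_mem_line (f : Frame) {p : ℝ × ℝ} (h : p.1 ^ 2 + p.2 ^ 2 < 1) (n : V) :
    f.kpt p ∈ line n ↔ mink n (f.kvec p) = 0 := by
  have : √(1 - p.1 ^ 2 - p.2 ^ 2) ≠ 0 := (Real.sqrt_pos.2 (by linarith)).ne'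
  change mink n (f.kpt p) = 0 ↔ _
  rw [f.coe_kpt h, mink_smul_right, mul_eq_zero, or_iff_right (inv_ne_zero this)]

theorem Frame.continuousAt_kpt (f : Frame) {p : ℝ × ℝ} (h : p.1 ^ 2 + p.2 ^ 2 < 1) :
    ContinuousAt f.kpt p := by
  refine Topology.IsInducing.subtypeVal.continuousAt_iff.2 ?_
  have h1 : ∀ᶠ q : ℝ × ℝ in 𝓝 p, q.1 ^ 2 + q.2 ^ 2 < 1 :=
    (isOpen_lt (by fun_prop) continuous_const).mem_nhds h
  have h2 : ContinuousAt (fun q : ℝ × ℝ => (√(1 - q.1 ^ 2 - q.2 ^ 2))⁻¹ • f.kvec q) p := by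
    have hs : ContinuousAt (fun q : ℝ × ℝ => (√(1 - q.1 ^ 2 - q.2 ^ 2))⁻¹) p :=
      ContinuousAt.inv₀ (by fun_prop) (Real.sqrt_pos.2 (by linarith)).ne'
    exact hs.smul f.continuous_kvec.continuousAt
  exact h2.congr (h1.mono fun q hq => (f.coe_kpt hq).symm)

theorem Frame.mink_kpt_kpt (f : Frame) {p q : ℝ × ℝ} (hp : p.1 ^ 2 + p.2 ^ 2 < 1)
    (hq : q.1 ^ 2 + q.2 ^ 2 < 1) :
    -mink (f.kpt p) (f.kpt q) = (1 - p.1 * q.1 - p.2 * q.2) /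
      (√(1 - p.1 ^ 2 - p.2 ^ 2) * √(1 - q.1 ^ 2 - q.2 ^ 2)) := by
  rw [f.coe_kpt hp, f.coe_kpt hq, mink_smul_left, mink_smul_right, f.mink_kvec_kvec]
  field_simp

@[simp] theorem Frame.kpt_zero (f : Frame) : f.kpt (0, 0) = f.X :=
  Subtype.ext (by rw [f.coe_kpt (by norm_num)]; simp [kvec])

/-- A geodesic disjoint from the axis of a frame is a graph `y = s + m x` in Klein coordinates. -/
theorem exists_slope (f : Frame) {n : V} (hn : mink n n = 1) (h : 1 ≤ mink n f.n ^ 2) :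
    ∃ n' : V, (n' = n ∨ n' = -n) ∧ ∃ s m ν : ℝ, 1 ≤ ν ∧ |m| ≤ |s| ∧
      n' = ν • (s • (f.X : V) - m • f.e + f.n) := by
  obtain ⟨n', hn', hpos⟩ : ∃ n' : V, (n' = n ∨ n' = -n) ∧ 0 ≤ mink n' f.n := by
    rcases le_total 0 (mink n f.n) with h0 | h0
    · exact ⟨n, Or.inl rfl, h0⟩
    · exact ⟨-n, Or.inr rfl, by simpa using h0⟩
  refine ⟨n', hn', ?_⟩
  have hn1 : mink n' n' = 1 := by rcases hn' with rfl | rfl <;> simpa using hn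
  have h1 : 1 ≤ mink n' f.n ^ 2 := by rcases hn' with rfl | rfl <;> simpa using h
  have hν : 1 ≤ mink n' f.n := by nlinarith
  have h2 := f.expand n'
  have h3 := sq_mink_e_le hn1 f h1
  have hν0 : mink n' f.n ≠ 0 := by linarith
  refine ⟨-mink n' f.X / mink n' f.n, -mink n' f.e / mink n' f.n, mink n' f.n, hν, ?_, ?_⟩
  · rw [abs_div, abs_div, abs_neg, abs_neg]
    exact div_le_div_of_nonneg_right (sq_le_sq.1 h3) (abs_nonneg _)
  · conv_lhs => rw [h2]
    rw [smul_add, smul_sub, smul_smul, smul_smul, mul_div_cancel₀ _ hν0, mul_div_cancel₀ _ hν0]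
    module

/-- Geodesics are straight lines in Klein coordinates: the form of this normal vector vanishes
exactly on `y = s + m x`, and `m`, `s` are slope and intercept. -/
theorem mink_slope_kvec (f : Frame) (s m ν : ℝ) (p : ℝ × ℝ) :
    mink (ν • (s • (f.X : V) - m • f.e + f.n)) (f.kvec p) = ν * (p.2 - (s + m * p.1)) := by
  simp [Frame.kvec, f.X.mink_self, f.ee, f.eX, f.Xe, f.nn, f.ne, f.en, f.Xn, f.nX]; ring

theorem mink_slope_slope (f : Frame) (s m s' m' ν ν' : ℝ) :
    mink (ν • (s • (f.X : V) - m • f.e + f.n)) (ν' • (s' • (f.X : V) - m' • f.e + f.n)) =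
      ν * ν' * (1 + m * m' - s * s') := by
  simp [f.X.mink_self, f.ee, f.eX, f.Xe, f.nn, f.ne, f.en, f.Xn, f.nX]; ring

section Lamination

variable {π : Type*} [Group π] {S : HypSurface π} (Λ : GeodesicLamination S)

theorem GeodesicLamination.exists_frame_of_mem {X : Hyp} (hX : X ∈ Λ.support) :
    ∃ f : Frame, f.X = X ∧ line f.n ∈ Λ.leaves := by
  obtain ⟨L, hL, hXL⟩ := hX
  obtain ⟨f, rfl⟩ := isGeodesicLine_iff.1 (Λ.isGeodesic L hL)
  exact ⟨Frame.ofNormal X f.n f.nn hXL, rfl, hL⟩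

theorem line_neg (n : V) : line (-n) = line n := by ext; simp [line]

/-- Normal vectors of leaves. -/
theorem GeodesicLamination.one_le_sq {n : V} (hn : mink n n = 1) (hL : line n ∈ Λ.leaves) (f : Frame)
    (hf : line f.n ∈ Λ.leaves) : 1 ≤ mink n f.n ^ 2 := by
  by_cases h : line n = line f.n
  · rcases eq_or_eq_neg_of_line_subset hn f h.symm.subset with rfl | rfl
    · rw [f.nn]; norm_num
    · simp [f.nn]
  · exact one_le_sq_of_disjoint hn f (Λ.disjoint hL hf h)

theorem GeodesicLamination.line_lin_mem (γ : π) {n : V} (h : line n ∈ Λ.leaves) :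
    line (lin (S.σ γ) n) ∈ Λ.leaves := by
  rw [← image_line]; exact Λ.invariant γ _ h

theorem GeodesicLamination.eq_of_mem {L L' : Set Hyp} (hL : L ∈ Λ.leaves) (hL' : L' ∈ Λ.leaves)
    {X : Hyp} (h : X ∈ L) (h' : X ∈ L') : L = L' :=
  Λ.disjoint.elim hL hL' (Set.not_disjoint_iff.2 ⟨X, h, h'⟩)

end Lamination

end LieLam

/-! ### Linear growth of the number of separated leaves on a short transversal -/

namespace LieLam

open Topology Filter

section Lamination

variable {π : Type*} [Group π] {S : HypSurface π} (Λ : GeodesicLamination S)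

/-- The normal vectors of the leaves crossing a transversal. -/
theorem exists_transversal_normal {f : Frame} (hf : line f.n ∈ Λ.leaves) {y : ℝ} (hy : |y| < 1)
    (h : f.kpt (0, y) ∈ Λ.support) : ∃ n : V, mink n n = 1 ∧ line n ∈ Λ.leaves ∧
      ∃ m ν : ℝ, 1 ≤ ν ∧ |m| ≤ |y| ∧ n = ν • (y • (f.X : V) - m • f.e + f.n) := by
  have hy' : ((0, y) : ℝ × ℝ).1 ^ 2 + ((0, y) : ℝ × ℝ).2 ^ 2 < 1 := by
    have := (sq_lt_one_iff_abs_lt_one y).2 hy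
    simpa using this
  obtain ⟨g, hgX, hg⟩ := Λ.exists_frame_of_mem h
  obtain ⟨n, hn, s, m, ν, hν, hm, hne⟩ := exists_slope f g.nn (Λ.one_le_sq g.nn hg f hf)
  have hnn : mink n n = 1 := by rcases hn with rfl | rfl <;> simp [g.nn]
  have hln : line n = line g.n := by rcases hn with rfl | rfl <;> simp [line_neg]
  have hmem : f.kpt (0, y) ∈ line n := by rw [hln, ← hgX, ← g.pt_zero]; exact g.pt_mem_line 0
  rw [f.kpt_mem_line hy', hne, mink_slope_kvec] at hmem
  have hs : y = s := by
    have := (mul_eq_zero.1 hmem).resolve_left (by linarith)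
    simp at this; linarith
  subst hs
  exact ⟨n, hnn, hln ▸ hg, m, ν, hν, hm, hne⟩

set_option maxHeartbeats 1000000 in
/-- The number of pairwise `T`-separated leaves crossing a short transversal grows at most linearly
in `T`. -/
theorem card_separated_le {f : Frame} (hf : line f.n ∈ Λ.leaves) :
    ∃ s₁ δ₀ A : ℝ, 0 < s₁ ∧ s₁ < 1 / 2 ∧ 0 < δ₀ ∧ ∀ (T : ℕ) (nr : ℝ → V) (F : ℝ → Frame) (E : Finset ℝ),
      (∀ x ∈ E, |x| ≤ s₁ ∧ mink (nr x) (nr x) = 1 ∧ line (nr x) ∈ Λ.leaves ∧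
        (∃ m ν : ℝ, 1 ≤ ν ∧ |m| ≤ |x| ∧ nr x = ν • (x • (f.X : V) - m • f.e + f.n)) ∧
        (F x).X = f.kpt (0, x) ∧ (F x).n = nr x) →
      (∀ x ∈ E, ∀ z ∈ E, x < z → ∃ t : ℝ, |t| ≤ T ∧ δ₀ ≤ |mink (nr z) ((F x).vec t)|) →
      (E.card : ℝ) ≤ A * (T + 1) := by
  -- Counting argument: each leaf `x` of `E` except the last is assigned the time `τ x` at which the
  -- strip between it and the next leaf of `E` has opened to a fixed width. Moved back to `K₀`, two
  -- such mouths in the same small cell and at nearly the same time must coincide. So their number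
  -- is at most the number of cells times the number of time slots.
  obtain ⟨U, hU, hXU, δ, hδ, hsep⟩ := exists_separated_nhds S f.X
  obtain ⟨K₀, hK₀, hcov⟩ := S.cocompact
  obtain ⟨c, hc1, hc⟩ := exists_two_le_of_isCompact hK₀
  -- the time constant
  obtain ⟨θ, hθ, hθδ⟩ : ∃ θ : ℝ, 0 < θ ∧ Real.cosh (2 * θ) < 1 + δ := by
    have h1 : Tendsto (fun θ : ℝ => Real.cosh (2 * θ)) (𝓝[>] 0) (𝓝 (Real.cosh (2 * 0))) :=
      (Continuous.tendsto (by fun_prop) _).mono_left nhdsWithin_le_nhds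
    rw [mul_zero, Real.cosh_zero] at h1
    obtain ⟨θ, h2⟩ := ((h1.eventually (gt_mem_nhds (show (1 : ℝ) < 1 + δ by linarith))).and
      (self_mem_nhdsWithin : Set.Ioi (0 : ℝ) ∈ 𝓝[>] 0)).exists
    exact ⟨θ, h2.2, h2.1⟩
  have hq : 1 < Real.cosh θ := Real.one_lt_cosh.2 hθ.ne'
  -- Chosen so that `cosh_sub_le_of_close`, applied to points with `cosh d < 1 + ε`, yields a time
  -- difference below `θ`.
  obtain ⟨ε, hε, hε2, hεq⟩ : ∃ ε : ℝ, 0 < ε ∧ ε < 1 ∧ 2 * (1 + ε) < (2 - ε) * Real.cosh θ := by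
    refine ⟨min ((Real.cosh θ - 1) / 4) (1 / 2), by positivity, by
      linarith [min_le_right ((Real.cosh θ - 1) / 4) (1 / 2)], ?_⟩
    have h1 := min_le_left ((Real.cosh θ - 1) / 4) (1 / 2)
    have h2 := min_le_right ((Real.cosh θ - 1) / 4) (1 / 2)
    have h3 : 0 < min ((Real.cosh θ - 1) / 4) (1 / 2) := by positivity
    nlinarith
  -- the length of the transversal
  obtain ⟨s₁, hs₁, hs₁2, hsU, hsε⟩ : ∃ s₁ : ℝ, 0 < s₁ ∧ s₁ < 1 / 8 ∧
      (∀ y, |y| ≤ s₁ → f.kpt (0, y) ∈ U) ∧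
      ∀ x y, |x| ≤ s₁ → |y| ≤ s₁ → -mink (f.kpt (0, x)) (f.kpt (0, y)) < 1 + ε := by
    have c1 : ContinuousAt (fun y : ℝ => f.kpt (0, y)) 0 :=
      ContinuousAt.comp (f := fun y : ℝ => ((0 : ℝ), y)) (f.continuousAt_kpt (by norm_num)) (by fun_prop)
    have c2 : ContinuousAt (fun p : ℝ × ℝ => -mink (f.kpt (0, p.1)) (f.kpt (0, p.2))) (0, 0) := by
      have h1 : ContinuousAt (fun p : ℝ × ℝ => (f.kpt (0, p.1) : V)) (0, 0) :=
        continuous_subtype_val.continuousAt.comp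
          (ContinuousAt.comp (f := fun p : ℝ × ℝ => p.1) (x := ((0 : ℝ), (0 : ℝ))) c1 continuousAt_fst)
      have h2 : ContinuousAt (fun p : ℝ × ℝ => (f.kpt (0, p.2) : V)) (0, 0) :=
        continuous_subtype_val.continuousAt.comp
          (ContinuousAt.comp (f := fun p : ℝ × ℝ => p.2) (x := ((0 : ℝ), (0 : ℝ))) c1 continuousAt_snd)
      exact (continuous_mink.continuousAt.comp (h1.prodMk h2)).neg
    have e1 := c1.eventually (hU.mem_nhds (by simpa using hXU))
    have h00 : -mink (f.kpt (0, ((0 : ℝ), (0 : ℝ)).1)) (f.kpt (0, ((0 : ℝ), (0 : ℝ)).2)) < 1 + ε := by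
      change -mink (f.kpt (0, 0)) (f.kpt (0, 0)) < _
      rw [f.kpt_zero, f.X.mink_self]; linarith
    have e2 := c2.eventually (gt_mem_nhds h00)
    obtain ⟨r1, hr1, h1⟩ := Metric.eventually_nhds_iff.1 e1
    obtain ⟨r2, hr2, h2⟩ := Metric.eventually_nhds_iff.1 e2
    refine ⟨min (1 / 16) (min r1 r2 / 2), by positivity, by
      linarith [min_le_left (1 / 16) (min r1 r2 / 2)], fun y hy => h1 ?_, fun x y hx hy => h2 (y := (x, y)) ?_⟩
    · rw [Real.dist_eq, sub_zero]
      have := min_le_right (1 / 16) (min r1 r2 / 2)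
      have := min_le_left r1 r2
      linarith
    · rw [Prod.dist_eq, Real.dist_eq, Real.dist_eq, sub_zero, sub_zero]
      have := min_le_right (1 / 16) (min r1 r2 / 2)
      have := min_le_right r1 r2
      exact max_lt (by linarith) (by linarith)
  -- the cells
  set ρ : ℝ := ε / (16 * c)
  have hρ : 0 < ρ := by positivity
  have hρc : 16 * c * ρ = ε := by simp only [ρ]; field_simp
  obtain ⟨t, ht, htc⟩ := Metric.totallyBounded_iff.1
    (isCompact_closedBall (0 : V × V × V) c).totallyBounded (ρ / 2) (by positivity)
  -- The leading `1` accounts for the last leaf of `E`, and `2 M + 1 ≤ (2 / θ + 5) (T + 1)` bounds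
  -- the number of time slots.
  refine ⟨s₁, 1, 1 + ht.toFinset.card * (2 / θ + 5), hs₁, by linarith, one_pos, fun T nr F E hE hT => ?_⟩
  classical
  set E' := E.filter fun x => ∃ z ∈ E, x < z
  have hball : ∀ y, |y| ≤ s₁ → ((0, y) : ℝ × ℝ).1 ^ 2 + ((0, y) : ℝ × ℝ).2 ^ 2 < 1 := fun y hy => by
    have := (sq_lt_one_iff_abs_lt_one y).2 (by linarith)
    simpa using this
  have hsucc : ∀ x ∈ E', ∃ z ∈ E, x < z ∧ ∀ y ∈ E, x < y → z ≤ y := by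
    intro x hx
    obtain ⟨z, hz, hxz⟩ := (Finset.mem_filter.1 hx).2
    obtain ⟨w, hw, hw'⟩ := Finset.exists_min_image (E.filter fun y => x < y) id
      ⟨z, Finset.mem_filter.2 ⟨hz, hxz⟩⟩
    exact ⟨w, (Finset.mem_filter.1 hw).1, (Finset.mem_filter.1 hw).2,
      fun y hy hxy => hw' y (Finset.mem_filter.2 ⟨hy, hxy⟩)⟩
  choose! xp hxpE hxxp hxpmin using hsucc
  have hsub : ∀ x ∈ E', x ∈ E := fun x hx => (Finset.mem_filter.1 hx).1
  have hframe : ∀ x ∈ E, line (F x).n ∈ Λ.leaves := fun x hx => by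
    rw [(hE x hx).2.2.2.2.2]; exact (hE x hx).2.2.1
  have hnx : ∀ x ∈ E, ∀ y, |y| ≤ s₁ → ∃ ν, 1 ≤ ν ∧ ν ^ 2 * (1 - 1 / 64) ≤ 1 ∧
      mink (nr x) (f.kvec (0, y)) = ν * (y - x) := by
    intro x hx y hy
    obtain ⟨hxs, hn, -, ⟨m, ν, hν, hm, he⟩, -⟩ := hE x hx
    refine ⟨ν, hν, ?_, by rw [he, mink_slope_kvec]; ring⟩
    rw [he, mink_slope_slope] at hn
    have : x ^ 2 ≤ (1 / 8) ^ 2 := sq_le_sq' (by linarith [abs_le.1 hxs]) (by linarith [abs_le.1 hxs])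
    nlinarith [sq_nonneg (ν * m), sq_nonneg ν]
  -- On the short transversal the strip is still narrow, with product above `-1`; by separation it
  -- reaches `-1` or less within time `T`, always on the same side. The intermediate value theorem
  -- gives a time of width exactly one.
  have htime : ∀ x ∈ E', ∃ τ : ℝ, |τ| ≤ T ∧ mink (nr (xp x)) ((F x).vec τ) = -1 := by
    intro x hx
    have hxE := hsub x hx
    have hpE := hxpE x hx
    obtain ⟨τ, hτ, hsepτ⟩ := hT x hxE (xp x) hpE (hxxp x hx)
    obtain ⟨hxs, -, -, -, hFX, hFn⟩ := hE x hxE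
    obtain ⟨hps, hpn, hpl, -⟩ := hE _ hpE
    obtain ⟨ν, hν, hν2, hνe⟩ := hnx _ hpE x hxs
    have hsq : 0 < √(1 - (0 : ℝ) ^ 2 - x ^ 2) := Real.sqrt_pos.2 (by have := hball x hxs; simp at this ⊢; linarith)
    have h0 : mink (nr (xp x)) (F x).X = (√(1 - (0 : ℝ) ^ 2 - x ^ 2))⁻¹ * (ν * (x - xp x)) := by
      rw [hFX, f.coe_kpt (hball x hxs), mink_smul_right, hνe]
    have hlt := hxxp x hx
    have h0neg : mink (nr (xp x)) (F x).X ≤ 0 := by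
      rw [h0]; exact mul_nonpos_of_nonneg_of_nonpos (by positivity) (by nlinarith)
    have h0gt : -1 < mink (nr (xp x)) (F x).X := by
      rw [h0, inv_mul_eq_div, lt_div_iff₀ hsq]
      have a1 := abs_le.1 hxs
      have a2 := abs_le.1 hps
      have a3 : ν < 2 := by nlinarith
      have a4 : 1 / 2 ≤ √(1 - (0 : ℝ) ^ 2 - x ^ 2) := by
        apply Real.le_sqrt_of_sq_le; nlinarith
      have a5 : ν * (xp x - x) ≤ 2 * (xp x - x) := mul_le_mul_of_nonneg_right a3.le (by linarith)
      have a6 : ν * (x - xp x) = -(ν * (xp x - x)) := by ring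
      rw [a6]
      have a7 : xp x - x < 1 / 4 := by linarith [a1.1, a2.2]
      have a8 : ν * (xp x - x) < 1 / 2 := lt_of_le_of_lt a5 (by linarith)
      rw [neg_one_mul]
      exact neg_lt_neg (lt_of_lt_of_le a8 a4)
    have hneg := mink_nonpos_on_line hpn (F x) (Λ.one_le_sq hpn hpl (F x) (hframe x hxE)) h0neg
      ((F x).pt_mem_line τ)
    rw [Frame.coe_pt] at hneg
    rw [abs_of_nonpos hneg] at hsepτ
    have hcont : ContinuousOn (fun s => mink (nr (xp x)) ((F x).vec s)) (Set.uIcc 0 τ) := by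
      apply Continuous.continuousOn
      simp only [Frame.mink_vec]; fun_prop
    obtain ⟨s, hs, hs'⟩ := intermediate_value_uIcc hcont (a := 0) (b := τ) (show (-1 : ℝ) ∈ _ by
      have e0 : mink (nr (xp x)) ((F x).vec 0) = mink (nr (xp x)) (F x).X := by simp [Frame.vec]
      simp only [e0]
      exact Set.mem_uIcc_of_ge (by linarith) (by linarith))
    refine ⟨s, le_trans ?_ hτ, hs'⟩
    have := Set.abs_sub_left_of_mem_uIcc hs
    simpa using this
  choose! τ hτT hτ using htime
  have hγ : ∀ x : ℝ, ∃ γ : π, act (S.σ γ) ((F x).pt (τ x)) ∈ K₀ := fun x => hcov _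
  choose γ hγK using hγ
  -- The leaf `x` at the mouth of its strip, carried into `K₀`. In this parametrization the
  -- transversal is crossed at time `-τ x`.
  set G : ℝ → Frame := fun x => ((F x).move (τ x)).map (S.σ (γ x)) with hG
  have hGc : ∀ x, ((G x).X : V) 2 ≤ c := fun x => hc _ (hγK x)
  have hGn : ∀ x, (G x).n = lin (S.σ (γ x)) (F x).n := fun x => rfl
  have hGleaf : ∀ x ∈ E, line (G x).n ∈ Λ.leaves := fun x hx => Λ.line_lin_mem _ (hframe x hx)
  have hGpt : ∀ x, (G x).pt (-τ x) = act (S.σ (γ x)) (F x).X := fun x => by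
    rw [hG, Frame.map_pt, Frame.move_pt, add_neg_cancel, Frame.pt_zero]
  have hpos : ∀ x z, ‖(G z).n - (G x).n‖ ≤ ρ → 0 < mink (G x).n (G z).n := by
    intro x z h
    have h1 := abs_mink_le (G x).n ((G z).n - (G x).n)
    rw [mink_sub_right, (G x).nn] at h1
    have h2 : 3 * ‖(G x).n‖ * ‖(G z).n - (G x).n‖ ≤ 3 * c * ρ := by
      gcongr; exact (G x).norm_n_le.trans (hGc x)
    have := (abs_le.1 (h1.trans h2)).1
    linarith
  -- The heart of the count: the leaf of `G z` runs inside the strip of `x`, hence crosses the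
  -- translated transversal between `x` and `xp x`. Fellow travelling identifies this crossing with
  -- the crossing at `z`, and `xp x` being the next leaf then leaves only `z = x`.
  have half : ∀ x ∈ E', ∀ z ∈ E', ‖((G z).X : V) - (G x).X‖ ≤ ρ → ‖(G z).e - (G x).e‖ ≤ ρ →
      ‖(G z).n - (G x).n‖ ≤ ρ → |τ x - τ z| ≤ θ → 0 ≤ mink (G x).n (G z).X → x = z := by
    intro x hx z hz hX he hn ht hside
    have hxE := hsub x hx
    have hzE := hsub z hz
    have hpE := hxpE x hx
    obtain ⟨hxs, hxn, -, ⟨m, ν, hν, hm, hxe⟩, hxX, hxF⟩ := hE x hxE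
    obtain ⟨hzs, -, -, -, hzX, hzF⟩ := hE z hzE
    obtain ⟨hps, hpn, hpl, ⟨m', ν', hν', hm', hpe⟩, hpX, hpF⟩ := hE _ hpE
    have hnpl : line (lin (S.σ (γ x)) (nr (xp x))) ∈ Λ.leaves := Λ.line_lin_mem _ hpl
    have hnpn : mink (lin (S.σ (γ x)) (nr (xp x))) (lin (S.σ (γ x)) (nr (xp x))) = 1 := by
      rw [mink_lin, hpn]
    have hnpg : 0 < mink (lin (S.σ (γ x)) (nr (xp x))) (G x).n := by
      rw [hGn, mink_lin, hxF, hpe, hxe, mink_slope_slope]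
      have a1 : |m' * m| ≤ 1 / 8 * (1 / 8) := by rw [abs_mul]; gcongr <;> linarith
      have a2 : |xp x * x| ≤ 1 / 8 * (1 / 8) := by rw [abs_mul]; gcongr <;> linarith
      have := abs_le.1 a1
      have := abs_le.1 a2
      have : 0 < 1 + m' * m - xp x * x := by linarith
      positivity
    obtain ⟨b1, b2, b3⟩ := between_of_close (g := G x) (h := G z) (δ₀ := 1) (c := c) (ρ := ρ) one_pos le_rfl
      (hGc x) (by linarith) hX hn (Λ.one_le_sq (G x).nn (hGleaf x hxE) _ (hGleaf z hzE)) (hpos x z hn)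
      hside hnpn (Λ.one_le_sq hnpn hnpl _ (hGleaf x hxE)) hnpg (Λ.one_le_sq hnpn hnpl _ (hGleaf z hzE))
      (by
        change mink _ (lin (S.σ (γ x)) ((F x).vec (τ x))) = -1
        rw [mink_lin, hτ x hx])
    have hsc : ∀ y, |y| ≤ s₁ → 0 < √(1 - (0 : ℝ) ^ 2 - y ^ 2) := fun y hy =>
      Real.sqrt_pos.2 (by have := hball y hy; simp at this ⊢; linarith)
    have hscale : ∀ (v : V) y, |y| ≤ s₁ → mink v (act (S.σ (γ x)) (f.kpt (0, y))) =
        (√(1 - (0 : ℝ) ^ 2 - y ^ 2))⁻¹ * mink v (lin (S.σ (γ x)) (f.kvec (0, y))) := by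
      intro v y hy
      rw [coe_act, f.coe_kpt (hball y hy), lin_smul, mink_smul_right]
    have c1 : mink (G z).n (lin (S.σ (γ x)) (f.kvec (0, x))) ≤ 0 := by
      have := b2 (act (S.σ (γ x)) (f.kpt (0, x))) (by
        rw [← hxX, ← hGpt]; exact (G x).pt_mem_line _)
      rw [hscale _ _ hxs] at this
      exact nonpos_of_mul_nonpos_right this (inv_pos.2 (hsc x hxs))
    have c2 : 0 ≤ mink (G z).n (lin (S.σ (γ x)) (f.kvec (0, xp x))) := by
      have := b3 (act (S.σ (γ x)) (f.kpt (0, xp x))) (by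
        change mink _ (lin _ _) = 0
        rw [mink_lin, ← hpX, ← hpF, (F (xp x)).nX])
      rw [hscale _ _ hps] at this
      exact nonneg_of_mul_nonneg_right this (inv_pos.2 (hsc _ hps))
    have hcont : ContinuousOn (fun y : ℝ => mink (G z).n (lin (S.σ (γ x)) (f.kvec (0, y))))
        (Set.Icc x (xp x)) :=
      (Continuous.mink continuous_const ((continuous_lin _).comp
        (f.continuous_kvec.comp (by fun_prop)))).continuousOn
    obtain ⟨y, hy, hy0⟩ := intermediate_value_Icc (hxxp x hx).le hcont (show (0 : ℝ) ∈ _ from ⟨c1, c2⟩)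
    simp only at hy0
    have hys : |y| ≤ s₁ := abs_le.2 ⟨by linarith [abs_le.1 hxs, hy.1], by linarith [abs_le.1 hps, hy.2]⟩
    have hQ : act (S.σ (γ x)) (f.kpt (0, y)) ∈ line (G z).n := by
      change mink _ _ = 0
      rw [hscale _ _ hys, hy0, mul_zero]
    have hQpt := (G z).mem_line hQ
    set u := Real.arsinh (mink (G z).e (act (S.σ (γ x)) (f.kpt (0, y))))
    have hρ12 : ρ * (12 * c) ≤ ε := by linarith
    -- The two crossing points lie on one short transversal, so the leaf of `G z` crosses at a time
    -- `u` within `θ` of `-τ x`, hence within `2 θ` of `-τ z`.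
    have d1 := cosh_sub_le_of_close (g := G x) (h := G z) (ε := ε) (hGc x)
      ((mul_le_mul_of_nonneg_right hX (by positivity)).trans hρ12)
      ((mul_le_mul_of_nonneg_right he (by positivity)).trans hρ12) u (-τ x)
    rw [← Frame.coe_pt, ← Frame.coe_pt, ← hQpt, hGpt, hxX, coe_act, coe_act, mink_lin] at d1
    have d2 := hsε y x hys hxs
    have d3 : Real.cosh (u - -τ x) < Real.cosh θ :=
      lt_of_mul_lt_mul_left (by linarith) (show 0 ≤ 2 - ε by linarith)
    have d4 : |u - -τ x| < θ := by
      rw [Real.cosh_lt_cosh, abs_of_pos hθ] at d3; exact d3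
    have d5 : -mink (act (S.σ (γ x)) (f.kpt (0, y))) (act (S.σ (γ z)) (f.kpt (0, z))) < 1 + δ := by
      rw [← hzX, ← hGpt, hQpt, Frame.coe_pt, Frame.coe_pt, Frame.mink_vec_vec, neg_neg]
      refine lt_of_le_of_lt ?_ hθδ
      rw [Real.cosh_le_cosh, abs_of_pos (show 0 < 2 * θ by linarith)]
      have := abs_lt.1 d4
      have := abs_le.1 ht
      exact abs_le.2 ⟨by linarith, by linarith⟩
    -- Both points are translates of points of `U` at distance below the separation constant of
    -- different translates.
    have d6 : γ x = γ z := by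
      by_contra hne
      have := hsep _ (hsU y hys) _ (hsU z hzs) ((γ x)⁻¹ * γ z)
        (fun h => hne (by rw [inv_mul_eq_one] at h; exact h))
      rw [map_mul, map_inv, lin_mul, mink_lin_inv_right] at this
      rw [coe_act, coe_act] at d5
      linarith
    have d7 : y = z := by
      obtain ⟨ν₂, hν₂, -, he₂⟩ := hnx z hzE y hys
      rw [hGn, d6, mink_lin, hzF, he₂] at hy0
      rcases mul_eq_zero.1 hy0 with h | h <;> linarith
    subst d7
    -- The only alternative is `z = xp x`; but `G z` lies strictly on one side of the translate of
    -- the leaf `xp x`.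
    by_contra hne
    have hlt := lt_of_le_of_ne hy.1 hne
    have heq : xp x = y := le_antisymm (hxpmin x hx y hzE hlt) hy.2
    have : mink (lin (S.σ (γ x)) (nr (xp x))) (G y).X = 0 := by
      change mink _ (lin (S.σ (γ y)) ((F y).vec (τ y))) = 0
      rw [heq, d6, mink_lin, ← hzF]
      exact (F y).pt_mem_line _
    linarith
  have full : ∀ x ∈ E', ∀ z ∈ E', ‖((G z).X : V) - (G x).X‖ ≤ ρ → ‖(G z).e - (G x).e‖ ≤ ρ →
      ‖(G z).n - (G x).n‖ ≤ ρ → |τ x - τ z| ≤ θ → x = z := by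
    intro x hx z hz hX he hn ht
    rcases le_total 0 (mink (G x).n (G z).X) with h | h
    · exact half x hx z hz hX he hn ht h
    · refine (half z hz x hx (by rwa [norm_sub_rev]) (by rwa [norm_sub_rev]) (by rwa [norm_sub_rev])
        (by rwa [abs_sub_comm]) ?_).symm
      exact mink_nonneg_antisymm (Λ.one_le_sq (G x).nn (hGleaf x (hsub x hx)) _ (hGleaf z (hsub z hz)))
        (hpos x z hn) h
  -- counting
  have hcell : ∀ x, ∃ y ∈ t, dist (((G x).X : V), (G x).e, (G x).n) y < ρ / 2 := by
    intro x
    have : (((G x).X : V), (G x).e, (G x).n) ∈ Metric.closedBall (0 : V × V × V) c := by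
      rw [mem_closedBall_zero_iff]
      exact max_le ((Hyp.norm_le _).trans (hGc x))
        (max_le ((G x).norm_e_le.trans (hGc x)) ((G x).norm_n_le.trans (hGc x)))
    obtain ⟨y, hy, hy'⟩ := Set.mem_iUnion₂.1 (htc this)
    exact ⟨y, hy, hy'⟩
  choose cell hcellt hcelld using hcell
  set M : ℕ := ⌈(T : ℝ) / θ⌉₊ + 1
  have hM : ((M : ℕ) : ℝ) ≤ T / θ + 2 := by
    have := Nat.ceil_lt_add_one (show 0 ≤ (T : ℝ) / θ by positivity)
    simp only [M]; push_cast; linarith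
  have hcard : E'.card ≤ (ht.toFinset ×ˢ Finset.Icc (-(M : ℤ)) M).card := by
    refine Finset.card_le_card_of_injOn (fun x => (cell x, ⌊τ x / θ⌋)) ?_ ?_
    · intro x hx
      have hx' : x ∈ E' := hx
      have h1 := abs_le.1 (hτT x hx')
      have h2 := Nat.le_ceil ((T : ℝ) / θ)
      have h3 : -((M : ℤ) : ℝ) ≤ τ x / θ := by
        rw [le_div_iff₀ hθ]
        have : (T : ℝ) ≤ ⌈(T : ℝ) / θ⌉₊ * θ := (div_le_iff₀ hθ).1 h2
        simp only [M]; push_cast; linarith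
      have h4 : τ x / θ ≤ (M : ℤ) := by
        rw [div_le_iff₀ hθ]
        have : (T : ℝ) ≤ ⌈(T : ℝ) / θ⌉₊ * θ := (div_le_iff₀ hθ).1 h2
        simp only [M]; push_cast; linarith
      simp only [Finset.coe_product, Set.mem_prod, Finset.mem_coe, Set.Finite.mem_toFinset, Finset.mem_Icc]
      refine ⟨hcellt x, Int.le_floor.2 (by exact_mod_cast h3), ?_⟩
      have := (Int.floor_le (τ x / θ)).trans h4
      exact_mod_cast this
    · intro x hx z hz h
      simp only [Prod.mk.injEq] at h
      have h1 : dist (((G z).X : V), (G z).e, (G z).n) (((G x).X : V), (G x).e, (G x).n) ≤ ρ := by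
        have := dist_triangle_right (((G z).X : V), (G z).e, (G z).n) (((G x).X : V), (G x).e, (G x).n) (cell x)
        have a := hcelld x
        have b := hcelld z
        rw [← h.1] at b
        linarith
      simp only [Prod.dist_eq, max_le_iff] at h1
      simp only [dist_eq_norm] at h1
      refine full x hx z hz h1.1 h1.2.1 h1.2.2 ?_
      have := Int.abs_sub_lt_one_of_floor_eq_floor h.2
      rw [← sub_div, abs_div, abs_of_pos hθ, div_lt_one hθ] at this
      exact this.le
  have hEE' : E.card ≤ E'.card + 1 := by
    rcases E.eq_empty_or_nonempty with h | h
    · simp [h]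
    · have : E ⊆ insert (E.max' h) E' := fun x hx => by
        rcases (E.le_max' x hx).eq_or_lt with h1 | h1
        · exact Finset.mem_insert.2 (Or.inl h1)
        · exact Finset.mem_insert_of_mem (Finset.mem_filter.2 ⟨hx, _, E.max'_mem h, h1⟩)
      exact (Finset.card_le_card this).trans (Finset.card_insert_le _ _)
  rw [Finset.card_product, Int.card_Icc] at hcard
  have e1 : ((M : ℤ) + 1 - -(M : ℤ)).toNat = 2 * M + 1 := by omega
  rw [e1] at hcard
  have e2 : (E.card : ℝ) ≤ ht.toFinset.card * (2 * M + 1) + 1 := by exact_mod_cast hEE'.trans (by omega)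
  have e3 : (2 * (M : ℝ) + 1) ≤ (2 / θ + 5) * (T + 1) := by
    have : (2 / θ + 5) * ((T : ℝ) + 1) = 2 * (T / θ) + 2 / θ + 5 * T + 5 := by ring
    have : 0 < 2 / θ := by positivity
    have : (0 : ℝ) ≤ T := T.cast_nonneg
    linarith
  have e4 := mul_le_mul_of_nonneg_left e3 (Nat.cast_nonneg (α := ℝ) ht.toFinset.card)
  have e5 : (0 : ℝ) ≤ T := T.cast_nonneg
  have e6 : (1 + ht.toFinset.card * (2 / θ + 5)) * ((T : ℝ) + 1) =
      (T + 1) + ht.toFinset.card * ((2 / θ + 5) * (T + 1)) := by ring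
  rw [e6]
  linarith

end Lamination
end LieLam

/-! ### Transversals of Hausdorff dimension zero -/

namespace LieLam

open Topology Filter

instance : Nonempty Frame := ⟨(exists_frame (chart 0)).choose⟩

section Lamination

variable {π : Type*} [Group π] {S : HypSurface π} (Λ : GeodesicLamination S)

/-- Exponential decay beats linear growth for every exponent `d > 0`; these are the sums that bound
the `d`-dimensional Hausdorff measure. -/
theorem tendsto_mul_rpow_cosh {A D d : ℝ} (hd : 0 < d) (hD : 0 ≤ D) :
    Tendsto (fun T : ℕ => A * ((T : ℝ) + 1) * (D / Real.cosh T) ^ d) atTop (𝓝 0) := by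
  have h1 : Tendsto (fun T : ℕ => d * (T : ℝ)) atTop atTop :=
    Tendsto.const_mul_atTop hd tendsto_natCast_atTop_atTop
  have h2 := (Real.tendsto_pow_mul_exp_neg_atTop_nhds_zero 1).comp h1
  have h3 := (Real.tendsto_pow_mul_exp_neg_atTop_nhds_zero 0).comp h1
  have h4 : Tendsto (fun T : ℕ => |A| * (2 * D) ^ d * (d⁻¹ * (((fun x => x ^ 1 * Real.exp (-x)) ∘ fun T : ℕ => d * (T : ℝ)) T)
      + ((fun x => x ^ 0 * Real.exp (-x)) ∘ fun T : ℕ => d * (T : ℝ)) T)) atTop (𝓝 (|A| * (2 * D) ^ d * (d⁻¹ * 0 + 0))) :=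
    ((h2.const_mul _).add h3).const_mul _
  simp only [mul_zero, add_zero] at h4
  refine squeeze_zero_norm (fun T => ?_) h4
  have hT : (0 : ℝ) ≤ T := T.cast_nonneg
  have hc : D / Real.cosh T ≤ 2 * D * Real.exp (-T) := by
    rw [div_le_iff₀ (Real.cosh_pos _), Real.cosh_eq]
    have : Real.exp (-(T : ℝ)) * Real.exp T = 1 := by rw [← Real.exp_add]; simp
    nlinarith [mul_nonneg hD (sq_nonneg (Real.exp (-(T : ℝ))))]
  have h5 : (D / Real.cosh T) ^ d ≤ (2 * D) ^ d * Real.exp (-(d * T)) := by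
    refine (Real.rpow_le_rpow (div_nonneg hD (Real.cosh_pos _).le) hc hd.le).trans (le_of_eq ?_)
    rw [Real.mul_rpow (by positivity) (Real.exp_pos _).le, ← Real.exp_mul]
    ring_nf
  have h6 : 0 ≤ (D / Real.cosh T) ^ d := Real.rpow_nonneg (div_nonneg hD (Real.cosh_pos _).le) _
  rw [Real.norm_eq_abs, abs_mul, abs_mul, abs_of_nonneg h6, abs_of_nonneg (show 0 ≤ (T : ℝ) + 1 by positivity)]
  simp only [Function.comp, pow_one, pow_zero, one_mul]
  have e : d⁻¹ * (d * (T : ℝ) * Real.exp (-(d * T))) = T * Real.exp (-(d * T)) := by field_simp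
  rw [e]
  calc |A| * ((T : ℝ) + 1) * (D / Real.cosh T) ^ d
      ≤ |A| * ((T : ℝ) + 1) * ((2 * D) ^ d * Real.exp (-(d * T))) := by gcongr
    _ = _ := by ring

/-- A short transversal of a leaf meets a geodesic lamination of a closed surface in a set of
Hausdorff dimension zero. -/
theorem exists_dimH_transversal_eq_zero {f : Frame} (hf : line f.n ∈ Λ.leaves) :
    ∃ s₁ : ℝ, 0 < s₁ ∧ s₁ < 1 / 2 ∧ dimH {y : ℝ | |y| ≤ s₁ ∧ f.kpt (0, y) ∈ Λ.support} = 0 := by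
  obtain ⟨s₁, δ₀, A, hs₁, hs₁2, hδ₀, hA⟩ := card_separated_le Λ hf
  refine ⟨s₁, hs₁, hs₁2, ?_⟩
  set C := {y : ℝ | |y| ≤ s₁ ∧ f.kpt (0, y) ∈ Λ.support} with hC
  have hball : ∀ y, |y| ≤ s₁ → ((0, y) : ℝ × ℝ).1 ^ 2 + ((0, y) : ℝ × ℝ).2 ^ 2 < 1 := fun y hy => by
    have := (sq_lt_one_iff_abs_lt_one y).2 (by linarith)
    simpa using this
  have hnr : ∀ y ∈ C, ∃ n : V, ∃ g : Frame, mink n n = 1 ∧ line n ∈ Λ.leaves ∧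
      (∃ m ν : ℝ, 1 ≤ ν ∧ |m| ≤ |y| ∧ n = ν • (y • (f.X : V) - m • f.e + f.n)) ∧
      g.X = f.kpt (0, y) ∧ g.n = n := by
    intro y hy
    obtain ⟨n, h1, h2, m, ν, h3, h4, h5⟩ := exists_transversal_normal Λ hf (by linarith [hy.1]) hy.2
    refine ⟨n, Frame.ofNormal (f.kpt (0, y)) n h1 ?_, h1, h2, ⟨m, ν, h3, h4, h5⟩, rfl, rfl⟩
    have : f.kpt (0, y) ∈ line n := by
      rw [f.kpt_mem_line (hball y hy.1), h5, mink_slope_kvec]; ring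
    exact this
  choose! nr F hn1 hn2 hn3 hn4 hn5 using hnr
  -- pairs of leaves which are close for a long time
  have hclose : ∀ (T : ℕ), ∀ x ∈ C, ∀ z ∈ C, (¬ ∃ t : ℝ, |t| ≤ T ∧ δ₀ ≤ |mink (nr z) ((F x).vec t)|) →
      |x - z| ≤ δ₀ / Real.cosh T := by
    intro T x hx z hz h
    push Not at h
    have h1 := abs_lt.1 (h T (by simp))
    have h2 := abs_lt.1 (h (-T) (by simp))
    rw [Frame.mink_vec] at h1 h2
    rw [Real.cosh_neg, Real.sinh_neg] at h2
    -- The values at `T` and `-T` add up to `2 cosh T (n_z, X)^♯`, the `sinh` terms cancelling.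
    have h3 : |mink (nr z) (F x).X| ≤ δ₀ / Real.cosh T := by
      rw [le_div_iff₀ (Real.cosh_pos _), ← abs_of_pos (Real.cosh_pos (T : ℝ)), ← abs_mul]
      exact abs_le.2 ⟨by linarith [h1.1, h2.1], by linarith [h1.2, h2.2]⟩
    refine le_trans ?_ h3
    obtain ⟨m, ν, hν, -, he⟩ := hn3 z hz
    have hlt := hball x hx.1
    simp only at hlt
    have hsq : 0 < √(1 - (0 : ℝ) ^ 2 - x ^ 2) := Real.sqrt_pos.2 (by linarith)
    have hsq1 : √(1 - (0 : ℝ) ^ 2 - x ^ 2) ≤ 1 := Real.sqrt_le_one.2 (by nlinarith [sq_nonneg x])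
    rw [hn4 x hx, f.coe_kpt (hball x hx.1), mink_smul_right, he, mink_slope_kvec, abs_mul, abs_mul]
    simp only [mul_zero, add_zero]
    rw [abs_of_pos (inv_pos.2 hsq), abs_of_pos (show 0 < ν by linarith)]
    have h4 : 1 ≤ (√(1 - (0 : ℝ) ^ 2 - x ^ 2))⁻¹ := (one_le_inv₀ hsq).2 hsq1
    have h5 : 1 ≤ (√(1 - (0 : ℝ) ^ 2 - x ^ 2))⁻¹ * ν := one_le_mul_of_one_le_of_one_le h4 hν
    rw [← mul_assoc]
    exact le_mul_of_one_le_left (abs_nonneg _) h5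
  -- coverings
  have hcover : ∀ T : ℕ, ∃ E : Finset ℝ, (E.card : ℝ) ≤ A * (T + 1) ∧
      C ⊆ ⋃ x ∈ E, Metric.closedBall x (δ₀ / Real.cosh T) := by
    intro T
    -- Separated sets have bounded size, so one of maximal size exists. By maximality every other
    -- point of `C` fails to be separated from some member, hence lies close to it by `hclose`.
    let P : Finset ℝ → Prop := fun E => (∀ x ∈ E, x ∈ C) ∧
      ∀ x ∈ E, ∀ z ∈ E, x < z → ∃ t : ℝ, |t| ≤ T ∧ δ₀ ≤ |mink (nr z) ((F x).vec t)|
    have hP : ∀ E, P E → (E.card : ℝ) ≤ A * (T + 1) := fun E hE =>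
      hA T nr F E (fun x hx => ⟨(hE.1 x hx).1, hn1 x (hE.1 x hx), hn2 x (hE.1 x hx), hn3 x (hE.1 x hx),
        hn4 x (hE.1 x hx), hn5 x (hE.1 x hx)⟩) hE.2
    obtain ⟨N, hN⟩ := exists_nat_ge (A * ((T : ℝ) + 1))
    have hbdd : BddAbove {k : ℕ | ∃ E, P E ∧ E.card = k} := ⟨N, by
      rintro k ⟨E, hE, rfl⟩
      exact_mod_cast (hP E hE).trans hN⟩
    have hne : {k : ℕ | ∃ E, P E ∧ E.card = k}.Nonempty := ⟨0, ∅, by simp [P], rfl⟩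
    obtain ⟨E, hE, hEc⟩ := Nat.sSup_mem hne hbdd
    refine ⟨E, hP E hE, fun y hy => ?_⟩
    have hr : 0 ≤ δ₀ / Real.cosh T := div_nonneg hδ₀.le (Real.cosh_pos _).le
    by_cases hyE : y ∈ E
    · exact Set.mem_iUnion₂.2 ⟨y, hyE, Metric.mem_closedBall_self hr⟩
    by_contra hnot
    simp only [Set.mem_iUnion, not_exists, Metric.mem_closedBall, Real.dist_eq] at hnot
    classical
    have hins : P (insert y E) := by
      refine ⟨fun x hx => ?_, fun x hx z hz hxz => ?_⟩
      · rcases Finset.mem_insert.1 hx with rfl | hx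
        · exact hy
        · exact hE.1 x hx
      · by_contra hns
        rcases Finset.mem_insert.1 hx with rfl | hx
        · rcases Finset.mem_insert.1 hz with rfl | hz
          · exact lt_irrefl _ hxz
          · exact hnot z hz (hclose T _ hy _ (hE.1 z hz) hns)
        · rcases Finset.mem_insert.1 hz with h | hz
          · rw [h] at hns
            exact hnot x hx (by rw [abs_sub_comm]; exact hclose T _ (hE.1 x hx) _ hy hns)
          · exact hns (hE.2 x hx z hz hxz)
    have := le_csSup hbdd ⟨_, hins, rfl⟩
    rw [Finset.card_insert_of_notMem hyE, ← hEc] at this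
    omega
  choose E hE1 hE2 using hcover
  -- the Hausdorff measures
  have hmeas : ∀ d : NNReal, 0 < d → dimH C ≤ d := by
    intro d hd
    apply dimH_le_of_hausdorffMeasure_ne_top
    have hd' : (0 : ℝ) < d := hd
    have hdiam : ∀ x r : ℝ, Metric.ediam (Metric.closedBall x r) = ENNReal.ofReal (2 * r) := fun x r => by
      rw [Real.closedBall_eq_Icc, Real.ediam_Icc]; congr 1; ring
    have hlim : Tendsto (fun T : ℕ => ENNReal.ofReal (A * ((T : ℝ) + 1) * (2 * δ₀ / Real.cosh T) ^ (d : ℝ)))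
        atTop (𝓝 0) := by
      rw [← ENNReal.ofReal_zero]
      exact ENNReal.tendsto_ofReal (tendsto_mul_rpow_cosh hd' (by positivity))
    have hr0 : Tendsto (fun T : ℕ => ENNReal.ofReal (2 * (δ₀ / Real.cosh T))) atTop (𝓝 0) := by
      rw [← ENNReal.ofReal_zero]
      refine ENNReal.tendsto_ofReal ?_
      have h := tendsto_mul_rpow_cosh (A := 1) (d := 1) (D := 2 * δ₀) one_pos (by positivity)
      refine squeeze_zero (fun T => by have := Real.cosh_pos (T : ℝ); positivity) (fun T => ?_) h
      have h2 : 0 ≤ 2 * (δ₀ / Real.cosh T) := by have := Real.cosh_pos (T : ℝ); positivity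
      have h3 : (0 : ℝ) ≤ T := T.cast_nonneg
      rw [Real.rpow_one, one_mul, mul_div_assoc]
      nlinarith
    -- At stage `T` there are at most `A (T + 1)` intervals of length `2 δ₀ / cosh T`.
    have := Measure.hausdorffMeasure_le_liminf_sum (ι := fun T : ℕ => E T) (d : ℝ) C _ hr0
      (fun T x => Metric.closedBall (x : ℝ) (δ₀ / Real.cosh T))
      (Eventually.of_forall fun T x => (hdiam _ _).le)
      (Eventually.of_forall fun T y hy => by
        obtain ⟨x, hx, hxy⟩ := Set.mem_iUnion₂.1 (hE2 T hy)
        exact Set.mem_iUnion.2 ⟨⟨x, hx⟩, hxy⟩)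
    refine ne_top_of_le_ne_top ENNReal.zero_ne_top (this.trans ?_)
    rw [← hlim.liminf_eq]
    refine liminf_le_liminf (Eventually.of_forall fun T => ?_)
    have hcp := Real.cosh_pos (T : ℝ)
    simp only [hdiam, Finset.sum_const, Finset.card_univ, Fintype.card_coe, nsmul_eq_mul]
    rw [ENNReal.ofReal_rpow_of_nonneg (by positivity) hd'.le, ← ENNReal.ofReal_natCast,
      ← ENNReal.ofReal_mul (Nat.cast_nonneg _), mul_div_assoc]
    exact ENNReal.ofReal_le_ofReal (mul_le_mul_of_nonneg_right (hE1 T) (by positivity))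
  refine le_antisymm (ENNReal.le_of_forall_pos_le_add fun ε hε _ => ?_) bot_le
  rw [zero_add]
  exact hmeas ε hε

end Lamination

/-! ### Klein coordinates are bi-Lipschitz -/

/-- Klein coordinates of a point in a frame. -/
noncomputable def Frame.kinv (f : Frame) (X : Hyp) : ℝ × ℝ :=
  (mink X f.e / -mink X f.X, mink X f.n / -mink X f.X)

theorem Frame.continuous_kinv (f : Frame) : Continuous f.kinv := by
  have h : ∀ X : Hyp, -mink (X : V) f.X ≠ 0 := fun X => by linarith [mink_hyp_le X f.X]
  unfold kinv
  exact ((Continuous.mink continuous_subtype_val continuous_const).div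
      (Continuous.mink continuous_subtype_val continuous_const).neg h).prodMk
    ((Continuous.mink continuous_subtype_val continuous_const).div
      (Continuous.mink continuous_subtype_val continuous_const).neg h)

theorem Frame.kinv_mem (f : Frame) (X : Hyp) : (f.kinv X).1 ^ 2 + (f.kinv X).2 ^ 2 < 1 := by
  have h1 := mink_hyp_le X f.X
  have h2 := f.mink_expand X X
  rw [X.mink_self] at h2
  simp only [kinv]
  rw [div_pow, div_pow, ← add_div, div_lt_one (by nlinarith)]
  nlinarith

theorem Frame.kpt_kinv (f : Frame) (X : Hyp) : f.kpt (f.kinv X) = X := by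
  apply Subtype.ext
  have h1 := mink_hyp_le X f.X
  have h2 := f.mink_expand X X
  rw [X.mink_self] at h2
  rw [f.coe_kpt (f.kinv_mem X)]
  have h3 : √(1 - (f.kinv X).1 ^ 2 - (f.kinv X).2 ^ 2) = (-mink X f.X)⁻¹ := by
    rw [Real.sqrt_eq_iff_mul_self_eq (by linarith [f.kinv_mem X]) (inv_nonneg.2 (by linarith))]
    simp only [kinv]
    have : mink X f.X ≠ 0 := by linarith
    field_simp
    linarith
  conv_rhs => rw [f.expand X]
  rw [h3, inv_inv, kvec, kinv]
  have h4 : -mink (X : V) f.X ≠ 0 := by linarith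
  simp only [smul_add, smul_smul, mul_div_cancel₀ _ h4]

theorem Frame.kinv_kpt (f : Frame) {p : ℝ × ℝ} (h : p.1 ^ 2 + p.2 ^ 2 < 1) : f.kinv (f.kpt p) = p := by
  have hs : 0 < √(1 - p.1 ^ 2 - p.2 ^ 2) := Real.sqrt_pos.2 (by linarith)
  simp only [kinv, f.coe_kpt h, mink_smul_left]
  have e1 : mink (f.kvec p) f.e = p.1 := by simp [kvec, f.ee, f.Xe, f.ne]
  have e2 : mink (f.kvec p) f.n = p.2 := by simp [kvec, f.nn, f.Xn, f.en]
  have e3 : mink (f.kvec p) f.X = -1 := by simp [kvec, f.X.mink_self, f.eX, f.nX]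
  rw [e1, e2, e3]
  ext <;> simp <;> field_simp

theorem sinh_le_mul_cosh {x : ℝ} (hx : 0 ≤ x) : Real.sinh x ≤ x * Real.cosh x := by
  have := (convex_Icc 0 x).image_sub_le_mul_sub_of_deriv_le (f := Real.sinh) (C := Real.cosh x)
    Real.continuous_sinh.continuousOn Real.differentiable_sinh.differentiableOn
    (fun y hy => by
      rw [interior_Icc] at hy
      rw [Real.deriv_sinh, Real.cosh_le_cosh, abs_of_pos hy.1, abs_of_nonneg hx]
      exact hy.2.le) 0 (Set.left_mem_Icc.2 hx) x (Set.right_mem_Icc.2 hx) hx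
  simp at this
  linarith

-- With `P = 1 - |p|²` and `Q = 1 - |q|²` one has `sinh² D · P Q = |p - q|² - (p ∧ q)²`. On the
-- small square `P`, `Q` are close to one and the wedge term is at most an eighth of `|p - q|²`.
set_option maxHeartbeats 600000 in
theorem Frame.hdist_kpt (f : Frame) {p q : ℝ × ℝ} (hp1 : |p.1| ≤ 1 / 4) (hp2 : |p.2| ≤ 1 / 4)
    (hq1 : |q.1| ≤ 1 / 4) (hq2 : |q.2| ≤ 1 / 4) :
    hdist (f.kpt p) (f.kpt q) ≤ 2 * dist p q ∧ dist p q ≤ 2 * hdist (f.kpt p) (f.kpt q) := by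
  have a1 : p.1 ^ 2 ≤ 1 / 16 := by have := sq_le_sq' (abs_le.1 hp1).1 (abs_le.1 hp1).2; linarith
  have a2 : p.2 ^ 2 ≤ 1 / 16 := by have := sq_le_sq' (abs_le.1 hp2).1 (abs_le.1 hp2).2; linarith
  have a3 : q.1 ^ 2 ≤ 1 / 16 := by have := sq_le_sq' (abs_le.1 hq1).1 (abs_le.1 hq1).2; linarith
  have a4 : q.2 ^ 2 ≤ 1 / 16 := by have := sq_le_sq' (abs_le.1 hq2).1 (abs_le.1 hq2).2; linarith
  have hp : p.1 ^ 2 + p.2 ^ 2 < 1 := by linarith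
  have hq : q.1 ^ 2 + q.2 ^ 2 < 1 := by linarith
  set D := hdist (f.kpt p) (f.kpt q)
  have hD : 0 ≤ D := hdist_nonneg _ _
  have hcosh : Real.cosh D = (1 - p.1 * q.1 - p.2 * q.2) /
      (√(1 - p.1 ^ 2 - p.2 ^ 2) * √(1 - q.1 ^ 2 - q.2 ^ 2)) := by
    rw [cosh_hdist, f.mink_kpt_kpt hp hq]
  set P := 1 - p.1 ^ 2 - p.2 ^ 2
  set Q := 1 - q.1 ^ 2 - q.2 ^ 2
  have hP : 7 / 8 ≤ P := by simp only [P]; linarith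
  have hQ : 7 / 8 ≤ Q := by simp only [Q]; linarith
  have hP1 : P ≤ 1 := by simp only [P]; linarith [sq_nonneg p.1, sq_nonneg p.2]
  have hQ1 : Q ≤ 1 := by simp only [Q]; linarith [sq_nonneg q.1, sq_nonneg q.2]
  have hPQ : Real.cosh D ^ 2 * (P * Q) = (1 - p.1 * q.1 - p.2 * q.2) ^ 2 := by
    have s1 : 0 < √P := Real.sqrt_pos.2 (by linarith)
    have s2 : 0 < √Q := Real.sqrt_pos.2 (by linarith)
    rw [hcosh, div_pow, mul_pow, Real.sq_sqrt (by linarith), Real.sq_sqrt (by linarith)]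
    have : P * Q ≠ 0 := by nlinarith
    field_simp
  have hsinh : Real.sinh D ^ 2 * (P * Q) = (p.1 - q.1) ^ 2 + (p.2 - q.2) ^ 2 -
      (p.1 * q.2 - p.2 * q.1) ^ 2 := by
    rw [Real.sinh_sq, sub_mul, hPQ]; simp only [P, Q]; ring
  have hPQ1 : 49 / 64 ≤ P * Q := by nlinarith
  have hPQ2 : P * Q ≤ 1 := by nlinarith
  set d := dist p q
  have hd1 : |p.1 - q.1| ≤ d := by rw [← Real.dist_eq]; exact le_max_left _ _
  have hd2 : |p.2 - q.2| ≤ d := by rw [← Real.dist_eq]; exact le_max_right _ _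
  have hd0 : 0 ≤ d := dist_nonneg
  have hdle : d ^ 2 ≤ (p.1 - q.1) ^ 2 + (p.2 - q.2) ^ 2 := by
    have : d = max |p.1 - q.1| |p.2 - q.2| := rfl
    rw [this]
    rcases max_choice |p.1 - q.1| |p.2 - q.2| with h | h <;> rw [h, sq_abs]
    · linarith [sq_nonneg (p.2 - q.2)]
    · linarith [sq_nonneg (p.1 - q.1)]
  have hdge : (p.1 - q.1) ^ 2 + (p.2 - q.2) ^ 2 ≤ 2 * d ^ 2 := by
    have := sq_le_sq' (abs_le.1 hd1).1 (abs_le.1 hd1).2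
    have := sq_le_sq' (abs_le.1 hd2).1 (abs_le.1 hd2).2
    linarith
  have hS0 : 0 ≤ Real.sinh D := Real.sinh_nonneg_iff.2 hD
  constructor
  · have h1 : Real.sinh D ^ 2 ≤ (2 * d) ^ 2 := by
      have h0 := mul_le_mul_of_nonneg_left hPQ1 (sq_nonneg (Real.sinh D))
      linarith [sq_nonneg (p.1 * q.2 - p.2 * q.1), sq_nonneg d]
    have h2 := abs_le_of_sq_le_sq' h1 (by positivity)
    exact (Real.self_le_sinh_iff.2 hD).trans h2.2
  · have hcr : (p.1 * q.2 - p.2 * q.1) ^ 2 ≤ 1 / 8 * ((p.1 - q.1) ^ 2 + (p.2 - q.2) ^ 2) := by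
      have e : p.1 * q.2 - p.2 * q.1 = p.2 * (p.1 - q.1) - p.1 * (p.2 - q.2) := by ring
      have : (p.2 * (p.1 - q.1) - p.1 * (p.2 - q.2)) ^ 2 ≤
          (p.1 ^ 2 + p.2 ^ 2) * ((p.1 - q.1) ^ 2 + (p.2 - q.2) ^ 2) := by
        linarith [sq_nonneg (p.1 * (p.1 - q.1) + p.2 * (p.2 - q.2))]
      rw [e]
      refine this.trans (mul_le_mul_of_nonneg_right (by linarith) (by positivity))
    have h1 : 7 / 8 * d ^ 2 ≤ Real.sinh D ^ 2 := by
      have h0 := mul_le_mul_of_nonneg_left hPQ2 (sq_nonneg (Real.sinh D))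
      linarith
    have h2 : Real.cosh D ≤ 9 / 7 := by
      have b1 : |p.1 * q.1| ≤ 1 / 4 * (1 / 4) := by rw [abs_mul]; gcongr
      have b2 : |p.2 * q.2| ≤ 1 / 4 * (1 / 4) := by rw [abs_mul]; gcongr
      have b3 : (1 - p.1 * q.1 - p.2 * q.2) ^ 2 ≤ (9 / 8) ^ 2 := by
        have := abs_le.1 b1
        have := abs_le.1 b2
        exact sq_le_sq' (by linarith) (by linarith)
      have b5 := mul_le_mul_of_nonneg_left hPQ1 (sq_nonneg (Real.cosh D))
      have b4 : Real.cosh D ^ 2 ≤ (9 / 7) ^ 2 := by linarith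
      exact (abs_le_of_sq_le_sq' b4 (by norm_num)).2
    have h3 : Real.sinh D ≤ D * (9 / 7) :=
      (sinh_le_mul_cosh hD).trans (mul_le_mul_of_nonneg_left h2 hD)
    have h5 := pow_le_pow_left₀ hS0 h3 2
    have h4 : d ^ 2 ≤ (2 * D) ^ 2 := by linarith [sq_nonneg D]
    exact (abs_le_of_sq_le_sq' h4 (by positivity)).2

end LieLam

/-! ### Flow-boxes: embedding in the surface, null sets, construction from a slope function -/

namespace LieLam

open Topology Filter Set

theorem norm_sub_le_hdist (A B : Hyp) :
    ‖(B : V) - A‖ ≤ 2 * (A : V) 2 * Real.cosh (hdist A B) * hdist A B := by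
  have h := norm_sub_le_of_mink A B
  have h0 := hdist_nonneg A B
  rw [← cosh_hdist] at h
  have e : mink A B ^ 2 - 1 = Real.sinh (hdist A B) ^ 2 := by
    rw [Real.sinh_sq, cosh_hdist, neg_sq]
  have hs : 0 ≤ Real.sinh (hdist A B) := Real.sinh_nonneg_iff.2 h0
  rw [e, Real.sqrt_sq hs] at h
  have h1 := sinh_le_mul_cosh h0
  have h2 : Real.cosh (hdist A B) - 1 ≤ Real.sinh (hdist A B) := by
    have := Real.exp_le_one_iff.2 (neg_nonpos.2 h0)
    rw [← Real.cosh_sub_sinh] at this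
    linarith
  have hA := A.norm_le
  have hA1 := A.one_le
  have h3 : (Real.cosh (hdist A B) - 1) * ‖(A : V)‖ ≤ Real.sinh (hdist A B) * (A : V) 2 :=
    mul_le_mul h2 hA (norm_nonneg _) hs
  have h4 := mul_le_mul_of_nonneg_left h1 (show 0 ≤ (A : V) 2 by linarith)
  linarith

section Lamination

variable {π : Type*} [Group π] {S : HypSurface π} {Λ : GeodesicLamination S}

namespace FlowBox

variable (R : FlowBox Λ)

/-- The parametrization of a flow-box. -/
def map (p : ℝ × ℝ) : Hyp := R.F p.1 p.2

/-- The closed rectangle. -/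
def rect : Set (ℝ × ℝ) := Icc R.a R.b ×ˢ Icc R.c R.d

/-- The image of the open rectangle. -/
def core : Set Hyp := R.map '' (Ioo R.a R.b ×ˢ Ioo R.c R.d)

theorem continuousOn_map : ContinuousOn R.map R.rect := by
  obtain ⟨K, -, h⟩ := R.biLipschitz
  exact continuousOn_of_hdist_le (F := R.map) fun p hp q hq => (h p hp q hq).1

/-- The lower Lipschitz bound is required for all deck transformations, so the box embeds in `M` and
not only in `ℍ`. -/
theorem eq_of_map_eq_act {p q : ℝ × ℝ} (hp : p ∈ R.rect) (hq : q ∈ R.rect) {γ : π}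
    (h : R.map p = act (S.σ γ) (R.map q)) : p = q := by
  obtain ⟨K, hK, h'⟩ := R.biLipschitz
  have h1 := (h' p hp q hq).2 γ
  change _ ≤ hdist (R.map p) (act (S.σ γ) (R.map q)) at h1
  rw [h, (hdist_eq_zero_iff _ _).2 rfl] at h1
  have h2 : dist p q ≤ 0 := nonpos_of_mul_nonpos_right h1 (inv_pos.2 hK)
  exact dist_le_zero.1 h2

theorem injOn_map : InjOn R.map R.rect := fun p hp q hq h =>
  R.eq_of_map_eq_act hp hq (γ := 1) (by rw [map_one, act_one, h])

theorem group_eq_one_of_map_eq {p q : ℝ × ℝ} (hp : p ∈ R.rect) (hq : q ∈ R.rect) {γ : π}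
    (h : R.map p = act (S.σ γ) (R.map q)) : γ = 1 := by
  have := R.eq_of_map_eq_act hp hq h
  subst this
  exact S.free γ _ h.symm

theorem isCompact_rect : IsCompact R.rect := isCompact_Icc.prod isCompact_Icc

theorem map_mem_support {t s : ℝ} (ht : t ∈ Icc R.a R.b) (hs : s ∈ R.C) :
    R.map (t, s) ∈ Λ.support :=
  (R.preimage t ht s (Ioo_subset_Icc_self (R.subset hs))).2 hs

theorem isCompact_C : IsCompact R.C :=
  isCompact_Icc.of_isClosed_subset R.isClosed (R.subset.trans Ioo_subset_Icc_self)

theorem volume_C : volume R.C = 0 := by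
  rw [← hausdorffMeasure_real]
  have := hausdorffMeasure_of_dimH_lt (s := R.C) (d := 1) (by rw [R.dim_zero]; norm_num)
  simpa using this

/-- The part of the lamination inside a flow-box has measure zero. -/
theorem volume_image_eq_zero : volume (chart ⁻¹' (R.map '' (Icc R.a R.b ×ˢ R.C))) = 0 := by
  obtain ⟨K, hK, h⟩ := R.biLipschitz
  have hsub : Icc R.a R.b ×ˢ R.C ⊆ R.rect :=
    prod_mono le_rfl (R.subset.trans Ioo_subset_Icc_self)
  obtain ⟨c, hc1, hc⟩ := exists_two_le_of_isCompact (R.isCompact_rect.image_of_continuousOn R.continuousOn_map)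
  set D := K * (|R.b - R.a| + |R.d - R.c|)
  set L : ℝ := 2 * c * Real.cosh D * K
  have hL : 0 ≤ L := by have := Real.cosh_pos D; positivity
  have hlip : LipschitzOnWith ⟨L, hL⟩ (fun p => crd (R.map p)) (Icc R.a R.b ×ˢ R.C) := by
    refine LipschitzOnWith.of_dist_le_mul fun p hp q hq => ?_
    have hp' := hsub hp
    have hq' := hsub hq
    have h1 := (h q hq' p hp').1
    change hdist (R.map q) (R.map p) ≤ _ at h1
    have h0 := hdist_nonneg (R.map q) (R.map p)
    have h2 : dist q p ≤ |R.b - R.a| + |R.d - R.c| := by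
      rw [Prod.dist_eq, Real.dist_eq, Real.dist_eq]
      have a1 := hp'.1; have a2 := hq'.1; have a3 := hp'.2; have a4 := hq'.2
      simp only [mem_Icc] at a1 a2 a3 a4
      refine max_le ?_ ?_
      · have : |q.1 - p.1| ≤ |R.b - R.a| :=
          (abs_le.2 ⟨by linarith, by linarith⟩ : |q.1 - p.1| ≤ R.b - R.a).trans (le_abs_self _)
        linarith [abs_nonneg (R.d - R.c)]
      · have : |q.2 - p.2| ≤ |R.d - R.c| :=
          (abs_le.2 ⟨by linarith, by linarith⟩ : |q.2 - p.2| ≤ R.d - R.c).trans (le_abs_self _)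
        linarith [abs_nonneg (R.b - R.a)]
    have h3 : hdist (R.map q) (R.map p) ≤ D := h1.trans (mul_le_mul_of_nonneg_left h2 hK.le)
    have h4 : dist (crd (R.map p)) (crd (R.map q)) ≤ ‖(R.map p : V) - (R.map q : V)‖ := by
      rw [Prod.dist_eq, Real.dist_eq, Real.dist_eq]
      exact max_le (norm_le_pi_norm ((R.map p : V) - (R.map q : V)) 0)
        (norm_le_pi_norm ((R.map p : V) - (R.map q : V)) 1)
    refine h4.trans ((norm_sub_le_hdist _ _).trans ?_)
    rw [dist_comm]
    change _ ≤ 2 * c * Real.cosh D * K * dist q p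
    have h5 : Real.cosh (hdist (R.map q) (R.map p)) ≤ Real.cosh D := by
      rw [Real.cosh_le_cosh, abs_of_nonneg h0]; exact h3.trans (le_abs_self _)
    have h6 := hc _ (mem_image_of_mem _ hq')
    have h7 := Hyp.one_le (R.map q)
    have h8 := Real.cosh_pos (hdist (R.map q) (R.map p))
    have h9 : 2 * (R.map q : V) 2 * Real.cosh (hdist (R.map q) (R.map p)) ≤ 2 * c * Real.cosh D := by
      gcongr
    rw [mul_assoc (2 * c * Real.cosh D)]
    exact mul_le_mul h9 h1 h0 (by have := Real.cosh_pos D; positivity)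
  have hnull : (volume : Measure (ℝ × ℝ)) (Icc R.a R.b ×ˢ R.C) = 0 := by
    rw [Measure.volume_eq_prod, Measure.prod_prod, R.volume_C, mul_zero]
  -- On `ℝ × ℝ` the two-dimensional Hausdorff measure is Lebesgue measure, and Lipschitz maps send
  -- its null sets to null sets.
  have him := hlip.hausdorffMeasure_image_le (d := 2) (by norm_num)
  rw [hausdorffMeasure_prod_real, hnull, mul_zero] at him
  refine measure_mono_null ?_ (le_antisymm him bot_le)
  rintro p ⟨q, hq, hqp⟩
  refine ⟨q, hq, ?_⟩
  change crd (R.map q) = p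
  rw [hqp]; rfl

end FlowBox

/-- A flow-box with open interior whose arcs lie in pairwise different leaves. -/
structure NiceBox (Λ : GeodesicLamination S) extends FlowBox Λ where
  isOpen_core : IsOpen toFlowBox.core
  arc_leaf : ∀ s ∈ C, ∃ L ∈ Λ.leaves, ∀ t ∈ Icc a b, F t s ∈ L
  leaf_inj : ∀ s ∈ C, ∀ s' ∈ C, ∀ L ∈ Λ.leaves, ∀ t ∈ Icc a b, ∀ t' ∈ Icc a b,
    F t s ∈ L → F t' s' ∈ L → s = s'

/-- The box is the sheared rectangle `(t, s) ↦ (t, s + m(s) t)` in Klein coordinates, whose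
horizontal arcs are straight and lie in leaves for `s ∈ C₀`. It is taken so small that the shear is
bi-Lipschitz and that distinct deck translates of it stay apart. -/
theorem exists_niceBox_of_slope {f : Frame} {m : ℝ → ℝ} (hm : LipschitzWith 2 m) (hm0 : m 0 = 0)
    {s₂ : ℝ} (hs₂ : 0 < s₂) {C₀ : Set ℝ}
    (hC : ∀ t s, |t| ≤ s₂ → |s| ≤ s₂ → (f.kpt (t, s + m s * t) ∈ Λ.support ↔ s ∈ C₀))
    (hL : ∀ s ∈ C₀, |s| ≤ s₂ → ∃ L ∈ Λ.leaves, ∀ t, |t| ≤ s₂ → f.kpt (t, s + m s * t) ∈ L)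
    (hinj : ∀ s ∈ C₀, ∀ s' ∈ C₀, |s| ≤ s₂ → |s'| ≤ s₂ → ∀ L ∈ Λ.leaves, f.kpt (0, s) ∈ L →
      f.kpt (0, s') ∈ L → s = s')
    (hdim : dimH {s | |s| ≤ s₂ ∧ s ∈ C₀} = 0) : ∃ Q : NiceBox Λ, f.X ∈ Q.core := by
  obtain ⟨U, hU, hXU, δ, hδ, hsep⟩ := exists_separated_nhds S f.X
  obtain ⟨r, hr, hr16, hrs, hrU⟩ : ∃ r : ℝ, 0 < r ∧ r ≤ 1 / 16 ∧ r ≤ s₂ ∧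
      ∀ t y, |t| ≤ r → |y| ≤ 3 * r → f.kpt (t, y) ∈ U := by
    have h1 := (f.continuousAt_kpt (p := (0, 0)) (by norm_num)).eventually
      (hU.mem_nhds (by simpa using hXU))
    obtain ⟨ε, hε, h2⟩ := Metric.eventually_nhds_iff.1 h1
    have a1 := min_le_left (min (1 / 16) s₂) (ε / 4)
    have a2 := min_le_right (min (1 / 16) s₂) (ε / 4)
    have a3 := min_le_left (1 / 16) s₂
    have a4 := min_le_right (1 / 16) s₂
    refine ⟨min (min (1 / 16) s₂) (ε / 4), by positivity, a1.trans a3, a1.trans a4,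
      fun t y ht hy => h2 ?_⟩
    rw [Prod.dist_eq, Real.dist_eq, Real.dist_eq, sub_zero, sub_zero]
    exact max_lt (by linarith) (by linarith)
  -- A set of dimension zero contains no interval, so the ends `c < 0 < d` can be placed off `C₀`;
  -- this keeps `C` inside the open interval.
  have hgap : ∀ u v : ℝ, u < v → (∀ s ∈ Ioo u v, |s| ≤ s₂) → ∃ s ∈ Ioo u v, s ∉ C₀ := by
    intro u v huv hle
    by_contra! hcon
    have h1 : dimH (Ioo u v) ≤ dimH {s | |s| ≤ s₂ ∧ s ∈ C₀} :=
      dimH_mono fun s hs => ⟨hle s hs, hcon s hs⟩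
    rw [hdim, Real.dimH_of_nonempty_interior (by rw [interior_Ioo]; exact nonempty_Ioo.2 huv)] at h1
    exact absurd h1 (by norm_num)
  obtain ⟨c, hc, hcC⟩ := hgap (-r) 0 (by linarith) fun s hs =>
    abs_le.2 ⟨by linarith [hs.1], by linarith [hs.2]⟩
  obtain ⟨d, hd, hdC⟩ := hgap 0 r hr fun s hs => abs_le.2 ⟨by linarith [hs.1], by linarith [hs.2]⟩
  have hsr : ∀ s ∈ Icc c d, |s| ≤ r := fun s hs =>
    abs_le.2 ⟨by linarith [hs.1, hc.1], by linarith [hs.2, hd.2]⟩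
  have htr : ∀ t ∈ Icc (-r) r, |t| ≤ r := fun t ht => abs_le.2 ht
  have hmm : ∀ s s', |m s - m s'| ≤ 2 * |s - s'| := fun s s' => by
    have := hm.dist_le_mul s s'
    rw [Real.dist_eq, Real.dist_eq] at this
    exact_mod_cast this
  have hms : ∀ s, |m s| ≤ 2 * |s| := fun s => by simpa [hm0] using hmm s 0
  have hy : ∀ t s, |t| ≤ r → |s| ≤ r → |s + m s * t| ≤ 3 * r := by
    intro t s ht hs
    have h1 : |m s * t| ≤ 2 * r * 1 := by
      rw [abs_mul]
      exact mul_le_mul ((hms s).trans (by linarith)) (by linarith) (abs_nonneg _) (by linarith)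
    exact (abs_add_le _ _).trans (by linarith)
  let G : ℝ × ℝ → ℝ × ℝ := fun p => (p.1, p.2 + m p.2 * p.1)
  have hG : ∀ p ∈ Icc (-r) r ×ˢ Icc c d, |(G p).1| ≤ 1 / 4 ∧ |(G p).2| ≤ 1 / 4 := fun p hp =>
    ⟨(htr _ hp.1).trans (by linarith), (hy _ _ (htr _ hp.1) (hsr _ hp.2)).trans (by linarith)⟩
  have hGd : ∀ p ∈ Icc (-r) r ×ˢ Icc c d, ∀ q ∈ Icc (-r) r ×ˢ Icc c d,
      dist (G p) (G q) ≤ 2 * dist p q ∧ dist p q ≤ 2 * dist (G p) (G q) := by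
    rintro ⟨t, s⟩ ⟨ht, hs⟩ ⟨t', s'⟩ ⟨ht', hs'⟩
    have ht := htr _ ht
    have ht' := htr _ ht'
    have hs := hsr _ hs
    have hs' := hsr _ hs'
    simp only [G, Prod.dist_eq, Real.dist_eq] at *
    have e : s + m s * t - (s' + m s' * t') = (s - s') + ((m s - m s') * t + m s' * (t - t')) := by ring
    have b1 : |(m s - m s') * t| ≤ 1 / 8 * |s - s'| := by
      rw [abs_mul]
      have := mul_le_mul (hmm s s') (ht.trans hr16) (abs_nonneg _) (by positivity)
      linarith
    have b2 : |m s' * (t - t')| ≤ 1 / 8 * |t - t'| := by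
      rw [abs_mul]
      exact mul_le_mul_of_nonneg_right ((hms s').trans (by linarith)) (abs_nonneg _)
    have b3 := (abs_add_le ((m s - m s') * t) (m s' * (t - t')))
    have b4 := abs_add_le (s - s') ((m s - m s') * t + m s' * (t - t'))
    have b5 := abs_sub_abs_le_abs_sub (s - s') (-((m s - m s') * t + m s' * (t - t')))
    rw [sub_neg_eq_add, abs_neg, ← e] at b5
    rw [← e] at b4
    constructor
    · have c1 := le_max_left |t - t'| |s - s'|
      have c2 := le_max_right |t - t'| |s - s'|
      have c3 := abs_nonneg (t - t')
      exact max_le (by linarith) (by linarith)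
    · have c1 := le_max_left |t - t'| |s + m s * t - (s' + m s' * t')|
      have c2 := le_max_right |t - t'| |s + m s * t - (s' + m s' * t')|
      have c3 := abs_nonneg (t - t')
      exact max_le (by linarith) (by linarith)
  set F : ℝ → ℝ → Hyp := fun t s => f.kpt (G (t, s)) with hF
  have hFU : ∀ p ∈ Icc (-r) r ×ˢ Icc c d, F p.1 p.2 ∈ U := fun p hp =>
    hrU _ _ (htr _ hp.1) (hy _ _ (htr _ hp.1) (hsr _ hp.2))
  set h₀ := Real.arcosh (1 + δ)
  have hh₀ : 0 < h₀ := Real.arcosh_pos (by linarith)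
  have hcont0 : ContinuousOn (fun s => F 0 s) (Icc c d) := by
    intro s hs
    have h1 := (abs_le.1 (hsr s hs))
    refine ContinuousAt.continuousWithinAt ?_
    simp only [hF, G, mul_zero, add_zero]
    exact ContinuousAt.comp (f := fun s : ℝ => ((0 : ℝ), s))
      (f.continuousAt_kpt (by simp only; nlinarith)) (by fun_prop)
  have hmem0 : ∀ s ∈ Icc c d, (F 0 s ∈ Λ.support ↔ s ∈ C₀) := fun s hs =>
    hC 0 s (by simp [hs₂.le]) ((hsr s hs).trans hrs)
  have hCcl : IsClosed (Icc c d ∩ C₀) := by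
    have : Icc c d ∩ C₀ = Icc c d ∩ (fun s => F 0 s) ⁻¹' Λ.support := by
      ext s
      exact and_congr_right fun hs => (hmem0 s hs).symm
    rw [this]
    exact hcont0.preimage_isClosed_of_isClosed isClosed_Icc Λ.isClosed
  let R : FlowBox Λ :=
    { a := -r
      b := r
      c := c
      d := d
      hab := by linarith
      hcd := hc.2.trans hd.1
      F := F
      biLipschitz := by
        -- For `γ = 1` the shear and the Klein chart contribute a factor two each. For `γ ≠ 1`
        -- parameter distances are at most one while the translates are at distance at least `h₀`.
        refine ⟨8 + h₀⁻¹, by positivity, fun p hp q hq => ⟨?_, fun γ => ?_⟩⟩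
        · have h1 := (f.hdist_kpt (hG p hp).1 (hG p hp).2 (hG q hq).1 (hG q hq).2).1
          have h2 := (hGd p hp q hq).1
          have h3 : 0 ≤ h₀⁻¹ * dist p q := by positivity
          change hdist (f.kpt (G p)) (f.kpt (G q)) ≤ _
          have : (0 : ℝ) ≤ dist p q := dist_nonneg
          linarith
        · rw [inv_mul_le_iff₀ (by positivity)]
          by_cases hγ : γ = 1
          · subst hγ
            have h1 := (f.hdist_kpt (hG p hp).1 (hG p hp).2 (hG q hq).1 (hG q hq).2).2
            have h2 := (hGd p hp q hq).2
            rw [map_one, act_one]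
            change _ ≤ _ * hdist (f.kpt (G p)) (f.kpt (G q))
            have h3 := hdist_nonneg (f.kpt (G p)) (f.kpt (G q))
            have h4 : 0 ≤ h₀⁻¹ * hdist (f.kpt (G p)) (f.kpt (G q)) := by positivity
            linarith
          · have h1 := hsep _ (hFU p hp) _ (hFU q hq) γ hγ
            have h2 : h₀ ≤ hdist (F p.1 p.2) (act (S.σ γ) (F q.1 q.2)) := by
              rw [hdist, coe_act]
              exact (Real.arcosh_le_arcosh (by linarith) (by linarith)).2 h1
            have h3 : dist p q ≤ 1 := by
              rw [Prod.dist_eq, Real.dist_eq, Real.dist_eq]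
              have := abs_le.1 (htr _ hp.1)
              have := abs_le.1 (htr _ hq.1)
              have := abs_le.1 (hsr _ hp.2)
              have := abs_le.1 (hsr _ hq.2)
              exact max_le (abs_le.2 ⟨by linarith, by linarith⟩) (abs_le.2 ⟨by linarith, by linarith⟩)
            have h4 : 1 ≤ h₀⁻¹ * hdist (F p.1 p.2) (act (S.σ γ) (F q.1 q.2)) := by
              rw [inv_mul_eq_div, one_le_div hh₀]; exact h2
            have h5 := hdist_nonneg (F p.1 p.2) (act (S.σ γ) (F q.1 q.2))
            linarith
      C := Icc c d ∩ C₀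
      isClosed := hCcl
      subset := fun s hs => ⟨lt_of_le_of_ne hs.1.1 (by rintro rfl; exact hcC hs.2),
        lt_of_le_of_ne hs.1.2 (by rintro rfl; exact hdC hs.2)⟩
      dim_zero := by
        refine le_antisymm ?_ bot_le
        rw [← hdim]
        exact dimH_mono fun s hs => ⟨(hsr s hs.1).trans hrs, hs.2⟩
      preimage := fun t ht s hs => by
        refine (hC t s ((htr t ht).trans hrs) ((hsr s hs).trans hrs)).trans ?_
        exact ⟨fun h => ⟨hs, h⟩, fun h => h.2⟩ }
  have harc : ∀ s ∈ R.C, ∃ L ∈ Λ.leaves, ∀ t ∈ Icc R.a R.b, R.F t s ∈ L := by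
    intro s hs
    obtain ⟨L, hL1, hL2⟩ := hL s hs.2 ((hsr s hs.1).trans hrs)
    exact ⟨L, hL1, fun t ht => hL2 t ((htr t ht).trans hrs)⟩
  have h0mem : (0 : ℝ) ∈ Icc R.a R.b := ⟨by change -r ≤ 0; linarith, hr.le⟩
  have hmono : ∀ t, |t| ≤ r → ∀ s s', s < s' → s + m s * t < s' + m s' * t := by
    intro t ht s s' hss
    have h1 : |(m s - m s') * t| ≤ 1 / 8 * |s - s'| := by
      rw [abs_mul]
      have := mul_le_mul (hmm s s') (ht.trans hr16) (abs_nonneg _) (by positivity)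
      linarith
    have h2 := abs_of_neg (sub_neg.2 hss)
    rw [h2] at h1
    have := (abs_le.1 h1).2
    have e : (m s - m s') * t = m s * t - m s' * t := by ring
    rw [e] at this
    linarith
  -- The core is cut out by four strict inequalities in Klein coordinates, hence open: for fixed `t`
  -- the height `s + m(s) t` increases with `s` and takes all intermediate values.
  have hcore : R.core = f.kinv ⁻¹' {p : ℝ × ℝ | -r < p.1 ∧ p.1 < r ∧ c + m c * p.1 < p.2 ∧
      p.2 < d + m d * p.1} := by
    ext X
    constructor
    · rintro ⟨⟨t, s⟩, ⟨ht, hs⟩, rfl⟩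
      have ht' := htr t (Ioo_subset_Icc_self ht)
      have hlt := hG (t, s) ⟨Ioo_subset_Icc_self ht, Ioo_subset_Icc_self hs⟩
      have := abs_le.1 hlt.1
      have := abs_le.1 hlt.2
      have e : R.map (t, s) = f.kpt (G (t, s)) := rfl
      rw [mem_preimage, e, f.kinv_kpt (by nlinarith)]
      exact ⟨ht.1, ht.2, hmono t ht' _ _ hs.1, hmono t ht' _ _ hs.2⟩
    · rintro ⟨h1, h2, h3, h4⟩
      have hcd : c ≤ d := (hc.2.trans hd.1).le
      have hcont : ContinuousOn (fun s => s + m s * (f.kinv X).1) (Icc c d) := by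
        have := hm.continuous; fun_prop
      obtain ⟨s, hs, hs'⟩ := intermediate_value_Ioo hcd hcont ⟨h3, h4⟩
      refine ⟨((f.kinv X).1, s), ⟨⟨h1, h2⟩, hs⟩, ?_⟩
      change f.kpt (G _) = X
      simp only at hs'
      simp only [G]
      rw [hs', Prod.mk.eta, f.kpt_kinv]
  refine ⟨{ toFlowBox := R, isOpen_core := ?_, arc_leaf := harc, leaf_inj := ?_ }, ?_⟩
  · rw [hcore]
    refine IsOpen.preimage f.continuous_kinv ?_
    simp only [Set.ofPred_and]
    exact (isOpen_lt (by fun_prop) (by fun_prop)).inter ((isOpen_lt (by fun_prop) (by fun_prop)).inter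
      ((isOpen_lt (by fun_prop) (by fun_prop)).inter (isOpen_lt (by fun_prop) (by fun_prop))))
  · intro s hs s' hs' L hLl t ht t' ht' hX hX'
    obtain ⟨L1, hL1, hL1'⟩ := harc s hs
    obtain ⟨L2, hL2, hL2'⟩ := harc s' hs'
    have e1 := Λ.eq_of_mem hLl hL1 hX (hL1' t ht)
    have e2 := Λ.eq_of_mem hLl hL2 hX' (hL2' t' ht')
    have g1 := hL1' 0 h0mem
    have g2 := hL2' 0 h0mem
    rw [← e1] at g1
    rw [← e2] at g2
    refine hinj s hs.2 s' hs'.2 ((hsr s hs.1).trans hrs) ((hsr s' hs'.1).trans hrs) L hLl ?_ ?_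
    · simpa [R, hF, G] using g1
    · simpa [R, hF, G] using g2
  · change f.X ∈ R.core
    refine ⟨(0, 0), ⟨⟨by change -r < 0; linarith, hr⟩, ⟨hc.2, hd.1⟩⟩, ?_⟩
    change f.kpt (G (0, 0)) = f.X
    simp [G]

end Lamination

end LieLam

/-! ### Existence of a flow-box around every point -/

namespace LieLam

open Topology Filter Set

section Lamination

variable {π : Type*} [Group π] {S : HypSurface π} (Λ : GeodesicLamination S)

/-- The leaves crossing the vertical transversal are graphs `y ↦ s + m₀(s) x` over the axis of `f`.
It remains to see that `m₀` is Lipschitz, and that near `f.X` every leaf crosses the transversal. -/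
theorem exists_niceBox_of_mem {f : Frame} (hf : line f.n ∈ Λ.leaves) :
    ∃ Q : NiceBox Λ, f.X ∈ Q.core := by
  obtain ⟨s₁, h0, h1, hdim⟩ := exists_dimH_transversal_eq_zero Λ hf
  set C₀ : Set ℝ := {y | |y| ≤ s₁ ∧ f.kpt (0, y) ∈ Λ.support} with hC₀
  have hex : ∀ y : ℝ, ∃ m : ℝ, y ∈ C₀ → |m| ≤ |y| ∧ ∃ n : V, line n ∈ Λ.leaves ∧
      ∀ p : ℝ × ℝ, p.1 ^ 2 + p.2 ^ 2 < 1 → (f.kpt p ∈ line n ↔ p.2 = y + m * p.1) := by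
    intro y
    by_cases hy : y ∈ C₀
    · obtain ⟨n, -, hn, m, ν, hν, hm, e⟩ := exists_transversal_normal Λ hf (by linarith [hy.1]) hy.2
      refine ⟨m, fun _ => ⟨hm, n, hn, fun p hp => ?_⟩⟩
      rw [f.kpt_mem_line hp, e, mink_slope_kvec, mul_eq_zero, or_iff_right (by linarith), sub_eq_zero]
    · exact ⟨0, fun h => absurd h hy⟩
  choose m₀ hm₀ using hex
  have hball : ∀ t y : ℝ, |t| ≤ 1 / 2 → |y| ≤ 3 / 4 → (t, y).1 ^ 2 + (t, y).2 ^ 2 < 1 := by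
    intro t y ht hy
    have a1 := sq_le_sq' (abs_le.1 ht).1 (abs_le.1 ht).2
    have a2 := sq_le_sq' (abs_le.1 hy).1 (abs_le.1 hy).2
    simp only
    linarith
  have huniq : ∀ y ∈ C₀, ∀ y' ∈ C₀, ∀ L ∈ Λ.leaves, f.kpt (0, y) ∈ L → f.kpt (0, y') ∈ L →
      y = y' := by
    intro y hy y' hy' L hL h h'
    obtain ⟨-, n, hn, hn'⟩ := hm₀ y hy
    have e : f.kpt (0, y) ∈ line n :=
      (hn' _ (hball _ _ (by norm_num) (by linarith [hy.1]))).2 (by simp)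
    rw [Λ.eq_of_mem hL hn h e, hn' _ (hball _ _ (by norm_num) (by linarith [hy'.1]))] at h'
    simpa using h'.symm
  -- If the slopes differed by more, the two lines would meet at an abscissa of size at most `1/2`,
  -- inside the disc, and the leaves would coincide.
  have hlip : LipschitzOnWith 2 m₀ C₀ := by
    refine LipschitzOnWith.of_dist_le_mul fun y hy y' hy' => ?_
    obtain ⟨hm, n, hn, hn'⟩ := hm₀ y hy
    obtain ⟨hm', n', hl, hl'⟩ := hm₀ y' hy'
    rw [Real.dist_eq, Real.dist_eq]
    change _ ≤ (2 : ℝ) * _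
    by_contra! hcon
    have hne : m₀ y - m₀ y' ≠ 0 := fun h0 => by
      rw [h0, abs_zero] at hcon; linarith [abs_nonneg (y - y')]
    set t := (y' - y) / (m₀ y - m₀ y') with ht
    have ht' : t * (m₀ y - m₀ y') = y' - y := div_mul_cancel₀ _ hne
    have ht2 : |t| ≤ 1 / 2 := by
      rw [ht, abs_div, div_le_iff₀ (abs_pos.2 hne), abs_sub_comm y']; linarith
    have hp : |y + m₀ y * t| ≤ 3 / 4 := by
      have a1 : |m₀ y * t| ≤ 1 / 2 * (1 / 2) := by
        rw [abs_mul]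
        exact mul_le_mul (hm.trans (by linarith [hy.1])) ht2 (abs_nonneg _) (by norm_num)
      exact (abs_add_le _ _).trans (by linarith [hy.1])
    have b1 := (hn' (t, y + m₀ y * t) (hball _ _ ht2 hp)).2 rfl
    have b2 := (hl' (t, y + m₀ y * t) (hball _ _ ht2 hp)).2 (by simp only; linarith)
    have hL := Λ.eq_of_mem hn hl b1 b2
    have c1 : f.kpt (0, y) ∈ line n :=
      (hn' _ (hball _ _ (by norm_num) (by linarith [hy.1]))).2 (by simp)
    have c2 : f.kpt (0, y') ∈ line n := by
      rw [hL]
      exact (hl' _ (hball _ _ (by norm_num) (by linarith [hy'.1]))).2 (by simp)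
    have := huniq y hy y' hy' _ hn c1 c2
    subst this
    exact hne (sub_self _)
  -- The slope between the leaves is immaterial; any Lipschitz extension will do.
  obtain ⟨m, hm, hmeq⟩ := hlip.extend_real
  have h0C : (0 : ℝ) ∈ C₀ := by
    refine ⟨by simp [h0.le], ?_⟩
    rw [f.kpt_zero]
    exact ⟨_, hf, by rw [← f.pt_zero]; exact f.pt_mem_line 0⟩
  have hm0 : m 0 = 0 := by
    rw [← hmeq h0C]
    simpa using (hm₀ 0 h0C).1
  have hmm : ∀ s s', |m s - m s'| ≤ 2 * |s - s'| := fun s s' => by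
    have := hm.dist_le_mul s s'
    rw [Real.dist_eq, Real.dist_eq] at this
    exact_mod_cast this
  have hms : ∀ s, |m s| ≤ 2 * |s| := fun s => by simpa [hm0] using hmm s 0
  have hin : ∀ t s, |t| ≤ s₁ / 2 → |s| ≤ s₁ / 2 →
      (t, s + m s * t).1 ^ 2 + (t, s + m s * t).2 ^ 2 < 1 := by
    intro t s ht hs
    have a1 : |m s * t| ≤ 1 * (1 / 4) := by
      rw [abs_mul]
      exact mul_le_mul ((hms s).trans (by linarith)) (by linarith) (abs_nonneg _) (by norm_num)
    exact hball _ _ (by linarith) ((abs_add_le _ _).trans (by linarith))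
  have hleaf : ∀ s ∈ C₀, |s| ≤ s₁ / 2 → ∃ L ∈ Λ.leaves, ∀ t, |t| ≤ s₁ / 2 →
      f.kpt (t, s + m s * t) ∈ L := by
    intro s hs hs2
    obtain ⟨-, n, hn, hn'⟩ := hm₀ s hs
    refine ⟨_, hn, fun t ht => (hn' _ (hin t s ht hs2)).2 ?_⟩
    rw [hmeq hs]
  refine exists_niceBox_of_slope hm hm0 (s₂ := s₁ / 2) (by linarith) (C₀ := C₀) ?_ hleaf ?_ ?_
  · intro t s ht hs
    refine ⟨fun hX => ?_, fun h => ?_⟩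
    · obtain ⟨g, hgX, hg⟩ := Λ.exists_frame_of_mem hX
      obtain ⟨n, hn, σ, μ, ν, hν, hμ, e⟩ := exists_slope f g.nn (Λ.one_le_sq g.nn hg f hf)
      have hln : line n = line g.n := by rcases hn with rfl | rfl <;> simp [line_neg]
      rw [← hln] at hg
      have hXn : f.kpt (t, s + m s * t) ∈ line n := by
        rw [hln, ← hgX, ← g.pt_zero]; exact g.pt_mem_line 0
      have hXn' := hXn
      rw [f.kpt_mem_line (hin t s ht hs), e, mink_slope_kvec, mul_eq_zero,
        or_iff_right (by linarith), sub_eq_zero] at hXn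
      simp only at hXn
      -- The leaf through the given point meets the vertical axis at a height `σ` still within the
      -- transversal, so it belongs to the family; injectivity of the shear then gives `σ = s`.
      have hσ : |σ| ≤ 2 * |s| := by
        have e1 : σ = s + (m s * t - μ * t) := by linarith
        have b1 : |m s * t| ≤ 2 * |s| * (1 / 4) := by
          rw [abs_mul]
          exact mul_le_mul (hms s) (by linarith) (abs_nonneg _) (by positivity)
        have b2 : |μ * t| ≤ |σ| * (1 / 4) := by
          rw [abs_mul]
          exact mul_le_mul hμ (by linarith) (abs_nonneg _) (by positivity)
        have b3 := abs_add_le s (m s * t - μ * t)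
        have b4 := abs_sub (m s * t) (μ * t)
        rw [← e1] at b3
        linarith
      have hin0 := hball 0 σ (by norm_num) (by linarith)
      have hσn : f.kpt (0, σ) ∈ line n := by
        rw [f.kpt_mem_line hin0, e, mink_slope_kvec]; simp
      have hσC : σ ∈ C₀ := ⟨by linarith, _, hg, hσn⟩
      obtain ⟨-, n', hn1, hn2⟩ := hm₀ σ hσC
      have hσn' : f.kpt (0, σ) ∈ line n' := (hn2 _ hin0).2 (by simp)
      rw [Λ.eq_of_mem hg hn1 hσn hσn', hn2 _ (hin t s ht hs), hmeq hσC] at hXn'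
      simp only at hXn'
      have c1 : |s - σ| ≤ 2 * |s - σ| * (1 / 4) := by
        have e2 : s - σ = -((m s - m σ) * t) := by linarith
        calc |s - σ| = |m s - m σ| * |t| := by rw [e2, abs_neg, abs_mul]
          _ ≤ _ := mul_le_mul (hmm s σ) (by linarith) (abs_nonneg _) (by positivity)
      have c2 : |s - σ| ≤ 0 := by linarith
      have c3 : s = σ := sub_eq_zero.1 (abs_nonpos_iff.1 c2)
      rwa [c3]
    · obtain ⟨L, hL, h'⟩ := hleaf s h hs
      exact ⟨L, hL, h' t ht⟩
  · intro s hs s' hs' _ _ L hL h h'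
    exact huniq s hs s' hs' L hL h h'
  · refine le_antisymm ?_ bot_le
    rw [← hdim]
    exact dimH_mono fun s hs => hs.2

/-- Off the lamination a small rectangle with `C` empty and slope zero suffices. -/
theorem exists_niceBox (X : Hyp) : ∃ Q : NiceBox Λ, X ∈ Q.core := by
  by_cases hX : X ∈ Λ.support
  · obtain ⟨f, rfl, hf⟩ := Λ.exists_frame_of_mem hX
    exact exists_niceBox_of_mem Λ hf
  · obtain ⟨f, rfl⟩ := exists_frame X
    have h1 := (f.continuousAt_kpt (p := (0, 0)) (by norm_num)).eventually
      (Λ.isClosed.isOpen_compl.mem_nhds (by rw [f.kpt_zero]; exact hX))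
    obtain ⟨ε, hε, h2⟩ := Metric.eventually_nhds_iff.1 h1
    refine exists_niceBox_of_slope (m := fun _ => 0) ((LipschitzWith.const 0).weaken (by norm_num)) rfl
      (s₂ := ε / 2) (by positivity) (C₀ := ∅) ?_ (by simp) (by simp) (by simp)
    intro t s ht hs
    refine iff_of_false (h2 ?_) (by simp)
    rw [Prod.dist_eq, Real.dist_eq, Real.dist_eq, sub_zero, sub_zero]
    exact max_lt (by linarith) (by simp only [zero_mul, add_zero]; linarith)

end Lamination

end LieLam

/-! ### Arcs lie in leaves; the leaves form a null set; continuity of the normals -/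

namespace LieLam

open Topology Filter Set

theorem continuous_hdist : Continuous fun p : Hyp × Hyp => hdist p.1 p.2 := by
  refine Real.continuousOn_arcosh.comp_continuous ?_ fun p => ?_
  · exact (Continuous.mink (by fun_prop) (by fun_prop)).neg
  · have := mink_hyp_le p.1 p.2
    rw [mem_Ici]; linarith

theorem eq_of_uIcc_subset_of_volume_eq_zero {C : Set ℝ} (hC : volume C = 0) {u v : ℝ}
    (h : uIcc u v ⊆ C) : u = v := by
  have h1 := measure_mono_null h hC
  rw [uIcc, Real.volume_Icc, ENNReal.ofReal_eq_zero] at h1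
  have h2 := inf_le_sup (a := u) (b := v)
  have h3 : u ⊓ v = u ⊔ v := by linarith
  exact inf_eq_sup.1 h3

section Lamination

variable {π : Type*} [Group π] {S : HypSurface π} {Λ : GeodesicLamination S}

namespace FlowBox

variable (R : FlowBox Λ)

/-- The coordinates of a point in a flow-box. -/
noncomputable def coord : Hyp → ℝ × ℝ := Function.invFunOn R.map R.rect

theorem coord_map {p : ℝ × ℝ} (hp : p ∈ R.rect) : R.coord (R.map p) = p :=
  R.injOn_map.leftInvOn_invFunOn hp

theorem continuousOn_coord : ContinuousOn R.coord (R.map '' R.rect) := by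
  obtain ⟨K, hK, h⟩ := R.biLipschitz
  rintro _ ⟨p, hp, rfl⟩
  refine tendsto_iff_dist_tendsto_zero.2 ?_
  have h1 : Tendsto (fun Y => K * hdist Y (R.map p)) (𝓝[R.map '' R.rect] (R.map p)) (𝓝 0) := by
    have h2 : Continuous fun Y => K * hdist Y (R.map p) :=
      continuous_const.mul (continuous_hdist.comp (by fun_prop : Continuous fun Y : Hyp => (Y, R.map p)))
    have h3 := h2.tendsto (R.map p)
    rw [(hdist_eq_zero_iff _ _).2 rfl, mul_zero] at h3
    exact h3.mono_left nhdsWithin_le_nhds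
  refine squeeze_zero' (Eventually.of_forall fun _ => dist_nonneg) ?_ h1
  filter_upwards [self_mem_nhdsWithin] with Y hY
  obtain ⟨q, hq, rfl⟩ := hY
  rw [R.coord_map hp, R.coord_map hq]
  have := (h q hq p hp).2 1
  rw [map_one, act_one, inv_mul_le_iff₀ hK] at this
  exact this

theorem core_subset : R.core ⊆ R.map '' R.rect :=
  image_mono (prod_mono Ioo_subset_Icc_self Ioo_subset_Icc_self)

theorem map_coord {X : Hyp} (hX : X ∈ R.core) : R.map (R.coord X) = X := by
  obtain ⟨p, hp, rfl⟩ := R.core_subset hX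
  rw [R.coord_map hp]

theorem coord_mem {X : Hyp} (hX : X ∈ R.core) : R.coord X ∈ Ioo R.a R.b ×ˢ Ioo R.c R.d := by
  obtain ⟨p, hp, rfl⟩ := hX
  rwa [R.coord_map (prod_mono Ioo_subset_Icc_self Ioo_subset_Icc_self hp)]

theorem coord_snd_mem {X : Hyp} (hX : X ∈ R.core) (h : X ∈ Λ.support) : (R.coord X).2 ∈ R.C := by
  have h1 := R.coord_mem hX
  refine (R.preimage (R.coord X).1 (Ioo_subset_Icc_self h1.1) _ (Ioo_subset_Icc_self h1.2)).1 ?_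
  change R.map (R.coord X) ∈ _
  rwa [R.map_coord hX]

theorem mem_rect {t s : ℝ} (ht : t ∈ Icc R.a R.b) (hs : s ∈ R.C) : (t, s) ∈ R.rect :=
  ⟨ht, Ioo_subset_Icc_self (R.subset hs)⟩

theorem continuousOn_arc {s : ℝ} (hs : s ∈ R.C) :
    ContinuousOn (fun t => R.map (t, s)) (Icc R.a R.b) :=
  R.continuousOn_map.comp (f := fun t => (t, s)) (by fun_prop) fun _ ht => R.mem_rect ht hs

theorem continuousOn_transversal {t : ℝ} (ht : t ∈ Icc R.a R.b) :
    ContinuousOn (fun s => R.map (t, s)) R.C :=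
  R.continuousOn_map.comp (f := fun s => (t, s)) (by fun_prop) fun _ hs => R.mem_rect ht hs

/-- A flow-box is only assumed to pull `λ` back to `[a,b] × C`. Inside a nice box the transverse
coordinate along an arc is continuous with values in a null set, hence constant, so the arc stays
locally in one leaf; connectedness of `[a,b]` does the rest. -/
theorem exists_leaf_of_mem {s : ℝ} (hs : s ∈ R.C) :
    ∃ L ∈ Λ.leaves, ∀ t ∈ Icc R.a R.b, R.map (t, s) ∈ L := by
  have key : ∀ t ∈ Icc R.a R.b, ∀ t' ∈ Icc R.a R.b,
      ∃ L ∈ Λ.leaves, R.map (t, s) ∈ L ∧ R.map (t', s) ∈ L := by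
    intro t ht t' ht'
    refine isPreconnected_Icc.induction₂
      (fun t t' => ∃ L ∈ Λ.leaves, R.map (t, s) ∈ L ∧ R.map (t', s) ∈ L) ?_ ?_ ?_ ht ht'
    · intro t ht
      obtain ⟨Q, hQ⟩ := exists_niceBox Λ (R.map (t, s))
      have h1 := (R.continuousOn_arc hs) t ht (Q.isOpen_core.mem_nhds hQ)
      obtain ⟨ε, hε, h2⟩ := Metric.mem_nhdsWithin_iff.1 h1
      refine Metric.mem_nhdsWithin_iff.2 ⟨ε, hε, fun t' ht' => ?_⟩
      have hsub : uIcc t t' ⊆ Icc R.a R.b := uIcc_subset_Icc ht ht'.2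
      have hcore : ∀ τ ∈ uIcc t t', R.map (τ, s) ∈ Q.core := by
        intro τ hτ
        refine h2 ⟨?_, hsub hτ⟩
        have h3 := abs_sub_left_of_mem_uIcc hτ
        rw [Metric.mem_ball, Real.dist_eq]
        have h4 := ht'.1
        rw [Metric.mem_ball, Real.dist_eq] at h4
        exact h3.trans_lt h4
      have hcont : ContinuousOn (fun τ => (Q.coord (R.map (τ, s))).2) (uIcc t t') := by
        refine continuous_snd.comp_continuousOn (Q.continuousOn_coord.comp
          ((R.continuousOn_arc hs).mono hsub) fun τ hτ => Q.core_subset (hcore τ hτ))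
      have hC : ∀ τ ∈ uIcc t t', (Q.coord (R.map (τ, s))).2 ∈ Q.C := fun τ hτ =>
        Q.coord_snd_mem (hcore τ hτ) (R.map_mem_support (hsub hτ) hs)
      have himg := intermediate_value_uIcc hcont
      have heq := eq_of_uIcc_subset_of_volume_eq_zero Q.volume_C
        (himg.trans (image_subset_iff.2 hC))
      obtain ⟨L, hL, hL'⟩ := Q.arc_leaf _ (hC t left_mem_uIcc)
      have hm : ∀ τ ∈ uIcc t t', (Q.coord (R.map (τ, s))).2 = (Q.coord (R.map (t, s))).2 →
          R.map (τ, s) ∈ L := by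
        intro τ hτ he
        have := hL' _ (Ioo_subset_Icc_self (Q.coord_mem (hcore τ hτ)).1)
        rw [← he] at this
        change Q.map (Q.coord _) ∈ L at this
        rwa [Q.map_coord (hcore τ hτ)] at this
      exact ⟨L, hL, hm t left_mem_uIcc rfl, hm t' right_mem_uIcc heq.symm⟩
    · rintro x y z - - - ⟨L, hL, h1, h2⟩ ⟨L', hL', h3, h4⟩
      have := Λ.eq_of_mem hL hL' h2 h3
      subst this
      exact ⟨L, hL, h1, h4⟩
    · rintro x y - - ⟨L, hL, h1, h2⟩
      exact ⟨L, hL, h2, h1⟩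
  obtain ⟨L, hL, h1, -⟩ := key R.a (left_mem_Icc.2 R.hab.le) R.a (left_mem_Icc.2 R.hab.le)
  refine ⟨L, hL, fun t ht => ?_⟩
  obtain ⟨L', hL', h3, h4⟩ := key R.a (left_mem_Icc.2 R.hab.le) t ht
  rwa [Λ.eq_of_mem hL hL' h1 h3]

end FlowBox

variable (Λ)

theorem exists_countable_niceBox : ∃ Q : ℕ → NiceBox Λ, ∀ X : Hyp, ∃ i, X ∈ (Q i).core := by
  choose q hq using exists_niceBox Λ
  obtain ⟨s, hs, hU⟩ := TopologicalSpace.countable_cover_nhds (f := fun X => (q X).core)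
    fun X => (q X).isOpen_core.mem_nhds (hq X)
  have hne : s.Nonempty := by
    by_contra hne
    rw [not_nonempty_iff_eq_empty.1 hne] at hU
    simp only [mem_empty_iff_false, iUnion_of_empty, iUnion_empty] at hU
    exact absurd (mem_univ (chart 0)) (by rw [← hU]; exact notMem_empty _)
  obtain ⟨g, hg⟩ := hs.exists_eq_range hne
  refine ⟨fun i => q (g i), fun X => ?_⟩
  have := hU.symm ▸ mem_univ X
  simp only [mem_iUnion] at this
  obtain ⟨Y, hY, hX⟩ := this
  rw [hg] at hY
  obtain ⟨i, rfl⟩ := hY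
  exact ⟨i, hX⟩

/-- Countably many boxes cover the plane, and each meets the lamination in a null set. This provides
the base point off the lamination and makes the values of `w` on leaves irrelevant. -/
theorem volume_support : volume (chart ⁻¹' Λ.support) = 0 := by
  obtain ⟨Q, hQ⟩ := exists_countable_niceBox Λ
  refine measure_mono_null ?_ (measure_iUnion_null fun i => (Q i).volume_image_eq_zero)
  intro p hp
  obtain ⟨i, hi⟩ := hQ (chart p)
  refine mem_iUnion.2 ⟨i, (Q i).coord (chart p), ⟨?_, ?_⟩, (Q i).map_coord hi⟩
  · exact Ioo_subset_Icc_self ((Q i).coord_mem hi).1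
  · exact (Q i).coord_snd_mem hi hp

theorem exists_notMem_support : ∃ O : Hyp, O ∉ Λ.support := by
  by_contra! h
  have : chart ⁻¹' Λ.support = univ := eq_univ_of_forall fun p => h _
  have h2 := volume_support Λ
  rw [this] at h2
  simp at h2

/-- A point off the lamination. -/
noncomputable def basePoint : Hyp := (exists_notMem_support Λ).choose

theorem basePoint_notMem : basePoint Λ ∉ Λ.support := (exists_notMem_support Λ).choose_spec

/-- Unit normal vectors of leaves. -/
def IsLeafNormal (n : V) : Prop := mink n n = 1 ∧ line n ∈ Λ.leaves

variable {Λ}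

theorem IsLeafNormal.neg {n : V} (h : IsLeafNormal Λ n) : IsLeafNormal Λ (-n) :=
  ⟨by simpa using h.1, by rw [line_neg]; exact h.2⟩

theorem IsLeafNormal.mem_support {n : V} (h : IsLeafNormal Λ n) {X : Hyp} (hX : mink n X = 0) :
    X ∈ Λ.support := ⟨_, h.2, hX⟩

theorem IsLeafNormal.mink_basePoint_ne {n : V} (h : IsLeafNormal Λ n) :
    mink n (basePoint Λ) ≠ 0 := fun h0 => basePoint_notMem Λ (h.mem_support h0)

theorem IsLeafNormal.eq_or_eq_neg {n n' : V} (h : IsLeafNormal Λ n) (h' : IsLeafNormal Λ n')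
    {X : Hyp} (hX : mink n X = 0) (hX' : mink n' X = 0) : n' = n ∨ n' = -n :=
  eq_or_eq_neg_of_line_subset h'.1 (Frame.ofNormal X n h.1 hX)
    (Λ.eq_of_mem h.2 h'.2 (X := X) hX hX').subset

variable (Λ)

open Classical in
/-- The unit normal vector, pointing away from the base point, of the leaf through a point. -/
noncomputable def normalAt (X : Hyp) : V :=
  if h : ∃ n, IsLeafNormal Λ n ∧ mink n X = 0 ∧ mink n (basePoint Λ) < 0 then h.choose else 0

variable {Λ}

theorem normalAt_spec {X : Hyp} (hX : X ∈ Λ.support) :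
    IsLeafNormal Λ (normalAt Λ X) ∧ mink (normalAt Λ X) X = 0 ∧
      mink (normalAt Λ X) (basePoint Λ) < 0 := by
  have h : ∃ n, IsLeafNormal Λ n ∧ mink n X = 0 ∧ mink n (basePoint Λ) < 0 := by
    obtain ⟨f, rfl, hf⟩ := Λ.exists_frame_of_mem hX
    have h1 : IsLeafNormal Λ f.n := ⟨f.nn, hf⟩
    rcases lt_or_gt_of_ne h1.mink_basePoint_ne with h2 | h2
    · exact ⟨f.n, h1, f.nX, h2⟩
    · exact ⟨-f.n, h1.neg, by simp [f.nX], by simpa using h2⟩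
  rw [normalAt, dif_pos h]
  exact h.choose_spec

theorem eq_normalAt {X : Hyp} {n : V} (h : IsLeafNormal Λ n) (hX : mink n X = 0)
    (hO : mink n (basePoint Λ) < 0) : n = normalAt Λ X := by
  obtain ⟨h1, h2, h3⟩ := normalAt_spec (h.mem_support hX)
  rcases h1.eq_or_eq_neg h h2 hX with h4 | h4
  · exact h4
  · rw [h4, mink_neg_left] at hO; linarith

theorem eq_or_eq_neg_normalAt {X : Hyp} {n : V} (h : IsLeafNormal Λ n) (hX : mink n X = 0) :
    n = normalAt Λ X ∨ n = -normalAt Λ X :=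
  (normalAt_spec (h.mem_support hX)).1.eq_or_eq_neg h (normalAt_spec (h.mem_support hX)).2.1 hX

theorem normalAt_eq_iff {X Y : Hyp} (hX : X ∈ Λ.support) (hY : Y ∈ Λ.support) :
    normalAt Λ X = normalAt Λ Y ↔ ∃ L ∈ Λ.leaves, X ∈ L ∧ Y ∈ L := by
  obtain ⟨h1, h2, h3⟩ := normalAt_spec hX
  obtain ⟨g1, g2, g3⟩ := normalAt_spec hY
  constructor
  · intro h
    refine ⟨_, h1.2, h2, ?_⟩
    rw [h]; exact g2
  · rintro ⟨L, hL, hXL, hYL⟩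
    refine eq_normalAt h1 ?_ h3
    have := Λ.eq_of_mem hL h1.2 hXL h2
    rw [this] at hYL
    exact hYL

/-- A geodesic that does not cross that of `f` satisfies `|(n', e)^♯| ≤ |(n', X)^♯|`, so if it
passes close to `X` its normal is close to `n` or `-n`. The base point, on the negative side of
both, decides the sign. -/
theorem continuousOn_normalAt : ContinuousOn (normalAt Λ) Λ.support := by
  intro X hX
  obtain ⟨h1, h2, h3⟩ := normalAt_spec hX
  let f := Frame.ofNormal X (normalAt Λ X) h1.1 h2
  set O := basePoint Λ
  set x : Hyp → ℝ := fun Y => |mink (normalAt Λ Y) X|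
  have hx0 : Tendsto x (𝓝[Λ.support] X) (𝓝 0) := by
    have h4 : Tendsto (fun Y : Hyp => 3 * (Y : V) 2 * ‖(X : V) - (Y : V)‖) (𝓝[Λ.support] X) (𝓝 0) := by
      have : Continuous (fun Y : Hyp => 3 * (Y : V) 2 * ‖(X : V) - (Y : V)‖) := by
        have h6 : Continuous fun Y : Hyp => (Y : V) 2 := (continuous_apply 2).comp continuous_subtype_val
        exact (continuous_const.mul h6).mul (continuous_const.sub continuous_subtype_val).norm
      have h5 := this.tendsto X
      simp only [sub_self, norm_zero, mul_zero] at h5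
      exact h5.mono_left nhdsWithin_le_nhds
    refine squeeze_zero' (Eventually.of_forall fun _ => abs_nonneg _) ?_ h4
    filter_upwards [self_mem_nhdsWithin] with Y hY
    obtain ⟨g1, g2, -⟩ := normalAt_spec hY
    have e : mink (normalAt Λ Y) X = mink (normalAt Λ Y) ((X : V) - (Y : V)) := by
      rw [mink_sub_right, g2, sub_zero]
    have h5 := norm_le_of_orthogonal Y g2
    rw [g1.1, Real.sqrt_one, mul_one] at h5
    simp only [x]
    rw [e]
    refine (abs_mink_le _ _).trans ?_
    gcongr
  have hc : 0 < -mink f.n O := by simp only [f, Frame.ofNormal]; linarith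
  have hsmall : ∀ᶠ Y in 𝓝[Λ.support] X,
      x Y * (|mink f.X O| + |mink f.e O|) < -mink f.n O := by
    have := hx0.mul_const (|mink f.X O| + |mink f.e O|)
    rw [zero_mul] at this
    exact this.eventually_lt_const hc
  refine tendsto_iff_norm_sub_tendsto_zero.2 ?_
  have hlim := hx0.mul_const (‖(f.X : V)‖ + ‖f.e‖ + ‖f.n‖)
  rw [zero_mul] at hlim
  refine squeeze_zero' (Eventually.of_forall fun _ => norm_nonneg _) ?_ hlim
  filter_upwards [self_mem_nhdsWithin, hsmall] with Y hY hs
  obtain ⟨g1, g2, g3⟩ := normalAt_spec hY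
  have b1 := Λ.one_le_sq g1.1 g1.2 f h1.2
  have b2 := sq_mink_e_le g1.1 f b1
  have b3 := f.mink_expand (normalAt Λ Y) (normalAt Λ Y)
  have b4 := f.expand (normalAt Λ Y)
  rw [g1.1] at b3
  change |mink (normalAt Λ Y) f.X| * _ < _ at hs
  change ‖_ - f.n‖ ≤ |mink (normalAt Λ Y) f.X| * _
  have g3' : mink (normalAt Λ Y) O < 0 := g3
  generalize normalAt Λ Y = n' at *
  set p := mink n' f.X
  set q := mink n' f.e
  set ν := mink n' f.n
  have b5 : |q| ≤ |p| := sq_le_sq.1 b2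
  -- Otherwise `n'` would be close to `-f.n` and positive at the base point.
  have hν : 1 ≤ ν := by
    by_contra! hlt
    have hν1 : ν ≤ -1 := by nlinarith
    rw [b4, mink_add_left, mink_add_left, mink_smul_left, mink_smul_left, mink_smul_left] at g3'
    have c1 : -(|p| * |mink f.X O|) ≤ -p * mink f.X O := by
      rw [← abs_mul]; have := le_abs_self (p * mink f.X O); linarith
    have c2 : -(|p| * |mink f.e O|) ≤ q * mink f.e O := by
      have := neg_abs_le (q * mink f.e O)
      rw [abs_mul] at this
      have := mul_le_mul_of_nonneg_right b5 (abs_nonneg (mink f.e O))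
      linarith
    have c3 := mul_le_mul_of_nonneg_right (show 1 ≤ -ν by linarith) hc.le
    nlinarith
  have hν2 : |ν - 1| ≤ |p| := by
    rw [abs_of_nonneg (by linarith)]
    have : ν ^ 2 ≤ (1 + |p|) ^ 2 := by nlinarith [sq_abs p, abs_nonneg p, sq_nonneg q]
    have := abs_le_of_sq_le_sq' this (by positivity)
    linarith [this.2]
  have e : n' - f.n = -p • (f.X : V) + q • f.e + (ν - 1) • f.n := by
    conv_lhs => rw [b4]
    rw [sub_smul, one_smul]; abel
  rw [e]
  refine (norm_add₃_le).trans ?_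
  rw [norm_smul, norm_smul, norm_smul, Real.norm_eq_abs, Real.norm_eq_abs, Real.norm_eq_abs, abs_neg]
  have d1 := mul_le_mul_of_nonneg_right b5 (norm_nonneg f.e)
  have d2 := mul_le_mul_of_nonneg_right hν2 (norm_nonneg f.n)
  linarith

end Lamination

end LieLam

/-! ### The transverse measure as a measure on normal vectors of leaves -/

namespace LieLam

open Topology Filter Set

section Lamination

variable {π : Type*} [Group π] {S : HypSurface π} {Λ : GeodesicLamination S}

namespace FlowBox

variable (R : FlowBox Λ)

/-- The midpoint of the horizontal arcs. -/
noncomputable def mid : ℝ := (R.a + R.b) / 2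

theorem mid_mem : R.mid ∈ Ioo R.a R.b := by
  have := R.hab
  constructor <;> simp only [mid] <;> linarith

theorem mid_mem_Icc : R.mid ∈ Icc R.a R.b := Ioo_subset_Icc_self R.mid_mem

/-- The normal vector, pointing away from the base point, of the leaf containing a horizontal
arc. -/
noncomputable def normal : ℝ → V := R.C.indicator fun s => normalAt Λ (R.map (R.mid, s))

theorem normalAt_map {t s : ℝ} (ht : t ∈ Icc R.a R.b) (hs : s ∈ R.C) :
    normalAt Λ (R.map (t, s)) = R.normal s := by
  rw [normal, indicator_of_mem hs, normalAt_eq_iff (R.map_mem_support ht hs)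
    (R.map_mem_support R.mid_mem_Icc hs)]
  obtain ⟨L, hL, h⟩ := R.exists_leaf_of_mem hs
  exact ⟨L, hL, h t ht, h _ R.mid_mem_Icc⟩

theorem normal_spec {s : ℝ} (hs : s ∈ R.C) :
    IsLeafNormal Λ (R.normal s) ∧ mink (R.normal s) (basePoint Λ) < 0 := by
  rw [← R.normalAt_map R.mid_mem_Icc hs]
  have := normalAt_spec (R.map_mem_support R.mid_mem_Icc hs)
  exact ⟨this.1, this.2.2⟩

theorem mink_normal_map {t s : ℝ} (ht : t ∈ Icc R.a R.b) (hs : s ∈ R.C) :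
    mink (R.normal s) (R.map (t, s)) = 0 := by
  rw [← R.normalAt_map ht hs]
  exact (normalAt_spec (R.map_mem_support ht hs)).2.1

theorem continuousOn_normal : ContinuousOn R.normal R.C := by
  have h : ContinuousOn (fun s => normalAt Λ (R.map (R.mid, s))) R.C :=
    continuousOn_normalAt.comp (R.continuousOn_transversal R.mid_mem_Icc)
      fun s hs => R.map_mem_support R.mid_mem_Icc hs
  exact h.congr fun s hs => (R.normalAt_map R.mid_mem_Icc hs).symm

theorem measurable_normal : Measurable R.normal := by
  classical
  rw [normal, ← piecewise_eq_indicator]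
  refine ContinuousOn.measurable_piecewise ?_ continuousOn_const R.isClosed.measurableSet
  exact R.continuousOn_normal.congr fun s hs => R.normalAt_map R.mid_mem_Icc hs

/-- The set of normal vectors of the leaves which cross the flow-box. -/
def normals : Set V := R.normal '' R.C

theorem isCompact_normals : IsCompact R.normals := R.isCompact_C.image_of_continuousOn R.continuousOn_normal

theorem measurableSet_image_normal {A : Set ℝ} (hA : MeasurableSet A) (hAC : A ⊆ R.C)
    (hinj : InjOn R.normal A) : MeasurableSet (R.normal '' A) :=
  hA.image_of_continuousOn_injOn (R.continuousOn_normal.mono hAC) hinj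

end FlowBox

theorem NiceBox.injOn_normal (Q : NiceBox Λ) : InjOn Q.normal Q.C := by
  intro s hs s' hs' h
  rw [← Q.normalAt_map Q.mid_mem_Icc hs, ← Q.normalAt_map Q.mid_mem_Icc hs', normalAt_eq_iff
    (Q.map_mem_support Q.mid_mem_Icc hs) (Q.map_mem_support Q.mid_mem_Icc hs')] at h
  obtain ⟨L, hL, h1, h2⟩ := h
  exact Q.leaf_inj s hs s' hs' L hL _ Q.mid_mem_Icc _ Q.mid_mem_Icc h1 h2

theorem FlowBox.normal_coord (Q : FlowBox Λ) {X : Hyp} (hX : X ∈ Q.core) (h : X ∈ Λ.support) :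
    Q.normal (Q.coord X).2 = normalAt Λ X := by
  rw [← Q.normalAt_map (t := (Q.coord X).1) (Ioo_subset_Icc_self (Q.coord_mem hX).1)
    (Q.coord_snd_mem hX h), Prod.mk.eta, Q.map_coord hX]

variable (m : TransverseMeasure Λ)

instance (R : FlowBox Λ) : IsFiniteMeasure (m.μ R) := m.finite R

/-- The transverse measure of a flow-box, as a measure on the normal vectors of the leaves. -/
noncomputable def TransverseMeasure.pushed (R : FlowBox Λ) : Measure V := (m.μ R).map R.normal

theorem TransverseMeasure.pushed_apply (R : FlowBox Λ) {B : Set V} (hB : MeasurableSet B) :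
    m.pushed R B = m.μ R (R.C ∩ R.normal ⁻¹' B) := by
  rw [pushed, Measure.map_apply R.measurable_normal hB]
  have h : ∀ᵐ s ∂(m.μ R), s ∈ R.C := m.supported R
  refine measure_congr ?_
  filter_upwards [h] with s hs
  exact propext ⟨fun h' => ⟨hs, h'⟩, fun h' => h'.2⟩

instance (R : FlowBox Λ) : IsFiniteMeasure (m.pushed R) := by
  unfold TransverseMeasure.pushed; infer_instance

theorem TransverseMeasure.ae_mem_normals (R : FlowBox Λ) : ∀ᵐ n ∂(m.pushed R), n ∈ R.normals := by
  rw [ae_iff, show {n | n ∉ R.normals} = R.normalsᶜ from rfl,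
    m.pushed_apply R R.isCompact_normals.isClosed.measurableSet.compl]
  convert measure_empty (μ := m.μ R)
  ext s
  simp only [mem_inter_iff, mem_preimage, mem_compl_iff, mem_empty_iff_false, iff_false, not_and, not_not]
  exact fun hs => mem_image_of_mem _ hs

/-- Near one arc the points at time `t₀` lie in the core of `Q`, and passing to their `Q`-height is
a holonomy map to which `compatible` applies. Labelled by normals of leaves this map is the
identity. Injectivity on `A` is needed since a leaf may cross a general box several times. -/
theorem TransverseMeasure.exists_measure_eq_pushed (R : FlowBox Λ) (Q : NiceBox Λ) {t₀ s₀ : ℝ}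
    (ht : t₀ ∈ Ioo R.a R.b) (hs : s₀ ∈ R.C) (hX : R.map (t₀, s₀) ∈ Q.core) :
    ∃ ε > 0, ∀ A : Set ℝ, MeasurableSet A → A ⊆ R.C → A ⊆ Metric.ball s₀ ε → InjOn R.normal A →
      R.normal '' A ⊆ Q.normals ∧ m.μ R A = m.pushed Q.toFlowBox (R.normal '' A) := by
  have ht' := Ioo_subset_Icc_self ht
  have h1 := R.continuousOn_transversal ht' s₀ hs (Q.isOpen_core.mem_nhds hX)
  obtain ⟨ε, hε, h2⟩ := Metric.mem_nhdsWithin_iff.1 h1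
  refine ⟨ε, hε, fun A hA hAC hAε hinj => ?_⟩
  have hcore : ∀ s ∈ A, R.map (t₀, s) ∈ Q.core := fun s hs => h2 ⟨hAε hs, hAC hs⟩
  have hsup : ∀ s ∈ A, R.map (t₀, s) ∈ Λ.support := fun s hs => R.map_mem_support ht' (hAC hs)
  set h : ℝ → ℝ := fun s => (Q.coord (R.map (t₀, s))).2
  have hcont : ContinuousOn h A := continuous_snd.comp_continuousOn
    (Q.continuousOn_coord.comp ((R.continuousOn_transversal ht').mono hAC)
      fun s hs => Q.core_subset (hcore s hs))
  have hC : ∀ s ∈ A, h s ∈ Q.C := fun s hs => Q.coord_snd_mem (hcore s hs) (hsup s hs)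
  have hn : ∀ s ∈ A, Q.normal (h s) = R.normal s := fun s hs => by
    rw [Q.normal_coord (hcore s hs) (hsup s hs), R.normalAt_map ht' (hAC hs)]
  have hhinj : InjOn h A := fun s hs s' hs' e => hinj hs hs' (by rw [← hn s hs, ← hn s' hs', e])
  refine ⟨?_, ?_⟩
  · rintro _ ⟨s, hs, rfl⟩
    exact ⟨h s, hC s hs, hn s hs⟩
  rw [m.compatible R Q.toFlowBox 1 A h hA hAC hcont hhinj, m.pushed_apply]
  · congr 1
    ext σ
    constructor
    · rintro ⟨s, hs, rfl⟩
      exact ⟨hC s hs, s, hs, (hn s hs).symm⟩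
    · rintro ⟨hσ, s, hs, e⟩
      exact ⟨s, hs, Q.injOn_normal (hC s hs) hσ ((hn s hs).trans e)⟩
  · exact R.measurableSet_image_normal hA hAC hinj
  · intro s hs
    refine ⟨hC s hs, t₀, ht, (Q.coord (R.map (t₀, s))).1, (Q.coord_mem (hcore s hs)).1, ?_⟩
    rw [map_one, act_one]
    exact (Q.map_coord (hcore s hs)).symm

/-- `W` is the complement of the compact set of normals of arcs at distance at least `ε` from the
arc of `X`; it contains the normal at `X` because different arcs of a nice box have different
normals. -/
theorem TransverseMeasure.exists_pushed_le (Q Q' : NiceBox Λ) {X : Hyp} (hX : X ∈ Q.core)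
    (hX' : X ∈ Q'.core) (hs : X ∈ Λ.support) :
    ∃ W : Set V, IsOpen W ∧ normalAt Λ X ∈ W ∧ ∀ B ⊆ W, MeasurableSet B →
      m.pushed Q.toFlowBox B ≤ m.pushed Q'.toFlowBox B := by
  have hC := Q.coord_snd_mem hX hs
  obtain ⟨ε, hε, h⟩ := m.exists_measure_eq_pushed Q.toFlowBox Q' (t₀ := (Q.coord X).1)
    (Q.coord_mem hX).1 hC (by rw [Prod.mk.eta, Q.map_coord hX]; exact hX')
  have hcpt : IsCompact (Q.C \ Metric.ball (Q.coord X).2 ε) := Q.isCompact_C.diff Metric.isOpen_ball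
  refine ⟨(Q.normal '' (Q.C \ Metric.ball (Q.coord X).2 ε))ᶜ,
    (hcpt.image_of_continuousOn (Q.continuousOn_normal.mono sdiff_subset)).isClosed.isOpen_compl,
    ?_, fun B hB hBm => ?_⟩
  · rintro ⟨s, hs', e⟩
    rw [← Q.normal_coord hX hs] at e
    have := Q.injOn_normal hs'.1 hC e
    subst this
    exact hs'.2 (Metric.mem_ball_self hε)
  · rw [m.pushed_apply _ hBm, (h _ _ _ _ _).2]
    · exact measure_mono (by rintro _ ⟨s, hs, rfl⟩; exact hs.2)
    · exact Q.isClosed.measurableSet.inter (Q.measurable_normal hBm)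
    · exact inter_subset_left
    · rintro s ⟨hs1, hs2⟩
      by_contra hcon
      exact hB hs2 ⟨s, ⟨hs1, hcon⟩, rfl⟩
    · exact Q.injOn_normal.mono inter_subset_left

theorem TransverseMeasure.exists_restrict_pushed_eq (Q Q' : NiceBox Λ) {X : Hyp} (hX : X ∈ Q.core)
    (hX' : X ∈ Q'.core) (hs : X ∈ Λ.support) :
    ∃ W : Set V, IsOpen W ∧ normalAt Λ X ∈ W ∧
      (m.pushed Q.toFlowBox).restrict W = (m.pushed Q'.toFlowBox).restrict W := by
  obtain ⟨W, hW, hn, h⟩ := m.exists_pushed_le Q Q' hX hX' hs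
  obtain ⟨W', hW', hn', h'⟩ := m.exists_pushed_le Q' Q hX' hX hs
  refine ⟨W ∩ W', hW.inter hW', ⟨hn, hn'⟩, Measure.ext fun B hB => ?_⟩
  rw [Measure.restrict_apply hB, Measure.restrict_apply hB]
  have hm := hB.inter (hW.inter hW').measurableSet
  exact le_antisymm (h _ (inter_subset_right.trans inter_subset_left) hm)
    (h' _ (inter_subset_right.trans inter_subset_right) hm)

/-- Two boxes crossed by the same leaf need not overlap. They are compared through a chain of
overlapping boxes along the leaf, by connectedness of the real line. -/
theorem TransverseMeasure.exists_restrict_pushed_eq_of_leaf (Q Q' : NiceBox Λ) {X X' : Hyp}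
    (hX : X ∈ Q.core) (hX' : X' ∈ Q'.core) (hs : X ∈ Λ.support) (hs' : X' ∈ Λ.support)
    (hn : normalAt Λ X = normalAt Λ X') :
    ∃ W : Set V, IsOpen W ∧ normalAt Λ X ∈ W ∧
      (m.pushed Q.toFlowBox).restrict W = (m.pushed Q'.toFlowBox).restrict W := by
  obtain ⟨h1, h2, h3⟩ := normalAt_spec hs
  set n := normalAt Λ X with hndef
  set f := Frame.ofNormal X n h1.1 h2
  have hpt : ∀ u, f.pt u ∈ Λ.support := fun u => h1.mem_support (f.pt_mem_line u)
  have hnpt : ∀ u, normalAt Λ (f.pt u) = n := fun u => (eq_normalAt h1 (f.pt_mem_line u) h3).symm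
  let P : ℝ → ℝ → Prop := fun u u' => ∀ Q Q' : NiceBox Λ, f.pt u ∈ Q.core → f.pt u' ∈ Q'.core →
    ∃ W : Set V, IsOpen W ∧ n ∈ W ∧
      (m.pushed Q.toFlowBox).restrict W = (m.pushed Q'.toFlowBox).restrict W
  have htrans : ∀ Q₁ Q₂ Q₃ : NiceBox Λ,
      (∃ W : Set V, IsOpen W ∧ n ∈ W ∧
        (m.pushed Q₁.toFlowBox).restrict W = (m.pushed Q₂.toFlowBox).restrict W) →
      (∃ W : Set V, IsOpen W ∧ n ∈ W ∧
        (m.pushed Q₂.toFlowBox).restrict W = (m.pushed Q₃.toFlowBox).restrict W) →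
      ∃ W : Set V, IsOpen W ∧ n ∈ W ∧
        (m.pushed Q₁.toFlowBox).restrict W = (m.pushed Q₃.toFlowBox).restrict W := by
    rintro Q₁ Q₂ Q₃ ⟨W, hW, hnW, h⟩ ⟨W', hW', hnW', h'⟩
    exact ⟨W ∩ W', hW.inter hW', ⟨hnW, hnW'⟩, (Measure.restrict_congr_mono inter_subset_left h).trans
      (Measure.restrict_congr_mono inter_subset_right h')⟩
  have key : ∀ u u', P u u' := by
    intro u u'
    refine isPreconnected_univ.induction₂ P ?_ ?_ ?_ (mem_univ u) (mem_univ u')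
    · intro u _
      obtain ⟨Q₀, hQ₀⟩ := exists_niceBox Λ (f.pt u)
      rw [nhdsWithin_univ]
      filter_upwards [f.continuous_pt.tendsto u (Q₀.isOpen_core.mem_nhds hQ₀)] with u' hu' Q Q' hQ hQ'
      have a1 := m.exists_restrict_pushed_eq Q Q₀ hQ hQ₀ (hpt u)
      have a2 := m.exists_restrict_pushed_eq Q₀ Q' hu' hQ' (hpt u')
      rw [hnpt] at a1 a2
      exact htrans _ _ _ a1 a2
    · intro x y z _ _ _ h h' Q Q' hQ hQ'
      obtain ⟨Q₀, hQ₀⟩ := exists_niceBox Λ (f.pt y)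
      exact htrans _ _ _ (h Q Q₀ hQ hQ₀) (h' Q₀ Q' hQ₀ hQ')
    · intro x y _ _ h Q Q' hQ hQ'
      obtain ⟨W, hW, hnW, e⟩ := h Q' Q hQ' hQ
      exact ⟨W, hW, hnW, e.symm⟩
  have hX'l : X' ∈ line f.n := by
    change mink n X' = 0
    rw [hn]; exact (normalAt_spec hs').2.1
  rw [f.line_eq] at hX'l
  obtain ⟨u', hu'⟩ := hX'l
  exact key 0 u' Q Q' (by rw [f.pt_zero]; exact hX) (by rw [hu']; exact hX')

theorem FlowBox.exists_mem_core (R : FlowBox Λ) {n : V} (hn : n ∈ R.normals) :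
    ∃ X ∈ R.core, X ∈ Λ.support ∧ normalAt Λ X = n := by
  obtain ⟨s, hs, rfl⟩ := hn
  exact ⟨R.map (R.mid, s), mem_image_of_mem _ ⟨R.mid_mem, R.subset hs⟩,
    R.map_mem_support R.mid_mem_Icc hs, R.normalAt_map R.mid_mem_Icc hs⟩

theorem TransverseMeasure.restrict_pushed_eq (Q Q' : NiceBox Λ) :
    (m.pushed Q.toFlowBox).restrict (Q.normals ∩ Q'.normals) =
      (m.pushed Q'.toFlowBox).restrict (Q.normals ∩ Q'.normals) := by
  have h : ∀ n ∈ Q.normals ∩ Q'.normals, ∃ W : Set V, IsOpen W ∧ n ∈ W ∧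
      (m.pushed Q.toFlowBox).restrict W = (m.pushed Q'.toFlowBox).restrict W := by
    rintro n ⟨hn, hn'⟩
    obtain ⟨X, hX, hs, e⟩ := Q.exists_mem_core hn
    obtain ⟨X', hX', hs', e'⟩ := Q'.exists_mem_core hn'
    have := m.exists_restrict_pushed_eq_of_leaf Q Q' hX hX' hs hs' (e.trans e'.symm)
    rwa [e] at this
  choose! W hW hnW he using h
  obtain ⟨t, hts, htc, hcov⟩ := TopologicalSpace.countable_cover_nhdsWithin
    (s := Q.normals ∩ Q'.normals) (f := W)
    fun n hn => mem_nhdsWithin_of_mem_nhds ((hW n hn).mem_nhds (hnW n hn))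
  have := htc.to_subtype
  rw [biUnion_eq_iUnion] at hcov
  refine Measure.restrict_congr_mono hcov ?_
  exact Measure.restrict_iUnion_congr.2 fun n => he n (hts n.2)

variable (Λ) in
/-- A countable family of flow-boxes which cover the plane. -/
noncomputable def boxes : ℕ → NiceBox Λ := (exists_countable_niceBox Λ).choose

theorem exists_mem_core_boxes (X : Hyp) : ∃ i, X ∈ (boxes Λ i).core :=
  (exists_countable_niceBox Λ).choose_spec X

theorem exists_mem_normals_boxes {n : V} (hn : IsLeafNormal Λ n) (hO : mink n (basePoint Λ) < 0)
    {X : Hyp} (hX : mink n X = 0) : ∃ i, X ∈ (boxes Λ i).core ∧ n ∈ (boxes Λ i).normals := by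
  obtain ⟨i, hi⟩ := exists_mem_core_boxes (Λ := Λ) X
  have hs := hn.mem_support hX
  refine ⟨i, hi, _, (boxes Λ i).coord_snd_mem hi hs, ?_⟩
  rw [(boxes Λ i).normal_coord hi hs, ← eq_normalAt hn hX hO]

theorem FlowBox.normals_subset_iUnion (R : FlowBox Λ) : R.normals ⊆ ⋃ i, (boxes Λ i).normals := by
  rintro _ ⟨s, hs, rfl⟩
  obtain ⟨i, -, hi⟩ := exists_mem_normals_boxes (R.normal_spec hs).1 (R.normal_spec hs).2
    (R.mink_normal_map R.mid_mem_Icc hs)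
  exact mem_iUnion.2 ⟨i, hi⟩

/-- The measure induced by a transverse measure on the set of leaves, represented by their
normal vectors pointing away from the base point. -/
noncomputable def TransverseMeasure.leafMeasure₀ : Measure V :=
  Measure.sum fun i => (m.pushed (boxes Λ i).toFlowBox).restrict
    (disjointed (fun i => (boxes Λ i).normals) i)

theorem measurableSet_disjointed_normals (i : ℕ) :
    MeasurableSet (disjointed (fun i => (boxes Λ i).normals) i) :=
  MeasurableSet.disjointed (fun i => (boxes Λ i).isCompact_normals.isClosed.measurableSet) i

/-- The gluing: on every disjoint piece the measure of the chosen box agrees with that of `Q`, and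
the pieces cover the normals of `Q`. So the choice of `boxes` does not matter. -/
theorem TransverseMeasure.restrict_leafMeasure₀ (Q : NiceBox Λ) :
    m.leafMeasure₀.restrict Q.normals = m.pushed Q.toFlowBox := by
  have hQ : MeasurableSet Q.normals := Q.isCompact_normals.isClosed.measurableSet
  set D := disjointed (fun i => (boxes Λ i).normals)
  have hD : ∀ i, MeasurableSet (D i) := measurableSet_disjointed_normals
  rw [leafMeasure₀, Measure.restrict_sum _ hQ]
  have h1 : ∀ i, ((m.pushed (boxes Λ i).toFlowBox).restrict (D i)).restrict Q.normals =
      (m.pushed Q.toFlowBox).restrict (Q.normals ∩ D i) := fun i => by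
    rw [Measure.restrict_restrict hQ]
    refine Measure.restrict_congr_mono ?_ (m.restrict_pushed_eq (boxes Λ i) Q)
    rintro n ⟨h1, h2⟩
    exact ⟨disjointed_subset (fun i => (boxes Λ i).normals) i h2, h1⟩
  simp only [D] at h1
  simp only [h1]
  rw [← Measure.restrict_iUnion, ← inter_iUnion, iUnion_disjointed]
  · rw [inter_eq_left.2 Q.normals_subset_iUnion]
    exact Measure.restrict_eq_self_of_ae_mem (m.ae_mem_normals _)
  · exact fun i j hij => (disjoint_disjointed _ hij).mono inter_subset_right inter_subset_right
  · exact fun i => hQ.inter (hD i)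

theorem TransverseMeasure.ae_mem_iUnion : ∀ᵐ n ∂m.leafMeasure₀, n ∈ ⋃ i, (boxes Λ i).normals := by
  rw [leafMeasure₀, Measure.ae_sum_iff]
  intro i
  filter_upwards [ae_restrict_of_ae (m.ae_mem_normals (boxes Λ i).toFlowBox)] with n hn
  exact mem_iUnion.2 ⟨i, hn⟩

theorem TransverseMeasure.ae_leafMeasure₀ :
    ∀ᵐ n ∂m.leafMeasure₀, IsLeafNormal Λ n ∧ mink n (basePoint Λ) < 0 := by
  filter_upwards [m.ae_mem_iUnion] with n hn
  obtain ⟨i, s, hs, rfl⟩ := mem_iUnion.1 hn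
  exact (boxes Λ i).normal_spec hs

end Lamination

end LieLam

/-! ### Deck invariance and local finiteness of the measure on leaves -/

namespace LieLam

open Topology Filter Set

namespace Frame

variable (f : Frame)

/-- The time at which the geodesic of a frame passes at (the projection of) a point. -/
noncomputable def time (X : Hyp) : ℝ := Real.arsinh (mink f.e X)

theorem continuous_time : Continuous f.time :=
  Real.continuous_arsinh.comp (Continuous.mink continuous_const continuous_subtype_val)

theorem pt_time {X : Hyp} (h : mink f.n X = 0) : f.pt (f.time X) = X := (f.mem_line h).symm

theorem time_pt (u : ℝ) : f.time (f.pt u) = u := f.pt_injective (f.pt_time (f.pt_mem_line u))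

theorem hdist_eq_abs_time {X Y : Hyp} (hX : mink f.n X = 0) (hY : mink f.n Y = 0) :
    hdist X Y = |f.time X - f.time Y| := by
  conv_lhs => rw [← f.pt_time hX, ← f.pt_time hY]
  exact f.hdist_pt _ _

end Frame

/-- The sign of a normal, fixed by the base point, is not respected by the deck group; after
symmetrization the sign no longer matters. -/
theorem map_add_map_neg_eq {α : Type*} [MeasurableSpace α] {μ : Measure α} {f g : α → V}
    (hf : Measurable f) (hg : Measurable g) (h : ∀ᵐ a ∂μ, g a = f a ∨ g a = -f a) :
    μ.map f + μ.map (fun a => -f a) = μ.map g + μ.map (fun a => -g a) := by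
  have key : ∀ {k : α → V} (hk : Measurable k) {B : Set V} (hB : MeasurableSet B),
      (μ.map k + μ.map (fun a => -k a)) B =
        ∫⁻ a, (B.indicator 1 (k a) + B.indicator 1 (-k a)) ∂μ := by
    intro k hk B hB
    have hi : Measurable (B.indicator (1 : V → ENNReal)) := measurable_one.indicator hB
    rw [lintegral_add_left (f := fun a => B.indicator 1 (k a)) (hi.comp hk), ← lintegral_map hi hk, ← lintegral_map hi (g := fun a => -k a) hk.neg,
      lintegral_indicator_one hB, lintegral_indicator_one hB]
    rfl
  ext B hB
  rw [key hf hB, key hg hB]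
  refine lintegral_congr_ae ?_
  filter_upwards [h] with a ha
  rcases ha with ha | ha
  · rw [ha]
  · rw [ha, neg_neg, add_comm]

theorem measurable_lin (g : SOPlus) : Measurable (lin g) := (continuous_lin g).measurable

section Lamination

variable {π : Type*} [Group π] {S : HypSurface π} {Λ : GeodesicLamination S}

theorem IsLeafNormal.lin {n : V} (h : IsLeafNormal Λ n) (γ : π) : IsLeafNormal Λ (lin (S.σ γ) n) :=
  ⟨by rw [mink_lin, h.1], Λ.line_lin_mem γ h.2⟩

theorem IsLeafNormal.exists_frame {n : V} (h : IsLeafNormal Λ n) : ∃ f : Frame, f.n = n := by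
  obtain ⟨f, hf⟩ := isGeodesicLine_iff.1 (Λ.isGeodesic _ h.2)
  have : f.X ∈ line n := by rw [hf, ← f.pt_zero]; exact f.pt_mem_line 0
  exact ⟨Frame.ofNormal f.X n h.1 this, rfl⟩

theorem image_act_inv_mem {γ : π} {L : Set Hyp} {X : Hyp} (h : act (S.σ γ) X ∈ L) :
    X ∈ act (S.σ γ⁻¹) '' L :=
  ⟨_, h, by rw [map_inv, act_inv_act]⟩

/-- The image of a flow-box under a deck transformation. -/
def FlowBox.translate (γ : π) (R : FlowBox Λ) : FlowBox Λ where
  a := R.a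
  b := R.b
  c := R.c
  d := R.d
  hab := R.hab
  hcd := R.hcd
  F t s := act (S.σ γ) (R.F t s)
  biLipschitz := by
    obtain ⟨K, hK, h⟩ := R.biLipschitz
    refine ⟨K, hK, fun p hp q hq => ⟨?_, fun γ' => ?_⟩⟩
    · rw [hdist_act]; exact (h p hp q hq).1
    · have := (h p hp q hq).2 (γ⁻¹ * γ' * γ)
      rw [map_mul, map_mul, act_mul, act_mul, map_inv, ← hdist_act (S.σ γ), act_act_inv] at this
      exact this
  C := R.C
  isClosed := R.isClosed
  subset := R.subset
  dim_zero := R.dim_zero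
  preimage t ht s hs := by
    rw [← R.preimage t ht s hs]
    constructor
    · rintro ⟨L, hL, h⟩
      exact ⟨_, Λ.invariant γ⁻¹ L hL, image_act_inv_mem h⟩
    · rintro ⟨L, hL, h⟩
      exact ⟨_, Λ.invariant γ L hL, mem_image_of_mem _ h⟩

/-- The image of a flow-box under a deck transformation. -/
def NiceBox.translate (γ : π) (Q : NiceBox Λ) : NiceBox Λ where
  toFlowBox := Q.toFlowBox.translate γ
  isOpen_core := by
    have : (Q.toFlowBox.translate γ).core = actHomeo (S.σ γ) '' Q.core := by
      rw [FlowBox.core, FlowBox.core, image_image]; rfl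
    rw [this]
    exact (actHomeo _).isOpenMap _ Q.isOpen_core
  arc_leaf s hs := by
    obtain ⟨L, hL, h⟩ := Q.arc_leaf s hs
    exact ⟨_, Λ.invariant γ L hL, fun t ht => mem_image_of_mem _ (h t ht)⟩
  leaf_inj s hs s' hs' L hL t ht t' ht' h h' :=
    Q.leaf_inj s hs s' hs' _ (Λ.invariant γ⁻¹ L hL) t ht t' ht' (image_act_inv_mem h)
      (image_act_inv_mem h')

namespace FlowBox

variable (R : FlowBox Λ)

theorem translate_normal (γ : π) {s : ℝ} (hs : s ∈ R.C) :
    (R.translate γ).normal s = lin (S.σ γ) (R.normal s) ∨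
      (R.translate γ).normal s = -lin (S.σ γ) (R.normal s) := by
  have h1 := ((R.normal_spec hs).1.lin γ)
  refine h1.eq_or_eq_neg ((R.translate γ).normal_spec hs).1 (X := (R.translate γ).map (R.mid, s)) ?_
    ((R.translate γ).mink_normal_map (R.mid_mem_Icc) hs)
  change mink _ (lin _ _) = 0
  rw [mink_lin]
  exact R.mink_normal_map R.mid_mem_Icc hs

/-- The normal vectors of both signs of the leaves which cross the flow-box. -/
def symNormals : Set V := R.normals ∪ Neg.neg ⁻¹' R.normals

theorem measurableSet_normals : MeasurableSet R.normals := R.isCompact_normals.isClosed.measurableSet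

theorem measurableSet_symNormals : MeasurableSet R.symNormals :=
  R.measurableSet_normals.union (measurable_neg R.measurableSet_normals)

theorem exists_arc_time {s : ℝ} (hs : s ∈ R.C) {f : Frame}
    (hf : f.n = R.normal s ∨ f.n = -R.normal s) :
    (∀ t ∈ Icc R.a R.b, f.pt (f.time (R.map (t, s))) = R.map (t, s)) ∧
    ContinuousOn (fun t => f.time (R.map (t, s))) (Icc R.a R.b) ∧
    (StrictMonoOn (fun t => f.time (R.map (t, s))) (Icc R.a R.b) ∨
      StrictAntiOn (fun t => f.time (R.map (t, s))) (Icc R.a R.b)) := by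
  have hn : ∀ t ∈ Icc R.a R.b, mink f.n (R.map (t, s)) = 0 := fun t ht => by
    have := R.mink_normal_map ht hs
    rcases hf with hf | hf <;> rw [hf] <;> simp [this]
  have hpt : ∀ t ∈ Icc R.a R.b, f.pt (f.time (R.map (t, s))) = R.map (t, s) := fun t ht =>
    f.pt_time (hn t ht)
  have hcont : ContinuousOn (fun t => f.time (R.map (t, s))) (Icc R.a R.b) :=
    f.continuous_time.comp_continuousOn (R.continuousOn_arc hs)
  have hinj : InjOn (fun t => f.time (R.map (t, s))) (Icc R.a R.b) := by
    intro t ht t' ht' h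
    have h' := congrArg f.pt h
    rw [hpt t ht, hpt t' ht'] at h'
    exact (Prod.ext_iff.1 (R.injOn_map (R.mem_rect ht hs) (R.mem_rect ht' hs) h')).1
  refine ⟨hpt, hcont, ?_⟩
  exact hcont.strictMonoOn_of_injOn_Icc' R.hab.le hinj

/-- The same leaf may return to a general box, but not at nearby heights: two arcs of one leaf whose
midpoints are close overlap in time, against injectivity of the box. -/
theorem exists_separation : ∃ δ > 0, ∀ s ∈ R.C, ∀ s' ∈ R.C, R.normal s = R.normal s' →
    |s - s'| < δ → s = s' := by
  obtain ⟨K, hK, h⟩ := R.biLipschitz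
  have hab := R.hab
  -- An arc reaches at least `K⁻¹ (b - a) / 2` to both sides of its midpoint, and heights closer
  -- than this `δ` bring the midpoints closer than that.
  refine ⟨K⁻¹ * (K⁻¹ * ((R.b - R.a) / 2)), by have : 0 < R.b - R.a := (by linarith); positivity,
    fun s hs s' hs' hn hlt => ?_⟩
  obtain ⟨f, hf⟩ := (R.normal_spec hs).1.exists_frame
  obtain ⟨h1, h2, h3⟩ := R.exists_arc_time hs (Or.inl hf)
  obtain ⟨g1, g2, g3⟩ := R.exists_arc_time hs' (Or.inl (hf.trans hn))
  have hdist1 : ∀ t ∈ Icc R.a R.b, ∀ t' ∈ Icc R.a R.b,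
      K⁻¹ * |t - t'| ≤ |f.time (R.map (t, s)) - f.time (R.map (t', s))| := by
    intro t ht t' ht'
    have := (h (t, s) (R.mem_rect ht hs) (t', s) (R.mem_rect ht' hs)).2 1
    rw [map_one, act_one] at this
    change _ ≤ hdist (R.map (t, s)) (R.map (t', s)) at this
    rw [← h1 t ht, ← h1 t' ht', f.hdist_pt, Prod.dist_eq, dist_self, Real.dist_eq] at this
    exact (mul_le_mul_of_nonneg_left (le_max_left _ _) (inv_pos.2 hK).le).trans this
  have hmid := R.mid_mem_Icc
  have hclose : |f.time (R.map (R.mid, s')) - f.time (R.map (R.mid, s))| <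
      K⁻¹ * ((R.b - R.a) / 2) := by
    have := (h (R.mid, s) (R.mem_rect hmid hs) (R.mid, s') (R.mem_rect hmid hs')).1
    change hdist (R.map (R.mid, s)) (R.map (R.mid, s')) ≤ _ at this
    rw [← h1 _ hmid, ← g1 _ hmid, f.hdist_pt, Prod.dist_eq, dist_self, Real.dist_eq,
      max_eq_right (abs_nonneg _), abs_sub_comm] at this
    refine this.trans_lt ?_
    rw [← lt_inv_mul_iff₀ hK]
    exact hlt
  have ha := hdist1 R.mid hmid R.a (left_mem_Icc.2 hab.le)
  have hb := hdist1 R.b (right_mem_Icc.2 hab.le) R.mid hmid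
  rw [show R.mid - R.a = (R.b - R.a) / 2 by simp only [mid]; ring, abs_of_pos (by linarith)] at ha
  rw [show R.b - R.mid = (R.b - R.a) / 2 by simp only [mid]; ring, abs_of_pos (by linarith)] at hb
  have hmem : f.time (R.map (R.mid, s')) ∈ (fun t => f.time (R.map (t, s))) '' Icc R.a R.b := by
    have c1 := abs_lt.1 hclose
    have m1 := R.mid_mem
    rcases h3 with h3 | h3
    · have e1 := h3 (left_mem_Icc.2 hab.le) hmid m1.1
      have e2 := h3 hmid (right_mem_Icc.2 hab.le) m1.2
      simp only at e1 e2
      rw [abs_of_pos (by linarith)] at ha hb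
      exact intermediate_value_Icc hab.le h2 ⟨by linarith, by linarith⟩
    · have e1 := h3 (left_mem_Icc.2 hab.le) hmid m1.1
      have e2 := h3 hmid (right_mem_Icc.2 hab.le) m1.2
      simp only at e1 e2
      rw [abs_of_neg (by linarith)] at ha hb
      exact intermediate_value_Icc' hab.le h2 ⟨by linarith, by linarith⟩
  obtain ⟨t, ht, e⟩ := hmem
  have e' := congrArg f.pt e
  simp only at e'
  rw [h1 t ht, g1 _ hmid] at e'
  exact (Prod.ext_iff.1 (R.injOn_map (R.mem_rect ht hs) (R.mem_rect hmid hs') e')).2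

end FlowBox

namespace TransverseMeasure

variable (m : TransverseMeasure Λ)

/-- Compatibility with the identity as transverse map and `γ` as deck transformation. -/
theorem μ_translate (γ : π) (R : FlowBox Λ) : m.μ (R.translate γ) = m.μ R := by
  have key : ∀ (R' : FlowBox Λ) {B : Set ℝ}, m.μ R' B = m.μ R' (R'.C ∩ B) := fun R' B => by
    have h : ∀ᵐ s ∂(m.μ R'), s ∈ R'.C := m.supported R'
    refine measure_congr ?_
    filter_upwards [h] with s hs
    exact propext ⟨fun h' => ⟨hs, h'⟩, fun h' => h'.2⟩
  ext B hB
  rw [key, key R]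
  have h := m.compatible (R.translate γ) R γ (R.C ∩ B) id (R.isClosed.measurableSet.inter hB)
    inter_subset_left continuousOn_id (injOn_id _) fun s hs =>
      ⟨hs.1, R.mid, R.mid_mem, R.mid, R.mid_mem, rfl⟩
  rw [image_id] at h
  exact h

/-- The measure induced by a transverse measure on the normal vectors of the leaves. -/
noncomputable def leafMeasure : Measure V := m.leafMeasure₀ + m.leafMeasure₀.map Neg.neg

instance : SFinite m.leafMeasure₀ := by unfold leafMeasure₀; infer_instance

instance : SFinite m.leafMeasure := by unfold leafMeasure; infer_instance

theorem ae_leafMeasure : ∀ᵐ n ∂m.leafMeasure, IsLeafNormal Λ n := by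
  rw [leafMeasure, ae_add_measure_iff]
  refine ⟨m.ae_leafMeasure₀.mono fun n hn => hn.1, ?_⟩
  refine (MeasurableEquiv.neg V).measurableEmbedding.ae_map_iff.2 ?_
  exact m.ae_leafMeasure₀.mono fun n hn => hn.1.neg

theorem restrict_leafMeasure (Q : NiceBox Λ) : m.leafMeasure.restrict Q.symNormals =
    (m.μ Q.toFlowBox).map Q.normal + (m.μ Q.toFlowBox).map (fun s => -Q.normal s) := by
  have hneg : Neg.neg ⁻¹' Q.symNormals = Q.symNormals := by
    ext n; simp [FlowBox.symNormals, or_comm]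
  have h0 : m.leafMeasure₀.restrict Q.symNormals = m.pushed Q.toFlowBox := by
    rw [← m.restrict_leafMeasure₀]
    refine Measure.restrict_congr_set ?_
    filter_upwards [m.ae_leafMeasure₀] with n hn
    refine propext ⟨fun h => ?_, fun h => Or.inl h⟩
    rcases h with h | ⟨s, hs, h⟩
    · exact h
    · have := (Q.normal_spec hs).2
      rw [h, mink_neg_left] at this
      linarith [hn.2]
  rw [leafMeasure, Measure.restrict_add, Measure.restrict_map measurable_neg Q.measurableSet_symNormals,
    hneg, h0, pushed, Measure.map_map measurable_neg Q.measurable_normal]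
  rfl

theorem mem_symNormals {n : V} (hn : IsLeafNormal Λ n) {X : Hyp} (hX : mink n X = 0) :
    ∃ i, X ∈ (boxes Λ i).core ∧ n ∈ (boxes Λ i).symNormals := by
  rcases lt_or_gt_of_ne hn.mink_basePoint_ne with h | h
  · obtain ⟨i, h1, h2⟩ := exists_mem_normals_boxes hn h hX
    exact ⟨i, h1, Or.inl h2⟩
  · obtain ⟨i, h1, h2⟩ := exists_mem_normals_boxes hn.neg (by simpa using h) (by simpa using hX)
    exact ⟨i, h1, Or.inr h2⟩

/-- On the normals of a translated box both sides are symmetrized push-forwards of the same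
transverse measure, by normal maps that agree up to sign. Countably many such boxes carry both
measures. -/
theorem map_lin_leafMeasure (γ : π) : m.leafMeasure.map (lin (S.σ γ)) = m.leafMeasure := by
  have hm := measurable_lin (S.σ γ)
  set E : ℕ → Set V := fun i => ((boxes Λ i).translate γ).symNormals with hE
  have hpre : ∀ i, lin (S.σ γ) ⁻¹' E i = (boxes Λ i).symNormals := by
    intro i
    have hinj : ∀ v w, lin (S.σ γ) v = lin (S.σ γ) w → v = w := fun v w h => by
      rw [← lin_inv_lin (S.σ γ) v, h, lin_inv_lin]
    ext n
    simp only [hE, FlowBox.symNormals, mem_preimage, mem_union, FlowBox.normals, mem_image]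
    constructor
    · rintro (⟨s, hs, h⟩ | ⟨s, hs, h⟩)
      · rcases (boxes Λ i).translate_normal γ hs with h' | h'
        · exact Or.inl ⟨s, hs, hinj _ _ (h'.symm.trans h)⟩
        · refine Or.inr ⟨s, hs, hinj _ _ ?_⟩
          rw [lin_neg, ← h]; exact (neg_eq_iff_eq_neg.2 h').symm
      · rcases (boxes Λ i).translate_normal γ hs with h' | h'
        · refine Or.inr ⟨s, hs, hinj _ _ ?_⟩
          rw [lin_neg, ← h]; exact h'.symm
        · refine Or.inl ⟨s, hs, hinj _ _ ?_⟩
          rw [← neg_inj, ← h]; exact h'.symm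
    · rintro (⟨s, hs, rfl⟩ | ⟨s, hs, h⟩)
      · rcases (boxes Λ i).translate_normal γ hs with h' | h'
        · exact Or.inl ⟨s, hs, h'⟩
        · exact Or.inr ⟨s, hs, h'⟩
      · have e : n = -(boxes Λ i).normal s := by rw [h, neg_neg]
        rw [e, lin_neg]
        rcases (boxes Λ i).translate_normal γ hs with h' | h'
        · exact Or.inr ⟨s, hs, by rw [neg_neg]; exact h'⟩
        · exact Or.inl ⟨s, hs, h'⟩
  have hae : ∀ᵐ n ∂m.leafMeasure, n ∈ ⋃ i, E i := by
    filter_upwards [m.ae_leafMeasure] with n hn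
    have h1 := hn.lin γ⁻¹
    obtain ⟨f, hf⟩ := h1.exists_frame
    obtain ⟨i, -, hi⟩ := mem_symNormals h1 (X := f.X) (by rw [← hf, f.nX])
    rw [← hpre, mem_preimage, map_inv, lin_lin_inv] at hi
    exact mem_iUnion.2 ⟨i, hi⟩
  have hae' : ∀ᵐ n ∂m.leafMeasure.map (lin (S.σ γ)), n ∈ ⋃ i, E i := by
    refine (ae_map_iff hm.aemeasurable
      (MeasurableSet.iUnion fun i => ((boxes Λ i).translate γ).measurableSet_symNormals)).2 ?_
    filter_upwards [m.ae_leafMeasure] with n hn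
    obtain ⟨f, hf⟩ := hn.exists_frame
    obtain ⟨i, -, hi⟩ := mem_symNormals hn (X := f.X) (by rw [← hf, f.nX])
    rw [← hpre] at hi
    exact mem_iUnion.2 ⟨i, hi⟩
  refine (Measure.restrict_eq_self_of_ae_mem hae').symm.trans
    (Eq.trans ?_ (Measure.restrict_eq_self_of_ae_mem hae))
  refine Measure.restrict_iUnion_congr.2 fun i => ?_
  have hMS := ((boxes Λ i).translate γ).measurableSet_symNormals
  have hneg : Measurable fun s => -(boxes Λ i).normal s := (boxes Λ i).measurable_normal.neg
  rw [Measure.restrict_map hm hMS, m.restrict_leafMeasure, hpre, m.restrict_leafMeasure,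
    Measure.map_add _ _ hm, Measure.map_map hm (boxes Λ i).measurable_normal,
    Measure.map_map hm hneg]
  have h1 : m.μ ((boxes Λ i).translate γ).toFlowBox = m.μ (boxes Λ i).toFlowBox := m.μ_translate γ _
  rw [h1]
  have h2 : lin (S.σ γ) ∘ (fun s => -(boxes Λ i).normal s) =
      fun s => -(lin (S.σ γ) ∘ (boxes Λ i).normal) s := by
    ext1 s; simp [lin_neg]
  rw [h2]
  refine map_add_map_neg_eq (hm.comp (boxes Λ i).measurable_normal)
    ((boxes Λ i).translate γ).measurable_normal ?_
  have h3 : ∀ᵐ s ∂(m.μ (boxes Λ i).toFlowBox), s ∈ (boxes Λ i).C := m.supported _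
  filter_upwards [h3] with s hs
  exact (boxes Λ i).translate_normal γ hs

theorem leafMeasure_lt_top {K : Set Hyp} (hK : IsCompact K) :
    m.leafMeasure {n | ∃ X ∈ K, mink n X = 0} < ⊤ := by
  obtain ⟨t, ht⟩ := hK.elim_finite_subcover (fun i => (boxes Λ i).core)
    (fun i => (boxes Λ i).isOpen_core) fun X _ => mem_iUnion.2 (exists_mem_core_boxes X)
  have h1 : m.leafMeasure {n | ∃ X ∈ K, mink n X = 0} ≤
      m.leafMeasure (⋃ i ∈ t, (boxes Λ i).symNormals) := by
    refine measure_mono_ae ?_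
    filter_upwards [m.ae_leafMeasure] with n hn
    rintro ⟨X, hX, h0⟩
    obtain ⟨i, hi, hXi⟩ := mem_iUnion₂.1 (ht hX)
    have hs := hn.mem_support h0
    refine mem_iUnion₂.2 ⟨i, hi, ?_⟩
    have hc := (boxes Λ i).coord_snd_mem hXi hs
    rcases eq_or_eq_neg_normalAt hn h0 with h | h
    · exact Or.inl ⟨_, hc, by rw [(boxes Λ i).normal_coord hXi hs, h]⟩
    · exact Or.inr ⟨_, hc, by rw [(boxes Λ i).normal_coord hXi hs, h, neg_neg]⟩
  refine h1.trans_lt ((measure_biUnion_finset_le _ _).trans_lt (ENNReal.sum_lt_top.2 fun i _ => ?_))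
  have hneg : Measurable fun s => -(boxes Λ i).normal s := (boxes Λ i).measurable_normal.neg
  rw [← Measure.restrict_apply_self, m.restrict_leafMeasure, Measure.add_apply,
    Measure.map_apply (boxes Λ i).measurable_normal (boxes Λ i).measurableSet_symNormals,
    Measure.map_apply hneg (boxes Λ i).measurableSet_symNormals]
  exact ENNReal.add_lt_top.2 ⟨measure_lt_top _ _, measure_lt_top _ _⟩

/-- By `exists_separation` the normal map of any flow-box is injective on short pieces of `C`; there
it transports `μ` to the leaf space, which will turn box integrals into leaf integrals. -/
theorem exists_map_normal_eq (R : FlowBox Λ) {s₀ : ℝ} (hs : s₀ ∈ R.C) :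
    ∃ ε > 0, ∀ A : Set ℝ, MeasurableSet A → A ⊆ R.C → A ⊆ Metric.ball s₀ ε → InjOn R.normal A ∧
      ((m.μ R).restrict A).map R.normal = m.leafMeasure₀.restrict (R.normal '' A) := by
  obtain ⟨Q, hQ⟩ := exists_niceBox Λ (R.map (R.mid, s₀))
  obtain ⟨ε₁, hε₁, h1⟩ := m.exists_measure_eq_pushed R Q R.mid_mem hs hQ
  obtain ⟨δ, hδ, h2⟩ := R.exists_separation
  refine ⟨min ε₁ (δ / 2), by positivity, fun A hA hAC hAε => ?_⟩
  have hinj : InjOn R.normal A := by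
    intro s hs s' hs' e
    refine h2 s (hAC hs) s' (hAC hs') e ?_
    have a1 := (Metric.mem_ball.1 (hAε hs)).trans_le (min_le_right _ _)
    have a2 := (Metric.mem_ball.1 (hAε hs')).trans_le (min_le_right _ _)
    rw [← Real.dist_eq]
    have := dist_triangle_right s s' s₀
    linarith
  refine ⟨hinj, Measure.ext fun B hB => ?_⟩
  rw [Measure.map_apply R.measurable_normal hB, Measure.restrict_apply (R.measurable_normal hB),
    Measure.restrict_apply hB, inter_comm, inter_comm B]
  have hsub : A ∩ R.normal ⁻¹' B ⊆ A := inter_subset_left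
  have hmeas := hA.inter (R.measurable_normal hB)
  obtain ⟨h3, h4⟩ := h1 _ hmeas (hsub.trans hAC)
    ((hsub.trans hAε).trans (Metric.ball_subset_ball (min_le_left _ _))) (hinj.mono hsub)
  rw [h4, ← image_inter_preimage, ← m.restrict_leafMeasure₀ Q, Measure.restrict_apply
    (R.measurableSet_image_normal hmeas (hsub.trans hAC) (hinj.mono hsub)), inter_eq_left.2 h3]

end TransverseMeasure

end Lamination

end LieLam

/-! ### Constancy of `B` along leaves; integration over leaves; unfolding -/

namespace LieLam

open Topology Filter Set

theorem mink_right_ext {v w : V} (h : ∀ c, mink v c = mink w c) : v = w := by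
  have h0 := h ![1, 0, 0]
  have h1 := h ![0, 1, 0]
  have h2 := h ![0, 0, 1]
  simp [mink_eq] at h0 h1 h2
  exact V.ext3 h0 h1 h2

theorem mink_lx_eq_det (a b c : V) : mink (lx a b) c = (Matrix.of ![a, b, c]).det := by
  simp [Matrix.det_fin_three, mink_eq, lx]; ring

/-- The cross product is determined by the determinant, and elements of the group have determinant
one. -/
theorem lx_lin (g : SOPlus) (a b : V) : lx (lin g a) (lin g b) = lin g (lx a b) := by
  refine mink_right_ext fun c => ?_
  obtain ⟨c, rfl⟩ : ∃ c', lin g c' = c := ⟨lin g⁻¹ c, lin_lin_inv g c⟩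
  rw [mink_lin, mink_lx_eq_det, mink_lx_eq_det]
  have : (Matrix.of ![lin g a, lin g b, lin g c] : Mat) =
      Matrix.of ![a, b, c] * ((g : Matrix.SpecialLinearGroup (Fin 3) ℝ) : Mat)ᵀ := by
    ext i j
    fin_cases i <;>
      simp [lin, Matrix.mul_apply, Matrix.mulVec, dotProduct, mul_comm]
  rw [this, Matrix.det_mul, Matrix.det_transpose, Matrix.SpecialLinearGroup.det_coe, mul_one]

/-- The element of `𝔤` which acts as the cross product with `n`. -/
def dual (n : V) : Mat := Matrix.of fun i j => lx n (Pi.single j 1) i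

theorem lx_add_right (a b c : V) : lx a (b + c) = lx a b + lx a c :=
  V.ext3 (by simp [lx]; ring) (by simp [lx]; ring) (by simp [lx]; ring)

theorem lx_add_left (a b c : V) : lx (a + b) c = lx a c + lx b c :=
  V.ext3 (by simp [lx]; ring) (by simp [lx]; ring) (by simp [lx]; ring)

theorem lx_smul_right (r : ℝ) (a b : V) : lx a (r • b) = r • lx a b :=
  V.ext3 (by simp [lx]; ring) (by simp [lx]; ring) (by simp [lx]; ring)

theorem lx_smul_left (r : ℝ) (a b : V) : lx (r • a) b = r • lx a b :=
  V.ext3 (by simp [lx]; ring) (by simp [lx]; ring) (by simp [lx]; ring)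

theorem lx_neg_left (a b : V) : lx (-a) b = -lx a b := by
  rw [← neg_one_smul ℝ a, lx_smul_left, neg_one_smul]

theorem lx_comm (a b : V) : lx a b = -lx b a :=
  V.ext3 (by simp [lx]; ring) (by simp [lx]; ring) (by simp [lx]; ring)

theorem lx_self (a : V) : lx a a = 0 :=
  V.ext3 (by simp [lx]; ring) (by simp [lx]; ring) (by simp [lx]; ring)

theorem continuous_lx : Continuous fun p : V × V => lx p.1 p.2 := by
  unfold lx
  refine continuous_pi fun i => ?_
  fin_cases i <;> simp <;> fun_prop

theorem dual_mulVec (n v : V) : dual n *ᵥ v = lx n v := by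
  refine V.ext3 ?_ ?_ ?_ <;>
    simp [dual, lx, Matrix.mulVec, dotProduct, Fin.sum_univ_three, Pi.single_apply] <;> ring

theorem dual_add (a b : V) : dual (a + b) = dual a + dual b :=
  Mat.ext_mulVec fun v => by rw [Matrix.add_mulVec, dual_mulVec, dual_mulVec, dual_mulVec, lx_add_left]

theorem dual_smul (r : ℝ) (a : V) : dual (r • a) = r • dual a :=
  Mat.ext_mulVec fun v => by rw [Matrix.smul_mulVec, dual_mulVec, dual_mulVec, lx_smul_left]

theorem dual_mem (n : V) : dual n ∈ so21 := by
  rw [mem_so21_iff]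
  intro v w
  rw [dual_mulVec, dual_mulVec]
  simp [mink_eq, lx]; ring

theorem Ad_dual (g : SOPlus) (n : V) : Ad g (dual n) = dual (lin g n) :=
  Mat.ext_mulVec fun v => by
    rw [Ad_mulVec, dual_mulVec, dual_mulVec, ← lx_lin, lin_lin_inv]

theorem Frame.lx_n_lx {f : Frame} (h : f.e = lx f.n f.X) : lx f.n f.e = f.X := by
  rw [h, lx_lx, f.nn, f.nX]; simp

/-- The key identity: with `e = n × X` both sides exchange `X` and `e` and kill `n`. So `B = e × X`
depends on the leaf and its direction, but not on the point. -/
theorem cross_lx_eq_dual {n : V} (hn : mink n n = 1) {X : Hyp} (hX : mink n X = 0) :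
    cross (lx n X) X = dual n := by
  let f := Frame.ofNormal X n hn hX
  have he : f.e = lx f.n f.X := rfl
  refine Mat.ext_mulVec fun v => ?_
  rw [cross_mulVec, dual_mulVec]
  change mink f.e v • (f.X : V) - mink f.X v • f.e = lx f.n v
  conv_rhs => rw [f.expand v]
  rw [lx_add_right, lx_add_right, lx_smul_right, lx_smul_right, lx_smul_right, f.lx_n_lx he, ← he,
    lx_self, smul_zero, add_zero, mink_comm v, mink_comm v, neg_smul]
  abel

/-- Arc-length parametrizations of the same directed geodesic differ by a translation of time, so
integrals along leaves do not depend on the starting point. -/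
theorem Frame.exists_shift {f g : Frame} (hn : g.n = f.n) (hf : f.e = lx f.n f.X)
    (hg : g.e = lx g.n g.X) : ∃ c : ℝ, ∀ u, g.pt u = f.pt (c + u) := by
  have hX : g.X = f.pt (f.time g.X) := (f.pt_time (by rw [← hn, g.nX])).symm
  refine ⟨f.time g.X, fun u => ?_⟩
  generalize f.time g.X = c at hX
  rw [← f.move_pt]
  refine Subtype.ext ?_
  have he : g.e = f.vel c := by
    rw [hg, hn, hX]
    change lx f.n (f.vec c) = f.vel c
    rw [vec, vel, lx_add_right, lx_smul_right, lx_smul_right, ← hf, f.lx_n_lx hf, add_comm]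
  change Real.cosh u • (g.X : V) + Real.sinh u • g.e = Real.cosh u • ((f.pt c : Hyp) : V) + Real.sinh u • f.vel c
  rw [he, ← hX]

section Foot

variable (O : Hyp)

/-- The point of the geodesic with normal vector `n` which is closest to `O`. -/
noncomputable def foot (n : V) : V := (√(1 + mink n O ^ 2))⁻¹ • ((O : V) - mink n O • n)

/-- The geodesic with normal vector `n`, parametrized by arc length starting at the foot of `O`. -/
noncomputable def leafVec (n : V) (u : ℝ) : V :=
  Real.cosh u • foot O n + Real.sinh u • lx n (foot O n)

/-- The geodesic with normal vector `n`, parametrized by arc length starting at the foot of `O`. -/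
noncomputable def leafPt (n : V) (u : ℝ) : Hyp := chart (crd (leafVec O n u))

theorem continuous_foot : Continuous (foot O) := by
  have h : Continuous fun n : V => mink n O := Continuous.mink continuous_id continuous_const
  have h2 : Continuous fun n : V => (O : V) - mink n O • n := continuous_const.sub (h.smul continuous_id)
  have h3 : Continuous fun n : V => (√(1 + mink n O ^ 2))⁻¹ :=
    (Real.continuous_sqrt.comp (continuous_const.add (h.pow 2))).inv₀ fun n =>
      (Real.sqrt_pos.2 (show (0 : ℝ) < 1 + mink n O ^ 2 by positivity)).ne'
  exact h3.smul h2

/-- Passing through the chart defines `leafPt` for every `n`, unit vector or not; joint continuity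
is then unconditional and gives measurability on the whole product. -/
theorem continuous_leafPt : Continuous fun z : V × ℝ => leafPt O z.1 z.2 := by
  refine continuous_chart.comp (contDiff_crd.continuous.comp ?_)
  have h1 : Continuous fun z : V × ℝ => foot O z.1 := (continuous_foot O).comp continuous_fst
  have h2 : Continuous fun z : V × ℝ => lx z.1 (foot O z.1) :=
    continuous_lx.comp (continuous_fst.prodMk h1)
  exact ((Real.continuous_cosh.comp continuous_snd).smul h1).add
    ((Real.continuous_sinh.comp continuous_snd).smul h2)

variable {O}

theorem mink_foot {n : V} (hn : mink n n = 1) :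
    mink (foot O n) (foot O n) = -1 ∧ mink n (foot O n) = 0 ∧
      mink (foot O n) O = -√(1 + mink n O ^ 2) := by
  have hp : 0 < 1 + mink n O ^ 2 := by positivity
  have hs := Real.mul_self_sqrt hp.le
  have hs0 : √(1 + mink n O ^ 2) ≠ 0 := (Real.sqrt_pos.2 hp).ne'
  have hO := O.mink_self
  have hc := mink_comm O n
  refine ⟨?_, ?_, ?_⟩
  · simp only [foot, mink_smul_left, mink_smul_right, mink_sub_left, mink_sub_right, hn, hO, hc]
    have hi : (√(1 + mink n O ^ 2))⁻¹ * (√(1 + mink n O ^ 2))⁻¹ * (1 + mink n O ^ 2) = 1 := by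
      rw [← mul_inv, hs, inv_mul_cancel₀ hp.ne']
    linear_combination -hi
  · simp only [foot, mink_smul_right, mink_sub_right, hn]; ring
  · simp only [foot, mink_smul_left, mink_sub_left, hO]
    rw [inv_mul_eq_iff_eq_mul₀ hs0, mul_neg, hs]; ring

/-- The frame at the foot of `O` on the geodesic with normal vector `n`. -/
noncomputable def footFrame (O : Hyp) (n : V) (hn : mink n n = 1) : Frame :=
  Frame.ofNormal ⟨foot O n, (mink_foot hn).1, one_le_of_mink_neg O (mink_foot hn).1 (by
    rw [mink_comm, (mink_foot hn).2.2]; simp)⟩ n hn (mink_foot hn).2.1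

theorem leafPt_eq {n : V} (hn : mink n n = 1) (u : ℝ) : leafPt O n u = (footFrame O n hn).pt u :=
  chart_crd ((footFrame O n hn).pt u)

theorem mink_leafPt {n : V} (hn : mink n n = 1) (u : ℝ) : mink n (leafPt O n u) = 0 := by
  rw [leafPt_eq hn]; exact (footFrame O n hn).pt_mem_line u

/-- With the foot of `O` as origin, `cosh` of the distance from `O` at time `u` is `cosh u · √(1 +
(n, O)²) ≥ |u|`. So all leaves leave a compact set within a common time. -/
theorem abs_le_mink_leafPt {n : V} (hn : mink n n = 1) (u : ℝ) :
    |u| ≤ -mink (leafPt O n u) O := by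
  rw [leafPt_eq hn, Frame.coe_pt, mink_comm, Frame.mink_vec]
  have h1 : mink O (footFrame O n hn).X = -√(1 + mink n O ^ 2) := by
    rw [mink_comm]; exact (mink_foot hn).2.2
  have h2 : mink O (footFrame O n hn).e = 0 := by
    change mink O (lx n (foot O n)) = 0
    simp [mink_eq, foot, lx]
    ring
  rw [h1, h2]
  have h3 : 1 ≤ √(1 + mink n O ^ 2) := by rw [Real.one_le_sqrt]; nlinarith [sq_nonneg (mink n O)]
  have h4 := Real.self_le_sinh_iff.2 (abs_nonneg u)
  have h5 := Real.sinh_lt_cosh |u|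
  rw [Real.cosh_abs] at h5
  nlinarith [Real.one_le_cosh u]

end Foot

section Lamination

variable {π : Type*} [Group π] {S : HypSurface π} {Λ : GeodesicLamination S}

/-- Functions of a point and a normal vector which can be integrated along the leaves. -/
structure IsLeafKernel (g : Hyp → V → ℝ) : Prop where
  measurable : Measurable (Function.uncurry g)
  supp : ∃ K, IsCompact K ∧ ∀ X ∉ K, ∀ n, g X n = 0
  bdd : ∃ B, ∀ (X : Hyp) (n : V), mink n n = 1 → mink n X = 0 → |g X n| ≤ B

namespace TransverseMeasure

variable (m : TransverseMeasure Λ)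

/-- The integral along the leaves of a function of a point and a normal vector. -/
noncomputable def leafIntegral (g : Hyp → V → ℝ) : ℝ :=
  2⁻¹ * ∫ z : V × ℝ, g (leafPt (basePoint Λ) z.1 z.2) z.1 ∂(m.leafMeasure.prod volume)

theorem ae_prod {p : V → Prop} (h : ∀ᵐ n ∂m.leafMeasure, p n) :
    ∀ᵐ z : V × ℝ ∂(m.leafMeasure.prod volume), p z.1 :=
  Measure.quasiMeasurePreserving_fst.ae h

theorem ae_prod_isLeafNormal : ∀ᵐ z : V × ℝ ∂(m.leafMeasure.prod volume), IsLeafNormal Λ z.1 :=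
  m.ae_prod m.ae_leafMeasure

theorem leafIntegral_congr {g h : Hyp → V → ℝ}
    (hgh : ∀ (X : Hyp) (n : V), IsLeafNormal Λ n → mink n X = 0 → g X n = h X n) :
    m.leafIntegral g = m.leafIntegral h := by
  rw [leafIntegral, leafIntegral]
  congr 1
  refine integral_congr_ae ?_
  filter_upwards [m.ae_prod_isLeafNormal] with z hz
  exact hgh _ _ hz (mink_leafPt hz.1 _)

/-- Only leaves meeting `K` and a bounded range of times contribute, a set of finite measure. `D`
depends on `K` alone, as is needed for bounded variation and for finite mass. -/
theorem exists_integrable_bound {K : Set Hyp} (hK : IsCompact K) :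
    ∃ D : ℝ, 0 ≤ D ∧ ∀ (g : Hyp → V → ℝ) (B : ℝ), 0 ≤ B → Measurable (Function.uncurry g) →
      (∀ X ∉ K, ∀ n, g X n = 0) →
      (∀ (X : Hyp) (n : V), mink n n = 1 → mink n X = 0 → |g X n| ≤ B) →
      Integrable (fun z : V × ℝ => g (leafPt (basePoint Λ) z.1 z.2) z.1)
        (m.leafMeasure.prod volume) ∧ |m.leafIntegral g| ≤ D * B := by
  set O := basePoint Λ
  obtain ⟨c, hc⟩ : ∃ c : ℝ, ∀ X ∈ K, -mink X O ≤ c := by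
    have hcont : Continuous fun X : Hyp => -mink X O :=
      (Continuous.mink continuous_subtype_val continuous_const).neg
    obtain ⟨c, hc⟩ := (hK.image hcont).bddAbove
    exact ⟨c, fun X hX => hc ⟨X, hX, rfl⟩⟩
  set E := toMeasurable m.leafMeasure {n | ∃ X ∈ K, mink n X = 0}
  have hE : MeasurableSet E := measurableSet_toMeasurable _ _
  have hE' : m.leafMeasure E < ⊤ := by
    rw [measure_toMeasurable]; exact m.leafMeasure_lt_top hK
  have hfin : (m.leafMeasure.prod volume) (E ×ˢ Icc (-c) c) < ⊤ := by
    rw [Measure.prod_prod]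
    exact ENNReal.mul_lt_top hE' measure_Icc_lt_top
  set D₀ := (m.leafMeasure.prod volume).real (E ×ˢ Icc (-c) c)
  refine ⟨2⁻¹ * D₀, by positivity, fun g B hB hg hgK hgB => ?_⟩
  have hmeas : MeasurableSet (E ×ˢ Icc (-c) c) := hE.prod measurableSet_Icc
  have hbi : Integrable ((E ×ˢ Icc (-c) c).indicator fun _ => B) (m.leafMeasure.prod volume) :=
    (integrable_indicator_iff hmeas).2 (integrableOn_const hfin.ne)
  have hbound : ∀ᵐ z : V × ℝ ∂(m.leafMeasure.prod volume),
      ‖g (leafPt O z.1 z.2) z.1‖ ≤ (E ×ˢ Icc (-c) c).indicator (fun _ => B) z := by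
    filter_upwards [m.ae_prod_isLeafNormal] with z hz
    by_cases hX : leafPt O z.1 z.2 ∈ K
    · rw [indicator_of_mem]
      · exact hgB _ _ hz.1 (mink_leafPt hz.1 _)
      · refine ⟨subset_toMeasurable _ _ ⟨_, hX, mink_leafPt hz.1 _⟩, ?_⟩
        exact abs_le.1 ((abs_le_mink_leafPt hz.1 _).trans (hc _ hX))
    · rw [hgK _ hX, norm_zero]
      exact indicator_nonneg (fun _ _ => hB) _
  have hmg : AEStronglyMeasurable (fun z : V × ℝ => g (leafPt O z.1 z.2) z.1)
      (m.leafMeasure.prod volume) :=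
    (hg.comp ((continuous_leafPt O).measurable.prodMk measurable_fst)).aestronglyMeasurable
  refine ⟨hbi.mono' hmg hbound, ?_⟩
  rw [leafIntegral, abs_mul, abs_of_pos (by norm_num : (0 : ℝ) < 2⁻¹), mul_assoc]
  refine mul_le_mul_of_nonneg_left ?_ (by norm_num)
  refine (norm_integral_le_of_norm_le hbi hbound).trans ?_
  rw [integral_indicator hmeas, setIntegral_const, smul_eq_mul]

end TransverseMeasure

namespace IsLeafKernel

variable {g h : Hyp → V → ℝ}

theorem integrable (hg : IsLeafKernel g) (m : TransverseMeasure Λ) :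
    Integrable (fun z : V × ℝ => g (leafPt (basePoint Λ) z.1 z.2) z.1)
      (m.leafMeasure.prod volume) := by
  obtain ⟨K, hK, hgK⟩ := hg.supp
  obtain ⟨B, hB⟩ := hg.bdd
  obtain ⟨D, -, hD⟩ := m.exists_integrable_bound hK
  exact (hD g |B| (abs_nonneg _) hg.measurable hgK
    fun X n h1 h2 => (hB X n h1 h2).trans (le_abs_self _)).1

theorem mul (hg : IsLeafKernel g) {b : Hyp → ℝ} (hb : Measurable b) {B' : ℝ}
    (hB' : ∀ X, |b X| ≤ B') : IsLeafKernel fun X n => b X * g X n := by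
  obtain ⟨K, hK, hgK⟩ := hg.supp
  obtain ⟨B, hB⟩ := hg.bdd
  refine ⟨(hb.comp measurable_fst).mul hg.measurable, ⟨K, hK, fun X hX n => ?_⟩, B' * |B|,
    fun X n h1 h2 => ?_⟩
  · rw [hgK X hX, mul_zero]
  · rw [abs_mul]
    exact mul_le_mul (hB' X) ((hB X n h1 h2).trans (le_abs_self _)) (abs_nonneg _)
      ((abs_nonneg _).trans (hB' X))

theorem indicator_of_continuous {g : Hyp → V → ℝ} (hc : Continuous (Function.uncurry g)) {F K : Set Hyp}
    (hF : MeasurableSet F) (hK : IsCompact K) (hFK : F ⊆ K) :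
    IsLeafKernel fun X n => F.indicator (fun X => g X n) X := by
  refine ⟨?_, ⟨K, hK, fun X hX n => indicator_of_notMem (fun h => hX (hFK h)) _⟩, ?_⟩
  · exact hc.measurable.indicator (measurable_fst hF)
  obtain ⟨c, hc1, hcK⟩ := exists_two_le_of_isCompact hK
  have hcpt : IsCompact (K ×ˢ Metric.closedBall (0 : V) c) := hK.prod (isCompact_closedBall _ _)
  obtain ⟨B, hB⟩ := (hcpt.image (continuous_abs.comp hc)).bddAbove
  refine ⟨max B 0, fun X n h1 h2 => ?_⟩
  by_cases hX : X ∈ F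
  · rw [indicator_of_mem hX]
    refine le_trans (hB ⟨(X, n), ⟨hFK hX, ?_⟩, rfl⟩) (le_max_left _ _)
    have := norm_le_of_orthogonal X h2
    rw [h1, Real.sqrt_one, mul_one] at this
    rw [mem_closedBall_zero_iff]
    exact this.trans (hcK X (hFK hX))
  · rw [indicator_of_notMem hX, abs_zero]; exact le_max_right _ _

theorem of_continuous {g : Hyp → V → ℝ} (hc : Continuous (Function.uncurry g)) {K : Set Hyp}
    (hK : IsCompact K) (hgK : ∀ X ∉ K, ∀ n, g X n = 0) : IsLeafKernel g := by
  have h := indicator_of_continuous hc hK.isClosed.measurableSet hK Subset.rfl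
  convert h using 3 with X n
  by_cases hX : X ∈ K
  · rw [indicator_of_mem hX]
  · rw [indicator_of_notMem hX, hgK X hX]

theorem comp_act (hg : IsLeafKernel g) (γ : π) :
    IsLeafKernel fun X n => g (act (S.σ γ) X) (lin (S.σ γ) n) := by
  obtain ⟨K, hK, hgK⟩ := hg.supp
  obtain ⟨B, hB⟩ := hg.bdd
  refine ⟨hg.measurable.comp (((continuous_act _).measurable.comp measurable_fst).prodMk
    ((measurable_lin _).comp measurable_snd)), ⟨act (S.σ γ) ⁻¹' K, ?_, fun X hX n => hgK _ hX _⟩, B,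
    fun X n h1 h2 => hB _ _ (by rw [mink_lin, h1]) ?_⟩
  · exact (actHomeo (S.σ γ)).isClosedEmbedding.isCompact_preimage hK
  · rw [coe_act, mink_lin, h2]

end IsLeafKernel

namespace TransverseMeasure

variable (m : TransverseMeasure Λ) {g h : Hyp → V → ℝ}

theorem leafIntegral_add (hg : IsLeafKernel g) (hh : IsLeafKernel h) :
    m.leafIntegral (fun X n => g X n + h X n) = m.leafIntegral g + m.leafIntegral h := by
  rw [leafIntegral, integral_add (hg.integrable m) (hh.integrable m), mul_add]
  rfl

theorem leafIntegral_const_mul (c : ℝ) (g : Hyp → V → ℝ) :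
    m.leafIntegral (fun X n => c * g X n) = c * m.leafIntegral g := by
  rw [leafIntegral, integral_const_mul, leafIntegral]; ring

theorem leafIntegral_sum {ι : Type*} (s : Finset ι) {g : ι → Hyp → V → ℝ}
    (hg : ∀ i ∈ s, IsLeafKernel (g i)) :
    m.leafIntegral (fun X n => ∑ i ∈ s, g i X n) = ∑ i ∈ s, m.leafIntegral (g i) := by
  rw [leafIntegral, integral_finsetSum _ fun i hi => (hg i hi).integrable m, Finset.mul_sum]
  rfl

theorem leafIntegral_eq (hg : IsLeafKernel g) : m.leafIntegral g =
    2⁻¹ * ∫ n, (∫ u, g (leafPt (basePoint Λ) n u) n) ∂m.leafMeasure := by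
  rw [leafIntegral, integral_prod _ (hg.integrable m)]

/-- A deck transformation carries the parametrization of leaf `n` to that of leaf `γ n` up to a
shift, and `leafMeasure` is invariant. -/
theorem leafIntegral_comp_act (hg : IsLeafKernel g) (γ : π) :
    m.leafIntegral (fun X n => g (act (S.σ γ) X) (lin (S.σ γ) n)) = m.leafIntegral g := by
  rw [m.leafIntegral_eq (hg.comp_act γ), m.leafIntegral_eq hg]
  congr 1
  set O := basePoint Λ
  have h1 : ∀ᵐ n ∂m.leafMeasure, (∫ u, g (act (S.σ γ) (leafPt O n u)) (lin (S.σ γ) n)) =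
      ∫ u, g (leafPt O (lin (S.σ γ) n) u) (lin (S.σ γ) n) := by
    filter_upwards [m.ae_leafMeasure] with n hn
    have hn' : mink (lin (S.σ γ) n) (lin (S.σ γ) n) = 1 := by rw [mink_lin, hn.1]
    obtain ⟨c, hc⟩ := Frame.exists_shift (f := footFrame O _ hn') (g := (footFrame O n hn.1).map (S.σ γ))
      rfl rfl (lx_lin _ _ _).symm
    rw [← integral_add_left_eq_self (fun u => g (leafPt O (lin (S.σ γ) n) u) (lin (S.σ γ) n)) c]
    congr 1
    ext u
    rw [leafPt_eq hn.1, leafPt_eq hn', ← hc, Frame.map_pt]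
  rw [integral_congr_ae h1]
  have h2 : MeasurableEmbedding (lin (S.σ γ)) := by
    refine Continuous.measurableEmbedding (continuous_lin _) fun v w e => ?_
    rw [← lin_inv_lin (S.σ γ) v, e, lin_inv_lin]
  conv_rhs => rw [← m.map_lin_leafMeasure γ]
  rw [h2.integral_map]

/-- Unfolding: in the sum over `γ` each term is moved by `γ⁻¹`, and the translates of `β` then add
up to one in front of `h`. Only finitely many `γ` matter, by proper discontinuity. -/
theorem leafIntegral_unfold {β : Hyp → ℝ} (hβ : Continuous β) {Kβ : Set Hyp} (hKβ : IsCompact Kβ)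
    (hβK : ∀ X ∉ Kβ, β X = 0) (hsum : ∀ X, ∑ᶠ γ : π, β (act (S.σ γ) X) = 1)
    {G h : Hyp → V → ℝ} (hh : IsLeafKernel h)
    (hG : ∀ (X : Hyp) (n : V), IsLeafNormal Λ n → mink n X = 0 →
      G X n = ∑ᶠ γ : π, h (act (S.σ γ) X) (lin (S.σ γ) n)) :
    m.leafIntegral (fun X n => β X * G X n) = m.leafIntegral h := by
  obtain ⟨K, hK, hhK⟩ := hh.supp
  have hfin := finite_return S (hKβ.union hK)
  set Γ := hfin.toFinset with hΓ
  have hbd : ∃ B, ∀ X, |β X| ≤ B := by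
    obtain ⟨B, hB⟩ := (hKβ.image (continuous_abs.comp hβ)).bddAbove
    refine ⟨max B 0, fun X => ?_⟩
    by_cases hX : X ∈ Kβ
    · exact (hB ⟨X, hX, rfl⟩).trans (le_max_left _ _)
    · rw [hβK X hX, abs_zero]; exact le_max_right _ _
  obtain ⟨B, hB⟩ := hbd
  have hβγ : ∀ γ : π, IsLeafKernel fun X n => β (act (S.σ γ⁻¹) X) * h X n := fun γ =>
    hh.mul (hβ.comp (continuous_act _)).measurable fun X => hB _
  have hmem : ∀ (γ : π) (X : Hyp), X ∈ Kβ → act (S.σ γ) X ∈ K → γ ∈ Γ := by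
    intro γ X hX hγ
    rw [hΓ, Set.Finite.mem_toFinset]
    exact ⟨X, Or.inl hX, Or.inr hγ⟩
  have e1 : m.leafIntegral (fun X n => β X * G X n) = m.leafIntegral fun X n => ∑ γ ∈ Γ,
      (fun X n => β (act (S.σ γ⁻¹) X) * h X n) (act (S.σ γ) X) (lin (S.σ γ) n) := by
    refine m.leafIntegral_congr fun X n hn hX => ?_
    simp only [map_inv, act_inv_act, ← Finset.mul_sum]
    by_cases hβX : X ∈ Kβ
    · rw [hG X n hn hX, finsum_eq_sum_of_support_subset]
      intro γ hγ
      by_contra hcon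
      refine hγ (hhK _ (fun h' => hcon (hmem γ X hβX h')) _)
    · rw [hβK X hβX, zero_mul, zero_mul]
  rw [e1, m.leafIntegral_sum _ fun γ _ => (hβγ γ).comp_act γ]
  simp only [m.leafIntegral_comp_act (hβγ _)]
  rw [← m.leafIntegral_sum _ fun γ _ => hβγ γ]
  refine m.leafIntegral_congr fun X n _ _ => ?_
  rw [← Finset.sum_mul]
  by_cases hX : X ∈ K
  · have h1 : ∑ γ ∈ Γ, β (act (S.σ γ⁻¹) X) = 1 := by
      rw [← hsum X, ← finsum_comp_equiv (Equiv.inv π), finsum_eq_sum_of_support_subset]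
      · rfl
      · intro γ hγ
        by_contra hcon
        refine hγ (hβK _ fun h' => hcon (hmem γ _ h' ?_))
        simpa [act_act_inv] using hX
    rw [h1, one_mul]
  · rw [hhK X hX, mul_zero]

end TransverseMeasure

end Lamination

end LieLam

/-! ### Smooth functions, densities along leaves, invariant partitions of unity -/

namespace LieLam

open Topology Filter Set

namespace SmoothOnHyp

variable {f g : Hyp → ℝ}

theorem continuous (hf : SmoothOnHyp f) : Continuous f := by
  have h0 : Continuous fun X : Hyp => crd X := contDiff_crd.continuous.comp continuous_subtype_val
  have h := (ContDiff.continuous hf).comp h0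
  convert h using 1
  ext X
  simp only [Function.comp_apply, chart_crd]

theorem add (hf : SmoothOnHyp f) (hg : SmoothOnHyp g) : SmoothOnHyp fun X => f X + g X :=
  ContDiff.add hf hg

theorem mul (hf : SmoothOnHyp f) (hg : SmoothOnHyp g) : SmoothOnHyp fun X => f X * g X :=
  ContDiff.mul hf hg

theorem const (c : ℝ) : SmoothOnHyp fun _ => c := contDiff_const

theorem sum {ι : Type*} {s : Finset ι} {f : ι → Hyp → ℝ} (hf : ∀ i ∈ s, SmoothOnHyp (f i)) :
    SmoothOnHyp fun X => ∑ i ∈ s, f i X :=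
  ContDiff.sum (f := fun i p => f i (chart p)) hf

theorem div (hf : SmoothOnHyp f) (hg : SmoothOnHyp g) (h0 : ∀ X, g X ≠ 0) :
    SmoothOnHyp fun X => f X / g X :=
  ContDiff.div hf hg fun _ => h0 _

theorem comp_act (hf : SmoothOnHyp f) (g : SOPlus) : SmoothOnHyp fun X => f (act g X) := by
  have h1 : ContDiff ℝ ∞ fun p : ℝ × ℝ => crd (lin g (chartV p)) := by
    refine contDiff_crd.comp ?_
    exact (Matrix.mulVecLin ((g : Matrix.SpecialLinearGroup (Fin 3) ℝ) : Mat)).toContinuousLinearMap.contDiff.comp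
      contDiff_chartV
  have h2 := ContDiff.comp hf h1
  have h3 : (fun p => f (act g (chart p))) =
      (fun p => f (chart p)) ∘ fun p => crd (lin g (chartV p)) := by
    ext p
    exact congrArg f (chart_crd (act g (chart p))).symm
  rw [SmoothOnHyp, h3]
  exact h2

theorem coord (i : Fin 3) : SmoothOnHyp fun X => (X : V) i :=
  (contDiff_apply ℝ ℝ i).comp contDiff_chartV

end SmoothOnHyp

theorem exists_bump {X : Hyp} {U : Set Hyp} (hU : IsOpen U) (hX : X ∈ U) :
    ∃ (b : Hyp → ℝ) (K : Set Hyp), SmoothOnHyp b ∧ (∀ Y, 0 ≤ b Y) ∧ 0 < b X ∧ IsCompact K ∧ K ⊆ U ∧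
      ∀ Y ∉ K, b Y = 0 := by
  have hn : chart ⁻¹' U ∈ 𝓝 (crd X) :=
    (hU.preimage continuous_chart).mem_nhds (by rw [mem_preimage, chart_crd]; exact hX)
  obtain ⟨f, h1, h2, h3, h4, h5⟩ := exists_contDiff_tsupport_subset (n := ⊤) hn
  refine ⟨fun Y => f (crd Y), chart '' tsupport f, h3, fun Y => (h4 ⟨_, rfl⟩).1, by simp [h5],
    IsCompact.image h2 continuous_chart, image_subset_iff.2 h1, fun Y hY => ?_⟩
  refine image_eq_zero_of_notMem_tsupport fun h => hY ⟨_, h, chart_crd Y⟩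

section Forms

/-- The coefficient of the one-form `(φ, B)^♯` on a geodesic with unit normal vector `n`. -/
def density (φ : Hyp → V → Mat) (X : Hyp) (n : V) : ℝ := killing (φ X (lx n X)) (dual n)

theorem RawForm.apply_eq (φ : RawForm) (X : Hyp) (v : V) (i j : Fin 3) :
    φ X v i j = ∑ k, v k * φ X (Pi.single k 1) i j := by
  have h : φ X v = ∑ k, v k • φ X (Pi.single k 1) := by
    conv_lhs => rw [pi_eq_sum_univ' v, map_sum]
    simp only [map_smul]
  rw [h, Matrix.sum_apply]
  rfl

theorem IsOneForm.smooth_apply {φ : RawForm} (hφ : IsOneForm φ) {w : Hyp → V}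
    (hw : ∀ k, SmoothOnHyp fun X => w X k) (i j : Fin 3) : SmoothOnHyp fun X => φ X (w X) i j := by
  have h : (fun X => φ X (w X) i j) = fun X => ∑ k, w X k * φ X (Pi.single k 1) i j := by
    ext X; exact RawForm.apply_eq φ X (w X) i j
  rw [h]
  exact SmoothOnHyp.sum fun k _ => (hw k).mul (hφ.2.2 _ i j)

theorem IsOneForm.continuous_density {φ : RawForm} (hφ : IsOneForm φ) :
    Continuous (Function.uncurry (density fun X v => φ X v)) := by
  have hlx : Continuous fun p : Hyp × V => lx p.2 p.1 :=
    continuous_lx.comp (continuous_snd.prodMk (continuous_subtype_val.comp continuous_fst))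
  have h : ∀ i j, Continuous fun p : Hyp × V => φ p.1 (lx p.2 p.1) i j := by
    intro i j
    have e : (fun p : Hyp × V => φ p.1 (lx p.2 p.1) i j) =
        fun p => ∑ k, lx p.2 p.1 k * φ p.1 (Pi.single k 1) i j := by
      ext p; exact RawForm.apply_eq φ _ _ i j
    rw [e]
    exact continuous_finsetSum _ fun k _ => ((continuous_apply k).comp hlx).mul
      ((hφ.2.2 _ i j).continuous.comp continuous_fst)
  have hd : ∀ i j, Continuous fun p : Hyp × V => dual p.2 i j := fun i j =>
    (continuous_apply (A := fun _ => ℝ) i).comp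
      (continuous_lx.comp (continuous_snd.prodMk (continuous_const (y := (Pi.single j 1 : V)))))
  have e : (Function.uncurry (density fun X v => φ X v)) =
      fun p => ∑ i, ∑ j, φ p.1 (lx p.2 p.1) i j * dual p.2 j i := by
    ext p; exact killing_eq _ _
  rw [e]
  exact continuous_finsetSum _ fun i _ => continuous_finsetSum _ fun j _ => (h i j).mul (hd j i)

/-- Direction and generator change sign together; this is why no orientation of `λ` is required. -/
theorem density_neg (φ : RawForm) (X : Hyp) (n : V) :
    density (fun X v => φ X v) X (-n) = density (fun X v => φ X v) X n := by
  have h : dual (-n) = -dual n := by rw [← neg_one_smul ℝ n, dual_smul, neg_one_smul]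
  simp only [density, lx_neg_left, map_neg, h, killing_neg_left, killing_neg_right, neg_neg]

end Forms

section Surface

variable {π : Type*} [Group π] {S : HypSurface π}

theorem density_act (φ : Omega1 S) (γ : π) (X : Hyp) (n : V) :
    density (fun X v => (φ : RawForm) X v) (act (S.σ γ) X) (lin (S.σ γ) n) =
      density (fun X v => (φ : RawForm) X v) X n := by
  simp only [density]
  rw [coe_act, lx_lin, φ.2.2, ← Ad_dual, killing_Ad]

variable (S) in
/-- The sum of a function over the deck group. -/
noncomputable def orbitSum (b : Hyp → ℝ) (X : Hyp) : ℝ := ∑ᶠ γ : π, b (act (S.σ γ) X)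

theorem orbitSum_act (b : Hyp → ℝ) (γ : π) (X : Hyp) :
    orbitSum S b (act (S.σ γ) X) = orbitSum S b X := by
  rw [orbitSum, orbitSum, ← finsum_comp_equiv (Equiv.mulRight γ) (f := fun γ => b (act (S.σ γ) X))]
  simp only [Equiv.coe_mulRight, map_mul, act_mul]

variable (S) in
theorem exists_finset_orbitSum {K N : Set Hyp} (hK : IsCompact K) (hN : IsCompact N) :
    ∃ Γ : Finset π, ∀ b : Hyp → ℝ, (∀ X ∉ K, b X = 0) →
      ∀ X ∈ N, (Function.support fun γ : π => b (act (S.σ γ) X)) ⊆ Γ ∧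
        orbitSum S b X = ∑ γ ∈ Γ, b (act (S.σ γ) X) := by
  have hfin := finite_return S (hN.union hK)
  refine ⟨hfin.toFinset, fun b hb X hX => ?_⟩
  have hsub : (Function.support fun γ : π => b (act (S.σ γ) X)) ⊆ hfin.toFinset := by
    intro γ hγ
    rw [Finset.mem_coe, Set.Finite.mem_toFinset]
    refine ⟨X, Or.inl hX, Or.inr ?_⟩
    by_contra h
    exact hγ (hb _ h)
  exact ⟨hsub, finsum_eq_sum_of_support_subset _ hsub⟩

theorem smooth_orbitSum {b : Hyp → ℝ} {K : Set Hyp} (hb : SmoothOnHyp b) (hK : IsCompact K)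
    (hbK : ∀ X ∉ K, b X = 0) : SmoothOnHyp (orbitSum S b) := by
  refine contDiff_iff_contDiffAt.2 fun p => ?_
  obtain ⟨Γ, hΓ⟩ := exists_finset_orbitSum S hK
    ((isCompact_closedBall p 1).image continuous_chart)
  have h1 : SmoothOnHyp fun X => ∑ γ ∈ Γ, b (act (S.σ γ) X) :=
    SmoothOnHyp.sum fun γ _ => hb.comp_act _
  refine (ContDiff.contDiffAt h1).congr_of_eventuallyEq ?_
  filter_upwards [Metric.closedBall_mem_nhds p one_pos] with q hq
  exact (hΓ b hbK (chart q) (mem_image_of_mem _ hq)).2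

theorem orbitSum_pos {b : Hyp → ℝ} {K : Set Hyp} (hK : IsCompact K) (hbK : ∀ X ∉ K, b X = 0)
    (hb : ∀ X, 0 ≤ b X) {X : Hyp} {γ : π} (h : 0 < b (act (S.σ γ) X)) : 0 < orbitSum S b X := by
  obtain ⟨Γ, hΓ⟩ := exists_finset_orbitSum S hK (isCompact_singleton (x := X))
  obtain ⟨h1, h2⟩ := hΓ b hbK X rfl
  rw [h2]
  exact Finset.sum_pos' (fun _ _ => hb _) ⟨γ, h1 h.ne', h⟩

variable (Λ : GeodesicLamination S)

/-- Bumps in finitely many boxes have translates covering the plane. With `B` their sum, dividing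
the orbit sum of each bump by that of `B` gives the invariant `ρ j`, and dividing `B` by its own
orbit sum gives the compactly supported `β`. -/
theorem exists_partition : ∃ (N : ℕ) (Q : Fin N → NiceBox Λ) (K : Fin N → Set Hyp)
    (ρ : Fin N → Hyp → ℝ) (β : Hyp → ℝ) (Kβ : Set Hyp),
    (∀ j, IsCompact (K j) ∧ K j ⊆ (Q j).core ∧ SmoothOnHyp (ρ j) ∧
      (∀ (γ : π) (X : Hyp), ρ j (act (S.σ γ) X) = ρ j X) ∧
      ∀ X, ρ j X ≠ 0 → ∃ γ : π, act (S.σ γ) X ∈ K j) ∧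
    (∀ X, ∑ j, ρ j X = 1) ∧ SmoothOnHyp β ∧ IsCompact Kβ ∧ (∀ X ∉ Kβ, β X = 0) ∧
    ∀ X, orbitSum S β X = 1 := by
  obtain ⟨K₀, hK₀, hcov⟩ := S.cocompact
  choose q hq using exists_niceBox Λ
  choose b K hbs hb0 hbpos hK hKq hbK using fun X => exists_bump (q X).isOpen_core (hq X)
  obtain ⟨t, ht⟩ := hK₀.elim_finite_subcover (fun X => {Y | 0 < b X Y})
    (fun X => isOpen_lt continuous_const (hbs X).continuous)
    fun X _ => mem_iUnion.2 ⟨X, hbpos X⟩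
  let e := t.equivFin.symm
  set B : Hyp → ℝ := fun X => ∑ j, b (e j) X with hB
  have hBs : SmoothOnHyp B := SmoothOnHyp.sum fun j _ => hbs _
  set KB : Set Hyp := ⋃ j, K (e j)
  have hKB : IsCompact KB := isCompact_iUnion fun j => hK _
  have hKjB : ∀ j, ∀ X ∉ KB, b (e j) X = 0 := fun j X hX =>
    hbK _ X fun h => hX (mem_iUnion.2 ⟨j, h⟩)
  have hBK : ∀ X ∉ KB, B X = 0 := fun X hX => Finset.sum_eq_zero fun j _ => hKjB j X hX
  have hB0 : ∀ X, 0 ≤ B X := fun X => Finset.sum_nonneg fun j _ => hb0 _ _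
  have hpos : ∀ X, 0 < orbitSum S B X := by
    intro X
    obtain ⟨γ, hγ⟩ := hcov X
    obtain ⟨Y, hY, hYX⟩ := mem_iUnion₂.1 (ht hγ)
    refine orbitSum_pos hKB hBK hB0 (γ := γ) ?_
    refine Finset.sum_pos' (fun j _ => hb0 _ _) ⟨e.symm ⟨Y, hY⟩, Finset.mem_univ _, ?_⟩
    rw [Equiv.apply_symm_apply]
    exact hYX
  have hSs : SmoothOnHyp (orbitSum S B) := smooth_orbitSum hBs hKB hBK
  have hinv : ∀ (γ : π) X, orbitSum S B (act (S.σ γ) X) = orbitSum S B X := orbitSum_act B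
  refine ⟨t.card, fun j => q (e j), fun j => K (e j), fun j X => orbitSum S (b (e j)) X / orbitSum S B X,
    fun X => B X / orbitSum S B X, KB, fun j => ⟨hK _, hKq _, ?_, ?_, ?_⟩, ?_, ?_, hKB, ?_, ?_⟩
  · exact (smooth_orbitSum (hbs _) (hK _) (hbK _)).div hSs fun X => (hpos X).ne'
  · intro γ X
    simp only [orbitSum_act]
  · intro X hX
    by_contra! hcon
    refine hX ?_
    have : orbitSum S (b (e j)) X = 0 := by
      rw [orbitSum]
      exact finsum_eq_zero_of_forall_eq_zero fun γ => hbK _ _ (hcon γ)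
    simp only [this, zero_div]
  · intro X
    rw [← Finset.sum_div, div_eq_one_iff_eq (hpos X).ne']
    obtain ⟨Γ, hΓ⟩ := exists_finset_orbitSum S hKB (isCompact_singleton (x := X))
    rw [(hΓ B hBK X rfl).2, Finset.sum_congr rfl fun j _ => (hΓ _ (hKjB j) X rfl).2, Finset.sum_comm]
  · exact hBs.div hSs fun X => (hpos X).ne'
  · intro X hX
    simp only [hBK X hX, zero_div]
  · intro X
    obtain ⟨Γ, hΓ⟩ := exists_finset_orbitSum S hKB (isCompact_singleton (x := X))
    rw [(hΓ (fun X => B X / orbitSum S B X) (fun X hX => by simp only [hBK X hX, zero_div]) X rfl).2]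
    simp only [hinv]
    rw [← Finset.sum_div, ← (hΓ B hBK X rfl).2, div_self (hpos X).ne']

/-- The product of an invariant function and an equivariant form. -/
def mulInvariant {ρ : Hyp → ℝ} (hρ : SmoothOnHyp ρ)
    (hinv : ∀ (γ : π) (X : Hyp), ρ (act (S.σ γ) X) = ρ X) (φ : Omega1 S) : Omega1 S :=
  ⟨fun X => ρ X • (φ : RawForm) X, ⟨fun X => by simp [φ.2.1.1 X], fun X v =>
      so21.smul_mem _ (φ.2.1.2.1 X v), fun v i j => hρ.mul (φ.2.1.2.2 v i j)⟩,
    fun γ X v => by simp only [LinearMap.smul_apply, hinv, φ.2.2, Ad_smul]⟩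

theorem exists_isDecomposition (φ : Omega1 S) : ∃ (n : ℕ) (R : Fin n → FlowBox Λ)
    (ψ : Fin n → Omega1 S), IsDecomposition φ R ψ := by
  obtain ⟨N, Q, K, ρ, -, -, h, hsum, -⟩ := exists_partition Λ
  refine ⟨N, fun j => (Q j).toFlowBox, fun j => mulInvariant (h j).2.2.1 (h j).2.2.2.1 φ, ?_, fun j => ?_⟩
  · refine Subtype.ext (funext fun X => ?_)
    rw [AddSubmonoidClass.coe_finsetSum, Finset.sum_apply]
    simp only [mulInvariant]
    rw [← Finset.sum_smul, hsum, one_smul]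
  · obtain ⟨h1, h2, -, -, h3⟩ := h j
    refine ⟨(Q j).coord '' K j, ?_, h1.image_of_continuousOn
      ((Q j).continuousOn_coord.mono (h2.trans (Q j).core_subset)), fun X hX => ?_⟩
    · rintro _ ⟨X, hX, rfl⟩
      exact (Q j).coord_mem (h2 hX)
    · obtain ⟨γ, hγ⟩ := h3 X fun h0 => hX (by simp only [mulInvariant, h0, zero_smul])
      refine ⟨γ⁻¹, _, mem_image_of_mem _ hγ, ?_⟩
      change X = act (S.σ γ⁻¹) ((Q j).map ((Q j).coord _))
      rw [(Q j).map_coord (h2 hγ), map_inv, act_inv_act]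

end Surface

end LieLam

/-! ### The integrand of a flow-box as an arc-length integral along a leaf -/

namespace LieLam

open Topology Filter Set

theorem volume_image_eq_zero_of_lipschitzOnWith {u : ℝ → ℝ} {C : NNReal} {s N : Set ℝ}
    (hu : LipschitzOnWith C u s) (hN : N ⊆ s) (h0 : volume N = 0) : volume (u '' N) = 0 := by
  have h := (hu.mono hN).hausdorffMeasure_image_le (d := 1) (by norm_num)
  rw [hausdorffMeasure_real, h0, mul_zero] at h
  exact le_antisymm h bot_le

/-- Change of variables for injective Lipschitz functions on an interval. -/
theorem setIntegral_abs_deriv_mul {u : ℝ → ℝ} {a b : ℝ} {C : NNReal}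
    (hu : LipschitzOnWith C u (Icc a b)) (hinj : InjOn u (Icc a b)) (g : ℝ → ℝ) :
    ∫ t in Ioo a b, |deriv u t| * g (u t) = ∫ x in u '' Icc a b, g x := by
  set D : Set ℝ := Ioo a b ∩ {t | DifferentiableAt ℝ u t}
  have hD : MeasurableSet D := measurableSet_Ioo.inter (measurableSet_of_differentiableAt ℝ u)
  have hDs : D ⊆ Icc a b := inter_subset_left.trans Ioo_subset_Icc_self
  -- A Lipschitz function has bounded variation and is differentiable almost everywhere; the
  -- exceptional set has a null image.
  have hdiff : ∀ᵐ t, t ∈ Ioo a b → t ∈ D := by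
    filter_upwards [hu.locallyBoundedVariationOn.ae_differentiableWithinAt_of_mem_real] with t ht htI
    exact ⟨htI, (ht (Ioo_subset_Icc_self htI)).differentiableAt (Icc_mem_nhds htI.1 htI.2)⟩
  have hae : Ioo a b =ᵐ[volume] D := by
    filter_upwards [hdiff] with t ht
    exact propext ⟨ht, fun h => h.1⟩
  have hnull : volume (Icc a b \ D) = 0 := by
    have h1 : volume (Ioo a b \ D) = 0 := by
      rw [measure_eq_zero_iff_ae_notMem]
      filter_upwards [hdiff] with t ht h
      exact h.2 (ht h.1)
    have h2 : Icc a b \ D ⊆ (Ioo a b \ D) ∪ {a, b} := by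
      rintro t ⟨ht, htD⟩
      by_cases h : t ∈ Ioo a b
      · exact Or.inl ⟨h, htD⟩
      · refine Or.inr ?_
        rcases eq_or_lt_of_le ht.1 with h3 | h3
        · exact Or.inl h3.symm
        rcases eq_or_lt_of_le ht.2 with h4 | h4
        · exact Or.inr h4
        exact absurd ⟨h3, h4⟩ h
    refine measure_mono_null h2 (measure_union_null h1 ?_)
    exact (Set.toFinite _).measure_zero _
  have him : u '' Icc a b =ᵐ[volume] u '' D := by
    have h3 := volume_image_eq_zero_of_lipschitzOnWith hu sdiff_subset hnull
    have h4 : ∀ᵐ x, x ∉ u '' (Icc a b \ D) := measure_eq_zero_iff_ae_notMem.1 h3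
    filter_upwards [h4] with x hx
    refine propext ⟨?_, fun h => image_mono hDs h⟩
    rintro ⟨t, ht, rfl⟩
    by_contra hcon
    exact hx ⟨t, ⟨ht, fun h => hcon ⟨t, h, rfl⟩⟩, rfl⟩
  rw [setIntegral_congr_set hae, setIntegral_congr_set him,
    integral_image_eq_integral_abs_deriv_smul hD (f' := deriv u)
      (fun t ht => ht.2.hasDerivAt.hasDerivWithinAt) (hinj.mono hDs)]
  rfl

theorem integrableOn_abs_deriv_mul {u : ℝ → ℝ} {a b : ℝ} {C : NNReal}
    (hu : LipschitzOnWith C u (Icc a b)) {g : ℝ → ℝ} (hg : Continuous g) :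
    IntegrableOn (fun t => |deriv u t| * g (u t)) (Ioo a b) := by
  have hcont : ContinuousOn (fun t => g (u t)) (Icc a b) := hg.comp_continuousOn hu.continuousOn
  obtain ⟨B, hB⟩ := (isCompact_Icc.image_of_continuousOn hcont.norm).bddAbove
  refine Integrable.of_bound (C := C * |B|) ?_ ?_
  · refine AEStronglyMeasurable.mul (measurable_deriv u).abs.aestronglyMeasurable ?_
    exact (hcont.mono Ioo_subset_Icc_self).aestronglyMeasurable measurableSet_Ioo
  · filter_upwards [ae_restrict_mem measurableSet_Ioo] with t ht
    rw [norm_mul, Real.norm_eq_abs, abs_abs]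
    refine mul_le_mul (norm_deriv_le_of_lipschitzOn (Icc_mem_nhds ht.1 ht.2) hu) ?_ (norm_nonneg _) C.2
    exact (hB ⟨t, Ioo_subset_Icc_self ht, rfl⟩).trans (le_abs_self _)

theorem image_Icc_eq_of_monotone_or_antitone {u : ℝ → ℝ} {a b : ℝ} (hab : a ≤ b)
    (hc : ContinuousOn u (Icc a b)) (h : StrictMonoOn u (Icc a b) ∨ StrictAntiOn u (Icc a b)) :
    u '' Icc a b = Icc (min (u a) (u b)) (max (u a) (u b)) := by
  refine Subset.antisymm ?_ (by
    have := intermediate_value_uIcc (hc.mono (by rw [uIcc_of_le hab]) : ContinuousOn u (uIcc a b))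
    rwa [uIcc_of_le hab] at this)
  rintro _ ⟨t, ht, rfl⟩
  rcases h with h | h
  · exact ⟨(min_le_left _ _).trans (h.monotoneOn (left_mem_Icc.2 hab) ht ht.1),
      (h.monotoneOn ht (right_mem_Icc.2 hab) ht.2).trans (le_max_right _ _)⟩
  · exact ⟨(min_le_right _ _).trans (h.antitoneOn ht (right_mem_Icc.2 hab) ht.2),
      (h.antitoneOn (left_mem_Icc.2 hab) ht ht.1).trans (le_max_left _ _)⟩

theorem Frame.vel_eq_lx {f : Frame} (hf : f.e = lx f.n f.X) (u : ℝ) : f.vel u = lx f.n (f.vec u) := by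
  rw [vec, vel, lx_add_right, lx_smul_right, lx_smul_right, ← hf, f.lx_n_lx hf, add_comm]

theorem Frame.mink_vel_vel (f : Frame) (u : ℝ) : mink (f.vel u) (f.vel u) = 1 := by
  simp only [vel, mink_add_left, mink_add_right, mink_smul_left, mink_smul_right, f.X.mink_self,
    f.ee, f.eX, f.Xe]
  have := Real.cosh_sq u
  linear_combination this

theorem Frame.hasDerivAt_vec (f : Frame) (u : ℝ) : HasDerivAt f.vec (f.vel u) u :=
  ((Real.hasDerivAt_cosh u).smul_const (f.X : V)).add ((Real.hasDerivAt_sinh u).smul_const f.e)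

section Foot

/-- The time at which the leaf with normal vector `n` passes at `X`. -/
noncomputable def leafTime (O : Hyp) (n : V) (X : Hyp) : ℝ := Real.arsinh (mink (lx n (foot O n)) X)

variable {O : Hyp}

theorem leafTime_eq {n : V} (hn : mink n n = 1) (X : Hyp) :
    leafTime O n X = (footFrame O n hn).time X := rfl

theorem footFrame_n {n : V} (hn : mink n n = 1) : (footFrame O n hn).n = n := rfl

theorem footFrame_e {n : V} (hn : mink n n = 1) :
    (footFrame O n hn).e = lx (footFrame O n hn).n (footFrame O n hn).X := rfl

theorem leafPt_leafTime {n : V} (hn : mink n n = 1) {X : Hyp} (hX : mink n X = 0) :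
    leafPt O n (leafTime O n X) = X := by
  rw [leafPt_eq hn, leafTime_eq hn]
  exact (footFrame O n hn).pt_time hX

theorem leafTime_leafPt {n : V} (hn : mink n n = 1) (u : ℝ) : leafTime O n (leafPt O n u) = u := by
  rw [leafPt_eq hn, leafTime_eq hn, Frame.time_pt]

theorem continuous_leafTime : Continuous fun p : V × Hyp => leafTime O p.1 p.2 := by
  have h1 : Continuous fun p : V × Hyp => lx p.1 (foot O p.1) :=
    continuous_lx.comp (continuous_fst.prodMk ((continuous_foot O).comp continuous_fst))
  exact Real.continuous_arsinh.comp (Continuous.mink h1 (continuous_subtype_val.comp continuous_snd))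

end Foot

section Lamination

variable {π : Type*} [Group π] {S : HypSurface π} {Λ : GeodesicLamination S}

namespace FlowBox

variable (R : FlowBox Λ)

/-- On the arc the velocity is `u'` times the unit tangent, and normalization in `generator` retains
only the sign of `u'`; the product is `|u'|`. Where `u' = 0` or `u` is not differentiable both sides
vanish, by the default values of `deriv` and of the inverse. -/
theorem integrand_eq {s t : ℝ} (hs : s ∈ R.C) (ht : t ∈ Ioo R.a R.b) {f : Frame}
    (hn : f.n = R.normal s) (hf : f.e = lx f.n f.X) (φ : RawForm) :
    R.integrand φ t s = |deriv (fun τ => f.time (R.map (τ, s))) t| *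
      density (fun X v => φ X v) (R.map (t, s)) f.n := by
  set u : ℝ → ℝ := fun τ => f.time (R.map (τ, s)) with hu
  have hpt : ∀ τ ∈ Icc R.a R.b, f.pt (u τ) = R.map (τ, s) := fun τ hτ =>
    f.pt_time (by rw [hn]; exact R.mink_normal_map hτ hs)
  have hev : (fun τ => (R.F τ s : V)) =ᶠ[𝓝 t] fun τ => f.vec (u τ) := by
    filter_upwards [Icc_mem_nhds ht.1 ht.2] with τ hτ
    exact (congrArg Subtype.val (hpt τ hτ)).symm
  have hX : R.map (t, s) = f.pt (u t) := (hpt t (Ioo_subset_Icc_self ht)).symm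
  have hdt : R.dt t s = deriv u t • f.vel (u t) := by
    by_cases hd : DifferentiableAt ℝ u t
    · rw [dt, hev.deriv_eq]
      exact ((f.hasDerivAt_vec (u t)).scomp t hd.hasDerivAt).deriv
    · have hd' : ¬DifferentiableAt ℝ (fun τ => (R.F τ s : V)) t := by
        intro h
        refine hd ?_
        have h1 : DifferentiableAt ℝ (fun τ => mink f.e (R.F τ s)) t := by
          simp only [mink_eq]
          have h2 := differentiableAt_pi.1 h
          exact (((h2 0).const_mul _).add ((h2 1).const_mul _)).sub ((h2 2).const_mul _)
        exact Real.differentiable_arsinh.differentiableAt.comp t h1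
      rw [dt, deriv_zero_of_not_differentiableAt hd', deriv_zero_of_not_differentiableAt hd, zero_smul]
  have hvel : f.vel (u t) = lx f.n (R.map (t, s)) := by rw [hX]; exact f.vel_eq_lx hf _
  have hcross : cross (f.vel (u t)) (R.map (t, s)) = dual f.n := by
    rw [hvel]
    refine cross_lx_eq_dual f.nn ?_
    rw [hX]; exact f.pt_mem_line _
  change killing (φ (R.map (t, s)) (R.dt t s)) (generator (R.map (t, s)) (R.dt t s)) = _
  rw [hdt, generator, mink_smul_left, mink_smul_right, f.mink_vel_vel, mul_one, Real.sqrt_mul_self_eq_abs,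
    cross_smul_left, hcross, map_smul, killing_smul_left, killing_smul_right, killing_smul_right, hvel,
    density]
  rcases eq_or_ne (deriv u t) 0 with h0 | h0
  · simp [h0]
  · have h1 : |deriv u t| ≠ 0 := abs_ne_zero.2 h0
    have h2 : deriv u t * (|deriv u t|⁻¹ * deriv u t) = |deriv u t| := by
      field_simp
      rw [sq_abs]
    linear_combination killing (φ (R.map (t, s)) (lx f.n (R.map (t, s)))) (dual f.n) * h2

theorem exists_lipschitzOnWith_time {s : ℝ} (hs : s ∈ R.C) {f : Frame} (hn : f.n = R.normal s) :
    ∃ C, LipschitzOnWith C (fun t => f.time (R.map (t, s))) (Icc R.a R.b) := by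
  obtain ⟨K, hK, h⟩ := R.biLipschitz
  refine ⟨⟨K, hK.le⟩, LipschitzOnWith.of_dist_le_mul fun t ht t' ht' => ?_⟩
  have h1 := (h (t, s) (R.mem_rect ht hs) (t', s) (R.mem_rect ht' hs)).1
  change hdist (R.map (t, s)) (R.map (t', s)) ≤ _ at h1
  rw [f.hdist_eq_abs_time (by rw [hn]; exact R.mink_normal_map ht hs)
    (by rw [hn]; exact R.mink_normal_map ht' hs), Prod.dist_eq, dist_self,
    max_eq_left dist_nonneg] at h1
  exact h1

theorem normal_mink {s : ℝ} (hs : s ∈ R.C) : mink (R.normal s) (R.normal s) = 1 :=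
  (R.normal_spec hs).1.1

/-- The set of times at which the leaf at height `s` runs through the flow-box. -/
noncomputable def arcTimes (s : ℝ) : Set ℝ :=
  Icc (min (leafTime (basePoint Λ) (R.normal s) (R.map (R.a, s)))
      (leafTime (basePoint Λ) (R.normal s) (R.map (R.b, s))))
    (max (leafTime (basePoint Λ) (R.normal s) (R.map (R.a, s)))
      (leafTime (basePoint Λ) (R.normal s) (R.map (R.b, s))))

theorem image_leafTime {s : ℝ} (hs : s ∈ R.C) :
    (fun t => leafTime (basePoint Λ) (R.normal s) (R.map (t, s))) '' Icc R.a R.b = R.arcTimes s := by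
  obtain ⟨-, h1, h2⟩ := R.exists_arc_time hs (f := footFrame (basePoint Λ) _ (R.normal_mink hs))
    (Or.inl rfl)
  exact image_Icc_eq_of_monotone_or_antitone R.hab.le h1 h2

theorem mem_arcTimes {s : ℝ} (hs : s ∈ R.C) (u : ℝ) : u ∈ R.arcTimes s ↔
    ∃ t ∈ Icc R.a R.b, R.map (t, s) = leafPt (basePoint Λ) (R.normal s) u := by
  rw [← R.image_leafTime hs]
  refine ⟨?_, ?_⟩
  · rintro ⟨t, ht, rfl⟩
    exact ⟨t, ht, (leafPt_leafTime (R.normal_mink hs) (R.mink_normal_map ht hs)).symm⟩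
  · rintro ⟨t, ht, e⟩
    refine ⟨t, ht, ?_⟩
    simp only [e, leafTime_leafPt (R.normal_mink hs)]

theorem continuous_density_leaf (φ : Omega1 S) : Continuous fun z : V × ℝ =>
    density (fun X v => (φ : RawForm) X v) (leafPt (basePoint Λ) z.1 z.2) z.1 :=
  φ.2.1.continuous_density.comp ((continuous_leafPt _).prodMk continuous_fst)

/-- The time along the leaf is an injective Lipschitz function of `t`, so the change of variables
applies although the box is merely bi-Lipschitz. -/
theorem intervalIntegrable_integrand (φ : Omega1 S) {s : ℝ} (hs : s ∈ R.C) :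
    IntervalIntegrable (fun t => R.integrand (φ : RawForm) t s) volume R.a R.b ∧
      ∫ t in R.a..R.b, R.integrand (φ : RawForm) t s = ∫ u in R.arcTimes s,
        density (fun X v => (φ : RawForm) X v) (leafPt (basePoint Λ) (R.normal s) u) (R.normal s) := by
  obtain ⟨f, hn, hfe, hft⟩ : ∃ f : Frame, f.n = R.normal s ∧ f.e = lx f.n f.X ∧
      ∀ X, leafTime (basePoint Λ) (R.normal s) X = f.time X :=
    ⟨footFrame (basePoint Λ) _ (R.normal_mink hs), footFrame_n _, footFrame_e _,
      leafTime_eq (R.normal_mink hs)⟩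
  obtain ⟨C, hC⟩ := R.exists_lipschitzOnWith_time hs hn
  obtain ⟨-, -, h2⟩ := R.exists_arc_time hs (f := f) (Or.inl hn)
  have hinj : InjOn (fun t => f.time (R.map (t, s))) (Icc R.a R.b) := by
    rcases h2 with h2 | h2
    · exact h2.injOn
    · exact h2.injOn
  obtain ⟨g, hg⟩ : ∃ g : ℝ → ℝ, g = fun x => density (fun X v => (φ : RawForm) X v)
    (leafPt (basePoint Λ) (R.normal s) x) (R.normal s) := ⟨_, rfl⟩
  have hgc : Continuous g := by
    rw [hg]
    have h := (continuous_density_leaf (Λ := Λ) φ).comp (Continuous.prodMk_right (R.normal s))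
    simpa only [Function.comp_def] using h
  have hcongr : ∀ t ∈ Ioo R.a R.b, R.integrand (φ : RawForm) t s =
      |deriv (fun t => f.time (R.map (t, s))) t| * g (f.time (R.map (t, s))) := by
    intro t ht
    rw [R.integrand_eq hs ht hn hfe, hg]
    simp only
    rw [← hft, leafPt_leafTime (R.normal_mink hs)
      (R.mink_normal_map (Ioo_subset_Icc_self ht) hs), hn]
  constructor
  · rw [intervalIntegrable_iff_integrableOn_Ioo_of_le R.hab.le]
    exact (integrableOn_abs_deriv_mul hC hgc).congr_fun (fun t ht => (hcongr t ht).symm)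
      measurableSet_Ioo
  · rw [intervalIntegral.integral_of_le R.hab.le, integral_Ioc_eq_integral_Ioo,
      setIntegral_congr_fun measurableSet_Ioo hcongr, setIntegral_abs_deriv_mul hC hinj,
      ← R.image_leafTime hs]
    simp only [hft, hg]

/-- The inner integral is a difference of values of a primitive of the density, at end times which,
like the normal, depend continuously on `s ∈ C`. -/
theorem continuousOn_integral (φ : Omega1 S) :
    ContinuousOn (fun s => ∫ t in R.a..R.b, R.integrand (φ : RawForm) t s) R.C := by
  obtain ⟨O, hO⟩ : ∃ O, O = basePoint Λ := ⟨_, rfl⟩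
  have hd : Continuous fun z : V × ℝ =>
      density (fun X v => (φ : RawForm) X v) (leafPt O z.1 z.2) z.1 := by
    rw [hO]; exact continuous_density_leaf φ
  have hJc : Continuous fun z : V × ℝ => ∫ u in (0 : ℝ)..z.2,
      density (fun X v => (φ : RawForm) X v) (leafPt O z.1 u) z.1 :=
    intervalIntegral.continuous_parametric_primitive_of_continuous
      (f := fun n u => density (fun X v => (φ : RawForm) X v) (leafPt O n u) n) hd
  have hA : ∀ t ∈ Icc R.a R.b,
      ContinuousOn (fun s => leafTime O (R.normal s) (R.map (t, s))) R.C := fun t ht => by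
    have h := R.continuousOn_normal.prodMk (R.continuousOn_transversal ht)
    have h' := (continuous_leafTime (O := O)).comp_continuousOn h
    simpa only [Function.comp_def] using h'
  have ha := hA R.a (left_mem_Icc.2 R.hab.le)
  have hb := hA R.b (right_mem_Icc.2 R.hab.le)
  have h1 := hJc.comp_continuousOn (R.continuousOn_normal.prodMk (ContinuousOn.sup ha hb))
  have h2 := hJc.comp_continuousOn (R.continuousOn_normal.prodMk (ContinuousOn.inf ha hb))
  refine (h1.sub h2).congr fun s hs => ?_
  have hg : Continuous fun u => density (fun X v => (φ : RawForm) X v) (leafPt O (R.normal s) u)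
      (R.normal s) := by
    have h := hd.comp (Continuous.prodMk_right (R.normal s))
    simpa only [Function.comp_def] using h
  have hmm := min_le_max (a := leafTime O (R.normal s) (R.map (R.a, s)))
    (b := leafTime O (R.normal s) (R.map (R.b, s)))
  simp only [(R.intervalIntegrable_integrand φ hs).2, arcTimes, ← hO]
  rw [integral_Icc_eq_integral_Ioc, ← intervalIntegral.integral_of_le hmm]
  exact (intervalIntegral.integral_interval_sub_left (hg.intervalIntegrable _ _)
    (hg.intervalIntegrable _ _)).symm

end FlowBox

namespace TransverseMeasure

variable (m : TransverseMeasure Λ)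

theorem restrict_C (R : FlowBox Λ) : (m.μ R).restrict R.C = m.μ R :=
  Measure.restrict_eq_self_of_ae_mem (m.supported R)

theorem integrable_integral (R : FlowBox Λ) (φ : Omega1 S) :
    Integrable (fun s => ∫ t in R.a..R.b, R.integrand (φ : RawForm) t s) (m.μ R) := by
  rw [← m.restrict_C R]
  exact (R.continuousOn_integral φ).integrableOn_compact R.isCompact_C

end TransverseMeasure

end Lamination

end LieLam

/-! ### Box integrals as leaf integrals; the current -/

namespace LieLam

open Topology Filter Set

theorem leafPt_neg (O : Hyp) (n : V) (u : ℝ) : leafPt O (-n) u = leafPt O n (-u) := by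
  have h : foot O (-n) = foot O n := by
    rw [foot, foot, mink_neg_left, neg_sq, smul_neg, neg_smul, neg_neg]
  rw [leafPt, leafPt, leafVec, leafVec, h, lx_neg_left, Real.cosh_neg, Real.sinh_neg, smul_neg, neg_smul]

section Lamination

variable {π : Type*} [Group π] {S : HypSurface π} {Λ : GeodesicLamination S}

namespace TransverseMeasure

variable (m : TransverseMeasure Λ)

/-- The two normals of a leaf contribute equally, which the factor one half compensates. -/
theorem leafIntegral_eq_of_even {h : Hyp → V → ℝ} (hh : IsLeafKernel h)
    (heven : ∀ X n, h X (-n) = h X n) :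
    m.leafIntegral h = ∫ n, (∫ u, h (leafPt (basePoint Λ) n u) n) ∂m.leafMeasure₀ := by
  rw [m.leafIntegral_eq hh]
  obtain ⟨J, hJ⟩ : ∃ J : V → ℝ, J = fun n => ∫ u, h (leafPt (basePoint Λ) n u) n := ⟨_, rfl⟩
  have hint : Integrable J m.leafMeasure := by rw [hJ]; exact (hh.integrable m).integral_prod_left
  have hneg : ∀ n, J (-n) = J n := by
    intro n
    rw [hJ]
    simp only [leafPt_neg, heven]
    exact integral_neg_eq_self (fun u => h (leafPt (basePoint Λ) n u) n) volume
  rw [← hJ]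
  rw [leafMeasure] at hint ⊢
  rw [integral_add_measure hint.left_of_add_measure hint.right_of_add_measure,
    show m.leafMeasure₀.map Neg.neg = m.leafMeasure₀.map (MeasurableEquiv.neg V) from rfl,
    (MeasurableEquiv.neg V).measurableEmbedding.integral_map]
  change 2⁻¹ * (_ + ∫ n, J (-n) ∂_) = _
  simp only [hneg]
  ring

end TransverseMeasure

theorem IsOneForm.isLeafKernel {φ : RawForm} (hφ : IsOneForm φ) {F K : Set Hyp}
    (hF : MeasurableSet F) (hK : IsCompact K) (hFK : F ⊆ K) :
    IsLeafKernel fun X n => F.indicator (fun X => density (fun X v => φ X v) X n) X :=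
  IsLeafKernel.indicator_of_continuous hφ.continuous_density hF hK hFK

namespace FlowBox

variable (R : FlowBox Λ)

/-- The part of a flow-box at the heights in `A`. -/
def slab (A : Set ℝ) : Set Hyp := R.map '' (Icc R.a R.b ×ˢ A)

variable {R}

theorem prod_subset_rect {A : Set ℝ} (hA : A ⊆ R.C) : Icc R.a R.b ×ˢ A ⊆ R.rect :=
  fun _ hp => R.mem_rect hp.1 (hA hp.2)

theorem measurableSet_slab {A : Set ℝ} (hA : MeasurableSet A) (hAC : A ⊆ R.C) :
    MeasurableSet (R.slab A) :=
  (measurableSet_Icc.prod hA).image_of_continuousOn_injOn (R.continuousOn_map.mono (prod_subset_rect hAC))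
    (R.injOn_map.mono (prod_subset_rect hAC))

theorem slab_subset {A : Set ℝ} (hAC : A ⊆ R.C) : R.slab A ⊆ R.map '' R.rect :=
  image_mono (prod_subset_rect hAC)

theorem isCompact_image_rect : IsCompact (R.map '' R.rect) :=
  R.isCompact_rect.image_of_continuousOn R.continuousOn_map

theorem isLeafKernel_slab {A : Set ℝ} (hA : MeasurableSet A) (hAC : A ⊆ R.C) (φ : Omega1 S) :
    IsLeafKernel fun X n => (R.slab A).indicator (fun X => density (fun X v => (φ : RawForm) X v) X n) X :=
  φ.2.1.isLeafKernel (measurableSet_slab hA hAC) isCompact_image_rect (slab_subset hAC)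

theorem normal_eq_of_map_eq {t s : ℝ} (ht : t ∈ Icc R.a R.b) (hs : s ∈ R.C) {n : V}
    (hn : IsLeafNormal Λ n) (hO : mink n (basePoint Λ) < 0) {u : ℝ}
    (h : R.map (t, s) = leafPt (basePoint Λ) n u) : R.normal s = n := by
  rw [← R.normalAt_map ht hs]
  refine (eq_normalAt hn ?_ hO).symm
  rw [h]; exact mink_leafPt hn.1 u

theorem leafPt_mem_slab {A : Set ℝ} (hAC : A ⊆ R.C) (hinj : InjOn R.normal A) {s : ℝ} (hs : s ∈ A)
    (u : ℝ) : leafPt (basePoint Λ) (R.normal s) u ∈ R.slab A ↔ u ∈ R.arcTimes s := by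
  rw [R.mem_arcTimes (hAC hs)]
  constructor
  · rintro ⟨⟨t, s'⟩, ⟨ht, hs'⟩, e⟩
    have hsp := R.normal_spec (hAC hs)
    have := hinj hs' hs (normal_eq_of_map_eq ht (hAC hs') hsp.1 hsp.2 e)
    simp only at this
    exact ⟨t, ht, this ▸ e⟩
  · rintro ⟨t, ht, e⟩
    exact ⟨(t, s), ⟨ht, hs⟩, e⟩

end FlowBox

namespace TransverseMeasure

variable (m : TransverseMeasure Λ) {R : FlowBox Λ} (φ : Omega1 S)

/-- When arcs with heights in `A` lie in different leaves, the leaf at height `s` is inside the slab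
exactly during `arcTimes s`. -/
theorem leafIntegral_slab_of_injOn {A : Set ℝ} (hA : MeasurableSet A) (hAC : A ⊆ R.C)
    (hinj : InjOn R.normal A)
    (hmap : ((m.μ R).restrict A).map R.normal = m.leafMeasure₀.restrict (R.normal '' A)) :
    m.leafIntegral (fun X n =>
      (R.slab A).indicator (fun X => density (fun X v => (φ : RawForm) X v) X n) X) =
      ∫ s in A, (∫ t in R.a..R.b, R.integrand (φ : RawForm) t s) ∂(m.μ R) := by
  have hk := FlowBox.isLeafKernel_slab hA hAC φ
  rw [m.leafIntegral_eq_of_even hk fun X n => by simp only [density_neg]]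
  obtain ⟨J, hJ⟩ : ∃ J : V → ℝ, J = fun n => ∫ u, (R.slab A).indicator
    (fun X => density (fun X v => (φ : RawForm) X v) X n) (leafPt (basePoint Λ) n u) := ⟨_, rfl⟩
  have hJm : StronglyMeasurable J := by
    rw [hJ]
    exact (hk.measurable.comp
      ((continuous_leafPt (basePoint Λ)).measurable.prodMk measurable_fst)).stronglyMeasurable.integral_prod_right'
  have hJ0 : ∀ᵐ n ∂m.leafMeasure₀, n ∉ R.normal '' A → J n = 0 := by
    filter_upwards [m.ae_leafMeasure₀] with n hn hnA
    rw [hJ]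
    refine integral_eq_zero_of_ae (Eventually.of_forall fun u => indicator_of_notMem ?_ _)
    rintro ⟨⟨t, s⟩, ⟨ht, hs⟩, e⟩
    exact hnA ⟨s, hs, FlowBox.normal_eq_of_map_eq ht (hAC hs) hn.1 hn.2 e⟩
  rw [← hJ, ← setIntegral_eq_integral_of_ae_compl_eq_zero hJ0, ← hmap,
    integral_map R.measurable_normal.aemeasurable hJm.aestronglyMeasurable]
  refine setIntegral_congr_fun hA fun s hs => ?_
  rw [(R.intervalIntegrable_integrand φ (hAC hs)).2, hJ]
  simp only
  rw [← integral_indicator (show MeasurableSet (R.arcTimes s) from measurableSet_Icc)]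
  congr 1
  ext u
  by_cases hu : u ∈ R.arcTimes s
  · rw [indicator_of_mem hu, indicator_of_mem ((FlowBox.leafPt_mem_slab hAC hinj hs u).2 hu)]
  · rw [indicator_of_notMem hu, indicator_of_notMem fun h => hu ((FlowBox.leafPt_mem_slab hAC hinj hs u).1 h)]

theorem leafIntegral_slab_union {A B : Set ℝ} (hA : MeasurableSet A) (hAC : A ⊆ R.C)
    (hB : MeasurableSet B) (hBC : B ⊆ R.C) (hd : Disjoint A B)
    (h1 : m.leafIntegral (fun X n =>
      (R.slab A).indicator (fun X => density (fun X v => (φ : RawForm) X v) X n) X) =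
      ∫ s in A, (∫ t in R.a..R.b, R.integrand (φ : RawForm) t s) ∂(m.μ R))
    (h2 : m.leafIntegral (fun X n =>
      (R.slab B).indicator (fun X => density (fun X v => (φ : RawForm) X v) X n) X) =
      ∫ s in B, (∫ t in R.a..R.b, R.integrand (φ : RawForm) t s) ∂(m.μ R)) :
    m.leafIntegral (fun X n =>
      (R.slab (A ∪ B)).indicator (fun X => density (fun X v => (φ : RawForm) X v) X n) X) =
      ∫ s in A ∪ B, (∫ t in R.a..R.b, R.integrand (φ : RawForm) t s) ∂(m.μ R) := by
  have hi := m.integrable_integral R φ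
  rw [setIntegral_union hd hB hi.integrableOn hi.integrableOn, ← h1, ← h2,
    ← m.leafIntegral_add (FlowBox.isLeafKernel_slab hA hAC φ) (FlowBox.isLeafKernel_slab hB hBC φ)]
  have hd' : Disjoint (R.slab A) (R.slab B) := by
    rw [Set.disjoint_left]
    rintro _ ⟨p, hp, rfl⟩ ⟨q, hq, e⟩
    have := R.injOn_map (FlowBox.prod_subset_rect hBC hq) (FlowBox.prod_subset_rect hAC hp) e
    subst this
    exact Set.disjoint_left.1 hd hp.2 hq.2
  congr 1
  ext X n
  rw [FlowBox.slab, prod_union, image_union]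
  change (R.slab A ∪ R.slab B).indicator _ X = _
  rw [indicator_union_of_disjoint hd']

/-- Injectivity of the normal map is only local. Compactness of `C` and additivity over disjoint
Borel sets of heights extend the previous case to all of `C`. -/
theorem leafIntegral_slab {A : Set ℝ} (hA : MeasurableSet A) (hAC : A ⊆ R.C) :
    m.leafIntegral (fun X n =>
      (R.slab A).indicator (fun X => density (fun X v => (φ : RawForm) X v) X n) X) =
      ∫ s in A, (∫ t in R.a..R.b, R.integrand (φ : RawForm) t s) ∂(m.μ R) := by
  suffices h : ∃ B : Set ℝ, MeasurableSet B ∧ R.C ⊆ B ∧ ∀ A, MeasurableSet A → A ⊆ R.C → A ⊆ B →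
      m.leafIntegral (fun X n =>
        (R.slab A).indicator (fun X => density (fun X v => (φ : RawForm) X v) X n) X) =
        ∫ s in A, (∫ t in R.a..R.b, R.integrand (φ : RawForm) t s) ∂(m.μ R) by
    obtain ⟨B, -, hB, h⟩ := h
    exact h A hA hAC (hAC.trans hB)
  refine R.isCompact_C.induction_on (p := fun s => ∃ B : Set ℝ, MeasurableSet B ∧ s ⊆ B ∧
      ∀ A, MeasurableSet A → A ⊆ R.C → A ⊆ B → m.leafIntegral (fun X n =>
        (R.slab A).indicator (fun X => density (fun X v => (φ : RawForm) X v) X n) X) =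
        ∫ s in A, (∫ t in R.a..R.b, R.integrand (φ : RawForm) t s) ∂(m.μ R)) ?_ ?_ ?_ ?_
  · refine ⟨∅, MeasurableSet.empty, Subset.rfl, fun A _ _ h => ?_⟩
    rw [subset_empty_iff.1 h]
    simp [FlowBox.slab, leafIntegral]
  · rintro s t hst ⟨B, hB, htB, h⟩
    exact ⟨B, hB, hst.trans htB, h⟩
  · rintro s t ⟨B, hB, hsB, h⟩ ⟨B', hB', htB, h'⟩
    refine ⟨B ∪ B', hB.union hB', union_subset_union hsB htB, fun A hA hAC hAB => ?_⟩
    rw [← inter_union_sdiff A B]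
    refine m.leafIntegral_slab_union φ (hA.inter hB) (inter_subset_left.trans hAC) (hA.diff hB)
      (sdiff_subset.trans hAC) (disjoint_sdiff_inter.symm) ?_ ?_
    · exact h _ (hA.inter hB) (inter_subset_left.trans hAC) inter_subset_right
    · exact h' _ (hA.diff hB) (sdiff_subset.trans hAC) fun x hx => (hAB hx.1).resolve_left hx.2
  · intro s hs
    obtain ⟨ε, hε, h⟩ := m.exists_map_normal_eq R hs
    refine ⟨Metric.ball s ε, mem_nhdsWithin_of_mem_nhds (Metric.ball_mem_nhds s hε), Metric.ball s ε,
      Metric.isOpen_ball.measurableSet, Subset.rfl, fun A hA hAC hAB => ?_⟩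
    obtain ⟨h1, h2⟩ := h A hA hAC hAB
    exact m.leafIntegral_slab_of_injOn φ hA hAC h1 h2

theorem leafIntegral_slab_C : m.leafIntegral (fun X n =>
      (R.slab R.C).indicator (fun X => density (fun X v => (φ : RawForm) X v) X n) X) =
    m.boxIntegral R (φ : RawForm) := by
  rw [m.leafIntegral_slab φ R.isClosed.measurableSet Subset.rfl, m.restrict_C]
  rfl

end TransverseMeasure

/-- Since the box embeds in `M`, exactly one translate of a point of `λ` with `φ ≠ 0` lies in the
slab; where `φ = 0` all terms vanish. -/
theorem FlowBox.Supports.density_eq {R : FlowBox Λ} {φ : Omega1 S} (h : R.Supports (φ : RawForm))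
    {X : Hyp} {n : V} (hn : IsLeafNormal Λ n) (hX : mink n X = 0) :
    density (fun X v => (φ : RawForm) X v) X n = ∑ᶠ γ : π, (R.slab R.C).indicator
      (fun Y => density (fun X v => (φ : RawForm) X v) Y (lin (S.σ γ) n)) (act (S.σ γ) X) := by
  classical
  obtain ⟨K, hKR, -, hK⟩ := h
  by_cases h0 : (φ : RawForm) X = 0
  · have hd : density (fun X v => (φ : RawForm) X v) X n = 0 := by
      rw [density, h0]; exact killing_zero_left _
    rw [hd]
    refine (finsum_eq_zero_of_forall_eq_zero fun γ => ?_).symm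
    rw [indicator_apply, density_act, hd, ite_self]
  obtain ⟨γ₀, p, hp, e⟩ := hK X h0
  change X = act (S.σ γ₀) (R.map p) at e
  have hpR : p ∈ R.rect := ⟨Ioo_subset_Icc_self (hKR hp).1, Ioo_subset_Icc_self (hKR hp).2⟩
  have e' : act (S.σ γ₀⁻¹) X = R.map p := by rw [e, map_inv, act_inv_act]
  have hpC : p.2 ∈ R.C := by
    refine (R.preimage p.1 hpR.1 p.2 hpR.2).1 ?_
    change R.map p ∈ _
    rw [← e']
    refine (hn.lin γ₀⁻¹).mem_support ?_
    rw [coe_act, mink_lin, hX]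
  rw [finsum_eq_single _ γ₀⁻¹, indicator_of_mem, density_act]
  · rw [e']; exact mem_image_of_mem _ ⟨hpR.1, hpC⟩
  · intro γ hγ
    refine indicator_of_notMem ?_ _
    rintro ⟨q, hq, hqX⟩
    refine hγ ?_
    rw [e, ← act_mul, ← map_mul] at hqX
    exact eq_inv_of_mul_eq_one_left
      (R.group_eq_one_of_map_eq (FlowBox.prod_subset_rect Subset.rfl hq) hpR hqX)

theorem exists_cutoff (Λ : GeodesicLamination S) : ∃ β : Hyp → ℝ, SmoothOnHyp β ∧
    (∃ K, IsCompact K ∧ ∀ X ∉ K, β X = 0) ∧ ∀ X, orbitSum S β X = 1 := by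
  obtain ⟨-, -, -, -, β, K, -, -, h1, h2, h3, h4⟩ := exists_partition Λ
  exact ⟨β, h1, ⟨K, h2, h3⟩, h4⟩

variable (Λ) in
/-- A compactly supported smooth function whose translates add up to one. -/
noncomputable def cutoff : Hyp → ℝ := (exists_cutoff Λ).choose

theorem smooth_cutoff : SmoothOnHyp (cutoff Λ) := (exists_cutoff Λ).choose_spec.1

theorem exists_isCompact_cutoff : ∃ K, IsCompact K ∧ ∀ X ∉ K, cutoff Λ X = 0 :=
  (exists_cutoff Λ).choose_spec.2.1

theorem orbitSum_cutoff (X : Hyp) : orbitSum S (cutoff Λ) X = 1 := (exists_cutoff Λ).choose_spec.2.2 X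

theorem IsOneForm.isLeafKernel_cutoff {φ : RawForm} (hφ : IsOneForm φ) :
    IsLeafKernel fun X n => cutoff Λ X * density (fun X v => φ X v) X n := by
  obtain ⟨K, hK, h⟩ := exists_isCompact_cutoff (Λ := Λ)
  refine IsLeafKernel.of_continuous ?_ hK fun X hX n => by rw [h X hX, zero_mul]
  exact (smooth_cutoff.continuous.comp continuous_fst).mul hφ.continuous_density

theorem density_add (φ ψ : Hyp → V → Mat) (X : Hyp) (n : V) :
    density (fun X v => φ X v + ψ X v) X n = density φ X n + density ψ X n := killing_add_left _ _ _

theorem density_const_smul (c : ℝ) (φ : Hyp → V → Mat) (X : Hyp) (n : V) :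
    density (fun X v => c • φ X v) X n = c * density φ X n := killing_smul_left _ _ _

namespace TransverseMeasure

variable (m : TransverseMeasure Λ)

/-- The current of integration over the leaves of a measured lamination. -/
noncomputable def current : Omega1 S →ₗ[ℝ] ℝ where
  toFun φ := m.leafIntegral fun X n => cutoff Λ X * density (fun X v => (φ : RawForm) X v) X n
  map_add' φ ψ := by
    rw [← m.leafIntegral_add φ.2.1.isLeafKernel_cutoff ψ.2.1.isLeafKernel_cutoff]
    congr 1
    ext X n
    rw [← mul_add, ← density_add]
    rfl
  map_smul' c φ := by
    rw [RingHom.id_apply, smul_eq_mul, ← m.leafIntegral_const_mul]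
    congr 1
    ext X n
    rw [mul_left_comm, ← density_const_smul c (fun X v => (φ : RawForm) X v)]
    rfl

/-- The current may be computed from any kernel whose orbit sum is the density of `φ`: slabs, test
forms on `ℍ` and exact forms each bring their own. -/
theorem current_eq_leafIntegral (φ : Omega1 S) {h : Hyp → V → ℝ} (hh : IsLeafKernel h)
    (hG : ∀ (X : Hyp) (n : V), IsLeafNormal Λ n → mink n X = 0 →
      density (fun X v => (φ : RawForm) X v) X n = ∑ᶠ γ : π, h (act (S.σ γ) X) (lin (S.σ γ) n)) :
    m.current φ = m.leafIntegral h := by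
  obtain ⟨K, hK, hβ⟩ := exists_isCompact_cutoff (Λ := Λ)
  exact m.leafIntegral_unfold smooth_cutoff.continuous hK hβ orbitSum_cutoff hh hG

theorem current_eq_boxIntegral {R : FlowBox Λ} {φ : Omega1 S} (h : R.Supports (φ : RawForm)) :
    m.current φ = m.boxIntegral R (φ : RawForm) := by
  rw [← m.leafIntegral_slab_C]
  exact m.current_eq_leafIntegral φ (FlowBox.isLeafKernel_slab R.isClosed.measurableSet Subset.rfl φ)
    fun X n hn hX => h.density_eq hn hX

theorem isStandardCurrent_current : IsStandardCurrent m m.current := by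
  rintro φ n R ψ ⟨rfl, h⟩
  rw [map_sum]
  exact Finset.sum_congr rfl fun i _ => m.current_eq_boxIntegral (h i)

theorem eq_current {T : Omega1 S →ₗ[ℝ] ℝ} (hT : IsStandardCurrent m T) : T = m.current := by
  ext φ
  obtain ⟨n, R, ψ, h⟩ := exists_isDecomposition (Λ := Λ) φ
  rw [hT φ n R ψ h, m.isStandardCurrent_current φ n R ψ h]

end TransverseMeasure

end Lamination

end LieLam

/-! ### Stokes' theorem in a half-plane and Fermi coordinates -/

namespace LieLam

open Topology Filter Set

theorem det_prod (L : ℝ × ℝ →L[ℝ] ℝ × ℝ) :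
    L.det = (L (1, 0)).1 * (L (0, 1)).2 - (L (1, 0)).2 * (L (0, 1)).1 := by
  rw [ContinuousLinearMap.det, ← LinearMap.det_toMatrix (Module.Basis.finTwoProd ℝ), Matrix.det_fin_two]
  simp [LinearMap.toMatrix_apply]
  ring

theorem clm_prod_apply {E : Type*} [NormedAddCommGroup E] [NormedSpace ℝ E] (L : ℝ × ℝ →L[ℝ] E)
    (a : ℝ × ℝ) : L a = a.1 • L (1, 0) + a.2 • L (0, 1) := by
  rw [← map_smul, ← map_smul, ← map_add]
  congr 1
  ext <;> simp

/-- The exterior derivative commutes with pull-backs. -/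
theorem pullback_curl {P Q : ℝ × ℝ → ℝ} {Φ : ℝ × ℝ → ℝ × ℝ} (hP : ContDiff ℝ ∞ P) (hQ : ContDiff ℝ ∞ Q)
    (hΦ : ContDiff ℝ ∞ Φ) (z : ℝ × ℝ) :
    fderiv ℝ (fun z => P (Φ z) * (fderiv ℝ Φ z (0, 1)).1 + Q (Φ z) * (fderiv ℝ Φ z (0, 1)).2) z (1, 0) -
      fderiv ℝ (fun z => P (Φ z) * (fderiv ℝ Φ z (1, 0)).1 + Q (Φ z) * (fderiv ℝ Φ z (1, 0)).2) z (0, 1) =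
    (fderiv ℝ Q (Φ z) (1, 0) - fderiv ℝ P (Φ z) (0, 1)) * (fderiv ℝ Φ z).det := by
  have hΦd := hΦ.differentiable (by simp)
  have hD : Differentiable ℝ (fderiv ℝ Φ) :=
    (hΦ.fderiv_right (m := ∞) (by simp)).differentiable (by simp)
  -- The terms with second derivatives of `Φ` cancel by symmetry; what remains is the Jacobian.
  have hsymm : fderiv ℝ (fderiv ℝ Φ) z (1, 0) (0, 1) = fderiv ℝ (fderiv ℝ Φ) z (0, 1) (1, 0) :=
    hΦ.contDiffAt.isSymmSndFDerivAt
      (by rw [minSmoothness_of_isRCLikeNormedField]; exact WithTop.coe_le_coe.2 (le_top : (2 : ℕ∞) ≤ ⊤)) _ _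
  have key : ∀ e f : ℝ × ℝ, fderiv ℝ (fun z => P (Φ z) * (fderiv ℝ Φ z e).1 +
      Q (Φ z) * (fderiv ℝ Φ z e).2) z f =
      P (Φ z) * (fderiv ℝ (fderiv ℝ Φ) z f e).1 + (fderiv ℝ Φ z e).1 * fderiv ℝ P (Φ z) (fderiv ℝ Φ z f) +
      (Q (Φ z) * (fderiv ℝ (fderiv ℝ Φ) z f e).2 +
        (fderiv ℝ Φ z e).2 * fderiv ℝ Q (Φ z) (fderiv ℝ Φ z f)) := by
    intro e f
    have h1 : HasFDerivAt (fun z => fderiv ℝ Φ z e) ((fderiv ℝ (fderiv ℝ Φ) z).flip e) z := by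
      have := (hD z).hasFDerivAt.clm_apply (hasFDerivAt_const e z)
      simpa using this
    have hPc := ((hP.differentiable (by simp)) (Φ z)).hasFDerivAt.comp z (hΦd z).hasFDerivAt
    have hQc := ((hQ.differentiable (by simp)) (Φ z)).hasFDerivAt.comp z (hΦd z).hasFDerivAt
    have h2 := (hPc.mul h1.fst).add (hQc.mul h1.snd)
    have h3 := h2.fderiv
    change fderiv ℝ (fun z => P (Φ z) * (fderiv ℝ Φ z e).1 + Q (Φ z) * (fderiv ℝ Φ z e).2) z = _ at h3
    rw [h3]
    simp
  rw [key, key, hsymm, det_prod, clm_prod_apply (fderiv ℝ P (Φ z)) (fderiv ℝ Φ z (1, 0)),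
    clm_prod_apply (fderiv ℝ P (Φ z)) (fderiv ℝ Φ z (0, 1)),
    clm_prod_apply (fderiv ℝ Q (Φ z)) (fderiv ℝ Φ z (1, 0)),
    clm_prod_apply (fderiv ℝ Q (Φ z)) (fderiv ℝ Φ z (0, 1))]
  simp only [smul_eq_mul]
  ring

theorem integrable_fderiv_apply {p : ℝ × ℝ → ℝ} (hp : ContDiff ℝ ∞ p) (hc : HasCompactSupport p)
    (e : ℝ × ℝ) : Integrable fun z => fderiv ℝ p z e := by
  refine Continuous.integrable_of_hasCompactSupport ?_ (hc.fderiv_apply ℝ e)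
  exact ((hp.fderiv_right (m := 0) (by simp)).continuous).clm_apply continuous_const

/-- Stokes' theorem in the upper half-plane. -/
theorem integral_half_plane_curl {p q : ℝ × ℝ → ℝ} (hp : ContDiff ℝ ∞ p) (hq : ContDiff ℝ ∞ q)
    (hpc : HasCompactSupport p) (hqc : HasCompactSupport q) :
    ∫ z in (univ : Set ℝ) ×ˢ Ioi (0 : ℝ), (fderiv ℝ q z (1, 0) - fderiv ℝ p z (0, 1)) = ∫ u, p (u, 0) := by
  have hline : ∀ (u : ℝ), Topology.IsClosedEmbedding fun v : ℝ => (u, v) := fun u =>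
    Topology.IsClosedEmbedding.of_continuous_injective_isClosedMap (by fun_prop)
      (fun _ _ h => (Prod.mk.inj h).2) fun s hs => by
        have : (fun v : ℝ => (u, v)) '' s = {u} ×ˢ s := by ext ⟨a, b⟩; simp [and_comm, eq_comm]
        rw [this]; exact isClosed_singleton.prod hs
  have hline' : ∀ (v : ℝ), Topology.IsClosedEmbedding fun u : ℝ => (u, v) := fun v =>
    Topology.IsClosedEmbedding.of_continuous_injective_isClosedMap (by fun_prop)
      (fun _ _ h => (Prod.mk.inj h).1) fun s hs => by
        have : (fun u : ℝ => (u, v)) '' s = s ×ˢ {v} := by ext ⟨a, b⟩; simp [eq_comm]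
        rw [this]; exact hs.prod isClosed_singleton
  have hqi := integrable_fderiv_apply hq hqc (1, 0)
  have hpi := integrable_fderiv_apply hp hpc (0, 1)
  rw [integral_sub hqi.integrableOn hpi.integrableOn]
  have h1 : ∫ z in (univ : Set ℝ) ×ˢ Ioi (0 : ℝ), fderiv ℝ q z (1, 0) = 0 := by
    rw [Measure.volume_eq_prod, ← Measure.prod_restrict, integral_prod_symm]
    · refine integral_eq_zero_of_ae (Eventually.of_forall fun v => ?_)
      rw [Measure.restrict_univ]
      have hc := hqc.comp_isClosedEmbedding (hline' v)
      have hd : ∀ u, HasDerivAt (fun u => q (u, v)) (fderiv ℝ q (u, v) (1, 0)) u := fun u =>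
        ((hq.differentiable (by simp)) (u, v)).hasFDerivAt.comp_hasDerivAt u
          ((hasDerivAt_id u).prodMk (hasDerivAt_const u v))
      have hi : Integrable fun u => fderiv ℝ q (u, v) (1, 0) :=
        Continuous.integrable_of_hasCompactSupport
          ((((hq.fderiv_right (m := 0) (by simp)).continuous).clm_apply continuous_const).comp
            (by fun_prop)) ((hqc.fderiv_apply ℝ (1, 0)).comp_isClosedEmbedding (hline' v))
      exact integral_eq_zero_of_hasDerivAt_of_integrable hd hi
        ((hq.continuous.comp (by fun_prop)).integrable_of_hasCompactSupport hc)
    · rw [Measure.prod_restrict]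
      exact hqi.integrableOn
  have h2 : ∫ z in (univ : Set ℝ) ×ˢ Ioi (0 : ℝ), fderiv ℝ p z (0, 1) = ∫ u, -p (u, 0) := by
    rw [Measure.volume_eq_prod, setIntegral_prod _ hpi.integrableOn, Measure.restrict_univ]
    congr 1
    ext u
    have hd : ∀ v, deriv (fun v => p (u, v)) v = fderiv ℝ p (u, v) (0, 1) := fun v =>
      (((hp.differentiable (by simp)) (u, v)).hasFDerivAt.comp_hasDerivAt v
          ((hasDerivAt_const v u).prodMk (hasDerivAt_id v))).deriv
    simp only [← hd]
    exact HasCompactSupport.integral_Ioi_deriv_eq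
      ((hp.of_le (by simp)).comp (contDiff_const.prodMk contDiff_id))
      (hpc.comp_isClosedEmbedding (hline u)) 0
  rw [h1, h2, integral_neg, zero_sub, neg_neg]

namespace Frame

variable (f : Frame)

/-- Fermi coordinates along the geodesic of a frame. -/
noncomputable def fermiVec (z : ℝ × ℝ) : V := Real.cosh z.2 • f.vec z.1 + Real.sinh z.2 • f.n

/-- Fermi coordinates along the geodesic of a frame. -/
noncomputable def fermiPt (z : ℝ × ℝ) : Hyp :=
  (Frame.mk' (f.pt z.1) f.n f.nn (f.move z.1).nX).pt z.2

/-- Fermi coordinates along the geodesic of a frame, in the global chart. -/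
noncomputable def fermi (z : ℝ × ℝ) : ℝ × ℝ := crd (f.fermiVec z)

theorem coe_fermiPt (z : ℝ × ℝ) : (f.fermiPt z : V) = f.fermiVec z := rfl

theorem chart_fermi (z : ℝ × ℝ) : chart (f.fermi z) = f.fermiPt z := chart_crd (f.fermiPt z)

theorem contDiff_fermiVec : ContDiff ℝ ∞ f.fermiVec := by
  unfold fermiVec vec
  have h1 : ContDiff ℝ ∞ fun z : ℝ × ℝ => Real.cosh z.2 := Real.contDiff_cosh.comp contDiff_snd
  have h2 : ContDiff ℝ ∞ fun z : ℝ × ℝ => Real.sinh z.2 := Real.contDiff_sinh.comp contDiff_snd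
  have h3 : ContDiff ℝ ∞ fun z : ℝ × ℝ => Real.cosh z.1 := Real.contDiff_cosh.comp contDiff_fst
  have h4 : ContDiff ℝ ∞ fun z : ℝ × ℝ => Real.sinh z.1 := Real.contDiff_sinh.comp contDiff_fst
  exact (h1.smul ((h3.smul contDiff_const).add (h4.smul contDiff_const))).add (h2.smul contDiff_const)

theorem contDiff_fermi : ContDiff ℝ ∞ f.fermi := contDiff_crd.comp f.contDiff_fermiVec

theorem fderiv_fermiVec_fst (z : ℝ × ℝ) :
    fderiv ℝ f.fermiVec z (1, 0) = Real.cosh z.2 • f.vel z.1 := by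
  have h1 := ((f.contDiff_fermiVec.differentiable (by simp)) (z.1, z.2)).hasFDerivAt.comp_hasDerivAt z.1
    ((hasDerivAt_id z.1).prodMk (hasDerivAt_const z.1 z.2))
  have h2 : HasDerivAt (fun u => Real.cosh z.2 • f.vec u + Real.sinh z.2 • f.n)
      (Real.cosh z.2 • f.vel z.1) z.1 := ((f.hasDerivAt_vec z.1).fun_const_smul _).add_const _
  exact h1.unique h2

theorem fderiv_fermiVec_snd (z : ℝ × ℝ) :
    fderiv ℝ f.fermiVec z (0, 1) = Real.sinh z.2 • f.vec z.1 + Real.cosh z.2 • f.n := by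
  have h1 := ((f.contDiff_fermiVec.differentiable (by simp)) (z.1, z.2)).hasFDerivAt.comp_hasDerivAt z.2
    ((hasDerivAt_const z.2 z.1).prodMk (hasDerivAt_id z.2))
  have h2 : HasDerivAt (fun v => Real.cosh v • f.vec z.1 + Real.sinh v • f.n)
      (Real.sinh z.2 • f.vec z.1 + Real.cosh z.2 • f.n) z.2 :=
    ((Real.hasDerivAt_cosh z.2).smul_const _).add ((Real.hasDerivAt_sinh z.2).smul_const _)
  exact h1.unique h2

theorem fderiv_fermi (z e : ℝ × ℝ) : fderiv ℝ f.fermi z e = crd (fderiv ℝ f.fermiVec z e) := by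
  let L : V →L[ℝ] ℝ × ℝ := (ContinuousLinearMap.proj (R := ℝ) (φ := fun _ : Fin 3 => ℝ) 0).prod
    (ContinuousLinearMap.proj (R := ℝ) (φ := fun _ : Fin 3 => ℝ) 1)
  have h := (L.hasFDerivAt (x := f.fermiVec z)).comp z
    ((f.contDiff_fermiVec.differentiable (by simp)) z).hasFDerivAt
  have h' : HasFDerivAt f.fermi (L ∘SL fderiv ℝ f.fermiVec z) z := h
  rw [h'.fderiv]
  rfl

theorem fderiv_chartV_fermi (z e : ℝ × ℝ) :
    fderiv ℝ chartV (f.fermi z) (fderiv ℝ f.fermi z e) = fderiv ℝ f.fermiVec z e := by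
  have h := ((contDiff_chartV.differentiable (by simp)) (f.fermi z)).hasFDerivAt.comp z
    ((f.contDiff_fermi.differentiable (by simp)) z).hasFDerivAt
  have h' : chartV ∘ f.fermi = f.fermiVec := by
    ext1 w
    exact congrArg Subtype.val (f.chart_fermi w)
  rw [h'] at h
  rw [h.fderiv]
  rfl

variable {f} in
-- The cross product of the two partial derivatives is `-cosh v` times the point itself; its last
-- component is minus the Jacobian, and points of `ℍ` have positive height. So the coordinates
-- preserve orientation.
theorem det_fderiv_fermi (hf : f.e = lx f.n f.X) (z : ℝ × ℝ) : 0 < (fderiv ℝ f.fermi z).det := by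
  have h1 : lx f.n (f.vel z.1) = f.vec z.1 := Frame.lx_n_lx (f := f.move z.1) (f.vel_eq_lx hf z.1)
  have h2 : lx (f.vec z.1) (f.vel z.1) = f.n := by
    have h : mink (f.vec z.1) f.n = 0 := (f.move z.1).Xn
    rw [f.vel_eq_lx hf, lx_comm f.n, ← neg_one_smul ℝ (lx _ _), lx_smul_right, lx_lx, h,
      (f.vec_mem z.1).1]
    simp
  have h3 : lx (fderiv ℝ f.fermiVec z (1, 0)) (fderiv ℝ f.fermiVec z (0, 1)) =
      -(Real.cosh z.2 • f.fermiVec z) := by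
    rw [fderiv_fermiVec_fst, fderiv_fermiVec_snd, lx_smul_left, lx_add_right, lx_smul_right, lx_smul_right,
      lx_comm _ (f.vec z.1), h2, lx_comm _ f.n, h1, fermiVec]
    module
  have h4 := congrFun h3 2
  rw [lx_two] at h4
  have h5 : 1 ≤ f.fermiVec z 2 := (f.fermiPt z).one_le
  rw [det_prod, fderiv_fermi, fderiv_fermi]
  simp only [crd]
  have h6 : 0 < Real.cosh z.2 * f.fermiVec z 2 := mul_pos (Real.cosh_pos _) (by linarith)
  simp only [Pi.neg_apply, Pi.smul_apply, smul_eq_mul] at h4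
  linarith

theorem mink_n_fermiPt (z : ℝ × ℝ) : mink f.n (f.fermiPt z) = Real.sinh z.2 := by
  rw [coe_fermiPt, fermiVec, mink_add_right, mink_smul_right, mink_smul_right, f.nn]
  have : mink f.n (f.vec z.1) = 0 := (f.move z.1).nX
  rw [this]; ring

theorem mink_e_fermiPt (z : ℝ × ℝ) : mink f.e (f.fermiPt z) = Real.cosh z.2 * Real.sinh z.1 := by
  rw [coe_fermiPt, fermiVec, mink_add_right, mink_smul_right, mink_smul_right, f.en, mink_vec, f.ee, f.eX]
  ring

theorem mink_X_fermiPt (z : ℝ × ℝ) : mink f.X (f.fermiPt z) = -(Real.cosh z.2 * Real.cosh z.1) := by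
  rw [coe_fermiPt, fermiVec, mink_add_right, mink_smul_right, mink_smul_right, f.Xn, mink_vec, f.Xe,
    f.X.mink_self]
  ring

theorem injective_fermi : Function.Injective f.fermi := by
  intro z w h
  have h' : f.fermiPt z = f.fermiPt w := by rw [← chart_fermi, ← chart_fermi, h]
  have h1 := f.mink_n_fermiPt z
  have h2 := f.mink_e_fermiPt z
  rw [h', mink_n_fermiPt] at h1
  rw [h', mink_e_fermiPt] at h2
  have h3 := Real.sinh_injective h1
  rw [h3] at h2
  exact Prod.ext (Real.sinh_injective (mul_left_cancel₀ (Real.cosh_pos _).ne' h2)).symm h3.symm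

theorem exists_fermiPt_eq (Y : Hyp) : ∃ z, f.fermiPt z = Y := by
  set s := mink f.n Y with hs
  set b := mink f.e Y with hb
  have hv : Real.cosh (Real.arsinh s) ≠ 0 := (Real.cosh_pos _).ne'
  have h1 := f.mink_expand Y Y
  rw [Y.mink_self, mink_comm _ f.e, mink_comm _ f.n, ← hs, ← hb, mink_comm _ f.X] at h1
  have h2 := mink_hyp_le f.X Y
  set z : ℝ × ℝ := (Real.arsinh (b / Real.cosh (Real.arsinh s)), Real.arsinh s) with hz
  have h3 : mink f.X Y = -(Real.cosh z.2 * Real.cosh z.1) := by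
    have h4 := Real.cosh_sq z.1
    have h5 := Real.cosh_sq z.2
    have h6 : Real.cosh z.2 * Real.sinh z.1 = b := by
      rw [hz, Real.sinh_arsinh]; field_simp
    have h7 : Real.sinh z.2 = s := Real.sinh_arsinh s
    rw [h7] at h5
    have h8 : (mink f.X Y) ^ 2 = (Real.cosh z.2 * Real.cosh z.1) ^ 2 := by
      have : (Real.cosh z.2 * Real.cosh z.1) ^ 2 = (Real.cosh z.2 * Real.sinh z.1) ^ 2 + Real.cosh z.2 ^ 2 := by
        rw [mul_pow, h4]; ring
      rw [this, h6, h5]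
      linarith
    have h9 : 0 < Real.cosh z.2 * Real.cosh z.1 := mul_pos (Real.cosh_pos _) (Real.cosh_pos _)
    rcases sq_eq_sq_iff_eq_or_eq_neg.1 h8 with h | h
    · linarith
    · exact h
  refine ⟨z, Subtype.ext ?_⟩
  rw [f.expand (f.fermiPt z), f.expand (Y : V), mink_comm _ f.X, mink_comm _ f.e, mink_comm _ f.n,
    mink_comm _ f.X, mink_comm _ f.e, mink_comm _ f.n, mink_n_fermiPt, mink_e_fermiPt, mink_X_fermiPt, h3,
    ← hs, ← hb]
  have h6 : Real.cosh z.2 * Real.sinh z.1 = b := by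
    rw [hz, Real.sinh_arsinh]; field_simp
  rw [h6, show Real.sinh z.2 = s from Real.sinh_arsinh s]

theorem image_fermi : f.fermi '' ((univ : Set ℝ) ×ˢ Ioi (0 : ℝ)) = {p | 0 < mink f.n (chart p)} := by
  ext p
  constructor
  · rintro ⟨z, hz, rfl⟩
    rw [Set.mem_ofPred_eq, chart_fermi, mink_n_fermiPt]
    exact Real.sinh_pos_iff.2 hz.2
  · intro hp
    obtain ⟨z, hz⟩ := f.exists_fermiPt_eq (chart p)
    refine ⟨z, ⟨mem_univ _, ?_⟩, ?_⟩
    · rw [Set.mem_ofPred_eq, ← hz, mink_n_fermiPt] at hp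
      exact Real.sinh_pos_iff.1 hp
    · have : chart (f.fermi z) = chart p := by rw [chart_fermi, hz]
      exact chartHomeo.injective this

/-- Makes compact supports in `ℍ` compact in Fermi coordinates. -/
theorem norm_le_of_fermiPt (z : ℝ × ℝ) : ‖z‖ ≤ -mink f.X (f.fermiPt z) := by
  have habs : ∀ x : ℝ, |x| ≤ Real.cosh x := fun x => by
    have h4 := Real.self_le_sinh_iff.2 (abs_nonneg x)
    have h5 := Real.sinh_lt_cosh |x|
    rw [Real.cosh_abs] at h5
    linarith
  rw [mink_X_fermiPt, neg_neg, Prod.norm_def, Real.norm_eq_abs, Real.norm_eq_abs]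
  have h1 := Real.one_le_cosh z.1
  have h2 := Real.one_le_cosh z.2
  refine max_le ((habs _).trans ?_) ((habs _).trans ?_) <;> nlinarith

end Frame

end LieLam

/-! ### Derivatives of indicator functions of half-planes; leaves separating points -/

namespace LieLam

open Topology Filter Set

theorem contDiff_killing {E : ℝ × ℝ → Mat} (hE : ∀ i j, ContDiff ℝ ∞ fun q => E q i j) (A : Mat) :
    ContDiff ℝ ∞ fun q => killing A (E q) := by
  simp only [killing_eq]
  exact ContDiff.sum fun i _ => ContDiff.sum fun j _ => contDiff_const.mul (hE j i)

theorem fderiv_killing {E : ℝ × ℝ → Mat} (hE : ∀ i j, ContDiff ℝ ∞ fun q => E q i j) (A : Mat)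
    (p e : ℝ × ℝ) : fderiv ℝ (fun q => killing A (E q)) p e =
      killing A (Matrix.of fun i j => fderiv ℝ (fun q => E q i j) p e) := by
  simp only [killing_eq, Matrix.of_apply]
  have hd : ∀ i j, HasFDerivAt (fun q => A i j * E q j i) (A i j • fderiv ℝ (fun q => E q j i) p) p :=
    fun i j => (((hE j i).differentiable (by simp)) p).hasFDerivAt.const_mul _
  have h := HasFDerivAt.fun_sum (u := Finset.univ) fun i _ =>
    HasFDerivAt.fun_sum (u := Finset.univ) fun j _ => hd i j
  rw [h.fderiv]
  simp

section Forms

variable {η : RawForm}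

theorem IsOneForm.contDiff_apply (hη : IsOneForm η) (e : ℝ × ℝ) (i j : Fin 3) :
    ContDiff ℝ ∞ fun q => η (chart q) (fderiv ℝ chartV q e) i j := by
  have hw : ∀ k, SmoothOnHyp fun X => fderiv ℝ chartV (crd X) e k := by
    intro k
    have h : ContDiff ℝ ∞ fun q => fderiv ℝ chartV q e :=
      (contDiff_chartV.fderiv_right (m := ∞) (by simp)).clm_apply contDiff_const
    exact (contDiff_pi.1 h) k
  exact hη.smooth_apply hw i j

theorem IsOneForm.killing_curl (hη : IsOneForm η) (A : Mat) (p : ℝ × ℝ) :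
    killing A (curl (fun X v => η X v) p) =
      fderiv ℝ (fun q => killing A (η (chart q) (fderiv ℝ chartV q (0, 1)))) p (1, 0) -
        fderiv ℝ (fun q => killing A (η (chart q) (fderiv ℝ chartV q (1, 0)))) p (0, 1) := by
  rw [fderiv_killing (hη.contDiff_apply _), fderiv_killing (hη.contDiff_apply _), sub_eq_add_neg,
    ← killing_neg_right, ← killing_add_right]
  rfl

theorem IsOneForm.continuous_killing_curl (hη : IsOneForm η) :
    Continuous fun z : (ℝ × ℝ) × V => killing (dual z.2) (curl (fun X v => η X v) z.1) := by
  simp only [killing_eq]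
  refine continuous_finsetSum _ fun i _ => continuous_finsetSum _ fun j _ => Continuous.mul ?_ ?_
  · exact (continuous_apply (A := fun _ => ℝ) i).comp
      (continuous_lx.comp (continuous_snd.prodMk (continuous_const (y := (Pi.single j 1 : V)))))
  · have h : ∀ e f, Continuous fun p => fderiv ℝ (fun q => η (chart q) (fderiv ℝ chartV q e) j i) p f :=
      fun e f => (((hη.contDiff_apply e j i).fderiv_right (m := 0) (by simp)).continuous).clm_apply
        continuous_const
    exact ((h _ _).sub (h _ _)).comp continuous_fst

theorem IsTestForm.curl_eq_zero {K : Set Hyp} (hη : IsTestForm K η) {p : ℝ × ℝ} (hp : chart p ∉ K) :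
    curl (fun X v => η X v) p = 0 := by
  have hU : chart ⁻¹' Kᶜ ∈ 𝓝 p := (hη.2.1.isClosed.isOpen_compl.preimage continuous_chart).mem_nhds hp
  have h : ∀ e i j, (fun q => η (chart q) (fderiv ℝ chartV q e) i j) =ᶠ[𝓝 p] fun _ => (0 : ℝ) := by
    intro e i j
    filter_upwards [hU] with q hq
    rw [hη.2.2 _ hq]; rfl
  ext i j
  simp only [curl, Matrix.of_apply, (h _ i j).fderiv_eq]
  simp

theorem IsTestForm.integrable_killing_curl {K : Set Hyp} (hη : IsTestForm K η) (n : V) :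
    Integrable fun p => killing (dual n) (curl (fun X v => η X v) p) := by
  refine Continuous.integrable_of_hasCompactSupport ?_ ?_
  · have h := hη.1.continuous_killing_curl.comp (Continuous.prodMk_left n)
    simpa only [Function.comp_def] using h
  · refine HasCompactSupport.intro (chartHomeo.isClosedEmbedding.isCompact_preimage hη.2.1) fun p hp => ?_
    rw [hη.curl_eq_zero hp, killing_zero_right]

/-- Stokes' theorem in a half-plane of the hyperbolic plane. -/
theorem IsTestForm.integral_half_plane {K : Set Hyp} (hη : IsTestForm K η) {f : Frame}
    (hf : f.e = lx f.n f.X) :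
    ∫ p in {p | 0 < mink f.n (chart p)}, killing (dual f.n) (curl (fun X v => η X v) p) =
      ∫ u, density (fun X v => η X v) (f.pt u) f.n := by
  obtain ⟨P, hP⟩ : ∃ P : ℝ × ℝ → ℝ,
    P = fun q => killing (dual f.n) (η (chart q) (fderiv ℝ chartV q (1, 0))) := ⟨_, rfl⟩
  obtain ⟨Q, hQ⟩ : ∃ Q : ℝ × ℝ → ℝ,
    Q = fun q => killing (dual f.n) (η (chart q) (fderiv ℝ chartV q (0, 1))) := ⟨_, rfl⟩
  have hPs : ContDiff ℝ ∞ P := by rw [hP]; exact contDiff_killing (hη.1.contDiff_apply _) _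
  have hQs : ContDiff ℝ ∞ Q := by rw [hQ]; exact contDiff_killing (hη.1.contDiff_apply _) _
  have hpull : ∀ z e, P (f.fermi z) * (fderiv ℝ f.fermi z e).1 + Q (f.fermi z) * (fderiv ℝ f.fermi z e).2 =
      killing (dual f.n) (η (f.fermiPt z) (fderiv ℝ f.fermiVec z e)) := by
    intro z e
    rw [← f.fderiv_chartV_fermi, clm_prod_apply (fderiv ℝ chartV (f.fermi z)), map_add, map_smul, map_smul,
      killing_add_right, killing_smul_right, killing_smul_right, ← f.chart_fermi, hP, hQ]
    ring
  have hsm : ∀ e, ContDiff ℝ ∞ fun z =>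
      P (f.fermi z) * (fderiv ℝ f.fermi z e).1 + Q (f.fermi z) * (fderiv ℝ f.fermi z e).2 := by
    intro e
    have h : ContDiff ℝ ∞ fun z => fderiv ℝ f.fermi z e :=
      (f.contDiff_fermi.fderiv_right (m := ∞) (by simp)).clm_apply contDiff_const
    exact ((hPs.comp f.contDiff_fermi).mul h.fst).add ((hQs.comp f.contDiff_fermi).mul h.snd)
  have hcs : ∀ e, HasCompactSupport fun z =>
      P (f.fermi z) * (fderiv ℝ f.fermi z e).1 + Q (f.fermi z) * (fderiv ℝ f.fermi z e).2 := by
    intro e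
    have hcont : Continuous fun X : Hyp => -mink f.X X :=
      (Continuous.mink continuous_const continuous_subtype_val).neg
    obtain ⟨c, hc⟩ := (hη.2.1.image hcont).bddAbove
    refine HasCompactSupport.intro (isCompact_closedBall (0 : ℝ × ℝ) c) fun z hz => ?_
    have : f.fermiPt z ∉ K := fun h =>
      hz (mem_closedBall_zero_iff.2 ((f.norm_le_of_fermiPt z).trans (hc ⟨_, h, rfl⟩)))
    rw [hpull, hη.2.2 _ this]
    exact killing_zero_right _
  have h := integral_half_plane_curl (hsm (1, 0)) (hsm (0, 1)) (hcs _) (hcs _)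
  -- Stokes is applied to the pulled back form; the Jacobian produced by the pull-back is the one in
  -- the change of variables, since it is positive.
  simp only [pullback_curl hPs hQs f.contDiff_fermi] at h
  rw [← f.image_fermi, integral_image_eq_integral_abs_det_fderiv_smul volume
    (MeasurableSet.univ.prod measurableSet_Ioi)
    (fun z _ => ((f.contDiff_fermi.differentiable (by simp)) z).hasFDerivAt.hasFDerivWithinAt)
    f.injective_fermi.injOn]
  refine Eq.trans (setIntegral_congr_fun (MeasurableSet.univ.prod measurableSet_Ioi) fun z _ => ?_)
    (h.trans ?_)
  · rw [abs_of_pos (Frame.det_fderiv_fermi hf z), hη.1.killing_curl, smul_eq_mul, mul_comm, hP, hQ]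
  · congr 1
    ext u
    have h0 : f.fermiPt (u, 0) = f.pt u := Subtype.ext (by simp [Frame.coe_fermiPt, Frame.fermiVec])
    rw [hpull, f.fderiv_fermiVec_fst, h0, Real.cosh_zero, one_smul, f.vel_eq_lx hf, killing_comm]
    rfl

end Forms

section Lamination

variable {π : Type*} [Group π] {S : HypSurface π} {Λ : GeodesicLamination S}

theorem IsLeafNormal.volume_eq_zero {n : V} (hn : IsLeafNormal Λ n) :
    volume {p : ℝ × ℝ | mink n (chart p) = 0} = 0 :=
  measure_mono_null (fun _ hp => hn.mem_support hp) (volume_support (Λ := Λ))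

theorem measurableSet_half_plane (n : V) : MeasurableSet {p : ℝ × ℝ | 0 < mink n (chart p)} :=
  (isOpen_lt continuous_const (Continuous.mink continuous_const
    (continuous_subtype_val.comp continuous_chart))).measurableSet

theorem IsTestForm.integral_half_plane_leafPt {K : Set Hyp} {η : RawForm} (hη : IsTestForm K η) {n : V}
    (hn : mink n n = 1) (O : Hyp) :
    ∫ p in {p | 0 < mink n (chart p)}, killing (dual n) (curl (fun X v => η X v) p) =
      ∫ u, density (fun X v => η X v) (leafPt O n u) n := by
  have h := hη.integral_half_plane (footFrame_e (O := O) hn)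
  rw [footFrame_n] at h
  rw [h]
  congr 1
  ext u
  rw [leafPt_eq hn]

theorem dual_neg (n : V) : dual (-n) = -dual n := by
  rw [← neg_one_smul ℝ n, dual_smul, neg_one_smul]

/-- The two sides of the leaf contribute the same integral along it with opposite signs, and the
leaf is a null set. -/
theorem IsTestForm.integral_killing_curl {K : Set Hyp} {η : RawForm} (hη : IsTestForm K η) {n : V}
    (hn : IsLeafNormal Λ n) : ∫ p, killing (dual n) (curl (fun X v => η X v) p) = 0 := by
  have h1 := hη.integral_half_plane_leafPt hn.1 (basePoint Λ)
  have h2 := hη.integral_half_plane_leafPt hn.neg.1 (basePoint Λ)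
  simp only [leafPt_neg, density_neg, dual_neg, killing_neg_left, mink_neg_left] at h2
  rw [integral_neg_eq_self (fun u => density (fun X v => η X v) (leafPt (basePoint Λ) n u) n) volume,
    integral_neg] at h2
  have hi := hη.integrable_killing_curl n
  rw [← integral_add_compl (measurableSet_half_plane n) hi, h1]
  have hae : ({p : ℝ × ℝ | 0 < mink n (chart p)}ᶜ : Set (ℝ × ℝ)) =ᵐ[volume]
      {p : ℝ × ℝ | 0 < -mink n (chart p)} := by
    filter_upwards [measure_eq_zero_iff_ae_notMem.1 hn.volume_eq_zero] with p hp
    refine propext ⟨fun h => ?_, fun h h' => ?_⟩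
    · have h3 : ¬ 0 < mink n (chart p) := h
      have h4 : mink n (chart p) ≠ 0 := hp
      exact neg_pos.2 (lt_of_le_of_ne (not_lt.1 h3) h4)
    · have h3 : 0 < mink n (chart p) := h'
      have h4 : 0 < -mink n (chart p) := h
      linarith
  rw [setIntegral_congr_set hae]
  linarith

/-- The difference of the values at two points of the indicator function of a half-plane. -/
noncomputable def side (n : V) (X Y : Hyp) : ℝ :=
  (if 0 < mink n X then 1 else 0) - (if 0 < mink n Y then 1 else 0)

theorem abs_side_le (n : V) (X Y : Hyp) : |side n X Y| ≤ 1 := by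
  unfold side; split_ifs <;> norm_num

theorem measurable_side (Y : Hyp) : Measurable fun z : (ℝ × ℝ) × V => side z.2 (chart z.1) Y := by
  have h1 : Continuous fun z : (ℝ × ℝ) × V => mink z.2 (chart z.1) :=
    Continuous.mink continuous_snd (continuous_subtype_val.comp (continuous_chart.comp continuous_fst))
  have h2 : Continuous fun z : (ℝ × ℝ) × V => mink z.2 Y := Continuous.mink continuous_snd continuous_const
  exact (Measurable.ite (isOpen_lt continuous_const h1).measurableSet measurable_const measurable_const).sub
    (Measurable.ite (isOpen_lt continuous_const h2).measurableSet measurable_const measurable_const)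

theorem measurable_side_left (X Y : Hyp) : Measurable fun n : V => side n X Y := by
  have h : ∀ X : Hyp, Continuous fun n : V => mink n X := fun X =>
    Continuous.mink continuous_id continuous_const
  exact (Measurable.ite (isOpen_lt continuous_const (h X)).measurableSet measurable_const
    measurable_const).sub (Measurable.ite (isOpen_lt continuous_const (h Y)).measurableSet
    measurable_const measurable_const)

/-- The indicator at the fixed point `Y` is constant in `p`, so by `integral_killing_curl` it
contributes nothing. -/
theorem IsTestForm.integral_side {K : Set Hyp} {η : RawForm} (hη : IsTestForm K η) {n : V}
    (hn : IsLeafNormal Λ n) (Y : Hyp) :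
    ∫ p, side n (chart p) Y * killing (dual n) (curl (fun X v => η X v) p) =
      ∫ u, density (fun X v => η X v) (leafPt (basePoint Λ) n u) n := by
  rw [← hη.integral_half_plane_leafPt hn.1, ← integral_indicator (measurableSet_half_plane n)]
  have hi := hη.integrable_killing_curl n
  have h : ∀ p, side n (chart p) Y * killing (dual n) (curl (fun X v => η X v) p) =
      {p : ℝ × ℝ | 0 < mink n (chart p)}.indicator
        (fun p => killing (dual n) (curl (fun X v => η X v) p)) p -
      (if 0 < mink n Y then 1 else 0) * killing (dual n) (curl (fun X v => η X v) p) := by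
    intro p
    rw [side, sub_mul, indicator_apply]
    congr 1
    simp only [Set.mem_ofPred_eq, ite_mul, one_mul, zero_mul]
  simp only [h]
  rw [integral_sub (hi.indicator (measurableSet_half_plane n)) (hi.const_mul _), integral_const_mul,
    hη.integral_killing_curl hn, mul_zero, sub_zero]

theorem exists_mink_eq_zero_of_side_ne {n : V} {s : Set Hyp} (hs : IsPreconnected s) {X Y : Hyp}
    (hX : X ∈ s) (hY : Y ∈ s) (h : side n X Y ≠ 0) : ∃ Z ∈ s, mink n Z = 0 := by
  have hcont : ContinuousOn (fun X : Hyp => mink n X) s :=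
    (Continuous.mink continuous_const continuous_subtype_val).continuousOn
  unfold side at h
  split_ifs at h with h1 h2 h2
  · exact absurd (sub_self _) h
  · exact hs.intermediate_value hY hX hcont ⟨not_lt.1 h2, h1.le⟩
  · exact hs.intermediate_value hX hY hcont ⟨not_lt.1 h1, h2.le⟩
  · exact absurd (sub_self _) h

/-- A leaf that separates two points of a connected set has to cross it. -/
theorem side_eq_zero_of_isPreconnected {s : Set Hyp} (hs : IsPreconnected s) (hsΛ : s ⊆ Λ.supportᶜ)
    {X Y : Hyp} (hX : X ∈ s) (hY : Y ∈ s) {n : V} (hn : IsLeafNormal Λ n) : side n X Y = 0 := by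
  by_contra h
  obtain ⟨Z, hZ, h0⟩ := exists_mink_eq_zero_of_side_ne hs hX hY h
  exact hsΛ hZ (hn.mem_support h0)

namespace TransverseMeasure

variable (m : TransverseMeasure Λ)

/-- `K` is enlarged to the image of a disc of the chart, which is compact and connected. Leaves
separating two points of `K` cross it, so they have finite total measure and bounded normals. -/
theorem exists_side_bound {K : Set Hyp} (hK : IsCompact K) :
    ∃ E, MeasurableSet E ∧ m.leafMeasure E < ⊤ ∧ ∃ c, 0 ≤ c ∧ ∀ᵐ n ∂m.leafMeasure,
      ∀ X ∈ K, ∀ Y ∈ K, side n X Y ≠ 0 → n ∈ E ∧ ‖n‖ ≤ c := by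
  have hK' : IsCompact (chart ⁻¹' K) := chartHomeo.isClosedEmbedding.isCompact_preimage hK
  obtain ⟨r, hr⟩ := hK'.isBounded.subset_closedBall (0 : ℝ × ℝ)
  set N : Set Hyp := chart '' Metric.closedBall 0 r with hN
  have hNc : IsCompact N := (isCompact_closedBall _ _).image continuous_chart
  have hNp : IsPreconnected N :=
    (convex_closedBall (0 : ℝ × ℝ) r).isPreconnected.image _ continuous_chart.continuousOn
  have hKN : K ⊆ N := fun X hX => ⟨crd X, hr (by rw [mem_preimage, chart_crd]; exact hX), chart_crd X⟩
  obtain ⟨c, hc1, hcN⟩ := exists_two_le_of_isCompact hNc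
  refine ⟨toMeasurable m.leafMeasure {n | ∃ X ∈ N, mink n X = 0}, measurableSet_toMeasurable _ _,
    by rw [measure_toMeasurable]; exact m.leafMeasure_lt_top hNc, c, by linarith, ?_⟩
  filter_upwards [m.ae_leafMeasure] with n hn X hX Y hY h
  obtain ⟨Z, hZ, h0⟩ := exists_mink_eq_zero_of_side_ne hNp (hKN hX) (hKN hY) h
  refine ⟨subset_toMeasurable _ _ ⟨Z, hZ, h0⟩, ?_⟩
  have := norm_le_of_orthogonal Z h0
  rw [hn.1, Real.sqrt_one, mul_one] at this
  exact this.trans (hcN Z hZ)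

end TransverseMeasure

end Lamination

end LieLam

/-! ### The primitive `w` -/

namespace LieLam

open Topology Filter Set

section Lamination

variable {π : Type*} [Group π] {S : HypSurface π} {Λ : GeodesicLamination S}

theorem side_add (n : V) (X Y Z : Hyp) : side n X Y + side n Y Z = side n X Z := by
  unfold side; ring

theorem side_lin (g : SOPlus) (n : V) (X Y : Hyp) : side (lin g n) (act g X) (act g Y) = side n X Y := by
  simp only [side, coe_act, mink_lin]

/-- The linear map `v ↦ (dual v, A)^♯`. -/
noncomputable def killingDual (A : Mat) : V →L[ℝ] ℝ :=
  LinearMap.toContinuousLinearMap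
    { toFun := fun v => killing (dual v) A
      map_add' := fun v w => by rw [dual_add, killing_add_left]
      map_smul' := fun c v => by rw [dual_smul, killing_smul_left]; rfl }

theorem killingDual_apply (A : Mat) (v : V) : killingDual A v = killing (dual v) A := rfl

/-- The linear action, as a continuous linear map. -/
noncomputable def linCLM (g : SOPlus) : V →L[ℝ] V :=
  LinearMap.toContinuousLinearMap
    (Matrix.mulVecLin ((g : Matrix.SpecialLinearGroup (Fin 3) ℝ) : Mat))

theorem linCLM_apply (g : SOPlus) (v : V) : linCLM g v = lin g v := rfl

namespace TransverseMeasure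

variable (m : TransverseMeasure Λ)

theorem integrable_side (X Y : Hyp) : Integrable (fun n => side n X Y • n) m.leafMeasure := by
  obtain ⟨E, hE, hE', c, hc, h⟩ := m.exists_side_bound (Set.toFinite {X, Y}).isCompact
  have hbi : Integrable (E.indicator fun _ => c) m.leafMeasure :=
    (integrable_indicator_iff hE).2 (integrableOn_const hE'.ne)
  refine hbi.mono' ((measurable_side_left X Y).smul measurable_id).aestronglyMeasurable ?_
  filter_upwards [h] with n hn
  by_cases h0 : side n X Y = 0
  · rw [h0, zero_smul, norm_zero]
    exact indicator_nonneg (fun _ _ => hc) _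
  · obtain ⟨h1, h2⟩ := hn X (by simp) Y (by simp) h0
    rw [indicator_of_mem h1, norm_smul, Real.norm_eq_abs]
    calc _ ≤ 1 * ‖n‖ := mul_le_mul_of_nonneg_right (abs_side_le n X Y) (norm_nonneg _)
      _ ≤ c := by rw [one_mul]; exact h2

/-- Half of the signed sum of the normal vectors of the leaves separating `X` from the base
point. -/
noncomputable def primitive (X : Hyp) : V :=
  (2⁻¹ : ℝ) • ∫ n, side n X (basePoint Λ) • n ∂m.leafMeasure

theorem primitive_sub (X Y : Hyp) :
    m.primitive X - m.primitive Y = (2⁻¹ : ℝ) • ∫ n, side n X Y • n ∂m.leafMeasure := by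
  rw [primitive, primitive, ← smul_sub, ← integral_sub (m.integrable_side _ _) (m.integrable_side _ _)]
  congr 2
  ext1 n
  rw [← sub_smul, ← side_add n X Y (basePoint Λ), add_sub_cancel_right]

/-- The difference of two values only involves the leaves separating the two points, hence is
equivariant by invariance of `leafMeasure`. The fixed base point produces the translation term. -/
theorem primitive_act (γ : π) (X : Hyp) : m.primitive (act (S.σ γ) X) =
    lin (S.σ γ) (m.primitive X) + m.primitive (act (S.σ γ) (basePoint Λ)) := by
  rw [← sub_eq_iff_eq_add, primitive_sub, primitive, ← linCLM_apply, map_smul,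
    ← ContinuousLinearMap.integral_comp_comm _ (m.integrable_side _ _)]
  have hemb : MeasurableEmbedding (lin (S.σ γ)) := by
    refine Continuous.measurableEmbedding (continuous_lin _) fun v w e => ?_
    rw [← lin_inv_lin (S.σ γ) v, e, lin_inv_lin]
  conv_lhs => rw [← m.map_lin_leafMeasure γ]
  rw [hemb.integral_map]
  simp only [side_lin, map_smul, linCLM_apply]

theorem primitive_eq_of_isPreconnected {s : Set Hyp} (hs : IsPreconnected s) (hsΛ : s ⊆ Λ.supportᶜ)
    {X Y : Hyp} (hX : X ∈ s) (hY : Y ∈ s) : m.primitive X = m.primitive Y := by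
  rw [← sub_eq_zero, primitive_sub]
  have h : (fun n => side n X Y • n) =ᵐ[m.leafMeasure] fun _ => 0 := by
    filter_upwards [m.ae_leafMeasure] with n hn
    rw [side_eq_zero_of_isPreconnected hs hsΛ hX hY hn, zero_smul]
  rw [integral_congr_ae h, integral_zero, smul_zero]

theorem measurable_primitive : Measurable fun p : ℝ × ℝ => m.primitive (chart p) := by
  have h : Measurable fun p : ℝ × ℝ => ∫ n, side n (chart p) (basePoint Λ) • n ∂m.leafMeasure :=
    ((measurable_side (basePoint Λ)).smul measurable_snd).stronglyMeasurable.integral_prod_right'.measurable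
  exact h.const_smul (2⁻¹ : ℝ)

theorem exists_norm_primitive_le {K : Set Hyp} (hK : IsCompact K) :
    ∃ c, ∀ X ∈ K, ‖m.primitive X‖ ≤ c := by
  obtain ⟨E, hE, hE', c, hc, h⟩ := m.exists_side_bound (hK.insert (basePoint Λ))
  have hbi : Integrable (E.indicator fun _ => c) m.leafMeasure :=
    (integrable_indicator_iff hE).2 (integrableOn_const hE'.ne)
  refine ⟨‖(2⁻¹ : ℝ)‖ * ∫ n, E.indicator (fun _ => c) n ∂m.leafMeasure, fun X hX => ?_⟩
  rw [primitive, norm_smul]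
  refine mul_le_mul_of_nonneg_left (norm_integral_le_of_norm_le hbi ?_) (norm_nonneg _)
  filter_upwards [h] with n hn
  by_cases h0 : side n X (basePoint Λ) = 0
  · rw [h0, zero_smul, norm_zero]
    exact indicator_nonneg (fun _ _ => hc) _
  · obtain ⟨h1, h2⟩ := hn X (mem_insert_of_mem _ hX) _ (mem_insert _ _) h0
    rw [indicator_of_mem h1, norm_smul, Real.norm_eq_abs]
    calc _ ≤ 1 * ‖n‖ := mul_le_mul_of_nonneg_right (abs_side_le _ _ _) (norm_nonneg _)
      _ ≤ c := by rw [one_mul]; exact h2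

theorem locallyIntegrable_primitive (i j : Fin 3) :
    LocallyIntegrable fun p : ℝ × ℝ => dual (m.primitive (chart p)) i j := by
  rw [locallyIntegrable_iff]
  intro K hK
  obtain ⟨c, hc⟩ := m.exists_norm_primitive_le (hK.image continuous_chart)
  have hd : Continuous fun v : V => dual v i j := (continuous_apply (A := fun _ => ℝ) i).comp
      (continuous_lx.comp (continuous_id.prodMk (continuous_const (y := (Pi.single j 1 : V)))))
  obtain ⟨B, hB⟩ := ((isCompact_closedBall (0 : V) c).image hd.norm).bddAbove
  have : IsFiniteMeasure (volume.restrict K) :=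
    ⟨by rw [Measure.restrict_apply_univ]; exact hK.measure_lt_top⟩
  refine Integrable.of_bound (C := B) ?_ ?_
  · exact (hd.measurable.comp m.measurable_primitive).aestronglyMeasurable
  · filter_upwards [ae_restrict_mem hK.measurableSet] with p hp
    exact hB ⟨_, mem_closedBall_zero_iff.2 (hc _ ⟨p, hp, rfl⟩), rfl⟩

theorem integrable_side_curl {K : Set Hyp} {η : RawForm} (hη : IsTestForm K η) :
    Integrable (fun z : (ℝ × ℝ) × V => side z.2 (chart z.1) (basePoint Λ) *
      killing (dual z.2) (curl (fun X v => η X v) z.1)) (volume.prod m.leafMeasure) := by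
  obtain ⟨E, hE, hE', c, hc, h⟩ := m.exists_side_bound (hη.2.1.insert (basePoint Λ))
  have hK : IsCompact (chart ⁻¹' K) := chartHomeo.isClosedEmbedding.isCompact_preimage hη.2.1
  have hcont := hη.1.continuous_killing_curl
  obtain ⟨B, hB⟩ := ((hK.prod (isCompact_closedBall (0 : V) c)).image hcont.norm).bddAbove
  have hm : MeasurableSet ((chart ⁻¹' K) ×ˢ E) := hK.measurableSet.prod hE
  have hbi : Integrable (((chart ⁻¹' K) ×ˢ E).indicator fun _ => |B|) (volume.prod m.leafMeasure) := by
    refine (integrable_indicator_iff hm).2 (integrableOn_const ?_)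
    rw [Measure.prod_prod]
    exact (ENNReal.mul_lt_top hK.measure_lt_top hE').ne
  refine hbi.mono' ((measurable_side _).mul hcont.measurable).aestronglyMeasurable ?_
  filter_upwards [Measure.quasiMeasurePreserving_snd.ae h] with z hz
  have hnn : 0 ≤ ((chart ⁻¹' K) ×ˢ E).indicator (fun _ => |B|) z := indicator_nonneg (fun _ _ => abs_nonneg _) _
  by_cases hzK : chart z.1 ∈ K
  · by_cases h0 : side z.2 (chart z.1) (basePoint Λ) = 0
    · rwa [h0, zero_mul, norm_zero]
    · obtain ⟨h1, h2⟩ := hz _ (mem_insert_of_mem _ hzK) _ (mem_insert _ _) h0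
      rw [indicator_of_mem (show z ∈ (chart ⁻¹' K) ×ˢ E from ⟨hzK, h1⟩), norm_mul, Real.norm_eq_abs]
      calc _ ≤ 1 * ‖killing (dual z.2) (curl (fun X v => η X v) z.1)‖ :=
            mul_le_mul_of_nonneg_right (abs_side_le _ _ _) (norm_nonneg _)
        _ ≤ |B| := by
            rw [one_mul]
            exact (hB ⟨z, ⟨hzK, mem_closedBall_zero_iff.2 h2⟩, rfl⟩).trans (le_abs_self _)
  · rwa [hη.curl_eq_zero hzK, killing_zero_right, mul_zero, norm_zero]

/-- The derivative of the primitive is the current of integration along the leaves. -/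
theorem dCurrent_primitive {K : Set Hyp} {η : RawForm} (hη : IsTestForm K η) :
    dCurrent (fun X => dual (m.primitive X)) (fun X v => η X v) =
      m.leafIntegral (density fun X v => η X v) := by
  have h1 : ∀ p, killing (dual (m.primitive (chart p))) (curl (fun X v => η X v) p) =
      2⁻¹ * ∫ n, side n (chart p) (basePoint Λ) * killing (dual n) (curl (fun X v => η X v) p)
        ∂m.leafMeasure := by
    intro p
    rw [← killingDual_apply, primitive, map_smul,
      ← ContinuousLinearMap.integral_comp_comm _ (m.integrable_side _ _), smul_eq_mul]
    simp only [map_smul, killingDual_apply, smul_eq_mul]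
  have hk : IsLeafKernel (density fun X v => η X v) :=
    IsLeafKernel.of_continuous hη.1.continuous_density hη.2.1 fun X hX n => by
      simp only [density, hη.2.2 X hX, LinearMap.zero_apply, killing_zero_left]
  rw [dCurrent, m.leafIntegral_eq hk]
  simp only [h1]
  -- By Fubini each leaf is treated separately, where `integral_side` is Stokes' theorem.
  rw [integral_const_mul, integral_integral_swap (m.integrable_side_curl hη)]
  congr 1
  refine integral_congr_ae ?_
  filter_upwards [m.ae_leafMeasure] with n hn
  exact hη.integral_side hn _

end TransverseMeasure

end Lamination

end LieLam

/-! ### Tangency, positivity, bounded variation, support and mass -/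

namespace LieLam

open Topology Filter Set

theorem mink_lx_self {n : V} (hn : mink n n = 1) {X : Hyp} (hX : mink n X = 0) :
    mink (lx n X) (lx n X) = 1 := by
  rw [mink_lx_lx, X.mink_self, hn, hX]; norm_num

/-- The projection of a form to the image of the Maurer-Cartan form, as a form. -/
def projRaw (η : RawForm) : RawForm := fun X =>
  { toFun := fun v => projForm η X v
    map_add' := fun v w => by
      simp only [projForm, projTangent, map_add, Matrix.add_mulVec, cross_add_left]
    map_smul' := fun c v => by
      simp only [projForm, projTangent, map_smul, Matrix.smul_mulVec, cross_smul_left, RingHom.id_apply] }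

theorem cross_apply (Y X : V) (i j : Fin 3) : cross Y X i j =
    X i * (![1, 1, -1] j * Y j) - Y i * (![1, 1, -1] j * X j) := by
  simp [cross, Matrix.vecMulVec_apply, eSharp, Matrix.mulVec_diagonal]

theorem SmoothOnHyp.cross {Y : Hyp → V} (hY : ∀ k, SmoothOnHyp fun X => Y X k) (i j : Fin 3) :
    SmoothOnHyp fun X => LieLam.cross (Y X) X i j := by
  simp only [cross_apply, sub_eq_add_neg]
  refine ((SmoothOnHyp.coord i).mul ((SmoothOnHyp.const _).mul (hY j))).add ?_
  have h := (SmoothOnHyp.const (-1)).mul ((hY i).mul ((SmoothOnHyp.const (![1, 1, -1] j)).mul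
    (SmoothOnHyp.coord j)))
  convert h using 2
  ring

theorem IsOneForm.projRaw {η : RawForm} (hη : IsOneForm η) : IsOneForm (projRaw η) := by
  refine ⟨fun X => ?_, fun X v => cross_mem _ _, fun v i j => ?_⟩
  · change LieLam.cross (η X X *ᵥ X) X = 0
    rw [hη.1, Matrix.zero_mulVec, ← zero_smul ℝ (X : V), cross_smul_left, zero_smul]
  · refine SmoothOnHyp.cross (Y := fun X => η X v *ᵥ X) (fun k => ?_) i j
    simp only [Matrix.mulVec, dotProduct]
    exact SmoothOnHyp.sum fun l _ => (hη.2.2 v k l).mul (SmoothOnHyp.coord l)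

/-- On the leaf `dual n = e × X` lies in the image of the projection, so pairing with it only sees
the projected form. -/
theorem density_projForm {η : RawForm} (hη : IsOneForm η) {n : V} (hn : mink n n = 1) {X : Hyp}
    (hX : mink n X = 0) :
    density (fun X v => projRaw η X v) X n = density (fun X v => η X v) X n := by
  change killing (cross (η X (lx n X) *ᵥ X) X) (dual n) = killing (η X (lx n X)) (dual n)
  rw [← cross_lx_eq_dual hn hX, killing_cross_cross, killing_cross (hη.2.1 _ _), X.mink_self,
    mink_comm X, mink_lx_right, mink_comm (lx n X)]
  ring

/-- The one-form `χ ω_mc`. -/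
def mcRaw (χ : Hyp → ℝ) : RawForm := fun X =>
  { toFun := maurerCartan χ X
    map_add' := fun v w => by simp only [maurerCartan, cross_add_left, smul_add]
    map_smul' := fun c v => by
      simp only [maurerCartan, cross_smul_left, smul_comm c, RingHom.id_apply] }

theorem isTestForm_mcRaw {χ : Hyp → ℝ} (hχ : SmoothOnHyp χ) (hc : HasCompactSupport χ) :
    IsTestForm (tsupport χ) (mcRaw χ) := by
  refine ⟨⟨fun X => ?_, fun X v => so21.smul_mem _ (cross_mem _ _), fun v i j => ?_⟩, hc, fun X hX => ?_⟩
  · change χ X • cross X X = 0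
    rw [cross_self, smul_zero]
  · exact hχ.mul (SmoothOnHyp.cross (fun k => SmoothOnHyp.const (v k)) i j)
  · refine LinearMap.ext fun v => ?_
    change χ X • cross v X = 0
    rw [image_eq_zero_of_notMem_tsupport hX, zero_smul]

theorem density_mcRaw (χ : Hyp → ℝ) {n : V} (hn : mink n n = 1) {X : Hyp} (hX : mink n X = 0) :
    density (fun X v => mcRaw χ X v) X n = 2 * χ X := by
  change killing (χ X • cross (lx n X) X) (dual n) = _
  rw [killing_smul_left, ← cross_lx_eq_dual hn hX, killing_cross_cross, mink_lx_self hn hX, X.mink_self,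
    mink_lx_right]
  ring

/-- Writing `φ(e) = a × X`, the hypothesis says that `a` has length at most one, and the density is
`2 (a, e)^♯`; Cauchy-Schwarz in the tangent plane applies. -/
theorem abs_density_le {φ : RawForm} (h1 : ∀ X v, φ X v = projForm φ X v)
    (h2 : ∀ (X : Hyp) (v : V), mink X v = 0 → killing (φ X v) (φ X v) ≤ 2 * mink v v) {n : V}
    (hn : mink n n = 1) {X : Hyp} (hX : mink n X = 0) : |density (fun X v => φ X v) X n| ≤ 2 := by
  set e := lx n X with he
  have hee : mink e e = 1 := mink_lx_self hn hX
  have heX : mink X e = 0 := by rw [mink_comm, he, mink_lx_right]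
  set a := φ X e *ᵥ (X : V) with ha
  have hφ : φ X e = cross a X := h1 X e
  have haX : mink a X = 0 := by
    have h := mem_so21_iff.1 (cross_mem a X) X X
    rw [← hφ, ← ha, mink_comm X a] at h
    linarith
  have h3 := h2 X e heX
  rw [hφ, killing_cross_cross, haX, hee, X.mink_self] at h3
  have h4 := mink_self_nonneg_of_orthogonal X (w := a - mink a e • e) (by
    rw [mink_sub_left, mink_smul_left, haX, mink_comm e, heX]; ring)
  simp only [mink_sub_left, mink_sub_right, mink_smul_left, mink_smul_right, hee, mink_comm e a] at h4
  have h5 : density (fun X v => φ X v) X n = 2 * mink a e := by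
    rw [density, ← he, ← cross_lx_eq_dual hn hX, ← he, hφ, killing_cross_cross, haX, X.mink_self]
    ring
  rw [h5, abs_mul, abs_two]
  have h6 : |mink a e| ≤ 1 := by
    rw [abs_le_one_iff_mul_self_le_one]
    nlinarith
  linarith

section Lamination

variable {π : Type*} [Group π] {S : HypSurface π} {Λ : GeodesicLamination S}

theorem IsTestForm.isLeafKernel {K : Set Hyp} {η : RawForm} (hη : IsTestForm K η) :
    IsLeafKernel (density fun X v => η X v) :=
  IsLeafKernel.of_continuous hη.1.continuous_density hη.2.1 fun X hX n => by
    simp only [density, hη.2.2 X hX, LinearMap.zero_apply, killing_zero_left]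

namespace TransverseMeasure

variable (m : TransverseMeasure Λ)

theorem dCurrent_projForm {K : Set Hyp} {η : RawForm} (hη : IsTestForm K η) :
    dCurrent (fun X => dual (m.primitive X)) (projForm η) =
      dCurrent (fun X => dual (m.primitive X)) (fun X v => η X v) := by
  have hp : IsTestForm K (projRaw η) := by
    refine ⟨hη.1.projRaw, hη.2.1, fun X hX => LinearMap.ext fun v => ?_⟩
    change cross (η X v *ᵥ X) X = 0
    rw [hη.2.2 X hX, LinearMap.zero_apply, Matrix.zero_mulVec, ← zero_smul ℝ (X : V), cross_smul_left,
      zero_smul]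
  change dCurrent _ (fun X v => projRaw η X v) = _
  rw [m.dCurrent_primitive hp, m.dCurrent_primitive hη]
  exact m.leafIntegral_congr fun X n hn hX => density_projForm hη.1 hn.1 hX

/-- The product of the transverse measure and the length along the leaves. -/
noncomputable def transverseLength : Measure Hyp :=
  (m.leafMeasure.prod volume).map fun z : V × ℝ => leafPt (basePoint Λ) z.1 z.2

theorem transverseLength_lt_top {K : Set Hyp} (hK : IsCompact K) : m.transverseLength K < ⊤ := by
  obtain ⟨D, -, hD⟩ := m.exists_integrable_bound hK
  have hmK := hK.isClosed.measurableSet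
  have hmeas : Measurable fun z : V × ℝ => leafPt (basePoint Λ) z.1 z.2 :=
    (continuous_leafPt _).measurable
  have h := (hD (fun X _ => K.indicator (fun _ => (1 : ℝ)) X) 1 zero_le_one
    ((measurable_const.indicator hmK).comp measurable_fst) (fun X hX _ => indicator_of_notMem hX _)
    fun X n _ _ => by
      classical
      rw [indicator_apply]
      split_ifs <;> norm_num).1
  rw [transverseLength, Measure.map_apply hmeas hmK]
  have h' : Integrable (((fun z : V × ℝ => leafPt (basePoint Λ) z.1 z.2) ⁻¹' K).indicator
      fun _ => (1 : ℝ)) (m.leafMeasure.prod volume) := h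
  rw [integrable_indicator_iff (hmeas hmK), integrableOn_const_iff (by simp)] at h'
  simpa using h'

/-- The Killing square of a generator is `2`, which cancels the factor one half of `leafIntegral`;
what is left is transverse measure times length. -/
theorem dCurrent_maurerCartan {χ : Hyp → ℝ} (hχ : SmoothOnHyp χ) (hc : HasCompactSupport χ) :
    dCurrent (fun X => dual (m.primitive X)) (maurerCartan χ) = ∫ X, χ X ∂m.transverseLength := by
  change dCurrent _ (fun X v => mcRaw χ X v) = _
  rw [m.dCurrent_primitive (isTestForm_mcRaw hχ hc),
    m.leafIntegral_congr (h := fun X _ => 2 * χ X) fun X n hn hX => density_mcRaw χ hn.1 hX, leafIntegral,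
    transverseLength, integral_map (continuous_leafPt _).measurable.aemeasurable
      hχ.continuous.aestronglyMeasurable, integral_const_mul]
  ring

theorem isLocallyBV_primitive : IsLocallyBV fun X => dual (m.primitive X) := by
  refine ⟨m.locallyIntegrable_primitive, fun K => ?_⟩
  -- `IsTestForm K` contains compactness of `K`, so other sets carry no test forms.
  by_cases hK : IsCompact K
  swap
  · exact ⟨0, fun η hη => absurd hη.2.1 hK⟩
  obtain ⟨D, hD, h⟩ := m.exists_integrable_bound hK
  obtain ⟨c, hc1, hcK⟩ := exists_two_le_of_isCompact hK
  have hdual : ∀ i j, Continuous fun p : Hyp × V => dual p.2 i j := fun i j =>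
    (continuous_apply (A := fun _ => ℝ) i).comp
      (continuous_lx.comp (continuous_snd.prodMk (continuous_const (y := (Pi.single j 1 : V)))))
  have hlx : Continuous fun p : Hyp × V => lx p.2 p.1 :=
    continuous_lx.comp (continuous_snd.prodMk (continuous_subtype_val.comp continuous_fst))
  have hcont : Continuous fun p : Hyp × V => ∑ i, ∑ j, ‖lx p.2 p.1‖ * |dual p.2 j i| :=
    continuous_finsetSum _ fun i _ => continuous_finsetSum _ fun j _ => hlx.norm.mul (hdual j i).abs
  obtain ⟨B, hB⟩ := ((hK.prod (isCompact_closedBall (0 : V) c)).image hcont).bddAbove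
  refine ⟨D * |B|, fun η hη hle => ?_⟩
  rw [m.dCurrent_primitive hη]
  refine (h _ |B| (abs_nonneg _) hη.1.continuous_density.measurable (fun X hX n => by
    simp only [density, hη.2.2 X hX, LinearMap.zero_apply, killing_zero_left]) fun X n hn hX => ?_).2
  by_cases hXK : X ∈ K
  · have hnc : ‖n‖ ≤ c := by
      have := norm_le_of_orthogonal X hX
      rw [hn, Real.sqrt_one, mul_one] at this
      exact this.trans (hcK X hXK)
    refine le_trans ?_ ((hB ⟨(X, n), ⟨hXK, mem_closedBall_zero_iff.2 hnc⟩, rfl⟩).trans (le_abs_self _))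
    rw [density, killing_eq]
    refine (Finset.abs_sum_le_sum_abs _ _).trans (Finset.sum_le_sum fun i _ => ?_)
    refine (Finset.abs_sum_le_sum_abs _ _).trans (Finset.sum_le_sum fun j _ => ?_)
    rw [abs_mul]
    exact mul_le_mul_of_nonneg_right (hle _ _ _ _) (abs_nonneg _)
  · simp only [density, hη.2.2 X hXK, LinearMap.zero_apply, killing_zero_left, abs_zero, abs_nonneg]

theorem isLieAlgebraTransverseMeasure_primitive :
    IsLieAlgebraTransverseMeasure Λ fun X => dual (m.primitive X) where
  mem X := dual_mem _
  plaque X hX := by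
    refine ⟨dual (m.primitive X), fun Y hY => ?_, ?_⟩
    · rw [m.primitive_eq_of_isPreconnected isPreconnected_connectedComponentIn
        (connectedComponentIn_subset _ _) hY (mem_connectedComponentIn hX)]
    -- A point of the closure off the lamination can be added to the component without losing
    -- connectedness; the points of the lamination form a null set.
    · filter_upwards [measure_eq_zero_iff_ae_notMem.1 (volume_support (Λ := Λ))] with p hp hpc
      have hs : IsPreconnected (insert (chart p) (connectedComponentIn Λ.supportᶜ X)) :=
        isPreconnected_connectedComponentIn.subset_closure (subset_insert _ _)
          (insert_subset hpc subset_closure)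
      rw [m.primitive_eq_of_isPreconnected hs (insert_subset hp (connectedComponentIn_subset _ _))
        (mem_insert _ _) (mem_insert_of_mem _ (mem_connectedComponentIn hX))]
  bv := m.isLocallyBV_primitive
  equivariant := by
    refine ⟨fun γ => dual (m.primitive (act (S.σ γ) (basePoint Λ))), fun γ => dual_mem _,
      fun γ₁ γ₂ => ?_, fun γ X => ?_⟩
    · beta_reduce
      rw [map_mul, act_mul, m.primitive_act, dual_add, Ad_dual]
    · rw [m.primitive_act, dual_add, Ad_dual]
  tangent K η hη := m.dCurrent_projForm hη
  positive := ⟨m.transverseLength, ⟨fun _ hK => m.transverseLength_lt_top hK⟩,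
    fun _ hχ hc => m.dCurrent_maurerCartan hχ hc⟩

/-- Unfolding with the density of `η` as kernel; its orbit sum is the density of `∑ γ·η` after
replacing `γ` by its inverse. -/
theorem isDerivative_current : IsDerivative m.current fun X => dual (m.primitive X) := by
  intro K η φ hη hφ
  rw [m.dCurrent_primitive hη]
  refine m.current_eq_leafIntegral φ hη.isLeafKernel fun X n _ _ => ?_
  have hfin := finite_return S (hη.2.1.union (isCompact_singleton (x := X)))
  have hsupp : ∀ v, (Function.support fun γ : π =>
      Ad (S.σ γ) (η (act (S.σ γ⁻¹) X) (lin (S.σ γ⁻¹) v))) ⊆ hfin.toFinset := by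
    intro v γ hγ
    rw [Finset.mem_coe, Set.Finite.mem_toFinset]
    have h : act (S.σ γ⁻¹) X ∈ K := by
      by_contra h
      refine hγ ?_
      simp only [hη.2.2 _ h, LinearMap.zero_apply]
      simp [Ad]
    exact ⟨_, Or.inl h, Or.inr (by rw [map_inv, act_act_inv]; rfl)⟩
  have hterm : ∀ γ : π, killing (Ad (S.σ γ) (η (act (S.σ γ⁻¹) X) (lin (S.σ γ⁻¹) (lx n X)))) (dual n) =
      density (fun X v => η X v) (act (S.σ γ⁻¹) X) (lin (S.σ γ⁻¹) n) := by
    intro γ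
    rw [density, coe_act, lx_lin, ← Ad_dual, map_inv]
    conv_rhs => rw [← killing_Ad (S.σ γ), Ad_Ad_inv]
  rw [← finsum_comp_equiv (Equiv.inv π)]
  simp only [Equiv.inv_apply, ← hterm]
  rw [density, hφ, finsum_eq_sum_of_support_subset _ (hsupp _), finsum_eq_sum_of_support_subset]
  · have h : ∀ (s : Finset π) (E : π → Mat) (B : Mat), killing (∑ γ ∈ s, E γ) B = ∑ γ ∈ s, killing (E γ) B :=
      fun s E B => by simp only [killing, Finset.sum_mul, Matrix.trace_sum]
    exact h _ _ _
  · intro γ hγ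
    refine hsupp (lx n X) fun h => hγ ?_
    simp only at h ⊢
    rw [h, killing_zero_left]

theorem isSupportedOn_current : IsSupportedOn m.current Λ := by
  intro U φ _ hU hφ
  rw [show m.current φ = m.leafIntegral fun X n =>
      cutoff Λ X * density (fun X v => (φ : RawForm) X v) X n from rfl]
  rw [m.leafIntegral_congr (h := fun _ _ => 0) fun X n hn hX => ?_]
  · simp [leafIntegral]
  · rw [density, hφ X (hU (hn.mem_support hX)), LinearMap.zero_apply, killing_zero_left, mul_zero]

/-- The kernel `cutoff · density` has a fixed compact support and, on these forms, a fixed bound. -/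
theorem hasFiniteMass_current : HasFiniteMass m.current := by
  obtain ⟨K, hK, hβ⟩ := exists_isCompact_cutoff (Λ := Λ)
  obtain ⟨D, -, hD⟩ := m.exists_integrable_bound hK
  have hc : Continuous (cutoff Λ) := smooth_cutoff.continuous
  obtain ⟨B, hB⟩ := (hK.image hc.norm).bddAbove
  have hB' : ∀ X, |cutoff Λ X| ≤ |B| := fun X => by
    by_cases hX : X ∈ K
    · exact (hB ⟨X, hX, rfl⟩).trans (le_abs_self _)
    · rw [hβ X hX, abs_zero]; exact abs_nonneg _
  refine ⟨D * (|B| * 2), fun φ h1 h2 => ?_⟩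
  refine (le_abs_self _).trans (hD _ _ (by positivity) φ.2.1.isLeafKernel_cutoff.measurable
    (fun X hX n => by rw [hβ X hX, zero_mul]) fun X n hn hX => ?_).2
  rw [abs_mul]
  exact mul_le_mul (hB' X) (abs_density_le h1 h2 hn hX) (abs_nonneg _) (abs_nonneg _)

end TransverseMeasure

end Lamination

end LieLam

/-! ### Closedness of the current -/

namespace LieLam

open Topology Filter Set

/-- The differential of a function on the hyperbolic plane, in the global chart. -/
noncomputable def differential (b : Hyp → ℝ) (X : Hyp) (v : V) : ℝ :=
  fderiv ℝ (fun q => b (chart q)) (crd X) (crd v)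

theorem Frame.hasDerivAt_crd_vec (f : Frame) (u : ℝ) :
    HasDerivAt (fun u => crd (f.vec u)) (crd (f.vel u)) u := by
  have h := hasDerivAt_pi.1 (f.hasDerivAt_vec u)
  exact (h 0).prodMk (h 1)

theorem SmoothOnHyp.hasDerivAt_pt {b : Hyp → ℝ} (hb : SmoothOnHyp b) (f : Frame) (u : ℝ) :
    HasDerivAt (fun u => b (f.pt u)) (differential b (f.pt u) (f.vel u)) u := by
  have h := ((ContDiff.differentiable hb (by simp)) (crd (f.pt u))).hasFDerivAt.comp_hasDerivAt u
    (f.hasDerivAt_crd_vec u)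
  have e : (fun u => b (f.pt u)) = (fun q => b (chart q)) ∘ fun u => crd (f.vec u) := by
    ext u
    exact congrArg b (chart_crd (f.pt u)).symm
  rw [e]
  exact h

theorem SmoothOnHyp.continuous_differential {b : Hyp → ℝ} (hb : SmoothOnHyp b) :
    Continuous fun z : Hyp × V => differential b z.1 z.2 := by
  have h : Continuous (fderiv ℝ fun q => b (chart q)) :=
    (ContDiff.fderiv_right (m := 0) hb (by simp)).continuous
  exact (h.comp (contDiff_crd.continuous.comp (continuous_subtype_val.comp continuous_fst))).clm_apply
    (contDiff_crd.continuous.comp continuous_snd)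

theorem differential_eq_zero {b : Hyp → ℝ} {K : Set Hyp} (hK : IsClosed K) (hb : ∀ X ∉ K, b X = 0)
    {X : Hyp} (hX : X ∉ K) (v : V) : differential b X v = 0 := by
  have h : (fun q => b (chart q)) =ᶠ[𝓝 (crd X)] fun _ => 0 := by
    have hU : chart ⁻¹' Kᶜ ∈ 𝓝 (crd X) := (hK.isOpen_compl.preimage continuous_chart).mem_nhds
      (by rw [mem_preimage, chart_crd]; exact hX)
    filter_upwards [hU] with q hq
    exact hb _ hq
  rw [differential, h.fderiv_eq]
  simp

theorem Frame.fderiv_chartV_vel (f : Frame) (u : ℝ) :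
    fderiv ℝ chartV (crd (f.vec u)) (crd (f.vel u)) = f.vel u := by
  have h := ((contDiff_chartV.differentiable (by simp)) (crd (f.vec u))).hasFDerivAt.comp_hasDerivAt u
    (f.hasDerivAt_crd_vec u)
  have e : chartV ∘ (fun u => crd (f.vec u)) = f.vec := by
    ext1 u
    exact congrArg Subtype.val (chart_crd (f.pt u))
  rw [e] at h
  exact h.unique (f.hasDerivAt_vec u)

theorem IsDifferential.hasDerivAt_killing {φ : RawForm} {ξ : Hyp → Mat} (h : IsDifferential φ ξ)
    (hξ : ∀ i j, SmoothOnHyp fun X => ξ X i j) (f : Frame) (B : Mat) (u : ℝ) :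
    HasDerivAt (fun u => killing (ξ (f.pt u)) B) (killing (φ (f.pt u) (f.vel u)) B) u := by
  have hd : ∀ i j, HasDerivAt (fun u => ξ (f.pt u) i j) (φ (f.pt u) (f.vel u) i j) u := by
    intro i j
    have h1 := (hξ i j).hasDerivAt_pt f u
    have h2 := h (crd (f.vec u)) (crd (f.vel u)) i j
    rw [f.fderiv_chartV_vel, show chart (crd (f.vec u)) = f.pt u from chart_crd (f.pt u)] at h2
    rw [h2]
    exact h1
  simp only [killing_eq]
  exact HasDerivAt.fun_sum fun i _ => HasDerivAt.fun_sum fun j _ => (hd i j).mul_const _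

section Lamination

variable {π : Type*} [Group π] {S : HypSurface π} {Λ : GeodesicLamination S}

/-- Near `X` one finite set of translates of `cutoff` adds up to one; differentiating along a
geodesic shows that their derivatives add up to zero. -/
theorem exists_sum_differential_cutoff (X : Hyp) : ∃ Γ : Finset π,
    (∀ γ ∉ Γ, cutoff Λ (act (S.σ γ) X) = 0 ∧ ∀ v, differential (cutoff Λ) (act (S.σ γ) X) v = 0) ∧
    ∑ γ ∈ Γ, cutoff Λ (act (S.σ γ) X) = 1 ∧ ∀ f : Frame, f.X = X →
      ∑ γ ∈ Γ, differential (cutoff Λ) (act (S.σ γ) X) (lin (S.σ γ) f.e) = 0 := by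
  obtain ⟨K, hK, hβ⟩ := exists_isCompact_cutoff (Λ := Λ)
  have hN : IsCompact (chart '' Metric.closedBall (crd X) 1) :=
    (isCompact_closedBall _ _).image continuous_chart
  have hXN : X ∈ chart '' Metric.closedBall (crd X) 1 :=
    ⟨crd X, Metric.mem_closedBall_self zero_le_one, chart_crd X⟩
  have hfin := finite_return S (hN.union hK)
  have hmem : ∀ γ ∉ hfin.toFinset, ∀ Y ∈ chart '' Metric.closedBall (crd X) 1, act (S.σ γ) Y ∉ K := by
    intro γ hγ Y hY h
    rw [Set.Finite.mem_toFinset] at hγ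
    exact hγ ⟨Y, Or.inl hY, Or.inr h⟩
  have hsum : ∀ Y ∈ chart '' Metric.closedBall (crd X) 1,
      ∑ γ ∈ hfin.toFinset, cutoff Λ (act (S.σ γ) Y) = 1 := by
    intro Y hY
    refine Eq.trans (finsum_eq_sum_of_support_subset _ ?_).symm (orbitSum_cutoff (Λ := Λ) Y)
    intro γ hγ
    by_contra h
    exact hγ (hβ _ (hmem γ h Y hY))
  refine ⟨hfin.toFinset, fun γ hγ => ?_, hsum X hXN, fun f hf => ?_⟩
  · exact ⟨hβ _ (hmem γ hγ X hXN), fun v => differential_eq_zero hK.isClosed hβ (hmem γ hγ X hXN) v⟩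
  · have h1 : HasDerivAt (fun u => ∑ γ ∈ hfin.toFinset, cutoff Λ ((f.map (S.σ γ)).pt u))
        (∑ γ ∈ hfin.toFinset, differential (cutoff Λ) ((f.map (S.σ γ)).pt 0) ((f.map (S.σ γ)).vel 0)) 0 :=
      HasDerivAt.fun_sum fun γ _ => smooth_cutoff.hasDerivAt_pt _ 0
    have h2 : (fun u => ∑ γ ∈ hfin.toFinset, cutoff Λ ((f.map (S.σ γ)).pt u)) =ᶠ[𝓝 0] fun _ => 1 := by
      have hc : Continuous fun u => crd (f.pt u) :=
        contDiff_crd.continuous.comp (continuous_subtype_val.comp f.continuous_pt)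
      have hU : ∀ᶠ u in 𝓝 (0 : ℝ), crd (f.pt u) ∈ Metric.closedBall (crd X) 1 := by
        refine hc.continuousAt.eventually_mem ?_
        rw [f.pt_zero, hf]
        exact Metric.closedBall_mem_nhds _ one_pos
      filter_upwards [hU] with u hu
      simp only [Frame.map_pt]
      exact hsum _ ⟨_, hu, chart_crd _⟩
    have h3 := (h1.congr_of_eventuallyEq h2.symm).unique (hasDerivAt_const (0 : ℝ) (1 : ℝ))
    rw [← h3]
    refine Finset.sum_congr rfl fun γ _ => ?_
    have hv : (f.map (S.σ γ)).vel 0 = lin (S.σ γ) f.e := by simp [Frame.vel, Frame.map]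
    rw [hv, Frame.map_pt, f.pt_zero, hf]

namespace TransverseMeasure

variable (m : TransverseMeasure Λ)

/-- The kernel `h` is the derivative of `β (ξ, B)^♯` along the leaf, where `B` is constant. Its
integral over each leaf vanishes. In its orbit sum the terms with `dβ` cancel and those with `β`
give the density of `dξ`, so `h` computes the current. -/
theorem isClosedCurrent_current : IsClosedCurrent m.current := by
  intro ξ φ hξ hφ
  obtain ⟨K, hK, hβ⟩ := exists_isCompact_cutoff (Λ := Λ)
  have hβs := smooth_cutoff (Λ := Λ)
  have hξc : Continuous fun z : Hyp × V => killing (ξ z.1) (dual z.2) := by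
    simp only [killing_eq]
    refine continuous_finsetSum _ fun i _ => continuous_finsetSum _ fun j _ => Continuous.mul ?_ ?_
    · exact (hξ.1 i j).continuous.comp continuous_fst
    · exact (continuous_apply (A := fun _ => ℝ) j).comp
        (continuous_lx.comp (continuous_snd.prodMk (continuous_const (y := (Pi.single i 1 : V)))))
  obtain ⟨h, hh⟩ : ∃ h : Hyp → V → ℝ, h = fun X n =>
      differential (cutoff Λ) X (lx n X) * killing (ξ X) (dual n) +
        cutoff Λ X * density (fun X v => (φ : RawForm) X v) X n := ⟨_, rfl⟩
  have hlx : Continuous fun p : Hyp × V => lx p.2 p.1 :=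
    continuous_lx.comp (continuous_snd.prodMk (continuous_subtype_val.comp continuous_fst))
  have hhc : Continuous (Function.uncurry h) := by
    rw [hh]
    exact ((hβs.continuous_differential.comp (continuous_fst.prodMk hlx)).mul hξc).add
      ((hβs.continuous.comp continuous_fst).mul φ.2.1.continuous_density)
  have hh0 : ∀ X ∉ K, ∀ n, h X n = 0 := fun X hX n => by
    rw [hh]
    simp only [differential_eq_zero hK.isClosed hβ hX, hβ X hX, zero_mul, add_zero]
  have hk : IsLeafKernel h := IsLeafKernel.of_continuous hhc hK hh0
  rw [m.current_eq_leafIntegral φ hk fun X n hn hX => ?_, m.leafIntegral_eq hk]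
  · have hz : (fun n => ∫ u, h (leafPt (basePoint Λ) n u) n) =ᵐ[m.leafMeasure] fun _ => 0 := by
      filter_upwards [m.ae_leafMeasure] with n hn
      set f := footFrame (basePoint Λ) n hn.1 with hf
      have hpt : ∀ u, leafPt (basePoint Λ) n u = f.pt u := leafPt_eq hn.1
      have hd : ∀ u, HasDerivAt (fun u => cutoff Λ (f.pt u) * killing (ξ (f.pt u)) (dual n))
          (h (f.pt u) n) u := by
        intro u
        have h1 := (hβs.hasDerivAt_pt f u).mul (hφ.hasDerivAt_killing hξ.1 f (dual n) u)
        have hvel : f.vel u = lx n (f.pt u) := f.vel_eq_lx (footFrame_e hn.1) u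
        rw [hvel] at h1
        rw [hh]
        exact h1
      have hcont : Continuous fun X : Hyp => -mink X (basePoint Λ) :=
        (Continuous.mink continuous_subtype_val continuous_const).neg
      obtain ⟨c, hc⟩ := (hK.image hcont).bddAbove
      -- The leaf stays in the support of the cutoff for a bounded time only, so the function
      -- integrated has compact support.
      have hout : ∀ u ∉ Metric.closedBall (0 : ℝ) c, f.pt u ∉ K := fun u hu hK' => by
        refine hu ?_
        rw [mem_closedBall_zero_iff, Real.norm_eq_abs]
        refine (abs_le_mink_leafPt (O := basePoint Λ) hn.1 u).trans ?_
        rw [hpt]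
        exact hc ⟨_, hK', rfl⟩
      have hcf : Continuous fun u => h (f.pt u) n := by
        have := hhc.comp (f.continuous_pt.prodMk (continuous_const (y := n)))
        simpa only [Function.comp_def, Function.uncurry] using this
      have hcg : Continuous fun u => cutoff Λ (f.pt u) * killing (ξ (f.pt u)) (dual n) := by
        have := hξc.comp (f.continuous_pt.prodMk (continuous_const (y := n)))
        exact (hβs.continuous.comp f.continuous_pt).mul (by simpa only [Function.comp_def] using this)
      simp only [hpt]
      refine integral_eq_zero_of_hasDerivAt_of_integrable hd ?_ ?_
      · exact hcf.integrable_of_hasCompactSupport (HasCompactSupport.intro (isCompact_closedBall _ _)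
          fun u hu => hh0 _ (hout u hu) n)
      · exact hcg.integrable_of_hasCompactSupport (HasCompactSupport.intro (isCompact_closedBall _ _)
          fun u hu => by rw [hβ _ (hout u hu), zero_mul])
    rw [integral_congr_ae hz, integral_zero, mul_zero]
  · obtain ⟨Γ, hΓ0, hΓ1, hΓ2⟩ := exists_sum_differential_cutoff (Λ := Λ) X
    have hterm : ∀ γ : π, h (act (S.σ γ) X) (lin (S.σ γ) n) =
        differential (cutoff Λ) (act (S.σ γ) X) (lin (S.σ γ) (lx n X)) * killing (ξ X) (dual n) +
          cutoff Λ (act (S.σ γ) X) * density (fun X v => (φ : RawForm) X v) X n := by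
      intro γ
      rw [hh]
      simp only
      rw [density_act, hξ.2.2, ← Ad_dual, killing_Ad, coe_act, lx_lin]
    simp only [hterm]
    have hΓ3 : ∑ γ ∈ Γ, differential (cutoff Λ) (act (S.σ γ) X) (lin (S.σ γ) (lx n X)) = 0 :=
      hΓ2 (Frame.ofNormal X n hn.1 hX) rfl
    rw [finsum_eq_sum_of_support_subset (s := Γ), Finset.sum_add_distrib, ← Finset.sum_mul,
      ← Finset.sum_mul, hΓ1, hΓ3, zero_mul, zero_add, one_mul]
    intro γ hγ
    by_contra hcon
    obtain ⟨h1, h2⟩ := hΓ0 γ hcon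
    exact hγ (by simp only [h1, h2, zero_mul, add_zero])

end TransverseMeasure

end Lamination

end LieLam

/-! ### The theorem -/

open LieLam
theorem mainTheorem8 {π : Type*} [Group π] (S : HypSurface π) (Λ : GeodesicLamination S)
    (m : TransverseMeasure Λ) :
    (∀ (R : FlowBox Λ) (φ : Omega1 S),
      (∀ s ∈ R.C, IntervalIntegrable (fun t => R.integrand (φ : RawForm) t s)
        MeasureTheory.volume R.a R.b) ∧
      MeasureTheory.Integrable (fun s => ∫ t in R.a..R.b, R.integrand (φ : RawForm) t s)
        (m.μ R)) ∧
    (∀ φ : Omega1 S, ∃ (n : ℕ) (R : Fin n → FlowBox Λ) (ψ : Fin n → Omega1 S),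
      IsDecomposition φ R ψ) ∧
    (∃! T : Omega1 S →ₗ[ℝ] ℝ, IsStandardCurrent m T) ∧
    ∀ T : Omega1 S →ₗ[ℝ] ℝ, IsStandardCurrent m T →
      IsClosedCurrent T ∧ IsSupportedOn T Λ ∧ HasFiniteMass T ∧
      ∃ w : Hyp → Mat, IsLieAlgebraTransverseMeasure Λ w ∧ IsDerivative T w := by
  refine ⟨fun R φ => ⟨fun s hs => (R.intervalIntegrable_integrand φ hs).1, m.integrable_integral R φ⟩,
    exists_isDecomposition Λ, ⟨m.current, m.isStandardCurrent_current, fun T hT => m.eq_current hT⟩,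
    fun T hT => ?_⟩
  rw [m.eq_current hT]
  exact ⟨m.isClosedCurrent_current, m.isSupportedOn_current, m.hasFiniteMass_current,
    fun X => dual (m.primitive X), m.isLieAlgebraTransverseMeasure_primitive, m.isDerivative_current⟩
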